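/- Fix $r$. For sample sizes $N,T\ge 1$ let $$z_{it}=\alpha_i+\lambda_i'f_t+e_{it},\qquad i=1,\dots,N,\ t=1,\dots,T,$$ where the loadings $\lambda_i\in\mathbb R^r$, factors $f_t\in\mathbb R^r$ and intercepts $\alpha_i$ are nonrandom and may depend on $(N,T)$ (as the exact normalizations below require), while the errors $e_{it}$ and variances $\sigma_i^2$ do not depend on $(N,T)$. Put $\Lambda=(\lambda_1,\dots,\lambda_N)'$, $\Sigma_{ee}=\operatorname{diag}(\sigma_1^2,\dots,\sigma_N^2)$, $M_{ff}=\frac1T\sum_t(f_t-\bar f)(f_t-\bar f)'$, $M_{zz}=\frac1T\sum_t(z_t-\bar z)(z_t-\bar z)'$; $\|\cdot\|$ is the Frobenius norm. All limits are joint, as $N,T\to\infty$ with no restriction on their relative rate. Assume, for some constant $C>0$: (A) $M_{ff}\to\overline M_{ff}$ with $\overline M_{ff}$ positive definite. (B) The $e_{it}$ are independent over all $i,t$ and identically distributed over $t$, with $E e_{it}=0$, $E e_{it}^2=\sigma_i^2$ and $\sup_{i,t}E e_{it}^4<\infty$. (C) $\|\lambda_j\|\le C$ and $C^{-2}\le\sigma_j^2\le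 C^2$ for all $j$; $\frac1N\Lambda'\Sigma_{ee}^{-1}\Lambda\to Q$ with $Q$ positive definite; and $\frac1N\sum_{i=1}^N\sigma_i^{-4}(\lambda_i\otimes\lambda_i)(\lambda_i'\otimes\lambda_i')$ converges to some matrix $\Omega$. (D) The quasi-likelihood below is maximized over $\sigma_i^2\in[C^{-2},C^2]$ and positive semidefinite $M_{ff}$ with all entries in $[-C,C]$; all entries of $\overline M_{ff}$ lie in $(-C,C)$. (IC) The true parameters satisfy, for all large $N,T$, one of the following sets of restrictions, with $\Lambda_1$ the upper $r\times r$ block of $\Lambda$: * IC1: $\Lambda_1=I_r$. * IC2: $M_{ff}$ is diagonal with distinct positive entries in decreasing order and $\frac1N\Lambda'\Sigma_{ee}^{-1}\Lambda=I_r$; moreover the diagonal entries of $\overline M_{ff}$ are distinct. * IC3: $M_{ff}=I_r$ and $\frac1N\Lambda'\Sigma_{ee}^{-1}\Lambda$ is diagonal with distinct positive entries in decreasing order; moreover the diagonal entries of $Q$ are distinct. * IC4: $M_{ff}$ is diagonal and $\Lambda_1$ is lower triangular with unit diagonal. * IC5: $M_{ff}=I_r$ and $\Lambda_1$ is lower triangular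 with nonzero diagonal entries; moreover these diagonal entries are bounded away from $0$ for large $N,T$. Let $\hat\theta=(\hat\lambda_1,\dots,\hat\lambda_N,\hat\sigma_1^2,\dots,\hat\sigma_N^2,\hat M_{ff})$ be an estimator which, with probability tending to one, maximizes $$-\frac1{2N}\ln|\Sigma_{zz}|-\frac1{2N}\operatorname{tr}(M_{zz}\Sigma_{zz}^{-1}),\qquad \Sigma_{zz}=\Lambda M_{ff}\Lambda'+\Sigma_{ee},$$ over all $(\Lambda,\Sigma_{ee},M_{ff})$ satisfying (D) and the same set of restrictions (the first of the clauses in each item, without those after "moreover"), and, under IC2, IC3 and IC5, has the same column signs as $\Lambda$: for each $k$ the $k$-th columns of $\hat\Lambda$ and $\Lambda$ have nonnegative inner product (under IC5 it is also enough, for a given $k$, that their $k$-th entries have the same sign). Then $$\frac1N\sum_{i=1}^N\frac1{\hat\sigma_i^2}\|\hat\lambda_i-\lambda_i\|^2=O_p(T^{-1}),\qquad \frac1N\sum_{i=1}^N(\hat\sigma_i^2-\sigma_i^2)^2=O_p(T^{-1}),\qquad \|\hat M_{ff}-M_{ff}\|^2=O_p(T^{-1}),$$ where $X_{N,T}=O_p(T^{-1})$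 means: for every $\varepsilon>0$ there are $K$ and $n_0$ with $P(T|X_{N,T}|>K)\le\varepsilon$ for all $N,T\ge n_0$. -/

import Mathlib

open MeasureTheory ProbabilityTheory Filter Topology Matrix

noncomputable section

/-- Euclidean norm of a vector, `‖v‖ = (v'v)^{1/2}`. -/
def vecNorm {n : ℕ} (v : Fin n → ℝ) : ℝ := Real.sqrt (v ⬝ᵥ v)

/-- Frobenius norm of a matrix, `‖A‖ = [tr(A'A)]^{1/2}`. -/
def frobNorm {m n : ℕ} (A : Matrix (Fin m) (Fin n) ℝ) : ℝ := Real.sqrt (Aᵀ * A).trace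

/-- Sample mean of `x_1, …, x_T`. -/
def sampleMean {T n : ℕ} (x : Fin T → Fin n → ℝ) : Fin n → ℝ :=
  (T : ℝ)⁻¹ • ∑ t, x t

/-- Sample second moment matrix `T⁻¹ ∑ₜ (xₜ - x̄)(xₜ - x̄)'`. -/
def sampleMoment {T n : ℕ} (x : Fin T → Fin n → ℝ) : Matrix (Fin n) (Fin n) ℝ :=
  (T : ℝ)⁻¹ • ∑ t, vecMulVec (x t - sampleMean x) (x t - sampleMean x)

/-- A parameter `θ = (λ_1, …, λ_N, σ_1², …, σ_N², M_ff)`; the `i`-th row of `loading` is `λ_i'`. -/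
structure FactorParam (N r : ℕ) where
  loading : Matrix (Fin N) (Fin r) ℝ
  variance : Fin N → ℝ
  moment : Matrix (Fin r) (Fin r) ℝ

namespace FactorParam

variable {N r : ℕ}

/-- `Σ_ee = diag(σ_1², …, σ_N²)`. -/
def sigmaEE (θ : FactorParam N r) : Matrix (Fin N) (Fin N) ℝ := Matrix.diagonal θ.variance

/-- `Σ_zz = Λ M_ff Λ' + Σ_ee`. -/
def sigmaZZ (θ : FactorParam N r) : Matrix (Fin N) (Fin N) ℝ :=
  θ.loading * θ.moment * θ.loadingᵀ + θ.sigmaEE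

/-- `N⁻¹ Λ' Σ_ee⁻¹ Λ`. -/
def weightedMoment (θ : FactorParam N r) : Matrix (Fin r) (Fin r) ℝ :=
  (N : ℝ)⁻¹ • (θ.loadingᵀ * θ.sigmaEE⁻¹ * θ.loading)

/-- `N⁻¹ ∑ᵢ σ_i⁻⁴ (λ_i ⊗ λ_i)(λ_i' ⊗ λ_i')`, an `r² × r²` matrix. -/
def kroneckerMoment (θ : FactorParam N r) : Matrix (Fin r × Fin r) (Fin r × Fin r) ℝ :=
  (N : ℝ)⁻¹ • ∑ i, ((θ.variance i) ^ 2)⁻¹ •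
    vecMulVec (fun p : Fin r × Fin r => θ.loading i p.1 * θ.loading i p.2)
      (fun p : Fin r × Fin r => θ.loading i p.1 * θ.loading i p.2)

/-- The quasi log-likelihood `-(2N)⁻¹ ln|Σ_zz| - (2N)⁻¹ tr(M_zz Σ_zz⁻¹)`
at the data moment matrix `Mzz`. -/
def logLik (Mzz : Matrix (Fin N) (Fin N) ℝ) (θ : FactorParam N r) : ℝ :=
  -(1 / (2 * (N : ℝ))) * Real.log θ.sigmaZZ.det
    - (1 / (2 * (N : ℝ))) * (Mzz * θ.sigmaZZ⁻¹).trace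

end FactorParam

/-- The five sets of identifying restrictions. -/
inductive IdentCond
  | IC1 | IC2 | IC3 | IC4 | IC5

namespace IdentCond

/-- The restrictions on a parameter. The upper `r × r` block of `Λ` consists of the entries
`Λ i k` with `i < r`. -/
def Holds {N r : ℕ} : IdentCond → FactorParam N r → Prop
  | IC1, θ => ∀ (i : Fin N) (k : Fin r), i.val < r →
      θ.loading i k = if i.val = k.val then 1 else 0
  | IC2, θ => (θ.moment.IsDiag ∧ StrictAnti (fun k => θ.moment k k) ∧ ∀ k, 0 < θ.moment k k) ∧
      θ.weightedMoment = 1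
  | IC3, θ => θ.moment = 1 ∧ θ.weightedMoment.IsDiag ∧
      StrictAnti (fun k => θ.weightedMoment k k) ∧ ∀ k, 0 < θ.weightedMoment k k
  | IC4, θ => θ.moment.IsDiag ∧ ∀ (i : Fin N) (k : Fin r),
      (i.val = k.val → θ.loading i k = 1) ∧ (i.val < k.val → θ.loading i k = 0)
  | IC5, θ => θ.moment = 1 ∧ ∀ (i : Fin N) (k : Fin r),
      (i.val = k.val → θ.loading i k ≠ 0) ∧ (i.val < k.val → θ.loading i k = 0)

/-- `θ'` and `θ` have the same column signs in `Λ`, required under IC2, IC3 and IC5, where `Λ` is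
identified only up to the signs of its columns: the `k`-th columns have nonnegative inner product.
Under IC5 the sign of a column may instead be read off its `k`-th entry. -/
def SameSigns {N r : ℕ} : IdentCond → FactorParam N r → FactorParam N r → Prop
  | IC1, _, _ => True
  | IC2, θ', θ => ∀ k, 0 ≤ ∑ i, θ'.loading i k * θ.loading i k
  | IC3, θ', θ => ∀ k, 0 ≤ ∑ i, θ'.loading i k * θ.loading i k
  | IC4, _, _ => True
  | IC5, θ', θ => ∀ k : Fin r, 0 ≤ ∑ i, θ'.loading i k * θ.loading i k ∨
      ∃ i : Fin N, i.val = k.val ∧ 0 < θ'.loading i k * θ.loading i k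

/-- The strict inequalities in IC2, IC3 and IC5 (distinct diagonal elements, nonzero `λ_kk`) persist
in the limit. The true parameters `θ N T` satisfying the restrictions exactly vary with `(N, T)`;
`Mbar` is the limit of `M_ff` and `Q` the limit of `N⁻¹ Λ' Σ_ee⁻¹ Λ`. -/
def HoldsInLimit {r : ℕ} : IdentCond → ((N T : ℕ) → FactorParam N r) →
    Matrix (Fin r) (Fin r) ℝ → Matrix (Fin r) (Fin r) ℝ → Prop
  | IC1, _, _, _ => True
  | IC2, _, Mbar, _ => Function.Injective (fun k => Mbar k k)
  | IC3, _, _, Q => Function.Injective (fun k => Q k k)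
  | IC4, _, _, _ => True
  | IC5, θ, _, _ => ∃ c : ℝ, 0 < c ∧ ∀ᶠ p : ℕ × ℕ in atTop,
      ∀ (i : Fin p.1) (k : Fin r), i.val = k.val → c ≤ |(θ p.1 p.2).loading i k|

end IdentCond

/-- The set over which the likelihood is maximized: `σ_i² ∈ [C⁻², C²]`, `M_ff` positive
semidefinite with entries in `[-C, C]`, and the identifying restrictions. -/
def paramSet (N r : ℕ) (C : ℝ) (ic : IdentCond) : Set (FactorParam N r) :=
  {θ | (∀ i, θ.variance i ∈ Set.Icc (C ^ 2)⁻¹ (C ^ 2)) ∧ θ.moment.PosSemidef ∧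
    (∀ k l, θ.moment k l ∈ Set.Icc (-C) C) ∧ ic.Holds θ}

/-- `θ` is a maximum likelihood estimate for the data moment matrix `Mzz`. -/
def IsMLE {N r : ℕ} (C : ℝ) (ic : IdentCond) (Mzz : Matrix (Fin N) (Fin N) ℝ)
    (θ : FactorParam N r) : Prop :=
  θ ∈ paramSet N r C ic ∧ IsMaxOn (FactorParam.logLik Mzz) (paramSet N r C ic) θ

/-- The true parameter at sample size `(N, T)`; `M_ff` is the sample variance of the factors. -/
def trueParam {r : ℕ} (lam : (N T : ℕ) → Fin N → Fin r → ℝ) (σ2 : ℕ → ℝ)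
    (f : (N T : ℕ) → Fin T → Fin r → ℝ) (N T : ℕ) : FactorParam N r where
  loading := Matrix.of (lam N T)
  variance := fun i => σ2 i
  moment := sampleMoment (f N T)

/-- The observations `z_it = α_i + λ_i' f_t + e_it`, as the vectors `z_t`, `t = 1, …, T`. -/
def observation {Ω : Type*} {r : ℕ} (α : (N T : ℕ) → Fin N → ℝ)
    (lam : (N T : ℕ) → Fin N → Fin r → ℝ) (f : (N T : ℕ) → Fin T → Fin r → ℝ)
    (e : ℕ → ℕ → Ω → ℝ) (N T : ℕ) (ω : Ω) : Fin T → Fin N → ℝ :=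
  fun t i => α N T i + lam N T i ⬝ᵥ f N T t + e i t ω

/-- The errors are independent over `i` and `t`, identically distributed over `t` (by independence
this is the same for the vectors `e_t` and for their entries), centered, with variances `σ_i²` and
uniformly bounded fourth moments. -/
structure ErrorAssumption {Ω : Type*} [MeasurableSpace Ω] (μ : Measure Ω)
    (e : ℕ → ℕ → Ω → ℝ) (σ2 : ℕ → ℝ) : Prop where
  memLp : ∀ i t, MemLp (e i t) 4 μ
  mean_zero : ∀ i t, ∫ ω, e i t ω ∂μ = 0
  variance : ∀ i t, ∫ ω, (e i t ω) ^ 2 ∂μ = σ2 i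
  fourth_moment : ∃ K : ℝ, ∀ i t, ∫ ω, (e i t ω) ^ 4 ∂μ ≤ K ^ 4
  indep : iIndepFun (fun p : ℕ × ℕ => e p.1 p.2) μ
  ident : ∀ i t t', IdentDistrib (e i t) (e i t') μ μ

/-- `X_{N,T} = O_p(a_{N,T})` as `N, T → ∞` jointly. -/
def IsBigOp {Ω : Type*} [MeasurableSpace Ω] (μ : Measure Ω) (X : ℕ → ℕ → Ω → ℝ)
    (a : ℕ → ℕ → ℝ) : Prop :=
  ∀ ε : ℝ, 0 < ε → ∃ K : ℝ, ∀ᶠ p : ℕ × ℕ in atTop,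
    μ {ω | K * |a p.1 p.2| < |X p.1 p.2 ω|} ≤ ENNReal.ofReal ε

end

/-! Chance and algebra are separated. Let W be the data moment matrix minus the true covariance
`sigmaZZ`. Every entry of W has second moment O(1/T), uniformly in N
(`ErrorAssumption.entry_bound`). By Markov's inequality, outside an event of probability O(1/κ) and
with τ = √(κ/T), the Frobenius norm is at most τN for W, τ√N for its diagonal and for its first r
rows, and τ for its r × r corner (`SmallNoise`). All the rest is deterministic: on this event the
squared errors, averaged over i where there are N of them, are at most a constant times τ², whatever
the relation of N and T.

Write M_ff = b b' and Γ = Λb. The likelihood depends only on ΓΓ' and the variances (`negLik`, which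
is to be minimized). Let (s, Γ) be the truth and (t, Δ) the estimate.

Variances and column space (`exists_variance_colSpace_rate`). The excess of `negLik` at (t, Δ) over
its value at (s, Γ) is split at (t, Γ). With the true loadings the excess grows quadratically in t -
s, up to a term of order τ√N‖t - s‖. With the variances fixed at t, whitening gives a problem with
unit variances and noise E, where the excess is at least X²/2 - O(‖E‖²/N), X being the distance of
the whitened Γ from the column space of the whitened Δ. A cruder bound first shows that X² is small
compared with N, which the sharp one needs. As the total excess is nonpositive, ‖t - s‖² and X² are
O(τ²N).

Products of the loadings (`exists_block_rate`). Once the column space is nearly right, the variables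
are projected on it and the data reduce to a matrix of fixed size (`negLik_compress`). In fixed
dimension the Gaussian likelihood is stable (`norm_sub_one_le_of_likelihood_le`): a covariance at
least as likely as the truth is within O(τ) of it, in the scale of the truth. The competitor is the
true Γ projected on the estimated space, with the estimated variances on the projected rows. This
yields ΔΔ' up to O(τN), and its blocks formed with the first r rows at their own, smaller, scales.

Identification. The competitor must obey the identifying restrictions, and the loadings must be
recovered from ΔΔ'. Under IC1, IC4 and IC5 only the first r rows and M_ff are restricted, so the
other rows of the competitor are free; the loadings follow from stability of the factorizations LDL'
and LL' (`exists_triangular_rate`). Under IC2 and IC3 the competitor is rotated to diagonalize its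
weighted second moments, and the loadings follow from perturbation of eigenvectors with separated
eigenvalues (`exists_diag_rate`). The column signs are fixed by `SameSigns`. -/

set_option linter.unusedSectionVars false

/-! ### Frobenius norm, positive definite matrices and concavity of log det. -/

section FrobeniusNorm

attribute [local instance] Matrix.frobeniusNormedAddCommGroup Matrix.frobeniusNormedSpace

variable {ι κ ν m n : Type*} [Fintype ι] [Fintype κ] [Fintype ν] [Fintype m] [Fintype n]

theorem frobenius_sq (A : Matrix m n ℝ) : ‖A‖ ^ 2 = ∑ i, ∑ j, A i j ^ 2 := by
  rw [Matrix.frobenius_norm_def, ← Real.sqrt_eq_rpow, Real.sq_sqrt (by positivity)]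
  simp

theorem frobenius_sq_eq_trace (A : Matrix m n ℝ) : ‖A‖ ^ 2 = (Aᵀ * A).trace := by
  rw [frobenius_sq, Finset.sum_comm]
  simp [Matrix.trace, Matrix.mul_apply, sq]

theorem frobenius_sq_eq_trace' (A : Matrix m n ℝ) : ‖A‖ ^ 2 = (A * Aᵀ).trace := by
  rw [frobenius_sq_eq_trace, Matrix.trace_mul_comm]

theorem abs_entry_le_frobenius (A : Matrix m n ℝ) (i : m) (j : n) : |A i j| ≤ ‖A‖ := by
  apply abs_le_of_sq_le_sq _ (norm_nonneg _)
  rw [frobenius_sq]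
  calc A i j ^ 2 ≤ ∑ j, A i j ^ 2 :=
        Finset.single_le_sum (f := fun j => A i j ^ 2) (fun _ _ => sq_nonneg _) (Finset.mem_univ j)
    _ ≤ _ := Finset.single_le_sum (f := fun i => ∑ j, A i j ^ 2)
        (fun _ _ => Finset.sum_nonneg fun _ _ => sq_nonneg _) (Finset.mem_univ i)

theorem abs_trace_mul_le (A : Matrix m n ℝ) (B : Matrix n m ℝ) :
    |(A * B).trace| ≤ ‖A‖ * ‖B‖ := by
  apply abs_le_of_sq_le_sq _ (by positivity)
  rw [mul_pow, ← Matrix.frobenius_norm_transpose B, frobenius_sq, frobenius_sq,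
    ← Fintype.sum_prod_type', ← Fintype.sum_prod_type']
  have : (A * B).trace = ∑ p : m × n, A p.1 p.2 * Bᵀ p.1 p.2 := by
    simp [Matrix.trace, Matrix.mul_apply, Fintype.sum_prod_type]
  rw [this]
  exact Finset.sum_mul_sq_le_sq_mul_sq _ _ _

theorem frobenius_one_sq [DecidableEq n] : ‖(1 : Matrix n n ℝ)‖ ^ 2 = Fintype.card n := by
  rw [frobenius_sq_eq_trace]; simp

theorem frobenius_sq_of_orthonormal [DecidableEq n] {U : Matrix m n ℝ} (hU : Uᵀ * U = 1) :
    ‖U‖ ^ 2 = Fintype.card n := by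
  rw [frobenius_sq_eq_trace, hU]; simp

theorem frobenius_mul_three (A : Matrix m n ℝ) (B : Matrix n ι ℝ) (D : Matrix ι κ ℝ) :
    ‖A * B * D‖ ≤ ‖A‖ * ‖B‖ * ‖D‖ :=
  (Matrix.frobenius_norm_mul _ _).trans
    (mul_le_mul_of_nonneg_right (Matrix.frobenius_norm_mul _ _) (norm_nonneg _))

theorem frobenius_diagonal_sq [DecidableEq n] (d : n → ℝ) :
    ‖Matrix.diagonal d‖ ^ 2 = ∑ i, d i ^ 2 := by
  rw [frobenius_sq]
  refine Finset.sum_congr rfl fun i _ => ?_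
  rw [Finset.sum_eq_single i] <;> simp +contextual [eq_comm]

/-- The norm of a product with a diagonal matrix. -/
theorem frobenius_diagonal_mul_le [DecidableEq m] {d : m → ℝ} {c : ℝ} (hc : 0 ≤ c)
    (hd : ∀ i, |d i| ≤ c) (A : Matrix m n ℝ) : ‖Matrix.diagonal d * A‖ ≤ c * ‖A‖ := by
  refine abs_le_of_sq_le_sq' ?_ (by positivity) |>.2
  rw [mul_pow, frobenius_sq, frobenius_sq, Finset.mul_sum]
  refine Finset.sum_le_sum fun i _ => ?_
  rw [Finset.mul_sum]
  refine Finset.sum_le_sum fun j _ => ?_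
  rw [Matrix.diagonal_mul, mul_pow]
  exact mul_le_mul_of_nonneg_right (sq_le_sq.2 (by rw [abs_of_nonneg hc]; exact hd i)) (sq_nonneg _)

theorem frobenius_mul_diagonal_le [DecidableEq n] {d : n → ℝ} {c : ℝ} (hc : 0 ≤ c)
    (hd : ∀ i, |d i| ≤ c) (A : Matrix m n ℝ) : ‖A * Matrix.diagonal d‖ ≤ c * ‖A‖ := by
  rw [← Matrix.frobenius_norm_transpose, Matrix.transpose_mul, Matrix.diagonal_transpose,
    ← Matrix.frobenius_norm_transpose A]
  exact frobenius_diagonal_mul_le hc hd _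

theorem posSemidef_transpose_mul_self (A : Matrix m n ℝ) : (Aᵀ * A).PosSemidef := by
  simpa using Matrix.posSemidef_conjTranspose_mul_self A

theorem posSemidef_self_mul_transpose (A : Matrix m n ℝ) : (A * Aᵀ).PosSemidef := by
  simpa using Matrix.posSemidef_self_mul_conjTranspose A

theorem posDef_one_add [DecidableEq m] (A : Matrix m n ℝ) : (1 + A * Aᵀ).PosDef :=
  Matrix.PosDef.one.add_posSemidef (posSemidef_self_mul_transpose A)

theorem posDef_one_add' [DecidableEq n] (A : Matrix m n ℝ) : (1 + Aᵀ * A).PosDef :=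
  Matrix.PosDef.one.add_posSemidef (posSemidef_transpose_mul_self A)

theorem posDef_congr [DecidableEq m] {A : Matrix m m ℝ} (hA : A.PosDef) {B : Matrix m m ℝ}
    (hB : IsUnit B.det) : (B * A * Bᵀ).PosDef := by
  have := hA.mul_mul_conjTranspose_same (B := B)
    ((Matrix.vecMul_injective_iff_isUnit).2 ((Matrix.isUnit_iff_isUnit_det _).2 hB))
  simpa using this

theorem posSemidef_congr {A : Matrix m m ℝ} (hA : A.PosSemidef) (B : Matrix n m ℝ) :
    (B * A * Bᵀ).PosSemidef := by
  simpa using hA.mul_mul_conjTranspose_same B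

theorem posDef_isUnit_det [DecidableEq m] {A : Matrix m m ℝ} (hA : A.PosDef) : IsUnit A.det :=
  isUnit_iff_ne_zero.2 hA.det_pos.ne'

theorem log_det_le_trace_sub [DecidableEq m] {A : Matrix m m ℝ} (hA : A.PosDef) :
    Real.log A.det ≤ A.trace - Fintype.card m := by
  rw [hA.1.det_eq_prod_eigenvalues, hA.1.trace_eq_sum_eigenvalues]
  simp only [RCLike.ofReal_real_eq_id, id]
  rw [Real.log_prod fun i _ => (hA.eigenvalues_pos i).ne', ← Finset.card_univ,
    Finset.card_eq_sum_ones, Nat.cast_sum, ← Finset.sum_sub_distrib]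
  exact Finset.sum_le_sum fun i _ => by
    simpa using Real.log_le_sub_one_of_pos (hA.eigenvalues_pos i)

theorem exists_eq_mul_transpose [DecidableEq m] {A : Matrix m m ℝ} (hA : A.PosSemidef) :
    ∃ B : Matrix m m ℝ, A = B * Bᵀ := by
  open scoped MatrixOrder in
  obtain ⟨B, hB⟩ := CStarAlgebra.nonneg_iff_eq_star_mul_self.1 hA.nonneg
  exact ⟨Bᵀ, by simpa [Matrix.star_eq_conjTranspose] using hB⟩

/-- Concavity of `log det`: the tangent inequality. -/
theorem log_det_le [DecidableEq m] {A B : Matrix m m ℝ} (hA : A.PosDef) (hB : B.PosDef) :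
    Real.log A.det ≤ Real.log B.det + (B⁻¹ * A).trace - Fintype.card m := by
  -- Congruence by a root of B⁻¹ turns B into the identity, where the claim is log x ≤ x - 1 for the
  -- eigenvalues.
  obtain ⟨F, hF⟩ := exists_eq_mul_transpose hB.inv.posSemidef
  have hFu : IsUnit F.det := by
    have := posDef_isUnit_det hB.inv
    rw [hF, Matrix.det_mul] at this
    exact isUnit_of_mul_isUnit_left this
  have hP : (Fᵀ * A * Fᵀᵀ).PosDef := posDef_congr hA (by rwa [Matrix.det_transpose])
  have h := log_det_le_trace_sub hP
  have hd : (Fᵀ * A * Fᵀᵀ).det = A.det / B.det := by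
    have : F.det * F.det = B.det⁻¹ := by
      rw [← Ring.inverse_eq_inv', ← Matrix.det_nonsing_inv, hF, Matrix.det_mul,
        Matrix.det_transpose]
    rw [Matrix.transpose_transpose, Matrix.det_mul, Matrix.det_mul, Matrix.det_transpose, div_eq_mul_inv, ← this]
    ring
  have ht : (Fᵀ * A * Fᵀᵀ).trace = (B⁻¹ * A).trace := by
    rw [Matrix.transpose_transpose, hF, Matrix.trace_mul_comm, ← Matrix.mul_assoc]
  rw [hd, Real.log_div hA.det_pos.ne' hB.det_pos.ne', ht] at h
  linarith

theorem trace_mul_nonneg [DecidableEq m] {A B : Matrix m m ℝ} (hA : A.PosSemidef)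
    (hB : B.PosSemidef) : 0 ≤ (A * B).trace := by
  obtain ⟨F, hF⟩ := exists_eq_mul_transpose hA
  rw [hF, Matrix.mul_assoc, Matrix.trace_mul_comm]
  simpa using (posSemidef_congr hB Fᵀ).trace_nonneg

/-- A symmetric matrix bounded below by `c` is positive definite with inverse of size `O(1/c)`. -/
theorem posDef_of_lower [DecidableEq m] {A : Matrix m m ℝ} (hA : Aᵀ = A) {c : ℝ} (hc : 0 < c)
    (h : ∀ v, c * (v ⬝ᵥ v) ≤ v ⬝ᵥ A *ᵥ v) : A.PosDef := by
  refine Matrix.PosDef.of_dotProduct_mulVec_pos (by simpa [Matrix.IsHermitian] using hA) ?_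
  intro v hv
  have : 0 < v ⬝ᵥ v := by
    have := Matrix.dotProduct_star_self_pos_iff.2 hv
    simpa using this
  simpa using (mul_pos hc this).trans_le (h v)

/-- The Frobenius norm of a positive semidefinite matrix is at most its trace. For the i-th column v
of the inverse, the lower bound reads c |v|² ≤ v_i, hence c v_i² ≤ v_i, and each diagonal entry is
at most 1/c. -/
theorem norm_inv_le_of_lower [DecidableEq m] {A : Matrix m m ℝ} (hA : Aᵀ = A) {c : ℝ} (hc : 0 < c)
    (h : ∀ v, c * (v ⬝ᵥ v) ≤ v ⬝ᵥ A *ᵥ v) : ‖A⁻¹‖ ≤ Fintype.card m / c := by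
  have hP := posDef_of_lower hA hc h
  obtain ⟨F, hF⟩ := exists_eq_mul_transpose hP.inv.posSemidef
  have h1 : ‖A⁻¹‖ ≤ A⁻¹.trace := by
    rw [hF, ← frobenius_sq_eq_trace']
    exact (Matrix.frobenius_norm_mul _ _).trans (by rw [Matrix.frobenius_norm_transpose, sq])
  refine h1.trans ?_
  rw [Matrix.trace, Fintype.card_eq_sum_ones, Nat.cast_sum, Finset.sum_div]
  refine Finset.sum_le_sum fun i _ => ?_
  set v : m → ℝ := fun j => A⁻¹ j i with hv
  have hAv : A *ᵥ v = Pi.single i 1 := by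
    have := congrArg (fun M : Matrix m m ℝ => fun j => M j i) (Matrix.mul_nonsing_inv A (posDef_isUnit_det hP))
    ext j
    simpa [Matrix.mulVec, dotProduct, Matrix.mul_apply, hv, Matrix.one_apply, Pi.single_apply] using congrFun this j
  have h2 := h v
  rw [hAv, dotProduct_single, mul_one] at h2
  have h3 : v i ^ 2 ≤ v ⬝ᵥ v := by
    rw [dotProduct, sq]
    exact Finset.single_le_sum (f := fun j => v j * v j) (fun _ _ => mul_self_nonneg _) (Finset.mem_univ i)
  have h4 : 0 ≤ v i := hP.inv.posSemidef.diag_nonneg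
  simp only [Matrix.diag_apply, Nat.cast_one]
  change v i ≤ 1 / c
  rw [le_div_iff₀ hc]
  rcases h4.eq_or_lt with h0 | h0
  · rw [← h0]; simp
  · have : c * v i ^ 2 ≤ v i := (mul_le_mul_of_nonneg_left h3 hc.le).trans h2
    nlinarith

theorem quadForm_transpose_mul_self (A : Matrix m n ℝ) (v : n → ℝ) :
    v ⬝ᵥ (Aᵀ * A) *ᵥ v = (A *ᵥ v) ⬝ᵥ (A *ᵥ v) := by
  rw [← Matrix.mulVec_mulVec, Matrix.dotProduct_mulVec, Matrix.vecMul_transpose]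

theorem sq_dotProduct_le (v w : m → ℝ) : (v ⬝ᵥ w) ^ 2 ≤ (v ⬝ᵥ v) * (w ⬝ᵥ w) := by
  have := Finset.sum_mul_sq_le_sq_mul_sq Finset.univ v w
  simpa [dotProduct, sq] using this

theorem dotProduct_self_nonneg' (v : m → ℝ) : 0 ≤ v ⬝ᵥ v := by
  rw [dotProduct]; exact Finset.sum_nonneg fun _ _ => mul_self_nonneg _

theorem mulVec_sq_le (A : Matrix m n ℝ) (v : n → ℝ) :
    (A *ᵥ v) ⬝ᵥ (A *ᵥ v) ≤ ‖A‖ ^ 2 * (v ⬝ᵥ v) := by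
  rw [frobenius_sq, dotProduct, Finset.sum_mul]
  refine Finset.sum_le_sum fun i _ => ?_
  have := sq_dotProduct_le (A i) v
  simpa [Matrix.mulVec, dotProduct, sq] using this

theorem abs_quadForm_le (A : Matrix m m ℝ) (v : m → ℝ) :
    |v ⬝ᵥ A *ᵥ v| ≤ ‖A‖ * (v ⬝ᵥ v) := by
  have h0 := dotProduct_self_nonneg' v
  refine abs_le_of_sq_le_sq ?_ (mul_nonneg (norm_nonneg _) h0)
  calc (v ⬝ᵥ A *ᵥ v) ^ 2 ≤ (v ⬝ᵥ v) * ((A *ᵥ v) ⬝ᵥ (A *ᵥ v)) := sq_dotProduct_le _ _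
    _ ≤ (v ⬝ᵥ v) * (‖A‖ ^ 2 * (v ⬝ᵥ v)) := mul_le_mul_of_nonneg_left (mulVec_sq_le A v) h0
    _ = _ := by ring

/-- For square `g`, a lower bound for `gᵀ g` is one for `g gᵀ`. -/
theorem lower_mul_transpose_of_lower [DecidableEq m] {g : Matrix m m ℝ} {c : ℝ} (hc : 0 < c)
    (h : ∀ v, c * (v ⬝ᵥ v) ≤ v ⬝ᵥ (gᵀ * g) *ᵥ v) (v : m → ℝ) :
    c * (v ⬝ᵥ v) ≤ v ⬝ᵥ (g * gᵀ) *ᵥ v := by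
  have hP := posDef_of_lower (by simp) hc h
  have hg : IsUnit g.det := by
    have := posDef_isUnit_det hP
    rw [Matrix.det_mul] at this
    exact isUnit_of_mul_isUnit_right this
  -- With v = gw one has |v|² = ⟨g'v, w⟩. By Cauchy–Schwarz |v|⁴ ≤ |g'v|² |w|², and the hypothesis
  -- at w bounds c|w|² by |v|².
  set w := g⁻¹ *ᵥ v
  have hw : g *ᵥ w = v := by
    rw [Matrix.mulVec_mulVec, Matrix.mul_nonsing_inv _ hg, Matrix.one_mulVec]
  have h1 := h w
  rw [quadForm_transpose_mul_self, hw] at h1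
  have h2 : v ⬝ᵥ (g * gᵀ) *ᵥ v = (gᵀ *ᵥ v) ⬝ᵥ (gᵀ *ᵥ v) := by
    simpa using quadForm_transpose_mul_self gᵀ v
  have h3 : v ⬝ᵥ v = (gᵀ *ᵥ v) ⬝ᵥ w := by
    conv_lhs => rw [← hw]
    rw [Matrix.mulVec_transpose, ← Matrix.dotProduct_mulVec, hw]
  have h4 := sq_dotProduct_le (gᵀ *ᵥ v) w
  rw [← h3] at h4
  rw [h2]
  have h5 := dotProduct_self_nonneg' v
  have h6 := dotProduct_self_nonneg' (gᵀ *ᵥ v)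
  rcases h5.eq_or_lt with h0 | h0
  · rw [← h0]; simpa using h6
  · have : c * (v ⬝ᵥ v) ^ 2 ≤ (gᵀ *ᵥ v ⬝ᵥ gᵀ *ᵥ v) * (v ⬝ᵥ v) := by
      calc _ ≤ c * ((gᵀ *ᵥ v ⬝ᵥ gᵀ *ᵥ v) * (w ⬝ᵥ w)) := mul_le_mul_of_nonneg_left h4 hc.le
        _ = (gᵀ *ᵥ v ⬝ᵥ gᵀ *ᵥ v) * (c * (w ⬝ᵥ w)) := by ring
        _ ≤ _ := mul_le_mul_of_nonneg_left h1 h6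
    nlinarith

end FrobeniusNorm

/-! ### The Gaussian likelihood: whitening and reduction to the column space of the loadings. -/

section FrobeniusNorm

attribute [local instance] Matrix.frobeniusNormedAddCommGroup Matrix.frobeniusNormedSpace

variable {ι κ ν m n : Type*} [Fintype ι] [Fintype κ] [Fintype ν] [Fintype m] [Fintype n]
  [DecidableEq ι] [DecidableEq κ] [DecidableEq ν] [DecidableEq m] [DecidableEq n]

/-- `log det (1 + G Gᵀ) + tr (M (1 + G Gᵀ)⁻¹)`, the likelihood with unit error variances. -/
noncomputable def unitNegLik (M : Matrix ι ι ℝ) (G : Matrix ι n ℝ) : ℝ :=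
  Real.log (1 + G * Gᵀ).det + (M * (1 + G * Gᵀ)⁻¹).trace

/-- `log det (D + Γ Γᵀ) + tr (M (D + Γ Γᵀ)⁻¹)` with `D = diag s`. -/
noncomputable def negLik (M : Matrix ι ι ℝ) (s : ι → ℝ) (Γ : Matrix ι n ℝ) : ℝ :=
  Real.log (Matrix.diagonal s + Γ * Γᵀ).det + (M * (Matrix.diagonal s + Γ * Γᵀ)⁻¹).trace

theorem inv_one_add_mul_transpose (G : Matrix ι n ℝ) :
    (1 + G * Gᵀ)⁻¹ = 1 - G * (1 + Gᵀ * G)⁻¹ * Gᵀ := by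
  apply Matrix.inv_eq_right_inv
  have h := Matrix.mul_nonsing_inv _ (posDef_isUnit_det (posDef_one_add' G))
  set R := (1 + Gᵀ * G)⁻¹
  have h2 : Gᵀ * G * R = 1 - R := by
    rw [Matrix.add_mul, Matrix.one_mul] at h
    exact eq_sub_of_add_eq' h
  calc (1 + G * Gᵀ) * (1 - G * R * Gᵀ) = 1 + G * Gᵀ - G * R * Gᵀ - G * (Gᵀ * G * R) * Gᵀ := by
        simp only [Matrix.mul_sub, Matrix.add_mul, Matrix.mul_one, Matrix.one_mul, Matrix.mul_assoc]
        abel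
    _ = 1 := by
        rw [h2]
        simp only [Matrix.mul_sub, Matrix.sub_mul, Matrix.mul_one, Matrix.mul_assoc]
        abel

theorem det_one_add_mul_transpose (G : Matrix ι n ℝ) : (1 + G * Gᵀ).det = (1 + Gᵀ * G).det :=
  Matrix.det_one_add_mul_comm _ _

theorem inv_one_add_orthonormal_mul {U : Matrix ι n ℝ} (hU : Uᵀ * U = 1) (L : Matrix n m ℝ) :
    (1 + U * L * (U * L)ᵀ)⁻¹ = 1 - U * (1 - (1 + L * Lᵀ)⁻¹) * Uᵀ := by
  rw [inv_one_add_mul_transpose, inv_one_add_mul_transpose L]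
  have : (U * L)ᵀ * (U * L) = Lᵀ * L := by
    rw [Matrix.transpose_mul, Matrix.mul_assoc, ← Matrix.mul_assoc Uᵀ, hU, Matrix.one_mul]
  rw [this, sub_sub_cancel, Matrix.transpose_mul]
  simp only [Matrix.mul_assoc]

theorem det_one_add_orthonormal_mul {U : Matrix ι n ℝ} (hU : Uᵀ * U = 1) (L : Matrix n m ℝ) :
    (1 + U * L * (U * L)ᵀ).det = (1 + L * Lᵀ).det := by
  rw [det_one_add_mul_transpose, det_one_add_mul_transpose L]
  rw [Matrix.transpose_mul, Matrix.mul_assoc, ← Matrix.mul_assoc Uᵀ, hU, Matrix.one_mul]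

/-- Reduction of the likelihood to the coordinates in the column space of the loadings. -/
theorem unitNegLik_orthonormal_mul (M : Matrix ι ι ℝ) {U : Matrix ι n ℝ} (hU : Uᵀ * U = 1)
    (L : Matrix n m ℝ) :
    unitNegLik M (U * L) = M.trace - (Uᵀ * M * U).trace + unitNegLik (Uᵀ * M * U) L := by
  rw [unitNegLik, unitNegLik, det_one_add_orthonormal_mul hU, inv_one_add_orthonormal_mul hU]
  have h1 : (M * (U * Uᵀ)).trace = (Uᵀ * M * U).trace := by
    rw [← Matrix.mul_assoc, Matrix.trace_mul_comm, ← Matrix.mul_assoc]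
  have h2 : (M * (U * (1 + L * Lᵀ)⁻¹ * Uᵀ)).trace = (Uᵀ * M * U * (1 + L * Lᵀ)⁻¹).trace := by
    rw [← Matrix.mul_assoc, Matrix.trace_mul_comm]
    simp only [Matrix.mul_assoc]
  simp only [Matrix.mul_sub, Matrix.sub_mul, Matrix.mul_one, Matrix.trace_sub]
  rw [h1, h2]
  ring

theorem diagonal_add_eq {s : ι → ℝ} (hs : ∀ i, 0 < s i) (Γ : Matrix ι n ℝ) :
    Matrix.diagonal s + Γ * Γᵀ = Matrix.diagonal (fun i => √(s i)) *
      (1 + (Matrix.diagonal (fun i => (√(s i))⁻¹) * Γ) *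
        (Matrix.diagonal (fun i => (√(s i))⁻¹) * Γ)ᵀ) * Matrix.diagonal (fun i => √(s i)) := by
  ext i j
  have hi := (Real.sqrt_pos.2 (hs i)).ne'
  have hj := (Real.sqrt_pos.2 (hs j)).ne'
  rw [Matrix.mul_diagonal, Matrix.diagonal_mul, Matrix.add_apply, Matrix.add_apply,
    Matrix.transpose_mul, Matrix.diagonal_transpose, ← Matrix.mul_assoc, Matrix.mul_diagonal,
    Matrix.mul_assoc, Matrix.diagonal_mul]
  rcases eq_or_ne i j with rfl | h
  · simp only [Matrix.diagonal_apply_eq, Matrix.one_apply_eq]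
    field_simp
    rw [Real.sq_sqrt (hs i).le]
  · simp only [Matrix.diagonal_apply_ne _ h, Matrix.one_apply_ne h]
    field_simp
    ring

theorem posDef_diagonal_add {s : ι → ℝ} (hs : ∀ i, 0 < s i) (Γ : Matrix ι n ℝ) :
    (Matrix.diagonal s + Γ * Γᵀ).PosDef :=
  (Matrix.PosDef.diagonal (fun i => hs i)).add_posSemidef (posSemidef_self_mul_transpose Γ)

theorem inv_diagonal_of_pos {s : ι → ℝ} (hs : ∀ i, 0 < s i) :
    (Matrix.diagonal s)⁻¹ = Matrix.diagonal (fun i => (s i)⁻¹) := by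
  apply Matrix.inv_eq_right_inv
  rw [Matrix.diagonal_mul_diagonal, ← Matrix.diagonal_one]
  congr 1; ext i; exact mul_inv_cancel₀ (hs i).ne'

theorem log_det_diagonal_add {s : ι → ℝ} (hs : ∀ i, 0 < s i) (Γ : Matrix ι n ℝ) :
    Real.log (Matrix.diagonal s + Γ * Γᵀ).det = ∑ i, Real.log (s i) +
      Real.log (1 + (Matrix.diagonal (fun i => (√(s i))⁻¹) * Γ) *
        (Matrix.diagonal (fun i => (√(s i))⁻¹) * Γ)ᵀ).det := by
  have hs' : ∀ i, 0 < √(s i) := fun i => Real.sqrt_pos.2 (hs i)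
  have h0 : (∏ i, √(s i)) ≠ 0 := Finset.prod_ne_zero_iff.2 fun i _ => (hs' i).ne'
  have h1 := (posDef_one_add (Matrix.diagonal (fun i => (√(s i))⁻¹) * Γ)).det_pos.ne'
  rw [diagonal_add_eq hs, Matrix.det_mul, Matrix.det_mul, Matrix.det_diagonal,
    Real.log_mul (mul_ne_zero h0 h1) h0, Real.log_mul h0 h1,
    Real.log_prod fun i _ => (hs' i).ne']
  have : ∀ i, Real.log (s i) = Real.log √(s i) + Real.log √(s i) := fun i => by
    rw [Real.log_sqrt (hs i).le]; ring
  simp_rw [this, Finset.sum_add_distrib]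
  ring

/-- Whitening by the standard deviations removes the variances from the loading problem: as long as
the variances are fixed, likelihoods can be compared as if they were all equal to one. -/
theorem negLik_eq {s : ι → ℝ} (hs : ∀ i, 0 < s i) (M : Matrix ι ι ℝ) (Γ : Matrix ι n ℝ) :
    negLik M s Γ = ∑ i, Real.log (s i) +
      unitNegLik (Matrix.diagonal (fun i => (√(s i))⁻¹) * M * Matrix.diagonal (fun i => (√(s i))⁻¹))
        (Matrix.diagonal (fun i => (√(s i))⁻¹) * Γ) := by
  rw [negLik, unitNegLik, log_det_diagonal_add hs, add_assoc]
  congr 2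
  have hs' : ∀ i, 0 < √(s i) := fun i => Real.sqrt_pos.2 (hs i)
  rw [diagonal_add_eq hs, Matrix.mul_inv_rev, Matrix.mul_inv_rev, inv_diagonal_of_pos hs']
  conv_rhs => rw [Matrix.mul_assoc, Matrix.mul_assoc, Matrix.trace_mul_comm]
  simp only [Matrix.mul_assoc]

/-- QR decomposition. -/
theorem exists_orthonormal_mul (h : Fintype.card m ≤ Fintype.card ι) (A : Matrix ι m ℝ) :
    ∃ (U : Matrix ι m ℝ) (L : Matrix m m ℝ), Uᵀ * U = 1 ∧ A = U * L := by
  obtain ⟨e⟩ : Nonempty (m ↪ ι) := Function.Embedding.nonempty_of_card_le h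
  let V : Submodule ℝ (EuclideanSpace ℝ ι) := Submodule.span ℝ (Set.range fun j => WithLp.toLp 2 (fun i => A i j))
  have hV : Module.finrank ℝ V ≤ Fintype.card m := finrank_range_le_card _
  -- an orthonormal basis of `V`, extended to the whole space
  let b := stdOrthonormalBasis ℝ V
  let f : Fin (Module.finrank ℝ V) ↪ m :=
    (Function.Embedding.nonempty_of_card_le (by simpa using hV)).some
  classical
  -- The columns may span fewer than `card m` dimensions. An orthonormal basis of the span is placed
  -- at the indices `e (f k)` and then completed, so that U has `card m` orthonormal columns in
  -- every case.
  let v : ι → EuclideanSpace ℝ ι := fun i => if h : ∃ k, e (f k) = i then (b h.choose : EuclideanSpace ℝ ι) else 0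
  let s : Set ι := Set.range fun k => e (f k)
  have hvk : ∀ k, v (e (f k)) = b k := by
    intro k
    have hk : ∃ k', e (f k') = e (f k) := ⟨k, rfl⟩
    have : hk.choose = k := f.injective (e.injective hk.choose_spec)
    simp only [v, dif_pos hk, this]
  have hs : Orthonormal ℝ (s.domRestrict v) := by
    let g : s → Fin (Module.finrank ℝ V) := fun x => x.2.choose
    have hg : ∀ x : s, e (f (g x)) = x := fun x => x.2.choose_spec
    have hgi : Function.Injective g := fun x y hxy => Subtype.ext (by rw [← hg x, ← hg y, hxy])
    have := (b.orthonormal.comp_linearIsometry V.subtypeₗᵢ).comp g hgi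
    convert! this using 1
    ext1 x
    simp only [Set.domRestrict_apply, Function.comp_apply]
    conv_lhs => rw [← hg x, hvk]
    rfl
  obtain ⟨B, hB⟩ := hs.exists_orthonormalBasis_extension_of_card_eq (by simp)
  refine ⟨Matrix.of fun i j => B (e j) i,
    Matrix.of fun j k => inner ℝ (B (e j)) (WithLp.toLp 2 (fun i => A i k)), ?_, ?_⟩
  · ext j k
    have := orthonormal_iff_ite.1 B.orthonormal (e k) (e j)
    simp only [PiLp.inner_apply, RCLike.inner_apply, conj_trivial] at this
    rw [Matrix.mul_apply, Matrix.one_apply]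
    simp only [EmbeddingLike.apply_eq_iff_eq] at this
    simp only [Matrix.transpose_apply, Matrix.of_apply]
    rw [this]; simp [eq_comm]
  · have key : ∀ k, (WithLp.toLp 2 (fun i => A i k) : EuclideanSpace ℝ ι) =
        ∑ j, inner ℝ (B (e j)) (WithLp.toLp 2 (fun i => A i k)) • B (e j) := by
      intro k
      set a : EuclideanSpace ℝ ι := WithLp.toLp 2 (fun i => A i k)
      have ha : a ∈ V := Submodule.subset_span ⟨k, rfl⟩
      -- Basis vectors at the other indices are orthogonal to the column span, so the expansion of a
      -- column involves only indices in the range of e.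
      have hz : ∀ i, i ∉ s → inner ℝ (B i) a = 0 := by
        intro i hi
        have h1 : ∀ l, inner ℝ (B i) (b l : EuclideanSpace ℝ ι) = 0 := by
          intro l
          have h2 : B (e (f l)) = b l := by rw [hB _ ⟨l, rfl⟩, hvk]
          rw [← h2]
          exact B.orthonormal.2 fun h => hi ⟨l, h.symm⟩
        have h3 := congrArg (Subtype.val : V → EuclideanSpace ℝ ι) (b.sum_repr ⟨a, ha⟩)
        have h4 : a = ∑ l, b.repr ⟨a, ha⟩ l • (b l : EuclideanSpace ℝ ι) := by
          conv_lhs => rw [show a = ((⟨a, ha⟩ : V) : EuclideanSpace ℝ ι) from rfl, ← h3]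
          simp
        rw [h4, inner_sum]
        exact Finset.sum_eq_zero fun l _ => by rw [inner_smul_right, h1, mul_zero]
      conv_lhs => rw [← B.sum_repr a]
      simp only [OrthonormalBasis.repr_apply_apply]
      symm
      rw [← Finset.sum_map Finset.univ e (fun i => inner ℝ (B i) a • B i)]
      refine Finset.sum_subset (Finset.subset_univ _) fun i _ hi => ?_
      rw [hz i, zero_smul]
      rintro ⟨l, rfl⟩
      exact hi (by simp)
    ext i k
    have := congrArg (fun x : EuclideanSpace ℝ ι => x.ofLp i) (key k)
    rw [Matrix.mul_apply]
    refine this.trans ?_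
    rw [WithLp.ofLp_sum, Finset.sum_apply]
    exact Finset.sum_congr rfl fun j _ => mul_comm _ _

/-! ### Stability of the Gaussian likelihood in fixed dimension. -/

theorem sub_one_sub_log_ge {z : ℝ} (hz : 0 < z) :
    (z - 1) ^ 2 / (2 * (z + 1)) ≤ z - 1 - Real.log z := by
  have hs := Real.sqrt_pos.2 hz
  have h1 := Real.log_le_sub_one_of_pos hs
  rw [Real.log_sqrt hz.le] at h1
  have h2 := Real.sq_sqrt hz.le
  -- Here log z = 2 log √z ≤ 2(√z - 1). The square (√z - 1)² is then compared with (z - 1)² through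
  -- (√z + 1)² ≤ 2(z + 1).
  have h3 : (√z - 1) ^ 2 ≤ z - 1 - Real.log z := by nlinarith
  refine le_trans ?_ h3
  rw [div_le_iff₀ (by positivity)]
  have h4 : (z - 1) ^ 2 = (√z - 1) ^ 2 * (√z + 1) ^ 2 := by
    rw [← mul_pow]; congr 1; linear_combination -h2
  rw [h4]
  exact mul_le_mul_of_nonneg_left (by nlinarith [sq_nonneg (√z - 1)]) (sq_nonneg _)

/-- The loss is a sum over the eigenvalues d of Z of d - 1 - log d, which is at least (d - 1)²/(2(d
+ 1)). Each d is within ‖Z - 1‖ of 1, which bounds all the denominators at once. The growth is thus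
quadratic near the identity and linear far from it. -/
theorem trace_sub_log_det_ge {Z : Matrix m m ℝ} (hZ : Z.PosDef) :
    ‖Z - 1‖ ^ 2 ≤ 2 * (2 + ‖Z - 1‖) * (Z.trace - Fintype.card m - Real.log Z.det) := by
  have hpos := hZ.eigenvalues_pos
  set d := hZ.1.eigenvalues
  have hnorm : ‖Z - 1‖ ^ 2 = ∑ i, (d i - 1) ^ 2 := by
    set V : Matrix m m ℝ := (hZ.1.eigenvectorUnitary : Matrix m m ℝ) with hV
    have hVV : Vᵀ * V = 1 := by
      simpa [Matrix.star_eq_conjTranspose] using Unitary.coe_star_mul_self hZ.1.eigenvectorUnitary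
    have hVV' : V * Vᵀ = 1 := by
      simpa [Matrix.star_eq_conjTranspose] using Unitary.coe_mul_star_self hZ.1.eigenvectorUnitary
    have hs : Z = V * Matrix.diagonal d * Vᵀ := by
      have := hZ.1.spectral_theorem
      rw [Unitary.conjStarAlgAut_apply] at this
      simpa [Matrix.star_eq_conjTranspose, Function.comp_def] using this
    have h1 : Z - 1 = V * Matrix.diagonal (fun i => d i - 1) * Vᵀ := by
      have : Matrix.diagonal (fun i => d i - 1) = Matrix.diagonal d - 1 := by
        rw [← Matrix.diagonal_one, Matrix.diagonal_sub]
      rw [this, Matrix.mul_sub, Matrix.sub_mul, ← hs, Matrix.mul_one, hVV']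
    rw [← frobenius_diagonal_sq, frobenius_sq_eq_trace, frobenius_sq_eq_trace, h1]
    simp only [Matrix.transpose_mul, Matrix.transpose_transpose, Matrix.mul_assoc]
    rw [← Matrix.mul_assoc Vᵀ V, hVV, Matrix.one_mul, Matrix.trace_mul_comm]
    simp only [Matrix.mul_assoc]
    rw [hVV, Matrix.mul_one]
  have htr : Z.trace - Fintype.card m - Real.log Z.det = ∑ i, (d i - 1 - Real.log (d i)) := by
    rw [hZ.1.det_eq_prod_eigenvalues, hZ.1.trace_eq_sum_eigenvalues]
    simp only [RCLike.ofReal_real_eq_id, id]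
    rw [Real.log_prod fun i _ => (hpos i).ne', Finset.sum_sub_distrib, Finset.sum_sub_distrib]
    simp [d]
  have hle : ∀ i, |d i - 1| ≤ ‖Z - 1‖ := fun i => by
    refine abs_le_of_sq_le_sq ?_ (norm_nonneg _)
    rw [hnorm]
    exact Finset.single_le_sum (f := fun i => (d i - 1) ^ 2) (fun _ _ => sq_nonneg _)
      (Finset.mem_univ i)
  rw [htr, hnorm, Finset.mul_sum]
  refine Finset.sum_le_sum fun i _ => ?_
  have h1 := sub_one_sub_log_ge (hpos i)
  have hp := hpos i
  rw [div_le_iff₀ (by positivity)] at h1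
  refine h1.trans ?_
  rw [mul_comm]
  have h0 : 0 ≤ d i - 1 - Real.log (d i) := by
    have := Real.log_le_sub_one_of_pos hp; linarith
  refine mul_le_mul_of_nonneg_right ?_ h0
  have := (abs_le.1 (hle i)).2
  linarith

/-- Stability of the Gaussian likelihood: a covariance matrix that is at least as likely as
`F Fᵀ`, for data close to `F Fᵀ`, is close to `F Fᵀ`. -/
theorem norm_sub_one_le_of_likelihood_le {F S M : Matrix m m ℝ} (hF : IsUnit F.det)
    (hS : S.PosDef) {ε : ℝ} (hε : ‖F⁻¹ * (M - F * Fᵀ) * F⁻¹ᵀ‖ ≤ ε) (hε' : ε ≤ 1 / 16)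
    (h : Real.log S.det + (M * S⁻¹).trace ≤
      Real.log (F * Fᵀ).det + (M * (F * Fᵀ)⁻¹).trace) :
    ‖F⁻¹ * S * F⁻¹ᵀ - 1‖ ≤ 8 * ε := by
  have hε0 : 0 ≤ ε := (norm_nonneg _).trans hε
  have hFt : IsUnit Fᵀ.det := by rwa [Matrix.det_transpose]
  set E := F⁻¹ * (M - F * Fᵀ) * F⁻¹ᵀ with hE
  have hM : M = F * (1 + E) * Fᵀ := by
    have h1 : F * E * Fᵀ = M - F * Fᵀ := by
      rw [hE, Matrix.transpose_nonsing_inv]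
      simp only [Matrix.mul_assoc]
      rw [Matrix.nonsing_inv_mul _ hFt, Matrix.mul_one, ← Matrix.mul_assoc,
        Matrix.mul_nonsing_inv _ hF, Matrix.one_mul]
    rw [Matrix.mul_add, Matrix.add_mul, h1, Matrix.mul_one]
    abel
  set Z := Fᵀ * S⁻¹ * F with hZ
  have hZP : Z.PosDef := by
    have := posDef_congr hS.inv hFt
    rwa [Matrix.transpose_transpose] at this
  set Y := F⁻¹ * S * F⁻¹ᵀ with hY
  have hZY : Z * Y = 1 := by
    rw [hZ, hY, Matrix.transpose_nonsing_inv]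
    calc Fᵀ * S⁻¹ * F * (F⁻¹ * S * Fᵀ⁻¹) = Fᵀ * S⁻¹ * (F * F⁻¹) * S * Fᵀ⁻¹ := by
          simp only [Matrix.mul_assoc]
      _ = Fᵀ * (S⁻¹ * S) * Fᵀ⁻¹ := by
          rw [Matrix.mul_nonsing_inv _ hF, Matrix.mul_one]; simp only [Matrix.mul_assoc]
      _ = 1 := by
          rw [Matrix.nonsing_inv_mul _ (posDef_isUnit_det hS), Matrix.mul_one,
            Matrix.mul_nonsing_inv _ hFt]
  have t1 : (M * S⁻¹).trace = Z.trace + (E * Z).trace := by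
    have : (M * S⁻¹).trace = ((1 + E) * Z).trace := by
      rw [hM, hZ, Matrix.mul_assoc, Matrix.mul_assoc, Matrix.trace_mul_comm]
      simp only [Matrix.mul_assoc]
    rw [this, Matrix.add_mul, Matrix.one_mul, Matrix.trace_add]
  have t2 : (M * (F * Fᵀ)⁻¹).trace = Fintype.card m + E.trace := by
    have : (M * (F * Fᵀ)⁻¹).trace = (1 + E).trace := by
      rw [Matrix.mul_inv_rev, hM]
      calc (F * (1 + E) * Fᵀ * (Fᵀ⁻¹ * F⁻¹)).trace
          = (F * (1 + E) * (Fᵀ * Fᵀ⁻¹) * F⁻¹).trace := by simp only [Matrix.mul_assoc]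
        _ = (1 + E).trace := by
          rw [Matrix.mul_nonsing_inv _ hFt, Matrix.mul_one, Matrix.trace_mul_comm,
            ← Matrix.mul_assoc, Matrix.nonsing_inv_mul _ hF, Matrix.one_mul]
    rw [this, Matrix.trace_add, Matrix.trace_one]
  have t3 : Real.log Z.det = Real.log (F * Fᵀ).det - Real.log S.det := by
    have hFF : (F * Fᵀ).det ≠ 0 := by
      rw [Matrix.det_mul]; exact (hF.mul hFt).ne_zero
    have : Z.det = (F * Fᵀ).det / S.det := by
      rw [hZ, Matrix.det_mul, Matrix.det_mul, Matrix.det_nonsing_inv, Ring.inverse_eq_inv',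
        Matrix.det_mul]
      ring
    rw [this, Real.log_div hFF hS.det_pos.ne']
  -- Z is the precision matrix of the rival in coordinates where the truth is the identity.
  -- Comparing the likelihoods bounds its loss by a term linear in Z - 1 with the small factor ε;
  -- quadratic growth then makes Z - 1 itself of order ε.
  have t4 : Z.trace - Fintype.card m - Real.log Z.det ≤ ε * ‖Z - 1‖ := by
    have h1 : Z.trace - Fintype.card m - Real.log Z.det ≤ -(E * (Z - 1)).trace := by
      rw [Matrix.mul_sub, Matrix.trace_sub, Matrix.mul_one]
      linarith
    refine h1.trans ((neg_le_abs _).trans ((abs_trace_mul_le _ _).trans ?_))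
    exact mul_le_mul_of_nonneg_right hε (norm_nonneg _)
  have t5 := trace_sub_log_det_ge hZP
  set d := ‖Z - 1‖
  have hd0 : 0 ≤ d := norm_nonneg _
  have t6 : d ≤ 2 * (2 + d) * ε := by
    rcases hd0.eq_or_lt with h0 | h0
    · rw [← h0]; positivity
    · have : d * d ≤ d * (2 * (2 + d) * ε) := by
        have := mul_le_mul_of_nonneg_left t4 (by positivity : 0 ≤ 2 * (2 + d))
        nlinarith
      exact le_of_mul_le_mul_left this h0
  -- From the precision Z to the covariance Y = Z⁻¹.
  have t7 : ‖Y - 1‖ ≤ d + d * ‖Y - 1‖ := by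
    have : Y - 1 = (1 - Z) + (1 - Z) * (Y - 1) := by
      rw [Matrix.sub_mul, Matrix.one_mul, Matrix.mul_sub, hZY, Matrix.mul_one]; abel
    conv_lhs => rw [this]
    refine (norm_add_le _ _).trans ?_
    have h1 : ‖1 - Z‖ = d := norm_sub_rev _ _
    rw [h1]
    exact add_le_add_right ((Matrix.frobenius_norm_mul _ _).trans (by rw [h1])) _
  have hy := norm_nonneg (Y - 1)
  -- As ε ≤ 1/16, `t6` gives d ≤ 32ε/7 ≤ 2/7. Then ‖Y - 1‖ ≤ d/(1 - d) is at most 32ε/5, below the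
  -- 8ε claimed.
  have hd1 : d ≤ 40 / 7 * ε * (4 / 5) := by nlinarith
  nlinarith

/-! ### Loss of likelihood caused by a wrong column space. -/

/-- The projection of `G` on the column space of `U` and the rest. -/
theorem norm_sq_proj {U : Matrix ι m ℝ} (hU : Uᵀ * U = 1) (G : Matrix ι n ℝ) :
    ‖G‖ ^ 2 = ‖Uᵀ * G‖ ^ 2 + ‖G - U * (Uᵀ * G)‖ ^ 2 ∧
    Gᵀ * G = (Uᵀ * G)ᵀ * (Uᵀ * G) +
      (G - U * (Uᵀ * G))ᵀ * (G - U * (Uᵀ * G)) ∧ Uᵀ * (G - U * (Uᵀ * G)) = 0 := by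
  have h0 : Uᵀ * (G - U * (Uᵀ * G)) = 0 := by
    rw [Matrix.mul_sub, ← Matrix.mul_assoc, hU, Matrix.one_mul, sub_self]
  have h1 : Gᵀ * G = (Uᵀ * G)ᵀ * (Uᵀ * G) +
      (G - U * (Uᵀ * G))ᵀ * (G - U * (Uᵀ * G)) := by
    conv_rhs => rw [Matrix.transpose_sub, Matrix.transpose_mul U, Matrix.sub_mul,
      Matrix.mul_assoc _ Uᵀ, h0, Matrix.mul_zero, sub_zero, Matrix.mul_sub, Matrix.transpose_mul,
      Matrix.transpose_transpose, ← Matrix.mul_assoc Gᵀ U]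
    abel
  exact ⟨by rw [frobenius_sq_eq_trace, h1, Matrix.trace_add, ← frobenius_sq_eq_trace,
    ← frobenius_sq_eq_trace], h1, h0⟩

theorem log_det_one_add_nonneg (L : Matrix n m ℝ) : 0 ≤ Real.log (1 + L * Lᵀ).det := by
  have h := log_det_le Matrix.PosDef.one (posDef_one_add L)
  rw [Matrix.det_one, Real.log_one, Matrix.mul_one, inv_one_add_mul_transpose, Matrix.trace_sub,
    Matrix.trace_one] at h
  have := (posSemidef_congr (posDef_one_add' L).inv.posSemidef L).trace_nonneg
  linarith

theorem unitNegLik_self {M : Matrix ι ι ℝ} {G : Matrix ι n ℝ} {E : Matrix ι ι ℝ}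
    (hM : M = 1 + G * Gᵀ + E) :
    unitNegLik M G = Real.log (1 + Gᵀ * G).det + Fintype.card ι + E.trace -
      (E * (G * (1 + Gᵀ * G)⁻¹ * Gᵀ)).trace := by
  rw [unitNegLik, det_one_add_mul_transpose, hM, Matrix.add_mul, Matrix.trace_add,
    Matrix.mul_nonsing_inv _ (posDef_isUnit_det (posDef_one_add G)), Matrix.trace_one,
    inv_one_add_mul_transpose, Matrix.mul_sub, Matrix.mul_one, Matrix.trace_sub]
  ring

theorem trace_sub_trace_compress {M : Matrix ι ι ℝ} {G : Matrix ι n ℝ} {E : Matrix ι ι ℝ}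
    (hM : M = 1 + G * Gᵀ + E) {U : Matrix ι m ℝ} (hU : Uᵀ * U = 1) :
    M.trace - (Uᵀ * M * U).trace = Fintype.card ι - Fintype.card m +
      ‖G - U * (Uᵀ * G)‖ ^ 2 + E.trace - (Uᵀ * E * U).trace := by
  have h1 : (Uᵀ * M * U) = 1 + (Uᵀ * G) * (Uᵀ * G)ᵀ + Uᵀ * E * U := by
    rw [hM, Matrix.mul_add, Matrix.add_mul, Matrix.mul_add, Matrix.add_mul, Matrix.mul_one, hU,
      Matrix.transpose_mul, Matrix.transpose_transpose]
    simp only [Matrix.mul_assoc]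
  rw [h1, hM]
  simp only [Matrix.trace_add, Matrix.trace_one]
  rw [← frobenius_sq_eq_trace', ← frobenius_sq_eq_trace', (norm_sq_proj hU G).1]
  ring

/-- Nothing is known about L, so log det(1 + LLᵀ) and the trace of the compressed data against a
positive definite inverse, both nonnegative, are dropped. The price is log det(1 + GᵀG) and a term
linear in E: enough for consistency of the column space, not for its rate. -/
theorem unitNegLik_sub_ge_crude {M : Matrix ι ι ℝ} (hMp : M.PosSemidef) {G : Matrix ι n ℝ}
    {E : Matrix ι ι ℝ} (hM : M = 1 + G * Gᵀ + E) {U : Matrix ι m ℝ} (hU : Uᵀ * U = 1)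
    (L : Matrix m n ℝ) :
    ‖G - U * (Uᵀ * G)‖ ^ 2 - Fintype.card m - Real.log (1 + Gᵀ * G).det -
      ‖E‖ * ‖G * (1 + Gᵀ * G)⁻¹ * Gᵀ - U * Uᵀ‖ ≤ unitNegLik M (U * L) - unitNegLik M G := by
  rw [unitNegLik_orthonormal_mul M hU, trace_sub_trace_compress hM hU, unitNegLik_self hM,
    unitNegLik]
  have h1 := log_det_one_add_nonneg L
  have hK : (Uᵀ * M * U).PosSemidef := by simpa using posSemidef_congr hMp Uᵀ
  have h2 := trace_mul_nonneg hK (posDef_one_add L).inv.posSemidef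
  have h3 := abs_trace_mul_le E (G * (1 + Gᵀ * G)⁻¹ * Gᵀ - U * Uᵀ)
  rw [Matrix.mul_sub, Matrix.trace_sub] at h3
  have h4 : (E * (U * Uᵀ)).trace = (Uᵀ * E * U).trace := by
    rw [← Matrix.mul_assoc, Matrix.trace_mul_comm, ← Matrix.mul_assoc]
  rw [h4] at h3
  have := (abs_le.1 h3).1
  linarith

/-- The tangent inequality minimizes over all covariances of the compressed data K = UᵀMU and leaves
log det K. Expanded around the noise-free value of K, the terms linear in E cancel except for the
difference of two ridge projections, which is small when the column spaces are close; what remains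
is quadratic in the compressed noise. -/
theorem unitNegLik_sub_ge_fine {M : Matrix ι ι ℝ} {G : Matrix ι n ℝ} {E : Matrix ι ι ℝ}
    (hM : M = 1 + G * Gᵀ + E) {U : Matrix ι m ℝ} (hU : Uᵀ * U = 1) (L : Matrix m n ℝ)
    (hK : (Uᵀ * M * U).PosDef) {R1 : Matrix n n ℝ} (hR1 : R1 = (1 + (Uᵀ * G)ᵀ * (Uᵀ * G))⁻¹) :
    ‖G - U * (Uᵀ * G)‖ ^ 2 - ‖R1‖ * ‖G - U * (Uᵀ * G)‖ ^ 2 -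
      ‖(Uᵀ * M * U)⁻¹‖ * ‖(1 + (Uᵀ * G) * (Uᵀ * G)ᵀ)⁻¹‖ * ‖Uᵀ * E * U‖ ^ 2 -
      ‖E‖ * ‖G * (1 + Gᵀ * G)⁻¹ * Gᵀ - (U * (Uᵀ * G)) * R1 * (U * (Uᵀ * G))ᵀ‖
      ≤ unitNegLik M (U * L) - unitNegLik M G := by
  rw [unitNegLik_orthonormal_mul M hU, trace_sub_trace_compress hM hU, unitNegLik_self hM,
    unitNegLik]
  have hKe : (Uᵀ * M * U) = 1 + (Uᵀ * G) * (Uᵀ * G)ᵀ + Uᵀ * E * U := by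
    rw [hM, Matrix.mul_add, Matrix.add_mul, Matrix.mul_add, Matrix.add_mul, Matrix.mul_one, hU,
      Matrix.transpose_mul, Matrix.transpose_transpose]
    simp only [Matrix.mul_assoc]
  obtain ⟨-, hG, -⟩ := norm_sq_proj hU G
  set g := Uᵀ * G
  set x := G - U * g
  set K := Uᵀ * M * U
  set E1 := Uᵀ * E * U with hE1
  set X1 := 1 + g * gᵀ with hX1
  have hX1P : X1.PosDef := posDef_one_add g
  have p1 := log_det_le hK (posDef_one_add L)
  rw [Matrix.trace_mul_comm] at p1
  have p2 := log_det_le (posDef_one_add' G) (posDef_one_add' g)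
  have e2 : ((1 + gᵀ * g)⁻¹ * (1 + Gᵀ * G)).trace = Fintype.card n + (R1 * (xᵀ * x)).trace := by
    rw [hG, ← add_assoc, Matrix.mul_add, Matrix.nonsing_inv_mul _
      (posDef_isUnit_det (posDef_one_add' g)), Matrix.trace_add, Matrix.trace_one, ← hR1]
  have e3 : (R1 * (xᵀ * x)).trace ≤ ‖R1‖ * ‖x‖ ^ 2 := by
    refine (le_abs_self _).trans ((abs_trace_mul_le _ _).trans ?_)
    refine mul_le_mul_of_nonneg_left ((Matrix.frobenius_norm_mul _ _).trans ?_) (norm_nonneg _)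
    rw [Matrix.frobenius_norm_transpose, sq]
  have p3 := log_det_le hX1P hK
  have hX1K : X1 = K - E1 := by rw [hKe]; abel
  have e4 : K⁻¹ * X1 = 1 - K⁻¹ * E1 := by
    rw [hX1K, Matrix.mul_sub, Matrix.nonsing_inv_mul _ (posDef_isUnit_det hK)]
  have e5 : K⁻¹ * E1 = X1⁻¹ * E1 - K⁻¹ * E1 * (X1⁻¹ * E1) := by
    have h1 : K⁻¹ = X1⁻¹ - K⁻¹ * E1 * X1⁻¹ := by
      have : K⁻¹ * X1 * X1⁻¹ = K⁻¹ := by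
        rw [Matrix.mul_assoc, Matrix.mul_nonsing_inv _ (posDef_isUnit_det hX1P), Matrix.mul_one]
      rw [e4, Matrix.sub_mul, Matrix.one_mul] at this
      exact this.symm
    conv_lhs => rw [h1, Matrix.sub_mul, Matrix.mul_assoc _ X1⁻¹]
  rw [e4, Matrix.trace_sub, Matrix.trace_one, e5, Matrix.trace_sub] at p3
  have e6 : (K⁻¹ * E1 * (X1⁻¹ * E1)).trace ≤ ‖K⁻¹‖ * ‖X1⁻¹‖ * ‖E1‖ ^ 2 := by
    refine (le_abs_self _).trans ((abs_trace_mul_le _ _).trans ?_)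
    calc ‖K⁻¹ * E1‖ * ‖X1⁻¹ * E1‖ ≤ (‖K⁻¹‖ * ‖E1‖) * (‖X1⁻¹‖ * ‖E1‖) :=
          mul_le_mul (Matrix.frobenius_norm_mul _ _) (Matrix.frobenius_norm_mul _ _)
            (norm_nonneg _) (by positivity)
      _ = _ := by ring
  have e7 : (X1⁻¹ * E1).trace = E1.trace - (E * ((U * g) * R1 * (U * g)ᵀ)).trace := by
    rw [hX1, inv_one_add_mul_transpose, ← hR1, Matrix.sub_mul, Matrix.one_mul, Matrix.trace_sub]
    congr 1
    rw [hE1, Matrix.trace_mul_comm E, Matrix.transpose_mul U g]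
    calc (g * R1 * gᵀ * (Uᵀ * E * U)).trace = ((g * R1 * gᵀ * Uᵀ * E) * U).trace := by
          simp only [Matrix.mul_assoc]
      _ = _ := by
          rw [Matrix.trace_mul_comm]; simp only [Matrix.mul_assoc]
  have e8 := (abs_le.1 (abs_trace_mul_le E (G * (1 + Gᵀ * G)⁻¹ * Gᵀ - (U * g) * R1 * (U * g)ᵀ))).1
  rw [Matrix.mul_sub, Matrix.trace_sub] at e8
  have e9 : Real.log X1.det = Real.log (1 + gᵀ * g).det := by
    rw [hX1, det_one_add_mul_transpose]
  linarith

/-- Perturbation of the ridge projection under projection of the columns. -/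
theorem norm_ridge_sub_le {G : Matrix ι n ℝ} {U : Matrix ι m ℝ} (hU : Uᵀ * U = 1)
    {R R1 : Matrix n n ℝ} (hR : R = (1 + Gᵀ * G)⁻¹)
    (hR1 : R1 = (1 + (Uᵀ * G)ᵀ * (Uᵀ * G))⁻¹) :
    ‖G * R * Gᵀ - (U * (Uᵀ * G)) * R1 * (U * (Uᵀ * G))ᵀ‖ ≤
      2 * ‖G - U * (Uᵀ * G)‖ * ‖R‖ * ‖G‖ +
        ‖G‖ ^ 2 * ‖R‖ * ‖R1‖ * ‖G - U * (Uᵀ * G)‖ ^ 2 := by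
  obtain ⟨hn, hG, -⟩ := norm_sq_proj hU G
  have hg : ‖U * (Uᵀ * G)‖ ^ 2 = ‖Uᵀ * G‖ ^ 2 := by
    rw [frobenius_sq_eq_trace, Matrix.transpose_mul, Matrix.mul_assoc, ← Matrix.mul_assoc Uᵀ U, hU,
      Matrix.one_mul, frobenius_sq_eq_trace]
  have hG1 : ‖U * (Uᵀ * G)‖ ≤ ‖G‖ := by
    refine abs_le_of_sq_le_sq' ?_ (norm_nonneg _) |>.2
    rw [hg, hn]; nlinarith [sq_nonneg ‖G - U * (Uᵀ * G)‖]
  set g := Uᵀ * G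
  set G1 := U * g
  set x := G - G1
  have hGx : G = G1 + x := by simp [x]
  have hRR : R - R1 = -(R * (xᵀ * x) * R1) := by
    have h1 : R * (1 + Gᵀ * G) = 1 := by
      rw [hR, Matrix.nonsing_inv_mul _ (posDef_isUnit_det (posDef_one_add' G))]
    have h2 : (1 + gᵀ * g) * R1 = 1 := by
      rw [hR1, Matrix.mul_nonsing_inv _ (posDef_isUnit_det (posDef_one_add' g))]
    have h3 : xᵀ * x = (1 + Gᵀ * G) - (1 + gᵀ * g) := by rw [hG]; abel
    rw [h3, Matrix.mul_sub, Matrix.sub_mul, h1, Matrix.one_mul, Matrix.mul_assoc, h2,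
      Matrix.mul_one]
    abel
  have key : G * R * Gᵀ - G1 * R1 * G1ᵀ = x * R * Gᵀ + G1 * R * xᵀ + G1 * (R - R1) * G1ᵀ := by
    have : x * R * Gᵀ = G * R * Gᵀ - G1 * R * Gᵀ := by rw [← Matrix.sub_mul, ← Matrix.sub_mul]
    rw [this]
    have : G1 * R * Gᵀ = G1 * R * G1ᵀ + G1 * R * xᵀ := by
      rw [← Matrix.mul_add, ← Matrix.transpose_add, ← hGx]
    rw [this, Matrix.mul_sub, Matrix.sub_mul]
    abel
  have n1 : ‖x * R * Gᵀ‖ ≤ ‖x‖ * ‖R‖ * ‖G‖ := by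
    simpa [Matrix.frobenius_norm_transpose] using frobenius_mul_three x R Gᵀ
  have n2 : ‖G1 * R * xᵀ‖ ≤ ‖G‖ * ‖R‖ * ‖x‖ := by
    have := frobenius_mul_three G1 R xᵀ
    rw [Matrix.frobenius_norm_transpose] at this
    refine this.trans ?_
    gcongr
  have n3 : ‖G1 * (R - R1) * G1ᵀ‖ ≤ ‖G‖ * (‖R‖ * (‖x‖ * ‖x‖) * ‖R1‖) * ‖G‖ := by
    have := frobenius_mul_three G1 (R - R1) G1ᵀ
    rw [Matrix.frobenius_norm_transpose] at this
    have h4 : ‖R - R1‖ ≤ ‖R‖ * (‖x‖ * ‖x‖) * ‖R1‖ := by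
      rw [hRR, norm_neg]
      refine (frobenius_mul_three _ _ _).trans ?_
      gcongr
      refine (Matrix.frobenius_norm_mul _ _).trans ?_
      rw [Matrix.frobenius_norm_transpose]
    refine this.trans ?_
    gcongr
  rw [key]
  calc _ ≤ ‖x * R * Gᵀ‖ + ‖G1 * R * xᵀ‖ + ‖G1 * (R - R1) * G1ᵀ‖ := norm_add₃_le
    _ ≤ _ := by nlinarith

/-! ### Regular loadings, bounded variances, and the loss caused by wrong variances. -/

/-- Loadings with bounded rows and second moment of exact order `N`. -/
structure RegularLoading (a b N : ℝ) (Γ : Matrix ι n ℝ) : Prop where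
  a_pos : 0 < a
  b_pos : 0 < b
  N_pos : 0 < N
  card_le : (Fintype.card ι : ℝ) ≤ N
  row_le : ∀ i, Γ i ⬝ᵥ Γ i ≤ a
  lower : ∀ v, b * N * (v ⬝ᵥ v) ≤ (Γ *ᵥ v) ⬝ᵥ (Γ *ᵥ v)

/-- Variances in `[q⁻¹, q]`. -/
structure VarianceBound (q : ℝ) (s : ι → ℝ) : Prop where
  one_le : 1 ≤ q
  lower : ∀ i, q⁻¹ ≤ s i
  upper : ∀ i, s i ≤ q

theorem VarianceBound.q_pos {q : ℝ} {s : ι → ℝ} (h : VarianceBound q s) : 0 < q :=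
  zero_lt_one.trans_le h.one_le

theorem VarianceBound.pos {q : ℝ} {s : ι → ℝ} (h : VarianceBound q s) (i : ι) : 0 < s i :=
  (inv_pos.2 h.q_pos).trans_le (h.lower i)

theorem VarianceBound.inv_le {q : ℝ} {s : ι → ℝ} (h : VarianceBound q s) (i : ι) : (s i)⁻¹ ≤ q := by
  have := inv_anti₀ (inv_pos.2 h.q_pos) (h.lower i)
  rwa [inv_inv] at this

theorem VarianceBound.le_inv {q : ℝ} {s : ι → ℝ} (h : VarianceBound q s) (i : ι) : q⁻¹ ≤ (s i)⁻¹ :=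
  inv_anti₀ (h.pos i) (h.upper i)

theorem VarianceBound.abs_inv_sub_le {q : ℝ} {s t : ι → ℝ} (hs : VarianceBound q s)
    (ht : VarianceBound q t) (i : ι) : |(s i)⁻¹ - (t i)⁻¹| ≤ q ^ 2 * |s i - t i| := by
  have h1 := hs.pos i
  have h2 := ht.pos i
  rw [inv_sub_inv h1.ne' h2.ne', abs_div, abs_of_pos (mul_pos h1 h2), abs_sub_comm, div_eq_mul_inv,
    mul_inv, mul_comm]
  refine mul_le_mul_of_nonneg_right ?_ (abs_nonneg _)
  rw [sq]
  exact mul_le_mul (hs.inv_le i) (ht.inv_le i) (inv_nonneg.2 h2.le) hs.q_pos.le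

theorem RegularLoading.norm_sq_le {a b N : ℝ} {Γ : Matrix ι n ℝ} (h : RegularLoading a b N Γ) :
    ‖Γ‖ ^ 2 ≤ a * N := by
  rw [frobenius_sq]
  calc ∑ i, ∑ j, Γ i j ^ 2 ≤ ∑ _i : ι, a := Finset.sum_le_sum fun i _ => by
        simpa [dotProduct, sq] using h.row_le i
    _ = a * Fintype.card ι := by simp [mul_comm]
    _ ≤ _ := mul_le_mul_of_nonneg_left h.card_le h.a_pos.le

theorem norm_le_of_sq_le {A : Matrix ι n ℝ} {c : ℝ} (h : ‖A‖ ^ 2 ≤ c) : ‖A‖ ≤ √c :=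
  Real.le_sqrt_of_sq_le h

theorem quadForm_weighted (Γ : Matrix ι n ℝ) (w : ι → ℝ) (v : n → ℝ) :
    v ⬝ᵥ (Γᵀ * Matrix.diagonal w * Γ) *ᵥ v = ∑ i, w i * (Γ *ᵥ v) i ^ 2 := by
  rw [← Matrix.mulVec_mulVec, ← Matrix.mulVec_mulVec, Matrix.dotProduct_mulVec,
    Matrix.vecMul_transpose, dotProduct]
  exact Finset.sum_congr rfl fun i _ => by rw [Matrix.mulVec_diagonal]; ring

theorem RegularLoading.weighted_lower {a b N q : ℝ} {Γ : Matrix ι n ℝ} {s : ι → ℝ}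
    (h : RegularLoading a b N Γ) (hs : VarianceBound q s) (v : n → ℝ) :
    b / q * N * (v ⬝ᵥ v) ≤ v ⬝ᵥ (Γᵀ * Matrix.diagonal (fun i => (s i)⁻¹) * Γ) *ᵥ v := by
  rw [quadForm_weighted]
  calc b / q * N * (v ⬝ᵥ v) = q⁻¹ * (b * N * (v ⬝ᵥ v)) := by rw [div_eq_mul_inv]; ring
    _ ≤ q⁻¹ * ((Γ *ᵥ v) ⬝ᵥ (Γ *ᵥ v)) :=
        mul_le_mul_of_nonneg_left (h.lower v) (inv_pos.2 hs.q_pos).le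
    _ = ∑ i, q⁻¹ * (Γ *ᵥ v) i ^ 2 := by rw [dotProduct, Finset.mul_sum]; simp_rw [sq]
    _ ≤ _ := Finset.sum_le_sum fun i _ => mul_le_mul_of_nonneg_right (hs.le_inv i) (sq_nonneg _)

theorem one_add_lower {A : Matrix n n ℝ} {c : ℝ}
    (h : ∀ v, c * (v ⬝ᵥ v) ≤ v ⬝ᵥ A *ᵥ v) (v : n → ℝ) : c * (v ⬝ᵥ v) ≤ v ⬝ᵥ (1 + A) *ᵥ v := by
  rw [Matrix.add_mulVec, Matrix.one_mulVec, dotProduct_add]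
  have := dotProduct_self_nonneg' v
  linarith [h v]

/-- The Woodbury formula for a diagonal matrix plus a matrix of low rank. -/
theorem inv_diagonal_add {s : ι → ℝ} (hs : ∀ i, 0 < s i) (Γ : Matrix ι n ℝ) :
    (Matrix.diagonal s + Γ * Γᵀ)⁻¹ = Matrix.diagonal (fun i => (s i)⁻¹) -
      (Matrix.diagonal (fun i => (s i)⁻¹) * Γ) *
        (1 + Γᵀ * Matrix.diagonal (fun i => (s i)⁻¹) * Γ)⁻¹ *
          (Matrix.diagonal (fun i => (s i)⁻¹) * Γ)ᵀ := by
  apply Matrix.inv_eq_right_inv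
  have hP : (1 + Γᵀ * Matrix.diagonal (fun i => (s i)⁻¹) * Γ).PosDef := by
    refine Matrix.PosDef.one.add_posSemidef ?_
    have := posSemidef_congr (Matrix.PosSemidef.diagonal (d := fun i => (s i)⁻¹)
      fun i => (inv_pos.2 (hs i)).le) Γᵀ
    rwa [Matrix.transpose_transpose] at this
  have h := Matrix.mul_nonsing_inv _ (posDef_isUnit_det hP)
  set V := Matrix.diagonal (fun i => (s i)⁻¹) with hV
  set R := (1 + Γᵀ * V * Γ)⁻¹
  have h2 : Γᵀ * V * Γ * R = 1 - R := by
    rw [Matrix.add_mul, Matrix.one_mul] at h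
    exact eq_sub_of_add_eq' h
  have h3 : Matrix.diagonal s * V = 1 := by
    rw [hV, Matrix.diagonal_mul_diagonal, ← Matrix.diagonal_one]
    congr 1; ext i; exact mul_inv_cancel₀ (hs i).ne'
  have hVt : Vᵀ = V := Matrix.diagonal_transpose _
  rw [Matrix.transpose_mul, hVt]
  calc (Matrix.diagonal s + Γ * Γᵀ) * (V - V * Γ * R * (Γᵀ * V))
      = Matrix.diagonal s * V + Γ * (Γᵀ * V) - Matrix.diagonal s * V * Γ * R * (Γᵀ * V)
        - Γ * (Γᵀ * V * Γ * R) * (Γᵀ * V) := by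
        simp only [Matrix.mul_sub, Matrix.add_mul, Matrix.mul_assoc]
        abel
    _ = 1 := by
        rw [h2, h3]
        simp only [Matrix.mul_sub, Matrix.sub_mul, Matrix.mul_one, Matrix.one_mul,
          Matrix.mul_assoc]
        abel

theorem log_det_diagonal_add' {s : ι → ℝ} (hs : ∀ i, 0 < s i) (Γ : Matrix ι n ℝ) :
    Real.log (Matrix.diagonal s + Γ * Γᵀ).det = ∑ i, Real.log (s i) +
      Real.log (1 + Γᵀ * Matrix.diagonal (fun i => (s i)⁻¹) * Γ).det := by
  rw [log_det_diagonal_add hs, det_one_add_mul_transpose, Matrix.transpose_mul,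
    Matrix.diagonal_transpose]
  congr 4
  rw [Matrix.mul_assoc, ← Matrix.mul_assoc (Matrix.diagonal _) (Matrix.diagonal _),
    Matrix.diagonal_mul_diagonal, Matrix.mul_assoc]
  congr 3; ext i
  rw [← mul_inv, Real.mul_self_sqrt (hs i).le]

theorem abs_sum_mul_le (v w : ι → ℝ) : |∑ i, v i * w i| ≤ √(∑ i, v i ^ 2) * √(∑ i, w i ^ 2) := by
  rw [← Real.sqrt_mul (Finset.sum_nonneg fun _ _ => sq_nonneg _)]
  exact Real.abs_le_sqrt (Finset.sum_mul_sq_le_sq_mul_sq _ _ _)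

theorem norm_resolvent_sub_le {A : Matrix m m ℝ} {B : Matrix m m ℝ} (hA : IsUnit A.det)
    (hB : IsUnit B.det) : ‖A⁻¹ - B⁻¹‖ ≤ ‖A⁻¹‖ * ‖A - B‖ * ‖B⁻¹‖ := by
  have : A⁻¹ - B⁻¹ = A⁻¹ * (B - A) * B⁻¹ := by
    rw [Matrix.mul_sub, Matrix.sub_mul, Matrix.nonsing_inv_mul _ hA, Matrix.mul_assoc,
      Matrix.mul_nonsing_inv _ hB]
    simp
  rw [this, norm_sub_rev A B]
  exact frobenius_mul_three _ _ _

/-- Change of the low rank part of the precision matrix with the variances. -/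
theorem norm_precision_sub_le {a b N q : ℝ} {Γ : Matrix ι n ℝ} {s t : ι → ℝ}
    (h : RegularLoading a b N Γ) (hs : VarianceBound q s) (ht : VarianceBound q t) :
    ‖(Matrix.diagonal (fun i => (t i)⁻¹) * Γ) *
        (1 + Γᵀ * Matrix.diagonal (fun i => (t i)⁻¹) * Γ)⁻¹ *
          (Matrix.diagonal (fun i => (t i)⁻¹) * Γ)ᵀ -
      (Matrix.diagonal (fun i => (s i)⁻¹) * Γ) *
        (1 + Γᵀ * Matrix.diagonal (fun i => (s i)⁻¹) * Γ)⁻¹ *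
          (Matrix.diagonal (fun i => (s i)⁻¹) * Γ)ᵀ‖ * √N ≤
      (2 * q ^ 4 * a * Fintype.card n / b + q ^ 6 * a ^ 2 * Fintype.card n ^ 2 / b ^ 2) *
        √(∑ i, (t i - s i) ^ 2) := by
  have hq := hs.q_pos
  have ha := h.a_pos
  have hb := h.b_pos
  have hN := h.N_pos
  set V1 := Matrix.diagonal (fun i => (t i)⁻¹)
  set V0 := Matrix.diagonal (fun i => (s i)⁻¹)
  set δ := √(∑ i, (t i - s i) ^ 2)
  have hδ0 : 0 ≤ δ := Real.sqrt_nonneg _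
  set k := (Fintype.card n : ℝ)
  have hk0 : 0 ≤ k := Nat.cast_nonneg _
  set ρ := k / (b / q * N) with hρ
  have hρ0 : 0 ≤ ρ := by positivity
  have hsym : ∀ w : ι → ℝ, (1 + Γᵀ * Matrix.diagonal w * Γ)ᵀ = 1 + Γᵀ * Matrix.diagonal w * Γ := by
    intro w; simp [Matrix.transpose_mul, Matrix.mul_assoc]
  have hc : 0 < b / q * N := by positivity
  have hP1 := posDef_of_lower (hsym _) hc (one_add_lower (h.weighted_lower ht))
  have hP0 := posDef_of_lower (hsym _) hc (one_add_lower (h.weighted_lower hs))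
  have hR1 : ‖(1 + Γᵀ * V1 * Γ)⁻¹‖ ≤ ρ :=
    norm_inv_le_of_lower (hsym _) hc (one_add_lower (h.weighted_lower ht))
  have hR0 : ‖(1 + Γᵀ * V0 * Γ)⁻¹‖ ≤ ρ :=
    norm_inv_le_of_lower (hsym _) hc (one_add_lower (h.weighted_lower hs))
  have hΓ : ‖Γ‖ ≤ √a * √N := by
    rw [← Real.sqrt_mul ha.le]; exact norm_le_of_sq_le h.norm_sq_le
  have hH1 : ‖V1 * Γ‖ ≤ q * (√a * √N) :=
    (frobenius_diagonal_mul_le hq.le (fun i => by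
      rw [abs_of_pos (inv_pos.2 (ht.pos i))]; exact ht.inv_le i) Γ).trans (by gcongr)
  have hH0 : ‖V0 * Γ‖ ≤ q * (√a * √N) :=
    (frobenius_diagonal_mul_le hq.le (fun i => by
      rw [abs_of_pos (inv_pos.2 (hs.pos i))]; exact hs.inv_le i) Γ).trans (by gcongr)
  have hD : ‖V1 * Γ - V0 * Γ‖ ≤ q ^ 2 * √a * δ := by
    refine abs_le_of_sq_le_sq' ?_ (by positivity) |>.2
    rw [mul_pow, mul_pow, Real.sq_sqrt ha.le,
      Real.sq_sqrt (Finset.sum_nonneg fun _ _ => sq_nonneg _), frobenius_sq, Finset.mul_sum]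
    refine Finset.sum_le_sum fun i _ => ?_
    have h1 : ∑ j, (V1 * Γ - V0 * Γ) i j ^ 2 = ((t i)⁻¹ - (s i)⁻¹) ^ 2 * (Γ i ⬝ᵥ Γ i) := by
      rw [dotProduct, Finset.mul_sum]
      refine Finset.sum_congr rfl fun j _ => ?_
      rw [Matrix.sub_apply, Matrix.diagonal_mul, Matrix.diagonal_mul]; ring
    rw [h1]
    have h2 : ((t i)⁻¹ - (s i)⁻¹) ^ 2 ≤ (q ^ 2) ^ 2 * (t i - s i) ^ 2 := by
      have := ht.abs_inv_sub_le hs i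
      rw [← mul_pow, ← sq_abs, ← sq_abs (q ^ 2 * _), abs_mul, abs_of_pos (by positivity : 0 < q ^ 2)]
      exact pow_le_pow_left₀ (abs_nonneg _) this 2
    calc _ ≤ ((q ^ 2) ^ 2 * (t i - s i) ^ 2) * a :=
          mul_le_mul h2 (h.row_le i) (dotProduct_self_nonneg' _) (by positivity)
      _ = _ := by ring
  have hRR : ‖(1 + Γᵀ * V1 * Γ)⁻¹ - (1 + Γᵀ * V0 * Γ)⁻¹‖ ≤
      ρ * (√a * √N * (q ^ 2 * √a * δ)) * ρ := by
    refine (norm_resolvent_sub_le (posDef_isUnit_det hP1) (posDef_isUnit_det hP0)).trans ?_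
    have : ‖1 + Γᵀ * V1 * Γ - (1 + Γᵀ * V0 * Γ)‖ ≤ √a * √N * (q ^ 2 * √a * δ) := by
      rw [add_sub_add_left_eq_sub, Matrix.mul_assoc, Matrix.mul_assoc, ← Matrix.mul_sub]
      refine (Matrix.frobenius_norm_mul _ _).trans ?_
      rw [Matrix.frobenius_norm_transpose]
      gcongr
    gcongr
  set H1 := V1 * Γ
  set H0 := V0 * Γ
  set R1 := (1 + Γᵀ * V1 * Γ)⁻¹
  set R0 := (1 + Γᵀ * V0 * Γ)⁻¹
  have key : H1 * R1 * H1ᵀ - H0 * R0 * H0ᵀ =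
      (H1 - H0) * R1 * H1ᵀ + H0 * (R1 - R0) * H1ᵀ + H0 * R0 * (H1 - H0)ᵀ := by
    rw [Matrix.transpose_sub, Matrix.mul_sub, Matrix.mul_sub, Matrix.sub_mul, Matrix.sub_mul,
      Matrix.sub_mul]
    abel
  have n1 : ‖(H1 - H0) * R1 * H1ᵀ‖ ≤ (q ^ 2 * √a * δ) * ρ * (q * (√a * √N)) := by
    refine (frobenius_mul_three _ _ _).trans ?_
    rw [Matrix.frobenius_norm_transpose]; gcongr
  have n2 : ‖H0 * (R1 - R0) * H1ᵀ‖ ≤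
      (q * (√a * √N)) * (ρ * (√a * √N * (q ^ 2 * √a * δ)) * ρ) * (q * (√a * √N)) := by
    refine (frobenius_mul_three _ _ _).trans ?_
    rw [Matrix.frobenius_norm_transpose]; gcongr
  have n3 : ‖H0 * R0 * (H1 - H0)ᵀ‖ ≤ (q * (√a * √N)) * ρ * (q ^ 2 * √a * δ) := by
    refine (frobenius_mul_three _ _ _).trans ?_
    rw [Matrix.frobenius_norm_transpose]; gcongr
  have hall := (key ▸ norm_add₃_le :
    ‖H1 * R1 * H1ᵀ - H0 * R0 * H0ᵀ‖ ≤ ‖(H1 - H0) * R1 * H1ᵀ‖ + ‖H0 * (R1 - R0) * H1ᵀ‖ +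
      ‖H0 * R0 * (H1 - H0)ᵀ‖)
  have hsN : 0 < √N := Real.sqrt_pos.2 hN
  calc _ ≤ ((q ^ 2 * √a * δ) * ρ * (q * (√a * √N)) +
      (q * (√a * √N)) * (ρ * (√a * √N * (q ^ 2 * √a * δ)) * ρ) * (q * (√a * √N)) +
      (q * (√a * √N)) * ρ * (q ^ 2 * √a * δ)) * √N :=
        mul_le_mul_of_nonneg_right (hall.trans (add_le_add (add_le_add n1 n2) n3)) hsN.le
    _ = 2 * q ^ 3 * (√a) ^ 2 * (ρ * (√N) ^ 2) * δ +
        q ^ 4 * ((√a) ^ 2) ^ 2 * (ρ * (√N) ^ 2) ^ 2 * δ := by ring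
    _ = _ := by
      rw [Real.sq_sqrt ha.le, Real.sq_sqrt hN.le, hρ]
      field_simp

theorem mul_mul_transpose_diag (Γ : Matrix ι n ℝ) (R : Matrix n n ℝ) (i : ι) :
    (Γ * R * Γᵀ) i i = Γ i ⬝ᵥ R *ᵥ Γ i :=
  (Matrix.dotProduct_mulVec _ _ _).symm

set_option maxHeartbeats 1000000 in
/-- With the true loadings, the likelihood is strongly concave in the variances. -/
theorem negLik_variance_sub_ge {a b N q τ : ℝ} {Γ : Matrix ι n ℝ} {s t : ι → ℝ}
    (h : RegularLoading a b N Γ) (hs : VarianceBound q s) (ht : VarianceBound q t)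
    {M W : Matrix ι ι ℝ} (hM : M = Matrix.diagonal s + Γ * Γᵀ + W)
    (hW : ‖W‖ ≤ τ * N) (hWd : √(∑ i, W i i ^ 2) ≤ τ * √N)
    (hN : 8 * q ^ 6 * a * Fintype.card n / b ≤ N) :
    (∑ i, (t i - s i) ^ 2) / (8 * q ^ 2) - τ * √N * (q ^ 2 +
      (2 * q ^ 4 * a * Fintype.card n / b + q ^ 6 * a ^ 2 * Fintype.card n ^ 2 / b ^ 2)) *
        √(∑ i, (t i - s i) ^ 2) ≤ negLik M t Γ - negLik M s Γ := by
  have hq := hs.q_pos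
  have ha := h.a_pos
  have hb := h.b_pos
  have hNp := h.N_pos
  have hJ := norm_precision_sub_le h hs ht
  set cJ := 2 * q ^ 4 * a * Fintype.card n / b + q ^ 6 * a ^ 2 * Fintype.card n ^ 2 / b ^ 2
  rw [negLik, negLik, log_det_diagonal_add' hs.pos, log_det_diagonal_add' ht.pos]
  have hsym : ∀ w : ι → ℝ, (1 + Γᵀ * Matrix.diagonal w * Γ)ᵀ = 1 + Γᵀ * Matrix.diagonal w * Γ := by
    intro w; simp [Matrix.transpose_mul, Matrix.mul_assoc]
  have hc : 0 < b / q * N := by positivity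
  have hP1 := posDef_of_lower (hsym _) hc (one_add_lower (h.weighted_lower ht))
  have hP0 := posDef_of_lower (hsym _) hc (one_add_lower (h.weighted_lower hs))
  have hR1 := norm_inv_le_of_lower (hsym _) hc (one_add_lower (h.weighted_lower ht))
  have hS1 := inv_diagonal_add ht.pos Γ
  have hS0 := inv_diagonal_add hs.pos Γ
  -- The low-rank determinant at s is bounded by its tangent at t, with the inverse at t in the
  -- linear term, as in the trace terms below; the terms of first order in t - s can then be
  -- combined.
  have hlog := log_det_le hP0 hP1
  set S1 := Matrix.diagonal t + Γ * Γᵀ with hS1d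
  set S0 := Matrix.diagonal s + Γ * Γᵀ with hS0d
  have hS1u := posDef_isUnit_det (posDef_diagonal_add ht.pos Γ)
  have hS0u := posDef_isUnit_det (posDef_diagonal_add hs.pos Γ)
  set V1 := Matrix.diagonal (fun i => (t i)⁻¹) with hV1
  set V0 := Matrix.diagonal (fun i => (s i)⁻¹) with hV0
  set R1 := (1 + Γᵀ * V1 * Γ)⁻¹ with hR1d
  set J1 := V1 * Γ * R1 * (V1 * Γ)ᵀ with hJ1
  set J0 := V0 * Γ * (1 + Γᵀ * V0 * Γ)⁻¹ * (V0 * Γ)ᵀ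
  -- The leverage of row i in the ridge regression on the loadings; it is of order 1/N.
  let ρ : ι → ℝ := fun i => Γ i ⬝ᵥ R1 *ᵥ Γ i
  -- the trace terms
  have hρtr : ∀ w : ι → ℝ, (R1 * (Γᵀ * Matrix.diagonal w * Γ)).trace = ∑ i, w i * ρ i := by
    intro w
    rw [Matrix.trace_mul_comm, Matrix.mul_assoc, Matrix.mul_assoc, Matrix.trace_mul_comm,
      Matrix.mul_assoc, Matrix.trace]
    refine Finset.sum_congr rfl fun i _ => ?_
    rw [Matrix.diag_apply, Matrix.diagonal_mul]
    rw [mul_mul_transpose_diag]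
  have t1 : (R1 * (1 + Γᵀ * V0 * Γ)).trace =
      Fintype.card n + ∑ i, ((s i)⁻¹ - (t i)⁻¹) * ρ i := by
    have : (1 + Γᵀ * V0 * Γ) = (1 + Γᵀ * V1 * Γ) +
        Γᵀ * Matrix.diagonal (fun i => (s i)⁻¹ - (t i)⁻¹) * Γ := by
      have : Matrix.diagonal (fun i => (s i)⁻¹ - (t i)⁻¹) = V0 - V1 := by
        rw [hV0, hV1, Matrix.diagonal_sub]
      rw [this, Matrix.mul_sub, Matrix.sub_mul]; abel
    rw [this, Matrix.mul_add, Matrix.trace_add, hR1d, Matrix.nonsing_inv_mul _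
      (posDef_isUnit_det hP1), Matrix.trace_one, ← hR1d, hρtr]
  have t2 : (S0 * S1⁻¹).trace = Fintype.card ι + ∑ i, (s i - t i) * ((t i)⁻¹ - (t i)⁻¹ ^ 2 * ρ i) := by
    have : S0 = S1 + Matrix.diagonal (fun i => s i - t i) := by
      have : Matrix.diagonal (fun i => s i - t i) = Matrix.diagonal s - Matrix.diagonal t := by
        rw [Matrix.diagonal_sub]
      rw [this, hS1d, hS0d]; abel
    rw [this, Matrix.add_mul, Matrix.trace_add, Matrix.mul_nonsing_inv _ hS1u, Matrix.trace_one,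
      hS1, Matrix.trace]
    congr 1
    refine Finset.sum_congr rfl fun i _ => ?_
    rw [Matrix.diag_apply, Matrix.diagonal_mul, Matrix.sub_apply, hV1, Matrix.diagonal_apply_eq]
    congr 2
    rw [hJ1, Matrix.transpose_mul, hV1, Matrix.diagonal_transpose, ← Matrix.mul_assoc,
      Matrix.mul_diagonal, Matrix.mul_assoc, Matrix.mul_assoc, Matrix.diagonal_mul, sq,
      ← Matrix.mul_assoc, mul_mul_transpose_diag]
    ring
  have t3 : (W * S1⁻¹).trace - (W * S0⁻¹).trace =
      ∑ i, W i i * ((t i)⁻¹ - (s i)⁻¹) - (W * (J1 - J0)).trace := by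
    rw [hS1, hS0, ← Matrix.trace_sub, ← Matrix.mul_sub]
    have : V1 - J1 - (V0 - J0) = (V1 - V0) - (J1 - J0) := by abel
    rw [this, Matrix.mul_sub, Matrix.trace_sub]
    congr 1
    rw [Matrix.trace]
    refine Finset.sum_congr rfl fun i _ => ?_
    rw [Matrix.diag_apply, hV1, hV0, Matrix.diagonal_sub, Matrix.mul_diagonal]
  have t4 : (M * S1⁻¹).trace - (M * S0⁻¹).trace = (S0 * S1⁻¹).trace - Fintype.card ι +
      ((W * S1⁻¹).trace - (W * S0⁻¹).trace) := by
    rw [hM, Matrix.add_mul S0, Matrix.add_mul S0, Matrix.trace_add, Matrix.trace_add,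
      Matrix.mul_nonsing_inv _ hS0u, Matrix.trace_one]
    ring
  -- the bounds
  set δ := √(∑ i, (t i - s i) ^ 2) with hδ
  have hδ0 : 0 ≤ δ := Real.sqrt_nonneg _
  have hδ2 : δ ^ 2 = ∑ i, (t i - s i) ^ 2 :=
    Real.sq_sqrt (Finset.sum_nonneg fun _ _ => sq_nonneg _)
  have hρ : ∀ i, |ρ i| ≤ Fintype.card n / (b / q * N) * a := fun i => by
    refine (abs_quadForm_le _ _).trans ?_
    exact mul_le_mul hR1 (h.row_le i) (dotProduct_self_nonneg' _) (by positivity)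
  -- Coordinate by coordinate: log t - log s + s/t - 1 is at least (t - s)²/(4q²), because t(s + t)
  -- ≤ 2q². The leverage multiplies (t - s)² by a factor of order 1/N, which for large N consumes at
  -- most half of this.
  have b1 : (∑ i, (t i - s i) ^ 2) / (8 * q ^ 2) ≤ ∑ i, (Real.log (t i) - Real.log (s i) +
      (s i - t i) * ((t i)⁻¹ - (t i)⁻¹ ^ 2 * ρ i) - ((s i)⁻¹ - (t i)⁻¹) * ρ i) := by
    rw [Finset.sum_div]
    refine Finset.sum_le_sum fun i _ => ?_
    have hsi := hs.pos i
    have hti := ht.pos i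
    have e1 := sub_one_sub_log_ge (div_pos hsi hti)
    rw [Real.log_div hsi.ne' hti.ne'] at e1
    have e2 : (t i - s i) ^ 2 / (4 * q ^ 2) ≤ (s i / t i - 1) ^ 2 / (2 * (s i / t i + 1)) := by
      have : (s i / t i - 1) ^ 2 / (2 * (s i / t i + 1)) =
          (t i - s i) ^ 2 / (2 * t i * (s i + t i)) := by
        field_simp; ring
      rw [this]
      refine div_le_div_of_nonneg_left (sq_nonneg _) (by positivity) ?_
      nlinarith [hs.upper i, ht.upper i]
    have e3 : (s i - t i) * ((t i)⁻¹ - (t i)⁻¹ ^ 2 * ρ i) - ((s i)⁻¹ - (t i)⁻¹) * ρ i =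
        (s i / t i - 1) - (t i - s i) ^ 2 * ((s i)⁻¹ * (t i)⁻¹ ^ 2 * ρ i) := by
      field_simp; ring
    have e4 : (s i)⁻¹ * (t i)⁻¹ ^ 2 * ρ i ≤ 1 / (8 * q ^ 2) := by
      have h1 : (s i)⁻¹ * (t i)⁻¹ ^ 2 ≤ q * q ^ 2 :=
        mul_le_mul (hs.inv_le i) (pow_le_pow_left₀ (inv_nonneg.2 hti.le) (ht.inv_le i) 2)
          (by positivity) hq.le
      have h2 : (s i)⁻¹ * (t i)⁻¹ ^ 2 * ρ i ≤
          q * q ^ 2 * (Fintype.card n / (b / q * N) * a) :=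
        (mul_le_mul_of_nonneg_left ((le_abs_self _).trans (hρ i)) (by positivity)).trans
          (mul_le_mul_of_nonneg_right h1 (by positivity))
      refine h2.trans ?_
      rw [div_le_iff₀ hb] at hN
      have : q * q ^ 2 * (Fintype.card n / (b / q * N) * a) =
          q ^ 4 * a * Fintype.card n / (b * N) := by field_simp
      rw [this, div_le_div_iff₀ (by positivity) (by positivity)]
      nlinarith
    have e5 : (t i - s i) ^ 2 * ((s i)⁻¹ * (t i)⁻¹ ^ 2 * ρ i) ≤ (t i - s i) ^ 2 / (8 * q ^ 2) := by
      rw [div_eq_mul_one_div]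
      exact mul_le_mul_of_nonneg_left e4 (sq_nonneg _)
    have e6 : (t i - s i) ^ 2 / (4 * q ^ 2) = 2 * ((t i - s i) ^ 2 / (8 * q ^ 2)) := by
      field_simp; ring
    linarith
  have b2 : -(τ * √N * q ^ 2 * δ) ≤ ∑ i, W i i * ((t i)⁻¹ - (s i)⁻¹) := by
    refine neg_le_of_abs_le ((abs_sum_mul_le _ _).trans ?_)
    have : √(∑ i, ((t i)⁻¹ - (s i)⁻¹) ^ 2) ≤ q ^ 2 * δ := by
      refine Real.sqrt_le_iff.2 ⟨by positivity, ?_⟩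
      rw [mul_pow, hδ2, Finset.mul_sum]
      refine Finset.sum_le_sum fun i _ => ?_
      have := ht.abs_inv_sub_le hs i
      rw [← mul_pow, ← sq_abs, ← sq_abs (q ^ 2 * _), abs_mul, abs_of_pos (by positivity : 0 < q ^ 2)]
      exact pow_le_pow_left₀ (abs_nonneg _) this 2
    calc _ ≤ (τ * √N) * (q ^ 2 * δ) :=
          mul_le_mul hWd this (Real.sqrt_nonneg _) ((Real.sqrt_nonneg _).trans hWd)
      _ = _ := by ring
  have b3 : (W * (J1 - J0)).trace ≤ τ * √N * cJ * δ := by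
    have hsN : 0 < √N := Real.sqrt_pos.2 hNp
    refine (le_abs_self _).trans ((abs_trace_mul_le _ _).trans ?_)
    have hτ : 0 ≤ τ := by
      have := (norm_nonneg W).trans hW
      exact nonneg_of_mul_nonneg_left this hNp
    calc ‖W‖ * ‖J1 - J0‖ ≤ τ * N * ‖J1 - J0‖ := mul_le_mul_of_nonneg_right hW (norm_nonneg _)
      _ = τ * √N * (‖J1 - J0‖ * √N) := by
        have := Real.mul_self_sqrt hNp.le
        linear_combination (-τ * ‖J1 - J0‖) * this
      _ ≤ τ * √N * (cJ * δ) := mul_le_mul_of_nonneg_left hJ (by positivity)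
      _ = _ := by ring
  rw [t1] at hlog
  rw [Finset.sum_sub_distrib, Finset.sum_add_distrib, Finset.sum_sub_distrib] at b1
  linarith

/-! ### Rates for the variances and the column space. -/

theorem log_det_one_add_le {G : Matrix ι n ℝ} {A N : ℝ} (hN : 1 ≤ N) (hG : ‖G‖ ^ 2 ≤ A * N) :
    Real.log (1 + Gᵀ * G).det ≤ 2 * Fintype.card n * √N + A := by
  have hN0 : 0 < N := by linarith
  -- The tangent is taken at N times the identity, the scale of GᵀG; with log N ≤ 2√N the bound is
  -- of smaller order than N.
  have hB : (N • (1 : Matrix n n ℝ)).PosDef := Matrix.PosDef.one.smul hN0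
  have h := log_det_le (posDef_one_add' G) hB
  have hinv : (N • (1 : Matrix n n ℝ))⁻¹ = N⁻¹ • 1 := by
    apply Matrix.inv_eq_right_inv
    rw [Matrix.smul_mul, Matrix.one_mul, smul_smul, mul_inv_cancel₀ hN0.ne', one_smul]
  rw [hinv, Matrix.det_smul, Matrix.det_one, mul_one, Real.log_pow, Matrix.smul_mul, Matrix.one_mul,
    Matrix.trace_smul, Matrix.trace_add, Matrix.trace_one, ← frobenius_sq_eq_trace, smul_eq_mul,
    mul_add] at h
  have h1 : N⁻¹ * ‖G‖ ^ 2 ≤ A := by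
    rw [inv_mul_le_iff₀ hN0, mul_comm]; exact hG
  have h2 : N⁻¹ * (Fintype.card n : ℝ) ≤ Fintype.card n :=
    mul_le_of_le_one_left (Nat.cast_nonneg _) (inv_le_one_of_one_le₀ hN)
  have h3 : Real.log N ≤ 2 * √N := by
    have := Real.log_le_sub_one_of_pos (Real.sqrt_pos.2 hN0)
    rw [Real.log_sqrt hN0.le] at this
    linarith
  have h4 : (Fintype.card n : ℝ) * Real.log N ≤ Fintype.card n * (2 * √N) :=
    mul_le_mul_of_nonneg_left h3 (Nat.cast_nonneg _)
  linarith

/-- A lower bound of the likelihood loss in terms of the distance of the column spaces; it is sharp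
up to terms of smaller order than `N`. -/
theorem colSpace_sq_sub_le_unitNegLik_sub {M : Matrix ι ι ℝ} (hMp : M.PosSemidef)
    {G : Matrix ι n ℝ} {E : Matrix ι ι ℝ} (hM : M = 1 + G * Gᵀ + E) {U : Matrix ι n ℝ}
    (hU : Uᵀ * U = 1) (L : Matrix n n ℝ) {A B N : ℝ} (hN : 1 ≤ N) (hB : 0 < B)
    (hG : ‖G‖ ^ 2 ≤ A * N) (hGl : ∀ v, B * N * (v ⬝ᵥ v) ≤ v ⬝ᵥ (Gᵀ * G) *ᵥ v) :
    ‖G - U * (Uᵀ * G)‖ ^ 2 - (Fintype.card n + 2 * Fintype.card n * √N + A) -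
      ‖E‖ * (A * Fintype.card n / B + Fintype.card n) ≤
        unitNegLik M (U * L) - unitNegLik M G := by
  have h := unitNegLik_sub_ge_crude hMp hM hU L
  have h1 := log_det_one_add_le hN hG
  have hN0 : 0 < N := by linarith
  have hBN : 0 < B * N := by positivity
  have hR : ‖(1 + Gᵀ * G)⁻¹‖ ≤ Fintype.card n / (B * N) :=
    norm_inv_le_of_lower (by simp) hBN (one_add_lower hGl)
  have h2 : ‖G * (1 + Gᵀ * G)⁻¹ * Gᵀ - U * Uᵀ‖ ≤ A * Fintype.card n / B + Fintype.card n := by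
    refine (norm_sub_le _ _).trans (add_le_add ?_ ?_)
    · refine (frobenius_mul_three _ _ _).trans ?_
      rw [Matrix.frobenius_norm_transpose]
      calc ‖G‖ * ‖(1 + Gᵀ * G)⁻¹‖ * ‖G‖ = ‖G‖ ^ 2 * ‖(1 + Gᵀ * G)⁻¹‖ := by ring
        _ ≤ (A * N) * (Fintype.card n / (B * N)) :=
            mul_le_mul hG hR (norm_nonneg _) ((sq_nonneg _).trans hG)
        _ = _ := by field_simp
    · refine (Matrix.frobenius_norm_mul _ _).trans ?_
      rw [Matrix.frobenius_norm_transpose, ← sq, frobenius_sq_of_orthonormal hU]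
  have h3 := mul_le_mul_of_nonneg_left h2 (norm_nonneg E)
  linarith

theorem proj_lower {G : Matrix ι n ℝ} {U : Matrix ι n ℝ} (hU : Uᵀ * U = 1) {c d : ℝ}
    (hGl : ∀ v, c * (v ⬝ᵥ v) ≤ v ⬝ᵥ (Gᵀ * G) *ᵥ v) (hx : ‖G - U * (Uᵀ * G)‖ ^ 2 ≤ d)
    (v : n → ℝ) : (c - d) * (v ⬝ᵥ v) ≤ v ⬝ᵥ ((Uᵀ * G)ᵀ * (Uᵀ * G)) *ᵥ v := by
  have h := hGl v
  rw [(norm_sq_proj hU G).2.1, Matrix.add_mulVec, dotProduct_add] at h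
  have h1 : v ⬝ᵥ ((G - U * (Uᵀ * G))ᵀ * (G - U * (Uᵀ * G))) *ᵥ v ≤ d * (v ⬝ᵥ v) := by
    rw [quadForm_transpose_mul_self]
    exact (mulVec_sq_le _ _).trans (mul_le_mul_of_nonneg_right hx (dotProduct_self_nonneg' v))
  linarith

theorem add_lower {A E : Matrix n n ℝ} {c d : ℝ} (h : ∀ v, c * (v ⬝ᵥ v) ≤ v ⬝ᵥ A *ᵥ v)
    (hE : ‖E‖ ≤ d) (v : n → ℝ) : (c - d) * (v ⬝ᵥ v) ≤ v ⬝ᵥ (A + E) *ᵥ v := by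
  rw [Matrix.add_mulVec, dotProduct_add]
  have h1 := (abs_le.1 (abs_quadForm_le E v)).1
  have h2 := mul_le_mul_of_nonneg_right hE (dotProduct_self_nonneg' v)
  linarith [h v]

set_option maxHeartbeats 1000000 in
-- This is the sharp bound, available once the squared distance x² of the column spaces is at most
-- BN/2. The compressed data are then of exact order N and their inverse is O(1/N). The difference
-- of the ridge projections is O(x/√N), so its product with ‖E‖ splits into x²/4 and a multiple of
-- ‖E‖²/N. The other loss in x² is also at most x²/4 for large N.
theorem half_colSpace_sq_sub_le_unitNegLik_sub {M : Matrix ι ι ℝ} (hMp : M.PosSemidef)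
    {G : Matrix ι n ℝ} {E : Matrix ι ι ℝ} (hM : M = 1 + G * Gᵀ + E) {U : Matrix ι n ℝ}
    (hU : Uᵀ * U = 1) (L : Matrix n n ℝ) {A B N : ℝ} (hN : 1 ≤ N) (hB : 0 < B) (hA : 0 ≤ A)
    (hG : ‖G‖ ^ 2 ≤ A * N) (hGl : ∀ v, B * N * (v ⬝ᵥ v) ≤ v ⬝ᵥ (Gᵀ * G) *ᵥ v)
    (hx : ‖G - U * (Uᵀ * G)‖ ^ 2 ≤ B / 2 * N) (hE : Fintype.card n * ‖E‖ ≤ B / 4 * N)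
    (hN2 : 8 * Fintype.card n / B ≤ N) :
    ‖G - U * (Uᵀ * G)‖ ^ 2 / 2 -
      (8 * Fintype.card n ^ 4 / B ^ 2 + (2 * Fintype.card n * √A / B +
        2 * √A ^ 3 * Fintype.card n ^ 2 / B ^ 2) ^ 2) * ‖E‖ ^ 2 / N ≤
        unitNegLik M (U * L) - unitNegLik M G := by
  have hN0 : 0 < N := by linarith
  set k := (Fintype.card n : ℝ) with hk
  have hk0 : 0 ≤ k := Nat.cast_nonneg _
  have hKp : (Uᵀ * M * U).PosSemidef := by simpa using posSemidef_congr hMp Uᵀ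
  have hKe : (Uᵀ * M * U) = 1 + ((Uᵀ * G) * (Uᵀ * G)ᵀ + Uᵀ * E * U) := by
    rw [hM, Matrix.mul_add, Matrix.add_mul, Matrix.mul_add, Matrix.add_mul, Matrix.mul_one, hU,
      Matrix.transpose_mul, Matrix.transpose_transpose]
    simp only [Matrix.mul_assoc, add_assoc]
  have hU2 : ‖U‖ ^ 2 = k := frobenius_sq_of_orthonormal hU
  have hE1 : ‖Uᵀ * E * U‖ ≤ k * ‖E‖ := by
    refine (frobenius_mul_three _ _ _).trans ?_
    rw [Matrix.frobenius_norm_transpose, ← hU2]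
    exact le_of_eq (by ring)
  have hg1 : ∀ v, B / 2 * N * (v ⬝ᵥ v) ≤ v ⬝ᵥ ((Uᵀ * G)ᵀ * (Uᵀ * G)) *ᵥ v := fun v => by
    have := proj_lower hU hGl hx v
    have e : B * N - B / 2 * N = B / 2 * N := by ring
    rwa [e] at this
  have hg2 := lower_mul_transpose_of_lower (by positivity) hg1
  have hc : 0 < B / 2 * N := by positivity
  have hc' : 0 < B / 4 * N := by positivity
  have hKl : ∀ v, B / 4 * N * (v ⬝ᵥ v) ≤ v ⬝ᵥ (Uᵀ * M * U) *ᵥ v := fun v => by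
    rw [hKe]
    refine one_add_lower (fun v => ?_) v
    have := add_lower hg2 (hE1.trans hE) v
    have e : B / 2 * N - B / 4 * N = B / 4 * N := by ring
    rwa [e] at this
  have hKt : (Uᵀ * M * U)ᵀ = Uᵀ * M * U := by simpa [Matrix.IsHermitian] using hKp.isHermitian
  have hK := posDef_of_lower hKt hc' hKl
  have nK := norm_inv_le_of_lower hKt hc' hKl
  have nX : ‖(1 + (Uᵀ * G) * (Uᵀ * G)ᵀ)⁻¹‖ ≤ k / (B / 2 * N) :=
    norm_inv_le_of_lower (by simp) hc (one_add_lower hg2)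
  have nR1 : ‖(1 + (Uᵀ * G)ᵀ * (Uᵀ * G))⁻¹‖ ≤ k / (B / 2 * N) :=
    norm_inv_le_of_lower (by simp) hc (one_add_lower hg1)
  have nR : ‖(1 + Gᵀ * G)⁻¹‖ ≤ k / (B * N) :=
    norm_inv_le_of_lower (by simp) (by positivity) (one_add_lower hGl)
  have hmain := unitNegLik_sub_ge_fine hM hU L hK rfl
  have hridge := norm_ridge_sub_le (G := G) hU rfl rfl
  have hGx : ‖G - U * (Uᵀ * G)‖ ≤ ‖G‖ := by
    refine abs_le_of_sq_le_sq' ?_ (norm_nonneg _) |>.2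
    rw [(norm_sq_proj hU G).1]; nlinarith [sq_nonneg ‖Uᵀ * G‖]
  have hGn : ‖G‖ ≤ √A * √N := by
    rw [← Real.sqrt_mul hA]; exact norm_le_of_sq_le hG
  set x := ‖G - U * (Uᵀ * G)‖ with hxd
  have hx0 : 0 ≤ x := norm_nonneg _
  have hsN : √N ^ 2 = N := Real.sq_sqrt hN0.le
  have hsN0 : 0 < √N := Real.sqrt_pos.2 hN0
  have e1 : ‖(1 + (Uᵀ * G)ᵀ * (Uᵀ * G))⁻¹‖ * x ^ 2 ≤ x ^ 2 / 4 := by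
    have : k / (B / 2 * N) ≤ 1 / 4 := by
      rw [div_le_iff₀ hB] at hN2
      rw [div_le_div_iff₀ hc (by norm_num)]
      nlinarith
    nlinarith [sq_nonneg x]
  have e2 : ‖(Uᵀ * M * U)⁻¹‖ * ‖(1 + (Uᵀ * G) * (Uᵀ * G)ᵀ)⁻¹‖ * ‖Uᵀ * E * U‖ ^ 2 ≤
      8 * k ^ 4 / B ^ 2 * ‖E‖ ^ 2 / N := by
    calc _ ≤ (k / (B / 4 * N)) * (k / (B / 2 * N)) * (k * ‖E‖) ^ 2 := by gcongr
      _ = 8 * k ^ 4 / B ^ 2 * ‖E‖ ^ 2 / N * (1 / N) := by field_simp; ring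
      _ ≤ 8 * k ^ 4 / B ^ 2 * ‖E‖ ^ 2 / N * 1 := by
        refine mul_le_mul_of_nonneg_left ?_ (by positivity)
        rw [div_le_one hN0]; exact hN
      _ = _ := mul_one _
  set c4 := 2 * k * √A / B + 2 * √A ^ 3 * k ^ 2 / B ^ 2 with hc4
  have e3 : 2 * x * ‖(1 + Gᵀ * G)⁻¹‖ * ‖G‖ + ‖G‖ ^ 2 * ‖(1 + Gᵀ * G)⁻¹‖ *
      ‖(1 + (Uᵀ * G)ᵀ * (Uᵀ * G))⁻¹‖ * x ^ 2 ≤ c4 * x / √N := by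
    have hx2 : x ^ 2 ≤ x * (√A * √N) := by
      rw [sq]; exact mul_le_mul_of_nonneg_left (hGx.trans hGn) hx0
    calc _ ≤ 2 * x * (k / (B * N)) * (√A * √N) + (√A * √N) ^ 2 * (k / (B * N)) *
          (k / (B / 2 * N)) * (x * (√A * √N)) := by gcongr
      _ = 2 * x * (k / (B * √N ^ 2)) * (√A * √N) + (√A * √N) ^ 2 * (k / (B * √N ^ 2)) *
          (k / (B / 2 * √N ^ 2)) * (x * (√A * √N)) := by rw [hsN]
      _ = c4 * x / √N := by rw [hc4]; field_simp
  have e4 : ‖E‖ * (c4 * x / √N) ≤ x ^ 2 / 4 + c4 ^ 2 * ‖E‖ ^ 2 / N := by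
    have h1 : c4 ^ 2 * ‖E‖ ^ 2 / N = (‖E‖ * c4 / √N) ^ 2 := by
      rw [div_pow, mul_pow, hsN]; ring
    have h2 : ‖E‖ * (c4 * x / √N) = x * (‖E‖ * c4 / √N) := by ring
    rw [h1, h2]
    nlinarith [sq_nonneg (x / 2 - ‖E‖ * c4 / √N)]
  have e5 := mul_le_mul_of_nonneg_left (hridge.trans e3) (norm_nonneg E)
  have e6 : (8 * k ^ 4 / B ^ 2 + c4 ^ 2) * ‖E‖ ^ 2 / N =
      8 * k ^ 4 / B ^ 2 * ‖E‖ ^ 2 / N + c4 ^ 2 * ‖E‖ ^ 2 / N := by ring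
  rw [e6]
  linarith

/-- The whitened loadings. -/
noncomputable def whiten (t : ι → ℝ) (Γ : Matrix ι n ℝ) : Matrix ι n ℝ :=
  Matrix.diagonal (fun i => (√(t i))⁻¹) * Γ

theorem whiten_transpose_mul {t : ι → ℝ} (ht : ∀ i, 0 < t i) (Γ : Matrix ι n ℝ)
    (Δ : Matrix ι m ℝ) :
    (whiten t Γ)ᵀ * whiten t Δ = Γᵀ * Matrix.diagonal (fun i => (t i)⁻¹) * Δ := by
  rw [whiten, whiten, Matrix.transpose_mul, Matrix.diagonal_transpose,
    Matrix.mul_assoc, ← Matrix.mul_assoc (Matrix.diagonal _) (Matrix.diagonal _),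
    Matrix.diagonal_mul_diagonal, Matrix.mul_assoc]
  congr 3; ext i
  rw [← mul_inv, Real.mul_self_sqrt (ht i).le]

theorem VarianceBound.abs_inv_sqrt_le {q : ℝ} {s : ι → ℝ} (h : VarianceBound q s) (i : ι) :
    |(√(s i))⁻¹| ≤ √q := by
  rw [abs_of_pos (inv_pos.2 (Real.sqrt_pos.2 (h.pos i))), ← Real.sqrt_inv]
  exact Real.sqrt_le_sqrt (h.inv_le i)

theorem VarianceBound.norm_whiten_le {q : ℝ} {s : ι → ℝ} (h : VarianceBound q s)
    (A : Matrix ι n ℝ) : ‖whiten s A‖ ≤ √q * ‖A‖ :=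
  frobenius_diagonal_mul_le (Real.sqrt_nonneg _) h.abs_inv_sqrt_le A

/-- The whitening uses the estimated variances t while the data have variances s. The discrepancy s
- t is counted as noise, whence its norm in the bound for E. -/
theorem whiten_data {q : ℝ} {t s : ι → ℝ} (ht : VarianceBound q t) {Γ : Matrix ι n ℝ}
    {M W : Matrix ι ι ℝ} (hM : M = Matrix.diagonal s + Γ * Γᵀ + W) :
    ∃ E : Matrix ι ι ℝ, Matrix.diagonal (fun i => (√(t i))⁻¹) * M *
      Matrix.diagonal (fun i => (√(t i))⁻¹) = 1 + whiten t Γ * (whiten t Γ)ᵀ + E ∧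
      ‖E‖ ≤ q * (√(∑ i, (t i - s i) ^ 2) + ‖W‖) := by
  set V := Matrix.diagonal (fun i => (√(t i))⁻¹) with hV
  refine ⟨V * (Matrix.diagonal (fun i => s i - t i) + W) * V, ?_, ?_⟩
  · have h1 : V * Matrix.diagonal t * V = 1 := by
      rw [hV, Matrix.diagonal_mul_diagonal, Matrix.diagonal_mul_diagonal, ← Matrix.diagonal_one]
      congr 1; ext i
      have h2 := Real.sqrt_pos.2 (ht.pos i)
      field_simp
      rw [Real.sq_sqrt (ht.pos i).le]
    have h2 : Matrix.diagonal (fun i => s i - t i) = Matrix.diagonal s - Matrix.diagonal t := by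
      rw [Matrix.diagonal_sub]
    have h3 : whiten t Γ * (whiten t Γ)ᵀ = V * (Γ * Γᵀ) * V := by
      rw [whiten, Matrix.transpose_mul, Matrix.diagonal_transpose]
      simp only [Matrix.mul_assoc, hV]
    rw [h3, ← h1, hM, h2]
    simp only [Matrix.mul_add, Matrix.add_mul, Matrix.mul_sub, Matrix.sub_mul]
    abel
  · have hq := ht.q_pos
    have h1 : ‖V * (Matrix.diagonal (fun i => s i - t i) + W) * V‖ ≤
        √q * (√q * ‖Matrix.diagonal (fun i => s i - t i) + W‖) := by
      refine (frobenius_mul_diagonal_le (Real.sqrt_nonneg _) ht.abs_inv_sqrt_le _).trans ?_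
      exact mul_le_mul_of_nonneg_left
        (frobenius_diagonal_mul_le (Real.sqrt_nonneg _) ht.abs_inv_sqrt_le _) (Real.sqrt_nonneg _)
    refine h1.trans ?_
    rw [← mul_assoc, Real.mul_self_sqrt hq.le]
    refine mul_le_mul_of_nonneg_left ((norm_add_le _ _).trans ?_) hq.le
    refine add_le_add (norm_le_of_sq_le ?_) le_rfl
    rw [frobenius_diagonal_sq]
    exact le_of_eq (Finset.sum_congr rfl fun i _ => by ring)

theorem VarianceBound.sqrt_sum_sub_sq_le {q N : ℝ} {s t : ι → ℝ} (hs : VarianceBound q s)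
    (ht : VarianceBound q t) (hN : (Fintype.card ι : ℝ) ≤ N) :
    √(∑ i, (t i - s i) ^ 2) ≤ q * √N := by
  have hq := hs.q_pos
  rw [Real.sqrt_le_iff]
  have hN0 : 0 ≤ N := (Nat.cast_nonneg _).trans hN
  refine ⟨by positivity, ?_⟩
  rw [mul_pow, Real.sq_sqrt hN0]
  calc ∑ i, (t i - s i) ^ 2 ≤ ∑ _i : ι, q ^ 2 := Finset.sum_le_sum fun i _ => by
        refine sq_le_sq' ?_ ?_ <;> linarith [hs.upper i, ht.upper i, hs.pos i, ht.pos i]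
    _ = q ^ 2 * Fintype.card ι := by simp [mul_comm]
    _ ≤ _ := by gcongr

set_option maxHeartbeats 1000000 in
/-- Rates of convergence of the variances and of the column space of the loadings, for any
parameter that is at least as likely as the truth. -/
theorem exists_variance_colSpace_rate (n : Type) [Fintype n] [DecidableEq n] (a b q : ℝ)
    (ha : 0 < a) (hb : 0 < b) (hq : 1 ≤ q) :
    ∃ c τ₀ N₀ : ℝ, 0 < c ∧ 0 < τ₀ ∧ ∀ (ι : Type) [Fintype ι] [DecidableEq ι] (N τ : ℝ)
      (s t : ι → ℝ) (Γ Δ : Matrix ι n ℝ) (M W : Matrix ι ι ℝ),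
      RegularLoading a b N Γ → VarianceBound q s → VarianceBound q t →
      Fintype.card n ≤ Fintype.card ι → M.PosSemidef →
      M = Matrix.diagonal s + Γ * Γᵀ + W → ‖W‖ ≤ τ * N → √(∑ i, W i i ^ 2) ≤ τ * √N →
      N₀ ≤ N → τ ≤ τ₀ → negLik M t Δ ≤ negLik M s Γ →
      ∑ i, (t i - s i) ^ 2 ≤ c * (τ ^ 2 * N) ∧
      ∃ (U : Matrix ι n ℝ) (L : Matrix n n ℝ), Uᵀ * U = 1 ∧ whiten t Δ = U * L ∧
        ‖whiten t Γ - U * (Uᵀ * whiten t Γ)‖ ^ 2 ≤ c * (τ ^ 2 * N) := by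
  have hq0 : 0 < q := by linarith
  obtain ⟨k, hk⟩ : ∃ k : ℝ, k = Fintype.card n := ⟨_, rfl⟩
  have hk0 : 0 ≤ k := hk ▸ Nat.cast_nonneg _
  obtain ⟨A, hA⟩ : ∃ A, A = q * a := ⟨_, rfl⟩
  obtain ⟨B, hB⟩ : ∃ B, B = b / q := ⟨_, rfl⟩
  have hA0 : 0 < A := by rw [hA]; positivity
  have hB0 : 0 < B := by rw [hB]; positivity
  obtain ⟨c2, hc2⟩ : ∃ c2, c2 = q ^ 2 + (2 * q ^ 4 * a * k / b + q ^ 6 * a ^ 2 * k ^ 2 / b ^ 2) :=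
    ⟨_, rfl⟩
  obtain ⟨c5, hc5⟩ : ∃ c5, c5 = 8 * k ^ 4 / B ^ 2 + (2 * k * √A / B + 2 * √A ^ 3 * k ^ 2 / B ^ 2) ^ 2 :=
    ⟨_, rfl⟩
  have hc20 : 0 < c2 := by rw [hc2]; positivity
  have hc50 : 0 ≤ c5 := by rw [hc5]; positivity
  obtain ⟨d, hd⟩ : ∃ d, d = q * (q + 1) * (A * k / B + k) := ⟨_, rfl⟩
  have hd0 : 0 ≤ d := by rw [hd]; positivity
  obtain ⟨c3, hc3⟩ : ∃ c3, c3 = 3 * k + A + d + 2 * q ^ 2 * c2 ^ 2 + k * (q * (q + 1)) := ⟨_, rfl⟩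
  have hc30 : 0 < c3 := by rw [hc3]; positivity
  refine ⟨16 * q ^ 2 * (8 * q ^ 2 * c2 ^ 2 + 2 * q ^ 2 * c5), min 1 (B / (8 * c3)),
    1 + (8 * c3 / B) ^ 2 + 8 * q ^ 6 * a * k / b + 8 * k / B + 64 * q ^ 4 * c5, by positivity,
    by positivity, ?_⟩
  intro ι _ _ N τ s t Γ Δ M W hΓ hs ht hcard hMp hM hW hWd hN hτ hlik
  have hN1 : 1 ≤ N := by
    have : 0 ≤ (8 * c3 / B) ^ 2 + 8 * q ^ 6 * a * k / b + 8 * k / B + 64 * q ^ 4 * c5 := by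
      positivity
    linarith
  have hNa : (8 * c3 / B) ^ 2 ≤ N := by
    have : 0 ≤ 1 + 8 * q ^ 6 * a * k / b + 8 * k / B + 64 * q ^ 4 * c5 := by positivity
    linarith
  have hNb : 8 * q ^ 6 * a * k / b ≤ N := by
    have : 0 ≤ 1 + (8 * c3 / B) ^ 2 + 8 * k / B + 64 * q ^ 4 * c5 := by positivity
    linarith
  have hNc : 8 * k / B ≤ N := by
    have : 0 ≤ 1 + (8 * c3 / B) ^ 2 + 8 * q ^ 6 * a * k / b + 64 * q ^ 4 * c5 := by positivity
    linarith
  have hNd : 64 * q ^ 4 * c5 ≤ N := by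
    have : 0 ≤ 1 + (8 * c3 / B) ^ 2 + 8 * q ^ 6 * a * k / b + 8 * k / B := by positivity
    linarith
  have hN0 : 0 < N := by linarith
  have hτ0 : 0 ≤ τ := nonneg_of_mul_nonneg_left ((norm_nonneg W).trans hW) hN0
  have hτ1 : τ ≤ 1 := hτ.trans (min_le_left _ _)
  have hτ2 : τ ≤ B / (8 * c3) := hτ.trans (min_le_right _ _)
  -- The excess is split at the pair (t, Γ): first the variances are changed with the true loadings,
  -- then the loadings with the variances fixed at t. The two lower bounds add up to something
  -- nonpositive.
  have hB2 := negLik_variance_sub_ge hΓ hs ht hM hW hWd (by rw [← hk]; exact hNb)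
  rw [← hk, ← hc2] at hB2
  obtain ⟨E, hE, hEn⟩ := whiten_data ht hM
  obtain ⟨U, L, hU, hL⟩ := exists_orthonormal_mul hcard (whiten t Δ)
  obtain ⟨δ, hδ⟩ : ∃ δ, δ = √(∑ i, (t i - s i) ^ 2) := ⟨_, rfl⟩
  have hδ0 : 0 ≤ δ := hδ ▸ Real.sqrt_nonneg _
  have hδ2 : ∑ i, (t i - s i) ^ 2 = δ ^ 2 := by
    rw [hδ, Real.sq_sqrt (Finset.sum_nonneg fun _ _ => sq_nonneg _)]
  have hδN : δ ≤ q * √N := hδ ▸ hs.sqrt_sum_sub_sq_le ht hΓ.card_le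
  rw [← hδ, hδ2] at hB2
  rw [← hδ] at hEn
  have hG : ‖whiten t Γ‖ ^ 2 ≤ A * N := by
    have := pow_le_pow_left₀ (norm_nonneg _) (ht.norm_whiten_le Γ) 2
    rw [mul_pow, Real.sq_sqrt hq0.le] at this
    refine this.trans ?_
    rw [hA, mul_assoc]
    exact mul_le_mul_of_nonneg_left hΓ.norm_sq_le hq0.le
  have hGl : ∀ v, B * N * (v ⬝ᵥ v) ≤ v ⬝ᵥ ((whiten t Γ)ᵀ * whiten t Γ) *ᵥ v := fun v => by
    rw [whiten_transpose_mul ht.pos, hB]; exact hΓ.weighted_lower ht v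
  have hMw : (Matrix.diagonal (fun i => (√(t i))⁻¹) * M *
      Matrix.diagonal (fun i => (√(t i))⁻¹)).PosSemidef := by
    have := posSemidef_congr hMp (Matrix.diagonal (fun i => (√(t i))⁻¹))
    rwa [Matrix.diagonal_transpose] at this
  have hdiff : unitNegLik (Matrix.diagonal (fun i => (√(t i))⁻¹) * M *
      Matrix.diagonal (fun i => (√(t i))⁻¹)) (U * L) -
      unitNegLik (Matrix.diagonal (fun i => (√(t i))⁻¹) * M *
        Matrix.diagonal (fun i => (√(t i))⁻¹)) (whiten t Γ) = negLik M t Δ - negLik M t Γ := by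
    rw [negLik_eq ht.pos, negLik_eq ht.pos, ← hL, add_sub_add_left_eq_sub]
    rfl
  have hcr := colSpace_sq_sub_le_unitNegLik_sub hMw hE hU L hN1 hB0 hG hGl
  rw [hdiff, ← hk] at hcr
  have hEn' : ‖E‖ ≤ q * (δ + τ * N) := hEn.trans (by gcongr)
  have hsN : √N ^ 2 = N := Real.sq_sqrt hN0.le
  have hsN0 : 0 < √N := Real.sqrt_pos.2 hN0
  have hsN1 : 1 ≤ √N := Real.one_le_sqrt.2 hN1
  obtain ⟨X, hX⟩ : ∃ X, X = ‖whiten t Γ - U * (Uᵀ * whiten t Γ)‖ := ⟨_, rfl⟩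
  rw [← hX] at hcr
  -- consistency
  have hamgm : τ * √N * c2 * δ ≤ δ ^ 2 / (32 * q ^ 2) + 8 * q ^ 2 * c2 ^ 2 * (τ ^ 2 * N) := by
    have h1 : δ ^ 2 / (32 * q ^ 2) = δ ^ 2 * (32 * q ^ 2)⁻¹ := div_eq_mul_inv _ _
    have h2 : (32 * q ^ 2) * (32 * q ^ 2)⁻¹ = 1 := mul_inv_cancel₀ (by positivity)
    have h3 : 0 < (32 * q ^ 2)⁻¹ := by positivity
    have h4 := mul_nonneg h3.le (sq_nonneg (δ - 16 * q ^ 2 * (τ * √N * c2)))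
    have h5 : (32 * q ^ 2)⁻¹ * (δ - 16 * q ^ 2 * (τ * √N * c2)) ^ 2 =
        δ ^ 2 / (32 * q ^ 2) - τ * √N * c2 * δ + 8 * q ^ 2 * c2 ^ 2 * (τ ^ 2 * √N ^ 2) := by
      field_simp; ring
    rw [h5, hsN] at h4
    linarith
  have hamgm' : τ * √N * c2 * δ ≤ δ ^ 2 / (8 * q ^ 2) + 2 * q ^ 2 * c2 ^ 2 * (τ ^ 2 * N) := by
    have h3 : 0 < (8 * q ^ 2)⁻¹ := by positivity
    have h4 := mul_nonneg h3.le (sq_nonneg (δ - 4 * q ^ 2 * (τ * √N * c2)))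
    have h5 : (8 * q ^ 2)⁻¹ * (δ - 4 * q ^ 2 * (τ * √N * c2)) ^ 2 =
        δ ^ 2 / (8 * q ^ 2) - τ * √N * c2 * δ + 2 * q ^ 2 * c2 ^ 2 * (τ ^ 2 * √N ^ 2) := by
      field_simp; ring
    rw [h5, hsN] at h4
    linarith
  have hEc : ‖E‖ ≤ q * (q + 1) * (√N + τ * N) := by
    refine hEn'.trans ?_
    have h1 : 0 ≤ τ * N := by positivity
    have h2 : δ + τ * N ≤ (q + 1) * (√N + τ * N) := by
      have := mul_nonneg hq0.le h1
      linarith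
    calc _ ≤ q * ((q + 1) * (√N + τ * N)) := mul_le_mul_of_nonneg_left h2 hq0.le
      _ = _ := by ring
  have hsmall : c3 * (√N + τ * N) ≤ B / 4 * N := by
    have h1 : 8 * c3 * √N ≤ B * N := by
      have : 8 * c3 / B ≤ √N := Real.le_sqrt_of_sq_le hNa
      rw [div_le_iff₀ hB0] at this
      calc 8 * c3 * √N ≤ (√N * B) * √N := mul_le_mul_of_nonneg_right this hsN0.le
        _ = B * √N ^ 2 := by ring
        _ = _ := by rw [hsN]
    have h2 : 8 * c3 * (τ * N) ≤ B * N := by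
      rw [le_div_iff₀ (by positivity)] at hτ2
      have := mul_le_mul_of_nonneg_right hτ2 hN0.le
      linarith
    linarith
  -- The crude bound for the loadings and the bound for the variances together: X² is small compared
  -- with N, as the sharp bound requires.
  have hXc : X ^ 2 ≤ c3 * (√N + τ * N) := by
    have h1 : ‖E‖ * (A * k / B + k) ≤ d * (√N + τ * N) := by
      have := mul_le_mul_of_nonneg_right hEc (by positivity : 0 ≤ A * k / B + k)
      rw [hd]; linarith
    have h2 : τ ^ 2 * N ≤ √N + τ * N := by
      have : τ * N * τ ≤ τ * N := mul_le_of_le_one_right (by positivity) hτ1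
      linarith
    have h3 : X ^ 2 ≤ k + 2 * k * √N + A + ‖E‖ * (A * k / B + k) +
        2 * q ^ 2 * c2 ^ 2 * (τ ^ 2 * N) := by linarith
    have h4 : 2 * q ^ 2 * c2 ^ 2 * (τ ^ 2 * N) ≤ 2 * q ^ 2 * c2 ^ 2 * (√N + τ * N) :=
      mul_le_mul_of_nonneg_left h2 (by positivity)
    have h5 : k + 2 * k * √N + A ≤ (3 * k + A) * (√N + τ * N) := by
      have e1 : 0 ≤ (3 * k + A) * (τ * N) := by positivity
      have e2 := mul_le_mul_of_nonneg_left hsN1 hk0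
      have e3 := mul_le_mul_of_nonneg_left hsN1 hA0.le
      linarith
    have h6 : 0 ≤ k * (q * (q + 1)) * (√N + τ * N) := by positivity
    rw [hc3]
    linarith
  have hXb : X ^ 2 ≤ B / 2 * N := by
    have : 0 < B * N := by positivity
    linarith
  have hEb : k * ‖E‖ ≤ B / 4 * N := by
    refine le_trans ?_ hsmall
    have h1 := mul_le_mul_of_nonneg_left hEc hk0
    have h6 : 0 ≤ (3 * k + A + d + 2 * q ^ 2 * c2 ^ 2) * (√N + τ * N) := by positivity
    rw [hc3]
    linarith
  -- rate
  have hfi := half_colSpace_sq_sub_le_unitNegLik_sub hMw hE hU L hN1 hB0 hA0.le hG hGl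
    (hX ▸ hXb) (hk ▸ hEb) (hk ▸ hNc)
  rw [hdiff, ← hk, ← hX, ← hc5] at hfi
  -- The whitened noise contains δ, but after division by N its square costs only a multiple of
  -- δ²/N, which large N absorbs into the gain from the variances.
  have hE2 : c5 * ‖E‖ ^ 2 / N ≤ δ ^ 2 / (32 * q ^ 2) + 2 * q ^ 2 * c5 * (τ ^ 2 * N) := by
    have h1 : ‖E‖ ^ 2 ≤ 2 * q ^ 2 * (δ ^ 2 + τ ^ 2 * N ^ 2) := by
      have := pow_le_pow_left₀ (norm_nonneg _) hEn' 2
      have e1 := mul_nonneg (sq_nonneg q) (sq_nonneg (δ - τ * N))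
      linarith
    have h2 : c5 * ‖E‖ ^ 2 / N ≤ c5 * (2 * q ^ 2 * (δ ^ 2 + τ ^ 2 * N ^ 2)) / N := by gcongr
    have h3 : c5 * (2 * q ^ 2 * (δ ^ 2 + τ ^ 2 * N ^ 2)) / N =
        2 * q ^ 2 * c5 / N * δ ^ 2 + 2 * q ^ 2 * c5 * (τ ^ 2 * N) := by field_simp
    have h4 : 2 * q ^ 2 * c5 / N ≤ 1 / (32 * q ^ 2) := by
      rw [div_le_div_iff₀ hN0 (by positivity)]
      linarith
    have h5 := mul_le_mul_of_nonneg_right h4 (sq_nonneg δ)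
    rw [h3] at h2
    have h6 : 1 / (32 * q ^ 2) * δ ^ 2 = δ ^ 2 / (32 * q ^ 2) := by ring
    linarith
  have hfin : X ^ 2 / 2 + δ ^ 2 / (16 * q ^ 2) ≤
      (8 * q ^ 2 * c2 ^ 2 + 2 * q ^ 2 * c5) * (τ ^ 2 * N) := by
    have e1 : δ ^ 2 / (16 * q ^ 2) = 2 * (δ ^ 2 / (32 * q ^ 2)) := by field_simp; ring
    have e2 : δ ^ 2 / (8 * q ^ 2) = 4 * (δ ^ 2 / (32 * q ^ 2)) := by field_simp; ring
    rw [e1]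
    rw [e2] at hB2
    linarith
  have hP : 0 ≤ (8 * q ^ 2 * c2 ^ 2 + 2 * q ^ 2 * c5) * (τ ^ 2 * N) := by positivity
  refine ⟨?_, U, L, hU, hL, ?_⟩
  · rw [hδ2]
    have h1 : δ ^ 2 / (16 * q ^ 2) ≤ (8 * q ^ 2 * c2 ^ 2 + 2 * q ^ 2 * c5) * (τ ^ 2 * N) := by
      have : 0 ≤ X ^ 2 / 2 := by positivity
      linarith
    rw [div_le_iff₀ (by positivity)] at h1
    linarith
  · rw [← hX]
    have h1 : X ^ 2 ≤ 2 * ((8 * q ^ 2 * c2 ^ 2 + 2 * q ^ 2 * c5) * (τ ^ 2 * N)) := by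
      have : 0 ≤ δ ^ 2 / (16 * q ^ 2) := by positivity
      linarith
    have hq2 := mul_le_mul_of_nonneg_right (one_le_pow₀ hq : 1 ≤ q ^ 2) hP
    linarith

/-! ### Projection of a block of variables on a fixed space, and rates for the blocks of ΓΓᵀ. -/

theorem diagonal_elim (v : κ → ℝ) (w : ν → ℝ) :
    Matrix.diagonal (Sum.elim v w) = Matrix.fromBlocks (Matrix.diagonal v) 0 0 (Matrix.diagonal w) :=
  (Matrix.fromBlocks_diagonal v w).symm

theorem whiten_elim_fromRows (v : κ → ℝ) (w : ν → ℝ) (A : Matrix κ n ℝ) (B : Matrix ν n ℝ) :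
    whiten (Sum.elim v w) (Matrix.fromRows A B) =
      Matrix.fromRows (whiten v A) (whiten w B) := by
  have : (fun i => (√(Sum.elim v w i))⁻¹) =
      Sum.elim (fun i => (√(v i))⁻¹) (fun i => (√(w i))⁻¹) := by
    ext i; cases i <;> rfl
  rw [whiten, this, diagonal_elim, Matrix.fromBlocks_mul_fromRows]
  simp [whiten]

/-- The linear map that keeps the variables in `κ` and projects the whitened variables in `ν` on
the columns of `U`. -/
noncomputable def compress (κ : Type*) [DecidableEq κ] (t : ν → ℝ) (U : Matrix ν n ℝ) : Matrix (κ ⊕ n) (κ ⊕ ν) ℝ :=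
  Matrix.fromBlocks 1 0 0 (whiten t U)ᵀ

/-- If part of the rows of the loadings vary only through the coordinates of their columns in a
fixed space, the likelihood depends on the data through the projection on this space. -/
theorem negLik_compress (M : Matrix (κ ⊕ ν) (κ ⊕ ν) ℝ) {t : ν → ℝ} (ht : ∀ i, 0 < t i)
    {U : Matrix ν n ℝ} (hU : Uᵀ * U = 1) :
    ∃ c : ℝ, ∀ (s : κ → ℝ) (A : Matrix κ n ℝ) (B : Matrix ν n ℝ) (L : Matrix n n ℝ),
      (∀ i, 0 < s i) → whiten t B = U * L →
      negLik M (Sum.elim s t) (Matrix.fromRows A B) = c +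
        negLik (compress κ t U * M * (compress κ t U)ᵀ) (Sum.elim s (fun _ => 1))
          (Matrix.fromRows A L) := by
  set V2 := Matrix.diagonal (fun i => (√(t i))⁻¹) with hV2
  refine ⟨∑ i, Real.log (t i) + (V2 * M.toBlocks₂₂ * V2).trace -
    (Uᵀ * (V2 * M.toBlocks₂₂ * V2) * U).trace, ?_⟩
  intro s A B L hs hB
  have hst : ∀ i, 0 < Sum.elim s t i := by rintro (i | i); exacts [hs i, ht i]
  have hs1 : ∀ i : κ ⊕ n, 0 < Sum.elim s (fun _ => (1 : ℝ)) i := by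
    rintro (i | i); exacts [hs i, one_pos]
  rw [negLik_eq hst, negLik_eq hs1]
  set V1 := Matrix.diagonal (fun i => (√(s i))⁻¹) with hV1
  have hD : Matrix.diagonal (fun i => (√(Sum.elim s t i))⁻¹) = Matrix.fromBlocks V1 0 0 V2 := by
    rw [hV1, hV2, ← diagonal_elim]; congr 1; ext i; cases i <;> rfl
  have hD1 : Matrix.diagonal (fun i : κ ⊕ n => (√(Sum.elim s (fun _ => (1 : ℝ)) i))⁻¹) =
      Matrix.fromBlocks V1 0 0 1 := by
    rw [hV1, ← Matrix.diagonal_one, ← diagonal_elim]; congr 1; ext i; cases i <;> simp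
  let Us : Matrix (κ ⊕ ν) (κ ⊕ n) ℝ := Matrix.fromBlocks 1 0 0 U
  have hUst : Usᵀ = Matrix.fromBlocks 1 0 0 Uᵀ := by
    simp [Us, Matrix.fromBlocks_transpose]
  have hUs : Usᵀ * Us = 1 := by
    rw [hUst]; simp [Us, Matrix.fromBlocks_multiply, hU]
  have hload : Matrix.fromBlocks V1 0 0 V2 * Matrix.fromRows A B =
      Us * (Matrix.fromBlocks V1 0 0 (1 : Matrix n n ℝ) * Matrix.fromRows A L) := by
    have hB' : V2 * B = U * L := hB
    simp [Us, Matrix.fromBlocks_mul_fromRows, hB']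
  rw [hD, hD1, hload, unitNegLik_orthonormal_mul _ hUs]
  have hUV : Usᵀ * Matrix.fromBlocks V1 0 0 V2 =
      (Matrix.fromBlocks V1 0 0 1 : Matrix (κ ⊕ n) (κ ⊕ n) ℝ) * compress κ t U := by
    rw [hUst]
    simp [compress, Matrix.fromBlocks_multiply, whiten, Matrix.transpose_mul, hV2]
  have hUV' : Matrix.fromBlocks V1 0 0 V2 * Us =
      (compress κ t U)ᵀ * (Matrix.fromBlocks V1 0 0 1 : Matrix (κ ⊕ n) (κ ⊕ n) ℝ) := by
    simp [compress, Us, Matrix.fromBlocks_transpose, Matrix.fromBlocks_multiply, whiten, hV2]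
  have hK : Usᵀ * (Matrix.fromBlocks V1 0 0 V2 * M * Matrix.fromBlocks V1 0 0 V2) * Us =
      (Matrix.fromBlocks V1 0 0 1 : Matrix (κ ⊕ n) (κ ⊕ n) ℝ) *
        (compress κ t U * M * (compress κ t U)ᵀ) * Matrix.fromBlocks V1 0 0 1 := by
    calc _ = (Usᵀ * Matrix.fromBlocks V1 0 0 V2) * M * (Matrix.fromBlocks V1 0 0 V2 * Us) := by
          simp only [Matrix.mul_assoc]
      _ = _ := by rw [hUV, hUV']; simp only [Matrix.mul_assoc]
  -- The traces over the block κ cancel. The constant therefore involves neither s nor the loadings,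
  -- and it disappears when two parameters are compared.
  have htr : (Matrix.fromBlocks V1 0 0 V2 * M * Matrix.fromBlocks V1 0 0 V2).trace -
      (Usᵀ * (Matrix.fromBlocks V1 0 0 V2 * M * Matrix.fromBlocks V1 0 0 V2) * Us).trace =
      (V2 * M.toBlocks₂₂ * V2).trace - (Uᵀ * (V2 * M.toBlocks₂₂ * V2) * U).trace := by
    rw [hUst]
    conv_lhs => rw [← Matrix.fromBlocks_toBlocks M]
    simp only [Us, Matrix.fromBlocks_multiply]
    simp [Matrix.trace, Fintype.sum_sum_type]
  rw [hK] at htr ⊢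
  rw [Fintype.sum_sum_type, Fintype.sum_sum_type]
  simp only [Sum.elim_inl, Sum.elim_inr, Real.log_one, Finset.sum_const_zero]
  linarith

/-- Precision in the compressed model: bounded on the coordinates in κ, but of order 1/c on the n
projected ones, whose signal has strength at least c. For the latter, the block of the inverse is 1
- gRgᵀ, which by cyclicity of the trace has the same trace as R(1 + Φ), where R is O(1/c). The two
scales decide how the blocks of noise are weighted. -/
theorem sum_inv_diag_blocks_le {q c : ℝ} {s : κ → ℝ} (hs : VarianceBound q s) (A : Matrix κ n ℝ)
    {g : Matrix n n ℝ} (hc : 0 < c) (hg : ∀ v, c * (v ⬝ᵥ v) ≤ v ⬝ᵥ (gᵀ * g) *ᵥ v) :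
    ∑ i : κ, (Matrix.diagonal (Sum.elim s (fun _ : n => (1 : ℝ))) +
      Matrix.fromRows A g * (Matrix.fromRows A g)ᵀ)⁻¹ (Sum.inl i) (Sum.inl i) ≤
        q * Fintype.card κ ∧
    ∑ j : n, (Matrix.diagonal (Sum.elim s (fun _ : n => (1 : ℝ))) +
      Matrix.fromRows A g * (Matrix.fromRows A g)ᵀ)⁻¹ (Sum.inr j) (Sum.inr j) ≤
        Fintype.card n / c * (√(Fintype.card n) + q * ‖A‖ ^ 2) := by
  have hs1 : ∀ i : κ ⊕ n, 0 < Sum.elim s (fun _ => (1 : ℝ)) i := by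
    rintro (i | i); exacts [hs.pos i, one_pos]
  rw [inv_diagonal_add hs1]
  set V1 := Matrix.diagonal (fun i => (s i)⁻¹) with hV1
  have hD : Matrix.diagonal (fun i => (Sum.elim s (fun _ : n => (1 : ℝ)) i)⁻¹) =
      Matrix.fromBlocks V1 0 0 1 := by
    rw [hV1, ← Matrix.diagonal_one, ← diagonal_elim]; congr 1; ext i; cases i <;> simp
  rw [hD]
  have hΦ : (Matrix.fromRows A g)ᵀ * (Matrix.fromBlocks V1 0 0 1 : Matrix (κ ⊕ n) (κ ⊕ n) ℝ) *
      Matrix.fromRows A g =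
      Aᵀ * V1 * A + gᵀ * g := by
    rw [Matrix.transpose_fromRows, Matrix.mul_assoc, Matrix.fromBlocks_mul_fromRows,
      Matrix.fromCols_mul_fromRows]
    simp [Matrix.mul_assoc]
  have hload : (Matrix.fromBlocks V1 0 0 1 : Matrix (κ ⊕ n) (κ ⊕ n) ℝ) * Matrix.fromRows A g =
      Matrix.fromRows (V1 * A) g := by
    simp [Matrix.fromBlocks_mul_fromRows]
  rw [hΦ, hload]
  set Φ := Aᵀ * V1 * A with hΦd
  have hΦp : Φ.PosSemidef := by
    have := posSemidef_congr (Matrix.PosSemidef.diagonal (d := fun i => (s i)⁻¹)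
      fun i => (inv_pos.2 (hs.pos i)).le) Aᵀ
    rwa [Matrix.transpose_transpose] at this
  have hΦt : Φᵀ = Φ := by simpa [Matrix.IsHermitian] using hΦp.isHermitian
  have hP : (1 + (Φ + gᵀ * g)).PosDef :=
    Matrix.PosDef.one.add_posSemidef (hΦp.add (posSemidef_transpose_mul_self g))
  have hl : ∀ v, c * (v ⬝ᵥ v) ≤ v ⬝ᵥ (1 + (Φ + gᵀ * g)) *ᵥ v := fun v => by
    refine one_add_lower (fun v => ?_) v
    rw [Matrix.add_mulVec, dotProduct_add]
    have := hΦp.dotProduct_mulVec_nonneg v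
    simp only [star_trivial] at this
    linarith [hg v]
  have hR : ‖(1 + (Φ + gᵀ * g))⁻¹‖ ≤ Fintype.card n / c :=
    norm_inv_le_of_lower (by simp [hΦt]) hc hl
  have hinv := Matrix.nonsing_inv_mul _ (posDef_isUnit_det hP)
  have hRp := hP.inv.posSemidef
  set R := (1 + (Φ + gᵀ * g))⁻¹
  have hblock : Matrix.fromRows (V1 * A) g * R * (Matrix.fromRows (V1 * A) g)ᵀ =
      Matrix.fromBlocks (V1 * A * R * (V1 * A)ᵀ) (V1 * A * R * gᵀ) (g * R * (V1 * A)ᵀ)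
        (g * R * gᵀ) := by
    rw [Matrix.transpose_fromRows, Matrix.fromRows_mul, Matrix.fromRows_mul_fromCols]
  rw [hblock]
  constructor
  · calc _ ≤ ∑ _i : κ, q := Finset.sum_le_sum fun i _ => by
          rw [Matrix.sub_apply, Matrix.fromBlocks_apply₁₁, Matrix.fromBlocks_apply₁₁, hV1,
            Matrix.diagonal_apply_eq]
          have h1 : 0 ≤ (V1 * A * R * (V1 * A)ᵀ) i i := (posSemidef_congr hRp _).diag_nonneg
          linarith [hs.inv_le i]
      _ = _ := by simp [mul_comm]
  · have h1 : ∑ j : n, (Matrix.fromBlocks V1 0 0 (1 : Matrix n n ℝ) -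
        Matrix.fromBlocks (V1 * A * R * (V1 * A)ᵀ) (V1 * A * R * gᵀ) (g * R * (V1 * A)ᵀ)
        (g * R * gᵀ)) (Sum.inr j) (Sum.inr j) = (R * (1 + Φ)).trace := by
      have h2 : R * (1 + Φ) = 1 - R * (gᵀ * g) := by
        rw [eq_sub_iff_add_eq, ← Matrix.mul_add, add_assoc, hinv]
      have h3 : (R * (gᵀ * g)).trace = (g * R * gᵀ).trace := by
        rw [← Matrix.mul_assoc, Matrix.trace_mul_comm, Matrix.mul_assoc]
      rw [h2, Matrix.trace_sub, h3, ← Matrix.trace_sub]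
      rfl
    rw [h1]
    refine (le_abs_self _).trans ((abs_trace_mul_le _ _).trans ?_)
    refine mul_le_mul hR ((norm_add_le _ _).trans (add_le_add ?_ ?_)) (norm_nonneg _)
      (by positivity)
    · exact norm_le_of_sq_le frobenius_one_sq.le
    · rw [hΦd, Matrix.mul_assoc]
      refine (Matrix.frobenius_norm_mul _ _).trans ?_
      rw [Matrix.frobenius_norm_transpose]
      have : ‖V1 * A‖ ≤ q * ‖A‖ := frobenius_diagonal_mul_le hs.q_pos.le (fun i => by
        rw [abs_of_pos (inv_pos.2 (hs.pos i))]; exact hs.inv_le i) A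
      calc _ ≤ ‖A‖ * (q * ‖A‖) := mul_le_mul_of_nonneg_left this (norm_nonneg _)
        _ = _ := by ring

theorem norm_sq_fromRows (A : Matrix κ n ℝ) (B : Matrix ν n ℝ) :
    ‖Matrix.fromRows A B‖ ^ 2 = ‖A‖ ^ 2 + ‖B‖ ^ 2 := by
  simp [frobenius_sq, Fintype.sum_sum_type]

theorem RegularLoading.snd {a b N : ℝ} {A : Matrix κ n ℝ} {B : Matrix ν n ℝ}
    (h : RegularLoading a b N (Matrix.fromRows A B)) (hN : 2 * a * Fintype.card κ / b ≤ N) :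
    RegularLoading a (b / 2) N B ∧ ‖A‖ ^ 2 ≤ a * Fintype.card κ := by
  have hA : ‖A‖ ^ 2 ≤ a * Fintype.card κ := by
    rw [frobenius_sq]
    calc ∑ i, ∑ j, A i j ^ 2 ≤ ∑ _i : κ, a := Finset.sum_le_sum fun i _ => by
          simpa [dotProduct, sq] using h.row_le (Sum.inl i)
      _ = _ := by simp [mul_comm]
  have hb := h.b_pos
  refine ⟨⟨h.a_pos, half_pos h.b_pos, h.N_pos, ?_, fun i => ?_, fun v => ?_⟩, hA⟩
  · refine le_trans ?_ h.card_le
    rw [Fintype.card_sum]; push_cast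
    linarith [(Nat.cast_nonneg (Fintype.card κ) : (0 : ℝ) ≤ _)]
  · exact h.row_le (Sum.inr i)
  · have h1 := h.lower v
    rw [Matrix.fromRows_mulVec, sumElim_dotProduct_sumElim] at h1
    have h2 := (mulVec_sq_le A v).trans
      (mul_le_mul_of_nonneg_right hA (dotProduct_self_nonneg' v))
    have h3 : a * Fintype.card κ ≤ b / 2 * N := by
      rw [div_le_iff₀ hb] at hN; linarith
    have h4 := mul_le_mul_of_nonneg_right h3 (dotProduct_self_nonneg' v)
    simp only [dotProduct] at h1 h2 h4 ⊢
    linarith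

theorem norm_fromBlocks_congr_le (Y1 : Matrix m κ ℝ) (Y2 : Matrix m ν ℝ) (A : Matrix κ κ ℝ)
    (B : Matrix κ ν ℝ) (D : Matrix ν ν ℝ) :
    ‖Matrix.fromCols Y1 Y2 * Matrix.fromBlocks A B Bᵀ D * (Matrix.fromCols Y1 Y2)ᵀ‖ ≤
      ‖Y1‖ ^ 2 * ‖A‖ + 2 * (‖Y1‖ * ‖Y2‖ * ‖B‖) + ‖Y2‖ ^ 2 * ‖D‖ := by
  have h : Matrix.fromCols Y1 Y2 * Matrix.fromBlocks A B Bᵀ D * (Matrix.fromCols Y1 Y2)ᵀ =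
      Y1 * A * Y1ᵀ + Y2 * Bᵀ * Y1ᵀ + (Y1 * B * Y2ᵀ + Y2 * D * Y2ᵀ) := by
    rw [Matrix.fromCols_mul_fromBlocks, Matrix.transpose_fromCols, Matrix.fromCols_mul_fromRows]
    simp only [Matrix.add_mul]
  rw [h]
  have h1 := frobenius_mul_three Y1 A Y1ᵀ
  have h2 := frobenius_mul_three Y2 Bᵀ Y1ᵀ
  have h3 := frobenius_mul_three Y1 B Y2ᵀ
  have h4 := frobenius_mul_three Y2 D Y2ᵀ
  simp only [Matrix.frobenius_norm_transpose] at h1 h2 h3 h4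
  have h5 := norm_add_le (Y1 * A * Y1ᵀ + Y2 * Bᵀ * Y1ᵀ) (Y1 * B * Y2ᵀ + Y2 * D * Y2ᵀ)
  have h6 := norm_add_le (Y1 * A * Y1ᵀ) (Y2 * Bᵀ * Y1ᵀ)
  have h7 := norm_add_le (Y1 * B * Y2ᵀ) (Y2 * D * Y2ᵀ)
  linarith

/-- Stability of the likelihood of two blocks of variables of different scales. -/
theorem block_sub_le_of_negLik_le {q c ε f₁ f₂ y₁ y₂ : ℝ} {s t : κ → ℝ} (hs : VarianceBound q s)
    (ht : VarianceBound q t) (A Δ : Matrix κ n ℝ) {g L : Matrix n n ℝ} (hc : 0 < c)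
    (hg : ∀ v, c * (v ⬝ᵥ v) ≤ v ⬝ᵥ (gᵀ * g) *ᵥ v) {M E : Matrix (κ ⊕ n) (κ ⊕ n) ℝ}
    {E11 : Matrix κ κ ℝ} {E12 : Matrix κ n ℝ} {E22 : Matrix n n ℝ}
    (hE : E = Matrix.fromBlocks E11 E12 E12ᵀ E22)
    (hM : M = Matrix.diagonal (Sum.elim s (fun _ => 1)) +
      Matrix.fromRows A g * (Matrix.fromRows A g)ᵀ + E)
    (hy₁ : √(q * Fintype.card κ) ≤ y₁)
    (hy₂ : √(Fintype.card n / c * (√(Fintype.card n) + q * ‖A‖ ^ 2)) ≤ y₂)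
    (hf₁ : √(q * Fintype.card κ + ‖A‖ ^ 2) ≤ f₁) (hf₂ : √(Fintype.card n + ‖g‖ ^ 2) ≤ f₂)
    (hε : y₁ ^ 2 * ‖E11‖ + 2 * (y₁ * y₂ * ‖E12‖) + y₂ ^ 2 * ‖E22‖ ≤ ε) (hε' : ε ≤ 1 / 16)
    (hlik : negLik M (Sum.elim t (fun _ => 1)) (Matrix.fromRows Δ L) ≤
      negLik M (Sum.elim s (fun _ => 1)) (Matrix.fromRows A g)) :
    ‖L * Δᵀ - g * Aᵀ‖ ≤ f₂ * (8 * ε) * f₁ ∧ ‖L * Lᵀ - g * gᵀ‖ ≤ f₂ * (8 * ε) * f₂ := by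
  have hs1 : ∀ i : κ ⊕ n, 0 < Sum.elim s (fun _ => (1 : ℝ)) i := by
    rintro (i | i); exacts [hs.pos i, one_pos]
  have ht1 : ∀ i : κ ⊕ n, 0 < Sum.elim t (fun _ => (1 : ℝ)) i := by
    rintro (i | i); exacts [ht.pos i, one_pos]
  obtain ⟨hI1, hI2⟩ := sum_inv_diag_blocks_le hs A hc hg
  have hSp := posDef_diagonal_add hs1 (Matrix.fromRows A g)
  have hTp := posDef_diagonal_add ht1 (Matrix.fromRows Δ L)
  obtain ⟨F, hF⟩ := exists_eq_mul_transpose hSp.posSemidef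
  have hFu : IsUnit F.det := by
    have := posDef_isUnit_det hSp
    rw [hF, Matrix.det_mul] at this
    exact isUnit_of_mul_isUnit_left this
  have hFtu : IsUnit Fᵀ.det := by rwa [Matrix.det_transpose]
  have hY : (F * Fᵀ)⁻¹ = F⁻¹ᵀ * F⁻¹ := by
    rw [Matrix.mul_inv_rev, Matrix.transpose_nonsing_inv]
  rw [negLik, negLik, hF] at hlik
  rw [hF] at hM hI1 hI2
  set S := Matrix.diagonal (Sum.elim t (fun _ => 1)) +
    Matrix.fromRows Δ L * (Matrix.fromRows Δ L)ᵀ with hSd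
  set Y := F⁻¹
  have hYc : Y = Matrix.fromCols Y.toCols₁ Y.toCols₂ := (Matrix.fromCols_toCols Y).symm
  -- As (FFᵀ)⁻¹ = YᵀY, the diagonal of the inverse covariance gives the column norms of Y. In the
  -- same way the diagonal of FFᵀ gives the row norms of F below.
  have hn1 : ‖Y.toCols₁‖ ^ 2 ≤ q * Fintype.card κ := by
    refine le_trans (le_of_eq ?_) hI1
    rw [hY, frobenius_sq, Finset.sum_comm]
    refine Finset.sum_congr rfl fun i _ => ?_
    rw [Matrix.mul_apply]
    exact Finset.sum_congr rfl fun j _ => sq _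
  have hn2 : ‖Y.toCols₂‖ ^ 2 ≤ Fintype.card n / c * (√(Fintype.card n) + q * ‖A‖ ^ 2) := by
    refine le_trans (le_of_eq ?_) hI2
    rw [hY, frobenius_sq, Finset.sum_comm]
    refine Finset.sum_congr rfl fun i _ => ?_
    rw [Matrix.mul_apply]
    exact Finset.sum_congr rfl fun j _ => sq _
  have hn1' := (norm_le_of_sq_le hn1).trans hy₁
  have hn2' := (norm_le_of_sq_le hn2).trans hy₂
  have hEb : ‖Y * (M - F * Fᵀ) * Yᵀ‖ ≤ ε := by
    have : M - F * Fᵀ = Matrix.fromBlocks E11 E12 E12ᵀ E22 := by rw [hM, ← hE]; abel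
    rw [this, hYc]
    refine (norm_fromBlocks_congr_le _ _ _ _ _).trans (le_trans ?_ hε)
    have := (norm_nonneg _).trans hn1'
    have := (norm_nonneg _).trans hn2'
    gcongr
  have hst := norm_sub_one_le_of_likelihood_le hFu hTp hEb hε' hlik
  set Z := Y * S * Yᵀ - 1 with hZ
  have hS : S = F * Fᵀ + F * Z * Fᵀ := by
    have h1 : F * (Y * S * Yᵀ) * Fᵀ = S := by
      calc F * (Y * S * Yᵀ) * Fᵀ = (F * Y) * S * (Yᵀ * Fᵀ) := by simp only [Matrix.mul_assoc]
        _ = S := by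
          rw [← Matrix.transpose_mul, Matrix.mul_nonsing_inv _ hFu]; simp
    rw [hZ, Matrix.mul_sub, Matrix.sub_mul, h1, Matrix.mul_one]; abel
  have hFr : F = Matrix.fromRows F.toRows₁ F.toRows₂ := (Matrix.fromRows_toRows F).symm
  have hFZ : F * Z * Fᵀ = Matrix.fromBlocks (F.toRows₁ * Z * F.toRows₁ᵀ) (F.toRows₁ * Z * F.toRows₂ᵀ)
      (F.toRows₂ * Z * F.toRows₁ᵀ) (F.toRows₂ * Z * F.toRows₂ᵀ) := by
    conv_lhs => rw [hFr]
    rw [Matrix.transpose_fromRows, Matrix.fromRows_mul, Matrix.fromRows_mul_fromCols]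
  have hblk : ∀ (v : κ → ℝ) (w : n → ℝ) (B : Matrix κ n ℝ) (l : Matrix n n ℝ),
      Matrix.diagonal (Sum.elim v w) + Matrix.fromRows B l * (Matrix.fromRows B l)ᵀ =
      Matrix.fromBlocks (Matrix.diagonal v + B * Bᵀ) (B * lᵀ) (l * Bᵀ)
        (Matrix.diagonal w + l * lᵀ) := by
    intro v w B l
    rw [diagonal_elim, Matrix.transpose_fromRows, Matrix.fromRows_mul_fromCols,
      Matrix.fromBlocks_add]
    simp
  rw [hFZ, ← hF, hSd, hblk, hblk, Matrix.fromBlocks_add, Matrix.fromBlocks_inj] at hS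
  -- The upper left block is discarded: it contains the variances t besides ΔΔᵀ. The product of the
  -- first rows is recovered from the other blocks later.
  obtain ⟨-, -, hS3, hS4⟩ := hS
  rw [hblk] at hF
  have hm1 : ‖F.toRows₁‖ ^ 2 ≤ q * Fintype.card κ + ‖A‖ ^ 2 := by
    have h1 : ‖F.toRows₁‖ ^ 2 = ∑ i : κ, (F * Fᵀ) (Sum.inl i) (Sum.inl i) := by
      rw [frobenius_sq]
      refine Finset.sum_congr rfl fun i _ => ?_
      rw [Matrix.mul_apply]
      exact Finset.sum_congr rfl fun j _ => sq _
    rw [h1, ← hF, frobenius_sq_eq_trace', Matrix.trace]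
    simp only [Matrix.fromBlocks_apply₁₁, Matrix.add_apply, Matrix.diagonal_apply_eq,
      Finset.sum_add_distrib, Matrix.diag_apply]
    refine add_le_add ?_ le_rfl
    calc _ ≤ ∑ _i : κ, q := Finset.sum_le_sum fun i _ => hs.upper i
      _ = _ := by simp [mul_comm]
  have hm2 : ‖F.toRows₂‖ ^ 2 ≤ Fintype.card n + ‖g‖ ^ 2 := by
    have h1 : ‖F.toRows₂‖ ^ 2 = ∑ i : n, (F * Fᵀ) (Sum.inr i) (Sum.inr i) := by
      rw [frobenius_sq]
      refine Finset.sum_congr rfl fun i _ => ?_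
      rw [Matrix.mul_apply]
      exact Finset.sum_congr rfl fun j _ => sq _
    rw [h1, ← hF, frobenius_sq_eq_trace', Matrix.trace]
    simp only [Matrix.fromBlocks_apply₂₂, Matrix.add_apply, Matrix.diagonal_apply_eq,
      Finset.sum_add_distrib, Matrix.diag_apply]
    simp
  have hm1' := (norm_le_of_sq_le hm1).trans hf₁
  have hm2' := (norm_le_of_sq_le hm2).trans hf₂
  have hf10 := (norm_nonneg _).trans hm1'
  have hf20 := (norm_nonneg _).trans hm2'
  have hε0 := (norm_nonneg _).trans hEb
  constructor
  · have : L * Δᵀ - g * Aᵀ = F.toRows₂ * Z * F.toRows₁ᵀ := by rw [hS3]; abel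
    rw [this]
    refine (frobenius_mul_three _ _ _).trans ?_
    rw [Matrix.frobenius_norm_transpose]
    gcongr
  · have : L * Lᵀ - g * gᵀ = F.toRows₂ * Z * F.toRows₂ᵀ := by
      have := add_left_cancel (hS4.trans (add_assoc _ _ _))
      rw [this]; abel
    rw [this]
    refine (frobenius_mul_three _ _ _).trans ?_
    rw [Matrix.frobenius_norm_transpose]
    gcongr

theorem norm_transpose_inv_mul_sub_le {A A₀ : Matrix n n ℝ} {B B₀ : Matrix n κ ℝ}
    (hA : IsUnit A.det) (hA₀ : IsUnit A₀.det) {i e β φ : ℝ} (h1 : ‖A⁻¹‖ ≤ i) (h2 : ‖A₀⁻¹‖ ≤ i)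
    (h3 : ‖A - A₀‖ ≤ e) (h4 : ‖B‖ ≤ β) (h5 : ‖B₀‖ ≤ β) (h6 : ‖B - B₀‖ ≤ φ) :
    ‖Bᵀ * A⁻¹ * B - B₀ᵀ * A₀⁻¹ * B₀‖ ≤ 2 * (φ * i * β) + β * (i * e * i) * β := by
  have h : Bᵀ * A⁻¹ * B - B₀ᵀ * A₀⁻¹ * B₀ =
      (B - B₀)ᵀ * A⁻¹ * B + B₀ᵀ * A⁻¹ * (B - B₀) + B₀ᵀ * (A⁻¹ - A₀⁻¹) * B₀ := by
    rw [Matrix.transpose_sub]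
    simp only [Matrix.sub_mul, Matrix.mul_sub]; abel
  rw [h]
  have hi := (norm_nonneg _).trans h1
  have hβ := (norm_nonneg _).trans h4
  have hφ := (norm_nonneg _).trans h6
  have he := (norm_nonneg _).trans h3
  have k1 : ‖(B - B₀)ᵀ * A⁻¹ * B‖ ≤ φ * i * β := by
    refine (frobenius_mul_three _ _ _).trans ?_
    rw [Matrix.frobenius_norm_transpose]; gcongr
  have k2 : ‖B₀ᵀ * A⁻¹ * (B - B₀)‖ ≤ β * i * φ := by
    refine (frobenius_mul_three _ _ _).trans ?_
    rw [Matrix.frobenius_norm_transpose]; gcongr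
  have k3 : ‖B₀ᵀ * (A⁻¹ - A₀⁻¹) * B₀‖ ≤ β * (i * e * i) * β := by
    refine (frobenius_mul_three _ _ _).trans ?_
    rw [Matrix.frobenius_norm_transpose]
    have : ‖A⁻¹ - A₀⁻¹‖ ≤ i * e * i := (norm_resolvent_sub_le hA hA₀).trans (by gcongr)
    gcongr
  refine (norm_add_le _ _).trans ((add_le_add (norm_add_le _ _) le_rfl).trans ?_)
  linarith [mul_comm (β * i) φ, mul_assoc φ i β, mul_comm β i]

theorem diagonal_sqrt_mul_whiten {t : ν → ℝ} (ht : ∀ i, 0 < t i) (A : Matrix ν n ℝ) :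
    Matrix.diagonal (fun i => √(t i)) * whiten t A = A := by
  rw [whiten, ← Matrix.mul_assoc, Matrix.diagonal_mul_diagonal]
  have : (fun i => √(t i) * (√(t i))⁻¹) = fun _ => 1 := by
    ext i; exact mul_inv_cancel₀ (Real.sqrt_pos.2 (ht i)).ne'
  rw [this, Matrix.diagonal_one, Matrix.one_mul]

theorem whiten_diagonal_sqrt_mul {t : ν → ℝ} (ht : ∀ i, 0 < t i) (A : Matrix ν n ℝ) :
    whiten t (Matrix.diagonal (fun i => √(t i)) * A) = A := by
  rw [whiten, ← Matrix.mul_assoc, Matrix.diagonal_mul_diagonal]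
  have : (fun i => (√(t i))⁻¹ * √(t i)) = fun _ => 1 := by
    ext i; exact inv_mul_cancel₀ (Real.sqrt_pos.2 (ht i)).ne'
  rw [this, Matrix.diagonal_one, Matrix.one_mul]

theorem VarianceBound.abs_sqrt_le {q : ℝ} {s : ι → ℝ} (h : VarianceBound q s) (i : ι) :
    |√(s i)| ≤ √q := by
  rw [abs_of_nonneg (Real.sqrt_nonneg _)]
  exact Real.sqrt_le_sqrt (h.upper i)

/-- The compressed data matrix is close to the covariance matrix of the compressed model. -/
theorem compress_data {q : ℝ} {s₁ : κ → ℝ} {s₂ t₂ : ν → ℝ} (ht : VarianceBound q t₂)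
    {Γ₁ : Matrix κ n ℝ} {Γ₂ : Matrix ν n ℝ} {W11 : Matrix κ κ ℝ} {W12 : Matrix κ ν ℝ}
    {W22 : Matrix ν ν ℝ} {M : Matrix (κ ⊕ ν) (κ ⊕ ν) ℝ}
    (hM : M = Matrix.diagonal (Sum.elim s₁ s₂) +
      Matrix.fromRows Γ₁ Γ₂ * (Matrix.fromRows Γ₁ Γ₂)ᵀ + Matrix.fromBlocks W11 W12 W12ᵀ W22)
    {U : Matrix ν n ℝ} (hU : Uᵀ * U = 1) :
    ∃ (E12 : Matrix κ n ℝ) (E22 : Matrix n n ℝ),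
      compress κ t₂ U * M * (compress κ t₂ U)ᵀ = Matrix.diagonal (Sum.elim s₁ (fun _ => 1)) +
        Matrix.fromRows Γ₁ (Uᵀ * whiten t₂ Γ₂) * (Matrix.fromRows Γ₁ (Uᵀ * whiten t₂ Γ₂))ᵀ +
        Matrix.fromBlocks W11 E12 E12ᵀ E22 ∧
      ‖E12‖ ≤ ‖W12‖ * √(q * Fintype.card n) ∧
      ‖E22‖ ≤ q * Fintype.card n * (√(∑ i, (t₂ i - s₂ i) ^ 2) + ‖W22‖) := by
  set P := whiten t₂ U with hP
  have hPn : ‖P‖ ≤ √(q * Fintype.card n) := by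
    refine (ht.norm_whiten_le U).trans (le_of_eq ?_)
    rw [Real.sqrt_mul ht.q_pos.le, ← frobenius_sq_of_orthonormal hU,
      Real.sqrt_sq (norm_nonneg _)]
  have hPΓ : Pᵀ * Γ₂ = Uᵀ * whiten t₂ Γ₂ := by
    simp [hP, whiten, Matrix.transpose_mul, Matrix.mul_assoc]
  have hPt : Pᵀ * Matrix.diagonal t₂ * P = 1 := by
    have : Matrix.diagonal t₂ = Matrix.diagonal (fun i => √(t₂ i)) *
        Matrix.diagonal (fun i => √(t₂ i)) := by
      rw [Matrix.diagonal_mul_diagonal]; congr 1; ext i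
      exact (Real.mul_self_sqrt (ht.pos i).le).symm
    have h2 : Matrix.diagonal (fun i => √(t₂ i)) * P = U := diagonal_sqrt_mul_whiten ht.pos U
    calc Pᵀ * Matrix.diagonal t₂ * P = (Matrix.diagonal (fun i => √(t₂ i)) * P)ᵀ *
          (Matrix.diagonal (fun i => √(t₂ i)) * P) := by
            rw [this, Matrix.transpose_mul, Matrix.diagonal_transpose]
            simp only [Matrix.mul_assoc]
      _ = 1 := by rw [h2, hU]
  refine ⟨W12 * P, Pᵀ * (Matrix.diagonal (fun i => s₂ i - t₂ i) + W22) * P, ?_, ?_, ?_⟩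
  · have hc : (compress κ t₂ U)ᵀ = Matrix.fromBlocks 1 0 0 P := by
      simp [compress, Matrix.fromBlocks_transpose, hP]
    have hst : Matrix.diagonal (fun i => s₂ i - t₂ i) =
        Matrix.diagonal s₂ - Matrix.diagonal t₂ := (Matrix.diagonal_sub _ _).symm
    have h22 : Pᵀ * (Matrix.diagonal s₂ + Γ₂ * Γ₂ᵀ + W22) * P = 1 +
        Uᵀ * whiten t₂ Γ₂ * (Uᵀ * whiten t₂ Γ₂)ᵀ +
        Pᵀ * (Matrix.diagonal (fun i => s₂ i - t₂ i) + W22) * P := by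
      rw [hst, ← hPΓ, Matrix.transpose_mul, Matrix.transpose_transpose, ← hPt]
      simp only [Matrix.mul_add, Matrix.add_mul, Matrix.mul_sub, Matrix.sub_mul, Matrix.mul_assoc]
      abel
    rw [hc, hM, compress, diagonal_elim, diagonal_elim, Matrix.transpose_fromRows,
      Matrix.transpose_fromRows, Matrix.fromRows_mul_fromCols, Matrix.fromRows_mul_fromCols]
    simp only [Matrix.fromBlocks_add, Matrix.fromBlocks_multiply, ← hP]
    rw [Matrix.fromBlocks_inj]
    refine ⟨by simp, ?_, ?_, ?_⟩
    · simp only [Matrix.one_mul, Matrix.zero_mul, Matrix.mul_zero, zero_add, add_zero, ← hPΓ,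
        Matrix.transpose_mul, Matrix.transpose_transpose, Matrix.add_mul, Matrix.mul_assoc]
    · simp only [Matrix.mul_one, Matrix.zero_mul, Matrix.mul_zero, zero_add, add_zero, ← hPΓ,
        Matrix.transpose_mul, Matrix.mul_add, Matrix.mul_assoc]
    · simp only [Matrix.zero_mul, Matrix.mul_zero, zero_add, h22]
      rw [Matrix.diagonal_one]
  · exact (Matrix.frobenius_norm_mul _ _).trans (mul_le_mul_of_nonneg_left hPn (norm_nonneg _))
  · refine (frobenius_mul_three _ _ _).trans ?_
    rw [Matrix.frobenius_norm_transpose]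
    have h1 : ‖Matrix.diagonal (fun i => s₂ i - t₂ i) + W22‖ ≤
        √(∑ i, (t₂ i - s₂ i) ^ 2) + ‖W22‖ := by
      refine (norm_add_le _ _).trans (add_le_add (norm_le_of_sq_le ?_) le_rfl)
      rw [frobenius_diagonal_sq]
      exact Finset.sum_le_sum fun i _ => (by ring_nf; rfl)
    have h2 : q * Fintype.card n = √(q * Fintype.card n) * √(q * Fintype.card n) :=
      (Real.mul_self_sqrt (mul_nonneg ht.q_pos.le (Nat.cast_nonneg _))).symm
    rw [h2]
    calc _ ≤ √(q * Fintype.card n) * (√(∑ i, (t₂ i - s₂ i) ^ 2) + ‖W22‖) *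
          √(q * Fintype.card n) := by gcongr
      _ = _ := by ring

theorem norm_orthonormal_mul {U : Matrix ι m ℝ} (hU : Uᵀ * U = 1) (A : Matrix m n ℝ) :
    ‖U * A‖ = ‖A‖ := by
  have h : ‖U * A‖ ^ 2 = ‖A‖ ^ 2 := by
    rw [frobenius_sq_eq_trace, frobenius_sq_eq_trace, Matrix.transpose_mul, Matrix.mul_assoc,
      ← Matrix.mul_assoc Uᵀ, hU, Matrix.one_mul]
  exact (sq_eq_sq₀ (norm_nonneg _) (norm_nonneg _)).1 h

/-- Restricting to the rows in `ν`: the column space of the restricted estimate still nearly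
contains that of the restricted loadings. -/
theorem exists_colSpace_snd (hn : Fintype.card n ≤ Fintype.card ν) {t₁ : κ → ℝ} {t₂ : ν → ℝ}
    {Γ₁ Δ₁ : Matrix κ n ℝ} {Γ₂ Δ₂ : Matrix ν n ℝ} {U : Matrix (κ ⊕ ν) n ℝ} {L : Matrix n n ℝ}
    (hUL : whiten (Sum.elim t₁ t₂) (Matrix.fromRows Δ₁ Δ₂) = U * L) {d : ℝ}
    (hd : ‖whiten (Sum.elim t₁ t₂) (Matrix.fromRows Γ₁ Γ₂) -
      U * (Uᵀ * whiten (Sum.elim t₁ t₂) (Matrix.fromRows Γ₁ Γ₂))‖ ^ 2 ≤ d) :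
    ∃ (U₂ : Matrix ν n ℝ) (L₂ : Matrix n n ℝ), U₂ᵀ * U₂ = 1 ∧ whiten t₂ Δ₂ = U₂ * L₂ ∧
      ‖whiten t₂ Γ₂ - U₂ * (U₂ᵀ * whiten t₂ Γ₂)‖ ^ 2 ≤ d := by
  obtain ⟨U₂, R, hU₂, hR⟩ := exists_orthonormal_mul hn U.toRows₂
  refine ⟨U₂, R * L, hU₂, ?_, ?_⟩
  · have hUr : U = Matrix.fromRows U.toRows₁ U.toRows₂ := (Matrix.fromRows_toRows U).symm
    rw [whiten_elim_fromRows, hUr, Matrix.fromRows_mul] at hUL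
    rw [(Matrix.fromRows_inj hUL).2, hR, Matrix.mul_assoc]
  · set Y := Uᵀ * whiten (Sum.elim t₁ t₂) (Matrix.fromRows Γ₁ Γ₂)
    refine le_trans ?_ hd
    have h1 : whiten (Sum.elim t₁ t₂) (Matrix.fromRows Γ₁ Γ₂) - U * Y =
        Matrix.fromRows (whiten t₁ Γ₁ - U.toRows₁ * Y) (whiten t₂ Γ₂ - U₂ * (R * Y)) := by
      rw [whiten_elim_fromRows]
      conv_lhs => rw [← Matrix.fromRows_toRows U]
      rw [Matrix.fromRows_mul, hR, Matrix.mul_assoc U₂ R Y]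
      ext (i | i) j <;> rfl
    rw [h1, norm_sq_fromRows]
    -- U₂(RY) lies in the column space of U₂, and no element of that space is closer to the whitened
    -- Γ₂ than the projection.
    set B := whiten t₂ Γ₂ - U₂ * (R * Y) with hB
    have h2 : whiten t₂ Γ₂ - U₂ * (U₂ᵀ * whiten t₂ Γ₂) = B - U₂ * (U₂ᵀ * B) := by
      rw [hB, Matrix.mul_sub, ← Matrix.mul_assoc U₂ᵀ U₂, hU₂, Matrix.one_mul, Matrix.mul_sub]; abel
    rw [h2]
    have := (norm_sq_proj hU₂ B).1
    linarith [sq_nonneg ‖U₂ᵀ * B‖, sq_nonneg ‖whiten t₁ Γ₁ - U.toRows₁ * Y‖]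

theorem norm_inv_transpose_le_of_lower {A : Matrix n n ℝ} {c : ℝ} (hc : 0 < c)
    {g : Matrix n n ℝ} (hA : A = g * gᵀ)
    (h : ∀ v, c * (v ⬝ᵥ v) ≤ v ⬝ᵥ A *ᵥ v) : ‖A⁻¹‖ ≤ Fintype.card n / c ∧ IsUnit A.det ∧
      IsUnit g.det := by
  have hAt : Aᵀ = A := by rw [hA, Matrix.transpose_mul, Matrix.transpose_transpose]
  have hu := posDef_isUnit_det (posDef_of_lower hAt hc h)
  refine ⟨norm_inv_le_of_lower hAt hc h, hu, ?_⟩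
  rw [hA, Matrix.det_mul] at hu
  exact isUnit_of_mul_isUnit_left hu

/-- The product AAᵀ is a function of gAᵀ and ggᵀ alone. The first rows thus have a computable
product although the variances spoil their own block of the covariance. -/
theorem transpose_mul_inv_mul {g : Matrix n n ℝ} (hg : IsUnit g.det) (A : Matrix κ n ℝ) :
    (g * Aᵀ)ᵀ * (g * gᵀ)⁻¹ * (g * Aᵀ) = A * Aᵀ := by
  have hgt : IsUnit gᵀ.det := by rwa [Matrix.det_transpose]
  rw [Matrix.mul_inv_rev, Matrix.transpose_mul, Matrix.transpose_transpose]
  calc A * gᵀ * (gᵀ⁻¹ * g⁻¹) * (g * Aᵀ) = A * (gᵀ * gᵀ⁻¹) * (g⁻¹ * g) * Aᵀ := by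
        simp only [Matrix.mul_assoc]
    _ = A * Aᵀ := by
        rw [Matrix.mul_nonsing_inv _ hgt, Matrix.nonsing_inv_mul _ hg]; simp

/-- From the compressed parameters back to the products of the loadings. -/
theorem cross_products_sub_le {q w τ c₁ c₂ x γ a₁ : ℝ} {t : ν → ℝ} (ht : VarianceBound q t)
    {Γ₁ Δ₁ : Matrix κ n ℝ} {Γ₂ Δ₂ : Matrix ν n ℝ} {U : Matrix ν n ℝ} {L : Matrix n n ℝ}
    (hU : Uᵀ * U = 1) (hL : whiten t Δ₂ = U * L)
    (h1 : ‖L * Δ₁ᵀ - Uᵀ * whiten t Γ₂ * Γ₁ᵀ‖ ≤ c₁ * (τ * w))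
    (h2 : ‖L * Lᵀ - Uᵀ * whiten t Γ₂ * (Uᵀ * whiten t Γ₂)ᵀ‖ ≤ c₂ * (τ * (w * w)))
    (hx : ‖whiten t Γ₂ - U * (Uᵀ * whiten t Γ₂)‖ ≤ x * (τ * w))
    (hγ : ‖whiten t Γ₂‖ ≤ γ * w) (ha : ‖Γ₁‖ ≤ a₁) :
    ‖Δ₂ * Δ₁ᵀ - Γ₂ * Γ₁ᵀ‖ ≤ √q * (c₁ + x * a₁) * (τ * w) ∧
    ‖Δ₂ * Δ₂ᵀ - Γ₂ * Γ₂ᵀ‖ ≤ q * (c₂ + 2 * (γ * x)) * (τ * (w * w)) := by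
  set G := whiten t Γ₂ with hG
  set g := Uᵀ * G with hg
  set X := G - U * g with hX
  set D := Matrix.diagonal (fun i => √(t i)) with hD
  have hΔ : Δ₂ = D * (U * L) := by rw [← hL, hD, diagonal_sqrt_mul_whiten ht.pos]
  have hΓ : Γ₂ = D * G := by rw [hG, hD, diagonal_sqrt_mul_whiten ht.pos]
  have hγ0 := (norm_nonneg _).trans hγ
  have hx0 := (norm_nonneg _).trans hx
  have hq0 := Real.sqrt_nonneg q
  have hgn : ‖U * g‖ ≤ γ * w := by
    rw [norm_orthonormal_mul hU]
    refine le_trans ?_ hγ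
    refine (sq_le_sq₀ (norm_nonneg _) (norm_nonneg _)).1 ?_
    linarith [(norm_sq_proj hU G).1, sq_nonneg ‖G - U * (Uᵀ * G)‖]
  have e1 : Δ₂ * Δ₁ᵀ - Γ₂ * Γ₁ᵀ = D * (U * (L * Δ₁ᵀ - g * Γ₁ᵀ) - X * Γ₁ᵀ) := by
    rw [hX, hΔ, hΓ]
    simp only [Matrix.sub_mul, Matrix.mul_sub, Matrix.mul_assoc]; abel
  have e2 : Δ₂ * Δ₂ᵀ - Γ₂ * Γ₂ᵀ =
      D * ((U * (L * Lᵀ - g * gᵀ) * Uᵀ - U * g * Xᵀ - X * Gᵀ) * D) := by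
    have h3 : G = U * g + X := by rw [hX]; abel
    have h4 : G * Gᵀ = U * (g * gᵀ) * Uᵀ + U * g * Xᵀ + X * Gᵀ := by
      conv_lhs => rw [h3]
      rw [Matrix.transpose_add, Matrix.mul_add, Matrix.add_mul, Matrix.add_mul]
      conv_rhs => rw [h3]
      simp only [Matrix.transpose_add, Matrix.transpose_mul, Matrix.mul_add, Matrix.mul_assoc]
      abel
    rw [hΔ, hΓ, Matrix.transpose_mul, Matrix.transpose_mul D G, hD, Matrix.diagonal_transpose, ← hD]
    have h5 : U * (L * Lᵀ - g * gᵀ) * Uᵀ - U * g * Xᵀ - X * Gᵀ =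
        U * L * (U * L)ᵀ - G * Gᵀ := by
      rw [h4, Matrix.transpose_mul U L]
      simp only [Matrix.mul_sub, Matrix.sub_mul, Matrix.mul_assoc]; abel
    rw [h5]
    simp only [Matrix.mul_sub, Matrix.sub_mul, Matrix.mul_assoc]
  constructor
  · rw [e1]
    refine (frobenius_diagonal_mul_le hq0 ht.abs_sqrt_le _).trans ?_
    rw [mul_assoc]
    refine mul_le_mul_of_nonneg_left ((norm_sub_le _ _).trans ?_) hq0
    rw [norm_orthonormal_mul hU]
    have : ‖X * Γ₁ᵀ‖ ≤ x * (τ * w) * a₁ := by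
      refine (Matrix.frobenius_norm_mul _ _).trans ?_
      rw [Matrix.frobenius_norm_transpose]; gcongr
    linarith
  · rw [e2]
    refine (frobenius_diagonal_mul_le hq0 ht.abs_sqrt_le _).trans ?_
    have h6 := frobenius_mul_diagonal_le hq0 ht.abs_sqrt_le
      (U * (L * Lᵀ - g * gᵀ) * Uᵀ - U * g * Xᵀ - X * Gᵀ)
    have h7 : ‖U * (L * Lᵀ - g * gᵀ) * Uᵀ - U * g * Xᵀ - X * Gᵀ‖ ≤
        (c₂ + 2 * (γ * x)) * (τ * (w * w)) := by
      refine (norm_sub_le _ _).trans ((add_le_add (norm_sub_le _ _) le_rfl).trans ?_)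
      have h8 : ‖U * (L * Lᵀ - g * gᵀ) * Uᵀ‖ ≤ c₂ * (τ * (w * w)) := by
        rw [← Matrix.frobenius_norm_transpose, Matrix.transpose_mul, Matrix.transpose_transpose,
          norm_orthonormal_mul hU, Matrix.frobenius_norm_transpose, norm_orthonormal_mul hU]
        exact h2
      have h9 : ‖U * g * Xᵀ‖ ≤ γ * w * (x * (τ * w)) := by
        refine (Matrix.frobenius_norm_mul _ _).trans ?_
        rw [Matrix.frobenius_norm_transpose]; gcongr
      have h10 : ‖X * Gᵀ‖ ≤ x * (τ * w) * (γ * w) := by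
        refine (Matrix.frobenius_norm_mul _ _).trans ?_
        rw [Matrix.frobenius_norm_transpose]; gcongr
      linarith
    have h11 : √q * √q = q := Real.mul_self_sqrt ht.q_pos.le
    calc _ ≤ √q * (√q * ((c₂ + 2 * (γ * x)) * (τ * (w * w)))) :=
          mul_le_mul_of_nonneg_left (h6.trans (mul_le_mul_of_nonneg_left h7 hq0)) hq0
      _ = _ := by rw [← mul_assoc, h11]; ring

/-- The product is written as (LΔ₁ᵀ)ᵀ(LLᵀ)⁻¹(LΔ₁ᵀ), and likewise for the truth, and the three
factors are perturbed. Here ggᵀ is at least lw², and the smallness of τ keeps half of this for LLᵀ;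
the powers of w cancel and an error of order τ is left. -/
theorem fst_products_sub_le {w τ c₁ c₂ γ a₁ l : ℝ} (hw : 0 < w) (hl : 0 < l) (hτ : τ ≤ 1)
    (hc₁ : 0 ≤ c₁)
    {Γ₁ Δ₁ : Matrix κ n ℝ} {g L : Matrix n n ℝ}
    (h1 : ‖L * Δ₁ᵀ - g * Γ₁ᵀ‖ ≤ c₁ * (τ * w)) (h2 : ‖L * Lᵀ - g * gᵀ‖ ≤ c₂ * (τ * (w * w)))
    (hγ : ‖g‖ ≤ γ * w) (ha : ‖Γ₁‖ ≤ a₁) (hcτ : c₂ * τ ≤ l / 2)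
    (hg : ∀ v, l * (w * w) * (v ⬝ᵥ v) ≤ v ⬝ᵥ (gᵀ * g) *ᵥ v) :
    ‖Δ₁ * Δ₁ᵀ - Γ₁ * Γ₁ᵀ‖ ≤ (4 * Fintype.card n * c₁ * (γ * a₁ + c₁) / l +
      4 * Fintype.card n ^ 2 * (γ * a₁ + c₁) ^ 2 * c₂ / l ^ 2) * τ := by
  have hlw : 0 < l * (w * w) := by positivity
  have hg' := lower_mul_transpose_of_lower hlw hg
  have hL' : ∀ v, l / 2 * (w * w) * (v ⬝ᵥ v) ≤ v ⬝ᵥ (L * Lᵀ) *ᵥ v := fun v => by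
    have h3 := add_lower hg' h2 v
    rw [add_sub_cancel] at h3
    refine le_trans (mul_le_mul_of_nonneg_right ?_ (dotProduct_self_nonneg' v)) h3
    have := mul_le_mul_of_nonneg_right hcτ (mul_pos hw hw).le
    linarith
  have hg2 : ∀ v, l / 2 * (w * w) * (v ⬝ᵥ v) ≤ v ⬝ᵥ (g * gᵀ) *ᵥ v := fun v =>
    le_trans (mul_le_mul_of_nonneg_right (by linarith) (dotProduct_self_nonneg' v)) (hg' v)
  have hl2 : 0 < l / 2 * (w * w) := by positivity
  obtain ⟨i1, u1, v1⟩ := norm_inv_transpose_le_of_lower hl2 rfl hL'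
  obtain ⟨i2, u2, v2⟩ := norm_inv_transpose_le_of_lower hl2 rfl hg2
  have hγ0 := (norm_nonneg _).trans hγ
  have ha0 := (norm_nonneg _).trans ha
  have hB0 : ‖g * Γ₁ᵀ‖ ≤ γ * w * a₁ := by
    refine (Matrix.frobenius_norm_mul _ _).trans ?_
    rw [Matrix.frobenius_norm_transpose]; gcongr
  have hcw : 0 ≤ c₁ * w := by positivity
  have hB : ‖L * Δ₁ᵀ‖ ≤ (γ * a₁ + c₁) * w := by
    have := norm_sub_norm_le (L * Δ₁ᵀ) (g * Γ₁ᵀ)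
    have h4 : c₁ * (τ * w) ≤ c₁ * w := by nlinarith
    linarith
  have h := norm_transpose_inv_mul_sub_le u1 u2 i1 i2 h2 hB (hB0.trans (by linarith)) h1
  rw [transpose_mul_inv_mul v1, transpose_mul_inv_mul v2] at h
  refine h.trans (le_of_eq ?_)
  field_simp
  ring

set_option maxHeartbeats 1000000 in
/-- Convergence rates of the blocks of `Γ Γᵀ` for an estimate whose likelihood exceeds that of all
parameters with the same `Γ₁`. -/
theorem exists_block_rate (n κ : Type) [Fintype n] [DecidableEq n] [Fintype κ] [DecidableEq κ]
    (a b q d η : ℝ) (hb : 0 < b) (hq : 1 ≤ q) (hd : 0 < d) (hη : 0 < η) :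
    ∃ c τ₀ N₀ : ℝ, 0 < c ∧ 0 < τ₀ ∧ ∀ (ν : Type) [Fintype ν] [DecidableEq ν] (N τ : ℝ)
      (s₁ t₁ : κ → ℝ) (s₂ t₂ : ν → ℝ) (Γ₁ Δ₁ : Matrix κ n ℝ) (Γ₂ Δ₂ : Matrix ν n ℝ)
      (W11 : Matrix κ κ ℝ) (W12 : Matrix κ ν ℝ) (W22 : Matrix ν ν ℝ)
      (M : Matrix (κ ⊕ ν) (κ ⊕ ν) ℝ),
      RegularLoading a b N (Matrix.fromRows Γ₁ Γ₂) → VarianceBound q (Sum.elim s₁ s₂) →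
      VarianceBound q (Sum.elim t₁ t₂) → Fintype.card n ≤ Fintype.card ν →
      M = Matrix.diagonal (Sum.elim s₁ s₂) +
        Matrix.fromRows Γ₁ Γ₂ * (Matrix.fromRows Γ₁ Γ₂)ᵀ + Matrix.fromBlocks W11 W12 W12ᵀ W22 →
      ‖W11‖ ≤ τ → ‖W12‖ ≤ τ * √N → ‖W22‖ ≤ τ * N →
      ∑ i, (t₂ i - s₂ i) ^ 2 ≤ d * (τ ^ 2 * N) →
      (∃ (U : Matrix (κ ⊕ ν) n ℝ) (L : Matrix n n ℝ), Uᵀ * U = 1 ∧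
        whiten (Sum.elim t₁ t₂) (Matrix.fromRows Δ₁ Δ₂) = U * L ∧
        ‖whiten (Sum.elim t₁ t₂) (Matrix.fromRows Γ₁ Γ₂) -
          U * (Uᵀ * whiten (Sum.elim t₁ t₂) (Matrix.fromRows Γ₁ Γ₂))‖ ^ 2 ≤ d * (τ ^ 2 * N)) →
      (∀ Γ' : Matrix ν n ℝ, ‖Γ' - Γ₂‖ ^ 2 ≤ η * N →
        negLik M (Sum.elim t₁ t₂) (Matrix.fromRows Δ₁ Δ₂) ≤
          negLik M (Sum.elim s₁ t₂) (Matrix.fromRows Γ₁ Γ')) →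
      N₀ ≤ N → τ ≤ τ₀ →
      ‖Δ₁ * Δ₁ᵀ - Γ₁ * Γ₁ᵀ‖ ≤ c * τ ∧ ‖Δ₂ * Δ₁ᵀ - Γ₂ * Γ₁ᵀ‖ ≤ c * (τ * √N) ∧
      ‖Δ₂ * Δ₂ᵀ - Γ₂ * Γ₂ᵀ‖ ≤ c * (τ * N) := by
  by_cases ha : 0 < a
  swap
  · exact ⟨1, 1, 0, one_pos, one_pos, fun ν _ _ N τ s₁ t₁ s₂ t₂ Γ₁ Δ₁ Γ₂ Δ₂ W11 W12 W22 M h =>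
      absurd h.a_pos ha⟩
  have hq0 : 0 < q := by linarith
  obtain ⟨k, hk⟩ : ∃ k : ℝ, k = Fintype.card κ := ⟨_, rfl⟩
  obtain ⟨p, hp⟩ : ∃ p : ℝ, p = Fintype.card n := ⟨_, rfl⟩
  have hk0 : 0 ≤ k := hk ▸ Nat.cast_nonneg _
  have hp0 : 0 ≤ p := hp ▸ Nat.cast_nonneg _
  obtain ⟨l, hl⟩ : ∃ l : ℝ, l = b / (4 * q) := ⟨_, rfl⟩
  have hl0 : 0 < l := by rw [hl]; positivity
  obtain ⟨K, hK⟩ : ∃ K : ℝ, K = p / l * (√p + q * (a * k)) := ⟨_, rfl⟩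
  have hK0 : 0 ≤ K := by rw [hK]; positivity
  obtain ⟨e, he⟩ : ∃ e : ℝ, e = q * k + 2 * (√(q * k) * √K * √(q * p)) +
    K * (q * p * (√d + 1)) := ⟨_, rfl⟩
  have he0 : 0 ≤ e := by rw [he]; positivity
  obtain ⟨c₁, hc₁⟩ : ∃ c₁ : ℝ, c₁ = √(p + q * a) * (8 * e) * √(q * k + a * k) := ⟨_, rfl⟩
  obtain ⟨c₂, hc₂⟩ : ∃ c₂ : ℝ, c₂ = (p + q * a) * (8 * e) := ⟨_, rfl⟩
  have hc₁0 : 0 ≤ c₁ := by rw [hc₁]; positivity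
  have hc₂0 : 0 ≤ c₂ := by rw [hc₂]; positivity
  obtain ⟨d₁, hd₁⟩ : ∃ d₁ : ℝ, d₁ = 4 * p * c₁ * (√(q * a) * √(a * k) + c₁) / l +
      4 * p ^ 2 * (√(q * a) * √(a * k) + c₁) ^ 2 * c₂ / l ^ 2 := ⟨_, rfl⟩
  obtain ⟨d₂, hd₂⟩ : ∃ d₂ : ℝ, d₂ = √q * (c₁ + √d * √(a * k)) := ⟨_, rfl⟩
  obtain ⟨d₃, hd₃⟩ : ∃ d₃ : ℝ, d₃ = q * (c₂ + 2 * (√(q * a) * √d)) := ⟨_, rfl⟩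
  have hd₁0 : 0 ≤ d₁ := by rw [hd₁]; positivity
  have hd₂0 : 0 ≤ d₂ := by rw [hd₂]; positivity
  have hd₃0 : 0 ≤ d₃ := by rw [hd₃]; positivity
  -- Each summand encodes one smallness condition, so that the single inequality τX ≤ 1 implies them
  -- all.
  obtain ⟨X, hX⟩ : ∃ X : ℝ, X = 16 * e + d / l + q * d / η + 2 * c₂ / l + 1 := ⟨_, rfl⟩
  have hX0 : 0 < X := by rw [hX]; positivity
  refine ⟨d₁ + d₂ + d₃ + 1, 1 / X, max 1 (2 * a * k / b), by positivity, by positivity, ?_⟩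
  intro ν _ _ N τ s₁ t₁ s₂ t₂ Γ₁ Δ₁ Γ₂ Δ₂ W11 W12 W22 M hreg hs ht hcard hM hW1 hW2 hW3 hvar hcol
    hcomp hN hτ
  have hN1 : 1 ≤ N := (le_max_left _ _).trans hN
  have hτ0 : 0 ≤ τ := (norm_nonneg _).trans hW1
  have hτX : τ * X ≤ 1 := by rwa [le_div_iff₀ hX0] at hτ
  have g1 : 0 ≤ d / l := by positivity
  have g2 : 0 ≤ q * d / η := by positivity
  have g3 : 0 ≤ 2 * c₂ / l := by positivity
  have hsum : 16 * e * τ + d / l * τ + q * d / η * τ + 2 * c₂ / l * τ + τ ≤ 1 := by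
    rw [hX] at hτX; linarith
  have m0 : 0 ≤ 16 * e * τ := by positivity
  have m1 := mul_nonneg g1 hτ0
  have m2 := mul_nonneg g2 hτ0
  have m3 := mul_nonneg g3 hτ0
  have hτe : 16 * e * τ ≤ 1 := by linarith
  have hτ1 : τ ≤ 1 := by linarith
  have hτc : 2 * c₂ / l * τ ≤ 1 := by linarith
  have hτ2 : τ ^ 2 ≤ τ := by rw [sq]; exact mul_le_of_le_one_left hτ0 hτ1
  have hτd : d / l * τ ^ 2 ≤ 1 := (mul_le_mul_of_nonneg_left hτ2 g1).trans (by linarith)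
  have hτη : q * d / η * τ ^ 2 ≤ 1 := (mul_le_mul_of_nonneg_left hτ2 g2).trans (by linarith)
  obtain ⟨w, hw⟩ : ∃ w, w = √N := ⟨_, rfl⟩
  have hwN : w * w = N := by rw [hw]; exact Real.mul_self_sqrt (by linarith)
  have hw1 : 1 ≤ w := by rw [hw]; exact Real.one_le_sqrt.2 hN1
  have hw0 : 0 < w := by linarith
  obtain ⟨hreg2, hΓ₁⟩ := hreg.snd (by rw [← hk]; exact (le_max_right _ _).trans hN)
  rw [← hk] at hΓ₁
  have hs₁ : VarianceBound q s₁ := ⟨hq, fun i => hs.lower (Sum.inl i), fun i => hs.upper (Sum.inl i)⟩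
  have ht₁ : VarianceBound q t₁ := ⟨hq, fun i => ht.lower (Sum.inl i), fun i => ht.upper (Sum.inl i)⟩
  have ht₂ : VarianceBound q t₂ := ⟨hq, fun i => ht.lower (Sum.inr i), fun i => ht.upper (Sum.inr i)⟩
  obtain ⟨U', L', -, hUL', hx'⟩ := hcol
  obtain ⟨U, L, hU, hL, hx⟩ := exists_colSpace_snd hcard hUL' hx'
  have hGn : ‖whiten t₂ Γ₂‖ ≤ √(q * a) * w := by
    refine (ht₂.norm_whiten_le _).trans ?_
    rw [Real.sqrt_mul hq0.le, mul_assoc, hw, ← Real.sqrt_mul ha.le]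
    exact mul_le_mul_of_nonneg_left (norm_le_of_sq_le hreg2.norm_sq_le) (Real.sqrt_nonneg _)
  have hGl : ∀ v, 2 * l * N * (v ⬝ᵥ v) ≤ v ⬝ᵥ ((whiten t₂ Γ₂)ᵀ * whiten t₂ Γ₂) *ᵥ v := fun v => by
    rw [whiten_transpose_mul ht₂.pos]
    refine le_trans (le_of_eq ?_) (hreg2.weighted_lower ht₂ v)
    rw [hl]; field_simp; ring
  set G := whiten t₂ Γ₂ with hG
  set g := Uᵀ * G with hg
  have hgl : ∀ v, l * (w * w) * (v ⬝ᵥ v) ≤ v ⬝ᵥ (gᵀ * g) *ᵥ v := fun v => by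
    refine le_trans (mul_le_mul_of_nonneg_right ?_ (dotProduct_self_nonneg' v))
      (proj_lower hU hGl hx v)
    have : d * τ ^ 2 ≤ l := by
      rw [div_mul_eq_mul_div, div_le_iff₀ hl0] at hτd; linarith
    have := mul_le_mul_of_nonneg_right this (zero_le_one.trans hN1)
    rw [hwN]; linarith
  have hgn : ‖g‖ ≤ √(q * a) * w := by
    refine le_trans ?_ hGn
    refine (sq_le_sq₀ (norm_nonneg _) (norm_nonneg _)).1 ?_
    linarith [(norm_sq_proj hU G).1, sq_nonneg ‖G - U * (Uᵀ * G)‖]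
  have hxn : ‖G - U * g‖ ≤ √d * (τ * w) := by
    refine (norm_le_of_sq_le hx).trans (le_of_eq ?_)
    rw [Real.sqrt_mul hd.le, Real.sqrt_mul (sq_nonneg _), Real.sqrt_sq hτ0, hw]
  have hΓ₁n : ‖Γ₁‖ ≤ √(a * k) := norm_le_of_sq_le hΓ₁
  -- the competitor
  have hlik := hcomp (Matrix.diagonal (fun i => √(t₂ i)) * (U * g)) (by
    have h1 : Matrix.diagonal (fun i => √(t₂ i)) * (U * g) - Γ₂ =
        -(Matrix.diagonal (fun i => √(t₂ i)) * (G - U * g)) := by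
      rw [Matrix.mul_sub, hG, diagonal_sqrt_mul_whiten ht₂.pos]; abel
    rw [h1, norm_neg]
    have h2 := frobenius_diagonal_mul_le (Real.sqrt_nonneg q) ht₂.abs_sqrt_le (G - U * g)
    have h3 : (√q * ‖G - U * g‖) ^ 2 ≤ q * (d * (τ ^ 2 * N)) := by
      rw [mul_pow, Real.sq_sqrt hq0.le]; gcongr
    have h4 : q * d * τ ^ 2 ≤ η := by
      rw [div_mul_eq_mul_div, div_le_iff₀ hη] at hτη; linarith
    calc _ ≤ (√q * ‖G - U * g‖) ^ 2 := by gcongr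
      _ ≤ _ := h3
      _ = q * d * τ ^ 2 * N := by ring
      _ ≤ _ := by gcongr)
  -- The estimate and the competitor have the same variances on ν and whitened rows there in the
  -- span of U, so the constant is common to both and cancels.
  obtain ⟨c0, hc0⟩ := negLik_compress (κ := κ) M ht₂.pos hU
  rw [hc0 t₁ Δ₁ Δ₂ L ht₁.pos hL, hc0 s₁ Γ₁ _ g hs₁.pos (whiten_diagonal_sqrt_mul ht₂.pos _)] at hlik
  have hlik := le_of_add_le_add_left hlik
  obtain ⟨E12, E22, hMc, hE12, hE22⟩ := compress_data ht₂ hM hU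
  rw [← hG, ← hg] at hMc
  rw [← hp] at hE12 hE22
  have hE12' : ‖E12‖ ≤ √(q * p) * (τ * w) := by
    refine hE12.trans ?_
    rw [mul_comm, hw]
    exact mul_le_mul_of_nonneg_left hW2 (Real.sqrt_nonneg _)
  have hE22' : ‖E22‖ ≤ q * p * (√d + 1) * (τ * (w * w)) := by
    refine hE22.trans ?_
    rw [mul_assoc (q * p) (√d + 1)]
    have hqp : 0 ≤ q * p := by positivity
    refine mul_le_mul_of_nonneg_left ?_ hqp
    have h1 : √(∑ i, (t₂ i - s₂ i) ^ 2) ≤ √d * (τ * w) := by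
      refine (Real.sqrt_le_sqrt hvar).trans (le_of_eq ?_)
      rw [Real.sqrt_mul hd.le, Real.sqrt_mul (sq_nonneg _), Real.sqrt_sq hτ0, hw]
    have h2 : √d * (τ * w) ≤ √d * (τ * (w * w)) := by
      gcongr; exact le_mul_of_one_le_left (by positivity) hw1
    rw [← hwN] at hW3
    linarith
  have hlw : 0 < l * (w * w) := by positivity
  -- The blocks of noise are of order τ, τw and τw² with w = √N. The inverse root of the covariance
  -- is of order 1 on κ and 1/w on the projected coordinates, so the standardized noise is of order
  -- τ in every block.
  obtain ⟨r1, r2⟩ := block_sub_le_of_negLik_le (q := q) (c := l * (w * w)) (ε := e * τ)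
    (f₁ := √(q * k + a * k)) (f₂ := √(p + q * a) * w) (y₁ := √(q * k)) (y₂ := √K / w)
    hs₁ ht₁ Γ₁ Δ₁ hlw hgl rfl hMc (by rw [hk]) (by
      rw [← hp]
      have h1 : √K / w = √(K / (w * w)) := by
        rw [Real.sqrt_div hK0, Real.sqrt_mul_self hw0.le]
      rw [h1]
      apply Real.sqrt_le_sqrt
      calc p / (l * (w * w)) * (√p + q * ‖Γ₁‖ ^ 2) ≤
          p / (l * (w * w)) * (√p + q * (a * k)) := by gcongr
        _ = K / (w * w) := by rw [hK]; field_simp) (by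
      rw [← hk]; apply Real.sqrt_le_sqrt; linarith) (by
      rw [← hp]
      have h1 : √(p + q * a) * w = √((p + q * a) * (w * w)) := by
        rw [Real.sqrt_mul (by positivity), Real.sqrt_mul_self hw0.le]
      rw [h1]
      apply Real.sqrt_le_sqrt
      have h2 : ‖g‖ ^ 2 ≤ (√(q * a) * w) ^ 2 := by gcongr
      rw [mul_pow, Real.sq_sqrt (by positivity), sq w, hwN] at h2
      have h3 := mul_le_mul_of_nonneg_left hN1 hp0
      rw [hwN]; linarith) (by
      have h1 : √(q * k) ^ 2 = q * k := Real.sq_sqrt (by positivity)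
      have h2 : √K ^ 2 = K := Real.sq_sqrt hK0
      calc _ ≤ √(q * k) ^ 2 * τ + 2 * (√(q * k) * (√K / w) * (√(q * p) * (τ * w))) +
            (√K / w) ^ 2 * (q * p * (√d + 1) * (τ * (w * w))) := by gcongr
        _ = e * τ := by
          rw [div_pow, h1, h2, he]; field_simp) (by linarith) hlik
  have r1' : ‖L * Δ₁ᵀ - g * Γ₁ᵀ‖ ≤ c₁ * (τ * w) := r1.trans (le_of_eq (by rw [hc₁]; ring))
  have r2' : ‖L * Lᵀ - g * gᵀ‖ ≤ c₂ * (τ * (w * w)) := by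
    refine r2.trans (le_of_eq ?_)
    have : √(p + q * a) * √(p + q * a) = p + q * a := Real.mul_self_sqrt (by positivity)
    calc √(p + q * a) * w * (8 * (e * τ)) * (√(p + q * a) * w) =
          √(p + q * a) * √(p + q * a) * (8 * e) * (τ * (w * w)) := by ring
      _ = _ := by rw [this, hc₂]
  have f1 := fst_products_sub_le hw0 hl0 hτ1 hc₁0 r1' r2' hgn hΓ₁n (by
    rw [div_mul_eq_mul_div, div_le_iff₀ hl0] at hτc; linarith) hgl
  obtain ⟨f2, f3⟩ := cross_products_sub_le ht₂ hU hL r1' r2' hxn hGn hΓ₁n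
  rw [← hp, ← hd₁] at f1
  rw [← hd₂, hw] at f2
  rw [← hd₃, hwN] at f3
  refine ⟨f1.trans ?_, f2.trans ?_, f3.trans ?_⟩
  · gcongr; linarith
  · gcongr; linarith
  · gcongr; linarith

/-! ### Identification by diagonal second moments with separated entries (IC2, IC3). -/

theorem strictMono_fin_eq {r : ℕ} {π : Fin r → Fin r} (h : StrictMono π) (i : Fin r) : π i = i := by
  have hs : Function.Surjective π := Finite.injective_iff_surjective.1 h.injective
  have := Subsingleton.elim (h.orderIsoOfSurjective π hs) (OrderIso.refl _)
  exact congrArg (fun e : Fin r ≃o Fin r => e i) this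

/-- If `R` approximately intertwines two decreasing diagonal matrices, of which one has
well separated entries, then their entries are close. -/
theorem abs_sub_le_of_intertwine {r : ℕ} {R E : Matrix (Fin r) (Fin r) ℝ} {D₀ D : Fin r → ℝ}
    {δ ρ : ℝ} (hρ : 0 < ρ) (h : R * Matrix.diagonal D = Matrix.diagonal D₀ * R + E)
    (hR : ∀ i, ρ ≤ (R * Rᵀ) i i) (hD₀ : ∀ i j, i < j → D₀ j + δ ≤ D₀ i) (hD : Antitone D)
    {ε : ℝ} (hε : √(r / ρ) * ‖E‖ ≤ ε) (hδ : 2 * ε < δ) (i : Fin r) : |D i - D₀ i| ≤ ε := by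
  have hent : ∀ i j, R i j * (D j - D₀ i) = E i j := fun i j => by
    have := congrFun (congrFun h i) j
    rw [Matrix.mul_diagonal, Matrix.add_apply, Matrix.diagonal_mul] at this
    linarith
  have hsq : ∀ i, (R * Rᵀ) i i = ∑ j, R i j ^ 2 := fun i => by
    rw [Matrix.mul_apply]; exact Finset.sum_congr rfl fun j _ => (sq _).symm
  have hex : ∀ i, ∃ j, |D j - D₀ i| ≤ ε := by
    intro i
    have hr : 0 < (r : ℝ) := by exact_mod_cast i.pos
    -- Row i has squared length at least ρ, hence an entry that is not small. As that entry times D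
    -- j - D₀ i is small, D j must be near D₀ i.
    obtain ⟨j, hj⟩ : ∃ j, ρ / r ≤ R i j ^ 2 := by
      by_contra! hcon
      have h1 : ∑ j, R i j ^ 2 < ∑ _j : Fin r, ρ / r :=
        Finset.sum_lt_sum_of_nonempty ⟨i, Finset.mem_univ _⟩ fun j _ => hcon j
      rw [← hsq] at h1
      have h2 : ∑ _j : Fin r, ρ / r = ρ := by simp; field_simp
      linarith [hR i]
    refine ⟨j, le_trans ?_ hε⟩
    have h3 : |R i j| * |D j - D₀ i| ≤ ‖E‖ := by
      rw [← abs_mul, hent]; exact abs_entry_le_frobenius E i j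
    have h4 : 1 ≤ √(r / ρ) * |R i j| := by
      rw [← Real.sqrt_sq_eq_abs, ← Real.sqrt_mul (by positivity), Real.one_le_sqrt]
      calc (1 : ℝ) = r / ρ * (ρ / r) := by field_simp
        _ ≤ _ := by gcongr
    calc |D j - D₀ i| = 1 * |D j - D₀ i| := (one_mul _).symm
      _ ≤ √(r / ρ) * |R i j| * |D j - D₀ i| := by gcongr
      _ = √(r / ρ) * (|R i j| * |D j - D₀ i|) := by ring
      _ ≤ _ := by gcongr
  choose π hπ using hex
  -- The entries of D₀ are more than 2ε apart and D is decreasing, so the matching respects the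
  -- order; a strictly increasing map of Fin r to itself is the identity.
  have hmono : StrictMono π := by
    intro i j hij
    by_contra! hcon
    have h1 := hD hcon
    have h2 := abs_le.1 (hπ i)
    have h3 := abs_le.1 (hπ j)
    linarith [hD₀ i j hij]
  have := hπ i
  rwa [strictMono_fin_eq hmono] at this

/-- An approximately intertwining matrix is approximately diagonal. -/
theorem exists_sign_of_intertwine {r : ℕ} {R E : Matrix (Fin r) (Fin r) ℝ} {D₀ D : Fin r → ℝ}
    {δ l ε φ : ℝ} (hl : 0 < l) (hδ : 0 < δ)
    (h : R * Matrix.diagonal D = Matrix.diagonal D₀ * R + E)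
    (hR : ∀ i, |(R * Rᵀ) i i - D₀ i ^ 2| ≤ φ) (hD₀ : ∀ i j, i < j → D₀ j + δ ≤ D₀ i)
    (hl₀ : ∀ i, l ≤ D₀ i) (hD : ∀ i, |D i - D₀ i| ≤ ε) (hε : 2 * ε ≤ δ) (hεl : 2 * ε ≤ l) :
    ∃ S : Fin r → ℝ, (∀ i, S i = 1 ∨ S i = -1) ∧ ∀ i j, |R i j - S i * (if i = j then D i else 0)| ≤
      2 / δ * ‖E‖ + 2 / l * (φ + ∑ _k : Fin r, (2 / δ * ‖E‖) ^ 2 + ε * (2 * |D₀ i| + ε)) := by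
  have hent : ∀ i j, R i j * (D j - D₀ i) = E i j := fun i j => by
    have := congrFun (congrFun h i) j
    rw [Matrix.mul_diagonal, Matrix.add_apply, Matrix.diagonal_mul] at this
    linarith
  have hsq : ∀ i, (R * Rᵀ) i i = ∑ j, R i j ^ 2 := fun i => by
    rw [Matrix.mul_apply]; exact Finset.sum_congr rfl fun j _ => (sq _).symm
  have hoff : ∀ i j, i ≠ j → |R i j| ≤ 2 / δ * ‖E‖ := by
    intro i j hij
    have h1 : δ / 2 ≤ |D j - D₀ i| := by
      have h2 := abs_le.1 (hD j)
      rcases lt_or_gt_of_ne hij with h3 | h3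
      · rw [le_abs]; right; linarith [hD₀ i j h3]
      · rw [le_abs]; left; linarith [hD₀ j i h3]
    have h2 : |R i j| * |D j - D₀ i| ≤ ‖E‖ := by
      rw [← abs_mul, hent]; exact abs_entry_le_frobenius E i j
    have h3 : |R i j| * (δ / 2) ≤ ‖E‖ := (by gcongr : _ ≤ _).trans h2
    rw [div_mul_eq_mul_div, le_div_iff₀ hδ]; linarith
  refine ⟨fun i => if 0 ≤ R i i then 1 else -1, fun i => ?_, fun i j => ?_⟩
  · dsimp only; split_ifs
    · exact Or.inl rfl
    · exact Or.inr rfl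
  have hε0 : 0 ≤ ε := (abs_nonneg _).trans (hD i)
  have hφ0 : 0 ≤ φ := (abs_nonneg _).trans (hR i)
  rcases eq_or_ne i j with rfl | hij
  swap
  · rw [if_neg hij, mul_zero, sub_zero]
    refine (hoff i j hij).trans (le_add_of_nonneg_right (by positivity))
  rw [if_pos rfl]
  refine le_trans ?_ (le_add_of_nonneg_left (by positivity))
  have hDi := abs_le.1 (hD i)
  have hDl : l / 2 ≤ D i := by linarith [hl₀ i]
  have hsum : |(R * Rᵀ) i i - R i i ^ 2| ≤ ∑ _k : Fin r, (2 / δ * ‖E‖) ^ 2 := by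
    rw [hsq, ← Finset.add_sum_erase _ _ (Finset.mem_univ i), add_sub_cancel_left,
      abs_of_nonneg (Finset.sum_nonneg fun _ _ => sq_nonneg _)]
    refine (Finset.sum_le_sum fun j hj => ?_).trans
      (Finset.sum_le_sum_of_subset_of_nonneg (Finset.erase_subset _ _) fun _ _ _ => sq_nonneg _)
    rw [← sq_abs]
    exact pow_le_pow_left₀ (abs_nonneg _) (hoff i j (Finset.ne_of_mem_erase hj).symm) 2
  have hDD : |D i ^ 2 - D₀ i ^ 2| ≤ ε * (2 * |D₀ i| + ε) := by
    have : D i ^ 2 - D₀ i ^ 2 = (D i - D₀ i) * (2 * D₀ i + (D i - D₀ i)) := by ring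
    rw [this, abs_mul]
    refine mul_le_mul (hD i) ((abs_add_le _ _).trans ?_) (abs_nonneg _) hε0
    rw [abs_mul, abs_two]; linarith [hD i]
  have hfin : |R i i ^ 2 - D i ^ 2| ≤
      φ + ∑ _k : Fin r, (2 / δ * ‖E‖) ^ 2 + ε * (2 * |D₀ i| + ε) := by
    have h1 := abs_le.1 (hR i)
    have h2 := abs_le.1 hsum
    have h3 := abs_le.1 hDD
    rw [abs_le]; constructor <;> linarith
  -- The squares are close by the row length and the smallness off the diagonal. With the sign of R
  -- i i chosen, the complementary factor of the difference of squares is at least D i ≥ l/2 in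
  -- size.
  have key : |R i i - (if 0 ≤ R i i then 1 else -1) * D i| * (l / 2) ≤ |R i i ^ 2 - D i ^ 2| := by
    split_ifs with hs
    · have : R i i ^ 2 - D i ^ 2 = (R i i - 1 * D i) * (R i i + D i) := by ring
      rw [this, abs_mul]
      refine mul_le_mul_of_nonneg_left ?_ (abs_nonneg _)
      rw [abs_of_nonneg (by linarith)]; linarith
    · have : R i i ^ 2 - D i ^ 2 = (R i i - -1 * D i) * (R i i - D i) := by ring
      rw [this, abs_mul]
      refine mul_le_mul_of_nonneg_left ?_ (abs_nonneg _)
      push Not at hs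
      rw [abs_of_nonpos (by linarith)]; linarith
  rw [div_mul_eq_mul_div, le_div_iff₀ hl]
  linarith

theorem norm_le_of_forall_abs_le {A : Matrix m n ℝ} {c : ℝ} (h : ∀ i j, |A i j| ≤ c) :
    ‖A‖ ≤ √(Fintype.card m * Fintype.card n * c ^ 2) := by
  refine norm_le_of_sq_le ?_
  rw [frobenius_sq]
  calc ∑ i, ∑ j, A i j ^ 2 ≤ ∑ _i : m, ∑ _j : n, c ^ 2 :=
        Finset.sum_le_sum fun i _ => Finset.sum_le_sum fun j _ => by
          rw [← sq_abs]; exact pow_le_pow_left₀ (abs_nonneg _) (h i j) 2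
    _ = _ := by simp; ring

theorem norm_mul_transpose_self (A : Matrix m n ℝ) : ‖A * Aᵀ‖ = ‖Aᵀ * A‖ := by
  refine (sq_eq_sq₀ (norm_nonneg _) (norm_nonneg _)).1 ?_
  rw [frobenius_sq_eq_trace, frobenius_sq_eq_trace]
  simp only [Matrix.transpose_mul, Matrix.transpose_transpose]
  rw [Matrix.mul_assoc, Matrix.trace_mul_comm]
  simp only [Matrix.mul_assoc]

theorem norm_transpose_mul_self_le (A : Matrix m n ℝ) : ‖A‖ ^ 2 ≤ √(Fintype.card n) * ‖Aᵀ * A‖ := by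
  rw [frobenius_sq_eq_trace]
  have := abs_trace_mul_le (1 : Matrix n n ℝ) (Aᵀ * A)
  rw [Matrix.one_mul] at this
  exact ((le_abs_self _).trans this).trans
    (mul_le_mul_of_nonneg_right (norm_le_of_sq_le frobenius_one_sq.le) (norm_nonneg _))

/-- A change of the weights in the second moments of the loadings. -/
theorem RegularLoading.weighted_sub_le {a b N q : ℝ} {Γ : Matrix ι n ℝ} {s t : ι → ℝ}
    (h : RegularLoading a b N Γ) (hs : VarianceBound q s) (ht : VarianceBound q t) :
    ‖Γᵀ * Matrix.diagonal (fun i => (t i)⁻¹) * Γ - Γᵀ * Matrix.diagonal (fun i => (s i)⁻¹) * Γ‖ ≤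
      a * q ^ 2 * √N * √(∑ i, (t i - s i) ^ 2) := by
  have h1 : Γᵀ * Matrix.diagonal (fun i => (t i)⁻¹) * Γ - Γᵀ * Matrix.diagonal (fun i => (s i)⁻¹) * Γ
      = Γᵀ * (Matrix.diagonal (fun i => (t i)⁻¹ - (s i)⁻¹) * Γ) := by
    rw [← Matrix.diagonal_sub]
    simp only [Matrix.sub_mul, Matrix.mul_sub, Matrix.mul_assoc]
  rw [h1]
  have ha := h.a_pos.le
  have h2 : ‖Γᵀ‖ ≤ √(a * N) := by
    rw [Matrix.frobenius_norm_transpose]; exact norm_le_of_sq_le h.norm_sq_le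
  have h3 : ‖Matrix.diagonal (fun i => (t i)⁻¹ - (s i)⁻¹) * Γ‖ ≤
      √(a * (q ^ 2) ^ 2 * ∑ i, (t i - s i) ^ 2) := by
    refine norm_le_of_sq_le ?_
    rw [frobenius_sq, Finset.mul_sum]
    refine Finset.sum_le_sum fun i _ => ?_
    simp only [Matrix.diagonal_mul, mul_pow]
    rw [← Finset.mul_sum]
    have h4 : ∑ j, Γ i j ^ 2 ≤ a := by
      refine le_trans (le_of_eq (Finset.sum_congr rfl fun j _ => sq _)) (h.row_le i)
    have h5 : ((t i)⁻¹ - (s i)⁻¹) ^ 2 ≤ (q ^ 2) ^ 2 * (t i - s i) ^ 2 := by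
      have := pow_le_pow_left₀ (abs_nonneg _) (ht.abs_inv_sub_le hs i) 2
      rwa [sq_abs, mul_pow, sq_abs] at this
    calc _ ≤ (q ^ 2) ^ 2 * (t i - s i) ^ 2 * a := by gcongr
      _ = _ := by ring
  refine (Matrix.frobenius_norm_mul _ _).trans ((mul_le_mul h2 h3 (norm_nonneg _)
    (Real.sqrt_nonneg _)).trans (le_of_eq ?_))
  rw [Real.sqrt_mul ha N, Real.sqrt_mul (by positivity : 0 ≤ a * (q ^ 2) ^ 2), Real.sqrt_mul ha,
    Real.sqrt_sq (by positivity)]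
  have : √a * √a = a := Real.mul_self_sqrt ha
  calc _ = (√a * √a) * q ^ 2 * √N * √(∑ i, (t i - s i) ^ 2) := by ring
    _ = _ := by rw [this]

/-- A sign reversal of a column changes the loadings by a nonvanishing amount. -/
theorem sign_eq_one {b N : ℝ} {Γ Δ : Matrix ι n ℝ}
    (hΓ : ∀ v, b * N * (v ⬝ᵥ v) ≤ (Γ *ᵥ v) ⬝ᵥ (Γ *ᵥ v)) {S : n → ℝ}
    (hd : ‖Δ - Γ * Matrix.diagonal S‖ * ‖Γ‖ < b * N) {k : n} (hS : S k = 1 ∨ S k = -1)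
    (hk : 0 ≤ ∑ i, Δ i k * Γ i k) : S k = 1 := by
  rcases hS with h1 | h1
  · exact h1
  exfalso
  have h2 : ∑ i, Δ i k * Γ i k = ∑ i, (Δ - Γ * Matrix.diagonal S) i k * Γ i k -
      ∑ i, Γ i k ^ 2 := by
    rw [← Finset.sum_sub_distrib]
    refine Finset.sum_congr rfl fun i _ => ?_
    rw [Matrix.sub_apply, Matrix.mul_diagonal, h1]; ring
  have h3 : b * N ≤ ∑ i, Γ i k ^ 2 := by
    have := hΓ (Pi.single k 1)
    simp only [Matrix.mulVec_single_one, single_one_dotProduct, Pi.single_eq_same, mul_one]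
      at this
    refine this.trans (le_of_eq (Finset.sum_congr rfl fun i _ => ?_))
    simp [Matrix.col_apply, sq]
  have hcol : ∀ A : Matrix ι n ℝ, √(∑ i, A i k ^ 2) ≤ ‖A‖ := fun A => by
    rw [← Real.sqrt_sq (norm_nonneg A), frobenius_sq]
    refine Real.sqrt_le_sqrt (Finset.sum_le_sum fun i _ => ?_)
    exact Finset.single_le_sum (f := fun j => A i j ^ 2) (fun j _ => sq_nonneg _) (Finset.mem_univ k)
  have h4 : ∑ i, (Δ - Γ * Matrix.diagonal S) i k * Γ i k ≤ ‖Δ - Γ * Matrix.diagonal S‖ * ‖Γ‖ :=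
    (le_abs_self _).trans ((abs_sum_mul_le _ _).trans
      (mul_le_mul (hcol _) (hcol _) (Real.sqrt_nonneg _) (norm_nonneg _)))
  linarith

set_option maxHeartbeats 1000000 in
/-- If `Γ Γᵀ` and `Δ Δᵀ` are close and the weighted second moments of the columns of `Γ` and `Δ`
are diagonal with decreasing entries, well separated for `Γ`, then the columns of `Γ` and `Δ` are
close, up to their signs. -/
theorem exists_diag_rate (r : ℕ) (a b q d δ : ℝ) (hb : 0 < b) (hq : 1 ≤ q)
    (hd : 0 < d) (hδ : 0 < δ) :
    ∃ c τ₀ : ℝ, 0 < c ∧ 0 < τ₀ ∧ ∀ (ι : Type) [Fintype ι] [DecidableEq ι] (N τ : ℝ)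
      (s t : ι → ℝ) (Γ Δ : Matrix ι (Fin r) ℝ) (D₀ D : Fin r → ℝ),
      RegularLoading a b N Γ → VarianceBound q s → VarianceBound q t →
      Γᵀ * Matrix.diagonal (fun i => (s i)⁻¹) * Γ = N • Matrix.diagonal D₀ →
      Δᵀ * Matrix.diagonal (fun i => (t i)⁻¹) * Δ = N • Matrix.diagonal D →
      (∀ i j, i < j → D₀ j + δ ≤ D₀ i) → Antitone D → 0 ≤ τ → τ ≤ τ₀ →
      ∑ i, (t i - s i) ^ 2 ≤ d * (τ ^ 2 * N) → ‖Δ * Δᵀ - Γ * Γᵀ‖ ≤ d * (τ * N) →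
      (∀ k, 0 ≤ ∑ i, Δ i k * Γ i k) →
      ‖Δ - Γ‖ ≤ c * (τ * √N) ∧ ∀ k, |D k - D₀ k| ≤ c * τ := by
  by_cases ha : 0 < a
  swap
  · exact ⟨1, 1, one_pos, one_pos, fun ι _ _ N τ s t Γ Δ D₀ D h => absurd h.a_pos ha⟩
  have hq0 : 0 < q := by linarith
  obtain ⟨p, hp⟩ : ∃ p : ℝ, p = Fintype.card (Fin r) := ⟨_, rfl⟩
  have hp0 : 0 ≤ p := hp ▸ Nat.cast_nonneg _
  obtain ⟨l, hl⟩ : ∃ l : ℝ, l = b / q := ⟨_, rfl⟩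
  have hl0 : 0 < l := by rw [hl]; positivity
  obtain ⟨u, hu⟩ : ∃ u : ℝ, u = √(q * a) := ⟨_, rfl⟩
  have hu0 : 0 ≤ u := by rw [hu]; positivity
  -- `h` bounds the whitened estimate, `v` the change of weights, `x` the outer product
  obtain ⟨h, hh⟩ : ∃ h : ℝ, h = √(√p * (u ^ 2 + q * d)) := ⟨_, rfl⟩
  have hh0 : 0 ≤ h := by rw [hh]; positivity
  obtain ⟨v, hv⟩ : ∃ v : ℝ, v = a * q ^ 2 * √d := ⟨_, rfl⟩
  have hv0 : 0 ≤ v := by rw [hv]; positivity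
  obtain ⟨x, hx⟩ : ∃ x : ℝ, x = q * d := ⟨_, rfl⟩
  have hx0 : 0 ≤ x := by rw [hx]; positivity
  obtain ⟨e, he⟩ : ∃ e : ℝ, e = u * x * h + v * u * h := ⟨_, rfl⟩
  have he0 : 0 ≤ e := by rw [he]; positivity
  obtain ⟨φ, hφ⟩ : ∃ φ : ℝ, φ = u * x * u + 2 * ((u ^ 2 + v) * v) + v * v := ⟨_, rfl⟩
  have hφ0 : 0 ≤ φ := by rw [hφ]; positivity
  obtain ⟨ε, hε⟩ : ∃ ε : ℝ, ε = √(r / (l ^ 2 / 2)) * e := ⟨_, rfl⟩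
  have hε0 : 0 ≤ ε := by rw [hε]; positivity
  obtain ⟨y, hy⟩ : ∃ y : ℝ, y = 2 / δ * e + 2 / l * (φ + r * (2 / δ * e) ^ 2 +
    ε * (2 * (u ^ 2 + v) + ε)) := ⟨_, rfl⟩
  have hy0 : 0 ≤ y := by rw [hy]; positivity
  obtain ⟨z, hz⟩ : ∃ z : ℝ, z = √q * (2 / l * (x * h + u * (p * y))) := ⟨_, rfl⟩
  have hz0 : 0 ≤ z := by rw [hz]; positivity
  obtain ⟨X, hX⟩ : ∃ X : ℝ, X = 1 + 2 * φ / l ^ 2 + 4 * ε / δ + 2 * ε / l + 2 * z * √a / b :=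
    ⟨_, rfl⟩
  have hX0 : 0 < X := by rw [hX]; positivity
  refine ⟨z + ε + 1, 1 / X, by positivity, by positivity, ?_⟩
  intro ι _ _ N τ s t Γ Δ D₀ D hreg hs ht hD₀ hD hgap hanti hτ0 hτ hvar hout hsign
  have hτX : τ * X ≤ 1 := by rwa [le_div_iff₀ hX0] at hτ
  have hsum : τ + 2 * φ / l ^ 2 * τ + 4 * ε / δ * τ + 2 * ε / l * τ + 2 * z * √a / b * τ ≤ 1 := by
    rw [hX] at hτX; linarith
  have m1 : 0 ≤ 2 * φ / l ^ 2 * τ := by positivity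
  have m2 : 0 ≤ 4 * ε / δ * τ := by positivity
  have m3 : 0 ≤ 2 * ε / l * τ := by positivity
  have m4 : 0 ≤ 2 * z * √a / b * τ := by positivity
  have hτ1 : τ ≤ 1 := by linarith
  have hτφ : φ * τ ≤ l ^ 2 / 2 := by
    have : 2 * φ / l ^ 2 * τ ≤ 1 := by linarith
    rw [div_mul_eq_mul_div, div_le_iff₀ (by positivity)] at this; linarith
  have hτδ : 4 * (ε * τ) ≤ δ := by
    have : 4 * ε / δ * τ ≤ 1 := by linarith
    rw [div_mul_eq_mul_div, div_le_iff₀ hδ] at this; linarith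
  have hτl : 2 * (ε * τ) ≤ l := by
    have : 2 * ε / l * τ ≤ 1 := by linarith
    rw [div_mul_eq_mul_div, div_le_iff₀ hl0] at this; linarith
  have hτz : 2 * (z * √a * τ) ≤ b := by
    have : 2 * z * √a / b * τ ≤ 1 := by linarith
    rw [div_mul_eq_mul_div, div_le_iff₀ hb] at this; linarith
  have hN := hreg.N_pos
  obtain ⟨w, hw⟩ : ∃ w, w = √N := ⟨_, rfl⟩
  have hw0 : 0 < w := by rw [hw]; exact Real.sqrt_pos.2 hN
  have hwN : N = w * w := by rw [hw]; exact (Real.mul_self_sqrt hN.le).symm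
  set G := whiten t Γ with hG
  set H := whiten t Δ with hH
  have hGn : ‖G‖ ≤ u * w := by
    refine (ht.norm_whiten_le _).trans ?_
    rw [hu, Real.sqrt_mul hq0.le, mul_assoc, hw, ← Real.sqrt_mul ha.le]
    exact mul_le_mul_of_nonneg_left (norm_le_of_sq_le hreg.norm_sq_le) (Real.sqrt_nonneg _)
  have hHG : ‖H * Hᵀ - G * Gᵀ‖ ≤ x * (τ * (w * w)) := by
    have h1 : H * Hᵀ - G * Gᵀ = Matrix.diagonal (fun i => (√(t i))⁻¹) * ((Δ * Δᵀ - Γ * Γᵀ) *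
        Matrix.diagonal (fun i => (√(t i))⁻¹)) := by
      rw [hH, hG, whiten, whiten, Matrix.transpose_mul, Matrix.transpose_mul,
        Matrix.diagonal_transpose]
      simp only [Matrix.mul_sub, Matrix.sub_mul, Matrix.mul_assoc]
    rw [h1, ← hwN]
    have hq2 := Real.sqrt_nonneg q
    refine (frobenius_diagonal_mul_le hq2 ht.abs_inv_sqrt_le _).trans ?_
    have h2 := frobenius_mul_diagonal_le hq2 ht.abs_inv_sqrt_le (Δ * Δᵀ - Γ * Γᵀ)
    calc _ ≤ √q * (√q * (d * (τ * N))) :=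
          mul_le_mul_of_nonneg_left (h2.trans (mul_le_mul_of_nonneg_left hout hq2)) hq2
      _ = (√q * √q) * (d * (τ * N)) := by ring
      _ = _ := by rw [Real.mul_self_sqrt hq0.le, hx]; ring
  have hHn : ‖H‖ ≤ h * w := by
    have h1 : ‖Hᵀ * H‖ ≤ (u ^ 2 + q * d) * (w * w) := by
      rw [← norm_mul_transpose_self]
      have h2 := norm_sub_norm_le (H * Hᵀ) (G * Gᵀ)
      have h3 : ‖G * Gᵀ‖ ≤ (u * w) * (u * w) := by
        refine (Matrix.frobenius_norm_mul _ _).trans ?_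
        rw [Matrix.frobenius_norm_transpose]; gcongr
      have h4 : x * (τ * (w * w)) ≤ x * (w * w) :=
        mul_le_mul_of_nonneg_left (mul_le_of_le_one_left (by positivity) hτ1) hx0
      rw [hx] at h4 hHG
      have h5 : (u ^ 2 + q * d) * (w * w) = u * w * (u * w) + q * d * (w * w) := by ring
      rw [h5]
      linarith
    have h2 : ‖H‖ ^ 2 ≤ √p * (u ^ 2 + q * d) * (w * w) := by
      refine (norm_transpose_mul_self_le H).trans ?_
      rw [← hp, mul_assoc]; gcongr
    refine (norm_le_of_sq_le h2).trans (le_of_eq ?_)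
    rw [Real.sqrt_mul (by positivity), Real.sqrt_mul_self hw0.le, hh]
  have hHH : Hᵀ * H = (w * w) • Matrix.diagonal D := by
    rw [hH, whiten_transpose_mul ht.pos, hD, hwN]
  obtain ⟨V, hGG, hV⟩ : ∃ V, Gᵀ * G = (w * w) • Matrix.diagonal D₀ + V ∧
      ‖V‖ ≤ v * (τ * (w * w)) := by
    refine ⟨Gᵀ * G - (w * w) • Matrix.diagonal D₀, by abel, ?_⟩
    rw [hG, whiten_transpose_mul ht.pos, ← hwN, ← hD₀]
    refine (hreg.weighted_sub_le hs ht).trans ?_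
    have h1 : √(∑ i, (t i - s i) ^ 2) ≤ √d * (τ * w) := by
      refine (Real.sqrt_le_sqrt hvar).trans (le_of_eq ?_)
      rw [Real.sqrt_mul hd.le, Real.sqrt_mul (sq_nonneg _), Real.sqrt_sq hτ0, hw]
    calc _ ≤ a * q ^ 2 * w * (√d * (τ * w)) := by rw [← hw]; gcongr
      _ = _ := by rw [hv, hwN]; ring
  have hDn : ‖Matrix.diagonal D₀‖ ≤ u ^ 2 + v := by
    have h1 : ‖(w * w) • Matrix.diagonal D₀‖ ≤ (u ^ 2 + v) * (w * w) := by
      have h2 : (w * w) • Matrix.diagonal D₀ = Gᵀ * G - V := by rw [hGG]; abel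
      rw [h2]
      refine (norm_sub_le _ _).trans ?_
      have h3 : ‖Gᵀ * G‖ ≤ (u * w) * (u * w) := by
        refine (Matrix.frobenius_norm_mul _ _).trans ?_
        rw [Matrix.frobenius_norm_transpose]; gcongr
      have h4 : v * (τ * (w * w)) ≤ v * (w * w) :=
        mul_le_mul_of_nonneg_left (mul_le_of_le_one_left (by positivity) hτ1) hv0
      linarith
    rw [norm_smul, Real.norm_eq_abs, abs_of_pos (by positivity), mul_comm] at h1
    exact le_of_mul_le_mul_right h1 (by positivity)
  have hD₀l : ∀ i, l ≤ D₀ i := fun i => by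
    have h1 := hreg.weighted_lower hs (Pi.single i 1)
    rw [hD₀] at h1
    simp only [Matrix.mulVec_single_one, single_one_dotProduct, Pi.single_eq_same, Matrix.col_apply,
      ← hl] at h1
    rw [Matrix.smul_apply, Matrix.diagonal_apply_eq, smul_eq_mul] at h1
    have h2 : l * N ≤ D₀ i * N := by linarith
    exact le_of_mul_le_mul_right h2 hN
  have hw2 : (w * w)⁻¹ * (w * w) = 1 := inv_mul_cancel₀ (by positivity)
  -- Since HHᵀ is close to GGᵀ, evaluating Gᵀ(HHᵀ)H and Gᵀ(HHᵀ)G in two ways gives RD ≈ D₀R and RRᵀ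
  -- ≈ D₀². Hence R is nearly a diagonal matrix of signs times D.
  set R := (w * w)⁻¹ • (Gᵀ * H) with hR
  have hGR : Gᵀ * H = (w * w) • R := by
    rw [hR, smul_smul, mul_comm, hw2, one_smul]
  obtain ⟨E, hE, hEn⟩ : ∃ E, R * Matrix.diagonal D = Matrix.diagonal D₀ * R + E ∧ ‖E‖ ≤ e * τ := by
    refine ⟨(w * w)⁻¹ • (w * w)⁻¹ • (Gᵀ * (H * Hᵀ - G * Gᵀ) * H + V * (Gᵀ * H)), ?_, ?_⟩
    · have h1 : Gᵀ * (H * Hᵀ - G * Gᵀ) * H + V * (Gᵀ * H) =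
          (w * w) • (w * w) • (R * Matrix.diagonal D - Matrix.diagonal D₀ * R) := by
        have h2 : V = Gᵀ * G - (w * w) • Matrix.diagonal D₀ := by rw [hGG]; abel
        calc _ = (Gᵀ * H) * (Hᵀ * H) - (w * w) • Matrix.diagonal D₀ * (Gᵀ * H) := by
              rw [h2]
              simp only [Matrix.mul_sub, Matrix.sub_mul, Matrix.mul_assoc]; abel
          _ = _ := by
              rw [hHH, hGR]
              simp only [Matrix.mul_smul, Matrix.smul_mul, smul_sub]
      rw [h1, smul_smul (w * w)⁻¹ (w * w), hw2, one_smul, smul_smul, hw2, one_smul]; abel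
    · rw [smul_smul, norm_smul, Real.norm_eq_abs, abs_of_pos (by positivity)]
      have h1 : ‖Gᵀ * (H * Hᵀ - G * Gᵀ) * H‖ ≤ (u * w) * (x * (τ * (w * w))) * (h * w) := by
        refine (frobenius_mul_three _ _ _).trans ?_
        rw [Matrix.frobenius_norm_transpose]; gcongr
      have h2 : ‖V * (Gᵀ * H)‖ ≤ v * (τ * (w * w)) * ((u * w) * (h * w)) := by
        refine (Matrix.frobenius_norm_mul _ _).trans ?_
        have h3 : ‖Gᵀ * H‖ ≤ (u * w) * (h * w) := by
          refine (Matrix.frobenius_norm_mul _ _).trans ?_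
          rw [Matrix.frobenius_norm_transpose]; gcongr
        gcongr
      calc _ ≤ (w * w)⁻¹ * (w * w)⁻¹ * ((u * w) * (x * (τ * (w * w))) * (h * w) +
            v * (τ * (w * w)) * ((u * w) * (h * w))) := by
            gcongr; exact (norm_add_le _ _).trans (add_le_add h1 h2)
        _ = e * τ := by rw [he]; field_simp
  have hRR : ∀ i, |(R * Rᵀ) i i - D₀ i ^ 2| ≤ φ * τ := by
    obtain ⟨Y, hY, hYn⟩ : ∃ Y, R * Rᵀ = Matrix.diagonal D₀ * Matrix.diagonal D₀ + Y ∧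
        ‖Y‖ ≤ φ * τ := by
      refine ⟨(w * w)⁻¹ • (w * w)⁻¹ • (Gᵀ * (H * Hᵀ - G * Gᵀ) * G + (((w * w) • Matrix.diagonal D₀) * V +
        V * ((w * w) • Matrix.diagonal D₀) + V * V)), ?_, ?_⟩
      · have h1 : Gᵀ * (H * Hᵀ - G * Gᵀ) * G + (((w * w) • Matrix.diagonal D₀) * V +
            V * ((w * w) • Matrix.diagonal D₀) + V * V) =
            (w * w) • (w * w) • (R * Rᵀ - Matrix.diagonal D₀ * Matrix.diagonal D₀) := by
          have h2 : V = Gᵀ * G - (w * w) • Matrix.diagonal D₀ := by rw [hGG]; abel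
          calc _ = (Gᵀ * H) * (Gᵀ * H)ᵀ -
                ((w * w) • Matrix.diagonal D₀) * ((w * w) • Matrix.diagonal D₀) := by
                rw [h2, Matrix.transpose_mul, Matrix.transpose_transpose]
                simp only [Matrix.mul_sub, Matrix.sub_mul, Matrix.mul_assoc]; abel
            _ = _ := by
                rw [hGR, Matrix.transpose_smul]
                simp only [Matrix.mul_smul, Matrix.smul_mul, smul_sub]
        rw [h1, smul_smul (w * w)⁻¹ (w * w), hw2, one_smul, smul_smul, hw2, one_smul]; abel
      · rw [smul_smul, norm_smul, Real.norm_eq_abs, abs_of_pos (by positivity)]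
        have h1 : ‖Gᵀ * (H * Hᵀ - G * Gᵀ) * G‖ ≤ (u * w) * (x * (τ * (w * w))) * (u * w) := by
          refine (frobenius_mul_three _ _ _).trans ?_
          rw [Matrix.frobenius_norm_transpose]; gcongr
        have h0 : ‖(w * w) • Matrix.diagonal D₀‖ ≤ (w * w) * (u ^ 2 + v) := by
          rw [norm_smul, Real.norm_eq_abs, abs_of_pos (by positivity)]; gcongr
        have h2 : ‖((w * w) • Matrix.diagonal D₀) * V‖ ≤
            ((w * w) * (u ^ 2 + v)) * (v * (τ * (w * w))) :=
          (Matrix.frobenius_norm_mul _ _).trans (by gcongr)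
        have h3 : ‖V * ((w * w) • Matrix.diagonal D₀)‖ ≤
            (v * (τ * (w * w))) * ((w * w) * (u ^ 2 + v)) :=
          (Matrix.frobenius_norm_mul _ _).trans (by gcongr)
        have h4 : ‖V * V‖ ≤ (v * (τ * (w * w))) * (v * (1 * (w * w))) := by
          refine (Matrix.frobenius_norm_mul _ _).trans ?_
          have : ‖V‖ ≤ v * (1 * (w * w)) := hV.trans (by gcongr)
          gcongr
        have h5 := norm_add_le (Gᵀ * (H * Hᵀ - G * Gᵀ) * G) (((w * w) • Matrix.diagonal D₀) * V +
            V * ((w * w) • Matrix.diagonal D₀) + V * V)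
        have h6 := norm_add_le (((w * w) • Matrix.diagonal D₀) * V +
            V * ((w * w) • Matrix.diagonal D₀)) (V * V)
        have h7 := norm_add_le (((w * w) • Matrix.diagonal D₀) * V)
            (V * ((w * w) • Matrix.diagonal D₀))
        calc _ ≤ (w * w)⁻¹ * (w * w)⁻¹ * ((u * w) * (x * (τ * (w * w))) * (u * w) +
              (((w * w) * (u ^ 2 + v)) * (v * (τ * (w * w))) +
              (v * (τ * (w * w))) * ((w * w) * (u ^ 2 + v)) +
              (v * (τ * (w * w))) * (v * (1 * (w * w))))) :=
              mul_le_mul_of_nonneg_left (by linarith) (by positivity)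
          _ = φ * τ := by rw [hφ]; field_simp; ring
    intro i
    refine le_trans ?_ hYn
    have h1 : (R * Rᵀ) i i - D₀ i ^ 2 = Y i i := by
      rw [hY, Matrix.diagonal_mul_diagonal, Matrix.add_apply, Matrix.diagonal_apply_eq]; ring
    rw [h1]; exact abs_entry_le_frobenius Y i i
  have hDD : ∀ i, |D i - D₀ i| ≤ ε * τ := by
    refine fun i => abs_sub_le_of_intertwine (ρ := l ^ 2 / 2) (by positivity) hE (fun i => ?_) hgap
      hanti ?_ ?_ i
    · have h1 := abs_le.1 (hRR i)
      have h2 : l ^ 2 ≤ D₀ i ^ 2 := pow_le_pow_left₀ hl0.le (hD₀l i) 2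
      linarith
    · rw [hε, mul_assoc]
      exact mul_le_mul_of_nonneg_left hEn (Real.sqrt_nonneg _)
    · linarith [mul_nonneg hε0 hτ0]
  obtain ⟨S, hS, hRS⟩ := exists_sign_of_intertwine hl0 hδ hE hRR hgap hD₀l hDD
    (by linarith [mul_nonneg hε0 hτ0]) hτl
  have hRS' : ‖R - Matrix.diagonal S * Matrix.diagonal D‖ ≤ p * (y * τ) := by
    have h1 : ∀ i j, |(R - Matrix.diagonal S * Matrix.diagonal D) i j| ≤ y * τ := by
      intro i j
      have h2 : (R - Matrix.diagonal S * Matrix.diagonal D) i j =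
          R i j - S i * (if i = j then D i else 0) := by
        rw [Matrix.sub_apply, Matrix.diagonal_mul, Matrix.diagonal_apply]
      rw [h2]
      refine (hRS i j).trans ?_
      have h3 : |D₀ i| ≤ u ^ 2 + v := by
        have := abs_entry_le_frobenius (Matrix.diagonal D₀) i i
        rw [Matrix.diagonal_apply_eq] at this
        exact this.trans hDn
      have h4 : (2 / δ * ‖E‖) ^ 2 ≤ (2 / δ * e) ^ 2 * τ := by
        calc (2 / δ * ‖E‖) ^ 2 ≤ (2 / δ * (e * τ)) ^ 2 := by gcongr
          _ = (2 / δ * e) ^ 2 * (τ * τ) := by ring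
          _ ≤ (2 / δ * e) ^ 2 * τ :=
            mul_le_mul_of_nonneg_left (mul_le_of_le_one_left hτ0 hτ1) (sq_nonneg _)
      have h5 : ε * τ ≤ ε := mul_le_of_le_one_right hε0 hτ1
      calc _ ≤ 2 / δ * (e * τ) + 2 / l * (φ * τ + ∑ _k : Fin r, (2 / δ * e) ^ 2 * τ +
            ε * τ * (2 * (u ^ 2 + v) + ε)) := by gcongr
        _ = y * τ := by rw [hy]; simp; ring
    refine (norm_le_of_forall_abs_le h1).trans (le_of_eq ?_)
    rw [← hp, Real.sqrt_mul (by positivity), Real.sqrt_mul_self hp0,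
      Real.sqrt_sq (by positivity)]
  have hHS : ‖H - G * Matrix.diagonal S‖ ≤ 2 / l * (x * h + u * (p * y)) * (τ * w) := by
    -- As HᵀH = N D, one has HD = N⁻¹HHᵀH, which is close to N⁻¹GGᵀH = GR and so to G S D. Division
    -- by D, which is at least l/2, gives the columns.
    have h1 : (H - G * Matrix.diagonal S) * Matrix.diagonal D =
        (w * w)⁻¹ • ((H * Hᵀ - G * Gᵀ) * H) + G * (R - Matrix.diagonal S * Matrix.diagonal D) := by
      have h2 : (w * w)⁻¹ • ((H * Hᵀ - G * Gᵀ) * H) = H * Matrix.diagonal D - G * R := by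
        rw [Matrix.sub_mul, Matrix.mul_assoc, Matrix.mul_assoc, hHH, hGR]
        simp only [Matrix.mul_smul, smul_sub, smul_smul, hw2, one_smul]
      rw [h2]
      simp only [Matrix.mul_sub, Matrix.sub_mul, Matrix.mul_assoc]; abel
    have hDl : ∀ i, l / 2 ≤ D i := fun i => by
      have := abs_le.1 (hDD i)
      linarith [hD₀l i]
    have h2 : H - G * Matrix.diagonal S = (H - G * Matrix.diagonal S) * Matrix.diagonal D *
        Matrix.diagonal (fun i => (D i)⁻¹) := by
      have h3 : (fun i => D i * (D i)⁻¹) = fun _ => 1 := by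
        ext i; exact mul_inv_cancel₀ (by linarith [hDl i])
      rw [Matrix.mul_assoc, Matrix.diagonal_mul_diagonal, h3, Matrix.diagonal_one, Matrix.mul_one]
    rw [h2, h1]
    refine (frobenius_mul_diagonal_le (c := 2 / l) (by positivity) (fun i => ?_) _).trans ?_
    · rw [abs_of_pos (inv_pos.2 (by linarith [hDl i])), ← inv_div]
      exact inv_anti₀ (by positivity) (hDl i)
    · rw [mul_assoc]
      refine mul_le_mul_of_nonneg_left ((norm_add_le _ _).trans ?_) (by positivity)
      rw [norm_smul, Real.norm_eq_abs, abs_of_pos (by positivity)]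
      have h3 : ‖(H * Hᵀ - G * Gᵀ) * H‖ ≤ x * (τ * (w * w)) * (h * w) :=
        (Matrix.frobenius_norm_mul _ _).trans (by gcongr)
      have h4 : ‖G * (R - Matrix.diagonal S * Matrix.diagonal D)‖ ≤ u * w * (p * (y * τ)) :=
        (Matrix.frobenius_norm_mul _ _).trans (by gcongr)
      calc _ ≤ (w * w)⁻¹ * (x * (τ * (w * w)) * (h * w)) + u * w * (p * (y * τ)) := by gcongr
        _ = _ := by field_simp
  have hΔS : ‖Δ - Γ * Matrix.diagonal S‖ ≤ z * (τ * w) := by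
    have h1 : Δ - Γ * Matrix.diagonal S =
        Matrix.diagonal (fun i => √(t i)) * (H - G * Matrix.diagonal S) := by
      rw [Matrix.mul_sub, hH, hG, diagonal_sqrt_mul_whiten ht.pos, ← Matrix.mul_assoc,
        diagonal_sqrt_mul_whiten ht.pos]
    rw [h1]
    refine (frobenius_diagonal_mul_le (Real.sqrt_nonneg q) ht.abs_sqrt_le _).trans ?_
    rw [hz, mul_assoc (√q)]
    exact mul_le_mul_of_nonneg_left hHS (Real.sqrt_nonneg q)
  have hS1 : ∀ k, S k = 1 := by
    intro k
    refine sign_eq_one hreg.lower ?_ (hS k) (hsign k)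
    have h5 : ‖Γ‖ ≤ √a * w := by
      rw [hw, ← Real.sqrt_mul ha.le]; exact norm_le_of_sq_le hreg.norm_sq_le
    calc _ ≤ z * (τ * w) * (√a * w) := by gcongr
      _ = z * √a * τ * N := by rw [hwN]; ring
      _ < b * N := mul_lt_mul_of_pos_right (by linarith) hN
  have hSd : Matrix.diagonal S = 1 := by
    rw [← Matrix.diagonal_one]; congr 1; ext k; exact hS1 k
  rw [hSd, Matrix.mul_one] at hΔS
  refine ⟨hΔS.trans ?_, fun k => (hDD k).trans ?_⟩
  · rw [hw]; gcongr; linarith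
  · gcongr; linarith

/-! ### Identification by triangular restrictions on the first rows (IC1, IC4, IC5). -/

theorem exists_norm_inv_le (r : ℕ) (R c : ℝ) (hc : 0 < c) : ∃ h : ℝ, 0 < h ∧
    ∀ A : Matrix (Fin r) (Fin r) ℝ, ‖A‖ ≤ R → c ≤ |A.det| → ‖A⁻¹‖ ≤ h := by
  -- Entries of the adjugate are determinants in which one row has been replaced by a unit vector;
  -- the entry bound must therefore be at least 1.
  set x := max R 1
  refine ⟨√(r * r * (c⁻¹ * (r.factorial * x ^ r)) ^ 2) + 1, by positivity, fun A hA hdet => ?_⟩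
  refine le_trans ?_ (le_add_of_nonneg_right zero_le_one)
  have h := norm_le_of_forall_abs_le (A := A⁻¹) (c := c⁻¹ * (r.factorial * x ^ r)) fun i j => by
    rw [Matrix.inv_def, Matrix.smul_apply, smul_eq_mul, abs_mul, Ring.inverse_eq_inv, abs_inv]
    refine mul_le_mul (inv_anti₀ hc hdet) ?_ (abs_nonneg _) (by positivity)
    rw [Matrix.adjugate_apply]
    have h1 := Matrix.det_le (A := A.updateRow j (Pi.single i 1)) (abv := AbsoluteValue.abs)
      (x := x) fun k l => by
        rcases eq_or_ne k j with rfl | hk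
        · rw [Matrix.updateRow_self, Pi.single_apply]
          split_ifs <;> simp [x]
        · rw [Matrix.updateRow_ne hk]
          exact ((abs_entry_le_frobenius A k l).trans hA).trans (le_max_left _ _)
    simpa using h1
  simpa using h

theorem lower_mul {r : ℕ} {A B : Matrix (Fin r) (Fin r) ℝ} (hA : ∀ i j, i < j → A i j = 0)
    (hB : ∀ i j, i < j → B i j = 0) :
    (∀ i j, i < j → (A * B) i j = 0) ∧ ∀ i, (A * B) i i = A i i * B i i := by
  constructor
  · intro i j hij
    rw [Matrix.mul_apply]
    refine Finset.sum_eq_zero fun k _ => ?_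
    rcases lt_or_ge i k with h | h
    · rw [hA i k h, zero_mul]
    · rw [hB k j (h.trans_lt hij), mul_zero]
  · intro i
    rw [Matrix.mul_apply]
    refine Finset.sum_eq_single_of_mem i (Finset.mem_univ _) fun k _ hk => ?_
    rcases lt_or_gt_of_ne hk with h | h
    · rw [hB k i h, mul_zero]
    · rw [hA i k h, zero_mul]

theorem lower_inv {r : ℕ} {A : Matrix (Fin r) (Fin r) ℝ} (hA : ∀ i j, i < j → A i j = 0)
    (hd : ∀ i, A i i ≠ 0) : IsUnit A.det ∧ (∀ i j, i < j → A⁻¹ i j = 0) ∧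
      ∀ i, A i i * A⁻¹ i i = 1 := by
  have hA' : A.BlockTriangular OrderDual.toDual := fun i j hij => hA i j hij
  have hdet : IsUnit A.det := by
    rw [Matrix.det_of_isLowerTriangular A hA', isUnit_iff_ne_zero]
    exact Finset.prod_ne_zero_iff.2 fun i _ => hd i
  have hinv : ∀ i j, i < j → A⁻¹ i j = 0 := fun i j hij => by
    let _ := Matrix.invertibleOfIsUnitDet A hdet
    exact Matrix.blockTriangular_inv_of_blockTriangular hA' hij
  refine ⟨hdet, hinv, fun i => ?_⟩
  rw [← (lower_mul hA hinv).2, Matrix.mul_nonsing_inv _ hdet, Matrix.one_apply_eq]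

/-- Stability of the `LDL'` decomposition. -/
theorem unit_lower_stability {r : ℕ} {T E : Matrix (Fin r) (Fin r) ℝ} {D D₀ : Fin r → ℝ} {l : ℝ}
    (hT : ∀ i j, i < j → T i j = 0) (hTd : ∀ i, T i i = 1) (hl : 0 < l) (hl₀ : ∀ i, l ≤ D₀ i)
    (h : T * Matrix.diagonal D * Tᵀ = Matrix.diagonal D₀ + E)
    (hE : 4 * (√r * ‖E‖) ≤ l) (hE' : 2 * ‖E‖ ≤ l) :
    ‖T⁻¹ - 1‖ ≤ 2 * √r / l * ‖E‖ ∧ ‖T - 1‖ ≤ 4 * r / l * ‖E‖ := by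
  obtain ⟨hdet, hTi, hTid⟩ := lower_inv hT (fun i => by rw [hTd]; exact one_ne_zero)
  have hdett : IsUnit Tᵀ.det := by rwa [Matrix.det_transpose]
  set Y := (T⁻¹)ᵀ with hY
  have hTY : Tᵀ * Y = 1 := by
    rw [hY, ← Matrix.transpose_mul, Matrix.nonsing_inv_mul _ hdet, Matrix.transpose_one]
  have hTD : T * Matrix.diagonal D = Matrix.diagonal D₀ * Y + E * Y := by
    rw [← Matrix.add_mul, ← h, Matrix.mul_assoc, hTY, Matrix.mul_one]
  have hone : ‖(1 : Matrix (Fin r) (Fin r) ℝ)‖ ≤ √r := by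
    have := norm_le_of_sq_le (frobenius_one_sq (n := Fin r)).le
    rwa [Fintype.card_fin] at this
  -- Y, the inverse transpose of T, is upper triangular with unit diagonal. Below and on the
  -- diagonal Y - 1 vanishes. Above it TD vanishes, so D₀Y = -EY there.
  have hY1 : l * ‖Y - 1‖ ≤ ‖E * Y‖ := by
    refine (sq_le_sq₀ (by positivity) (norm_nonneg _)).1 ?_
    rw [mul_pow, frobenius_sq, frobenius_sq, Finset.mul_sum]
    refine Finset.sum_le_sum fun i _ => ?_
    rw [Finset.mul_sum]
    refine Finset.sum_le_sum fun j _ => ?_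
    rcases lt_trichotomy i j with hij | rfl | hij
    · have h1 := congrFun (congrFun hTD i) j
      rw [Matrix.mul_diagonal, hT i j hij, Matrix.add_apply, Matrix.diagonal_mul] at h1
      rw [Matrix.sub_apply, Matrix.one_apply_ne hij.ne, sub_zero]
      have h2 : (E * Y) i j = -(D₀ i * Y i j) := by linarith
      rw [h2, neg_sq, mul_pow]
      gcongr
      exact hl₀ i
    · have h1 : Y i i = 1 := by
        have := hTid i
        rwa [hTd, one_mul] at this
      rw [Matrix.sub_apply, h1, Matrix.one_apply_eq, sub_self]
      simp; positivity
    · have h1 : Y i j = 0 := hTi j i hij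
      rw [Matrix.sub_apply, h1, Matrix.one_apply_ne hij.ne', sub_self]
      simp; positivity
  have hEY := Matrix.frobenius_norm_mul E Y
  have hYn : ‖Y‖ ≤ 2 * √r := by
    have h1 : ‖Y‖ ≤ ‖Y - 1‖ + √r := by
      have := norm_sub_norm_le Y 1
      linarith
    have h2 : ‖E‖ * ‖Y‖ ≤ l / 2 * ‖Y‖ := by gcongr; linarith
    have h3 : ‖Y - 1‖ ≤ ‖Y‖ / 2 := by
      have : l * ‖Y - 1‖ ≤ l * (‖Y‖ / 2) := by linarith
      exact le_of_mul_le_mul_left this hl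
    linarith
  have hYf : ‖Y - 1‖ ≤ 2 * √r / l * ‖E‖ := by
    rw [div_mul_eq_mul_div, le_div_iff₀ hl, mul_comm]
    refine hY1.trans (hEY.trans ?_)
    rw [mul_comm]; gcongr
  have hY2 : ‖T⁻¹ - 1‖ = ‖Y - 1‖ := by
    rw [hY, ← Matrix.frobenius_norm_transpose, Matrix.transpose_sub, Matrix.transpose_one]
  refine ⟨hY2.trans_le hYf, ?_⟩
  have hT1 : T - 1 = -(T * (T⁻¹ - 1)) := by
    rw [Matrix.mul_sub, Matrix.mul_nonsing_inv _ hdet, Matrix.mul_one]; abel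
  have hT2 : ‖T - 1‖ ≤ ‖T‖ * ‖Y - 1‖ := by
    rw [hT1, norm_neg, ← hY2]; exact Matrix.frobenius_norm_mul _ _
  have hY3 : ‖Y - 1‖ ≤ 1 / 2 := by
    refine hYf.trans ?_
    rw [div_mul_eq_mul_div, div_le_iff₀ hl]; linarith
  have hTn : ‖T‖ ≤ 2 * √r := by
    have h1 : ‖T‖ ≤ ‖T - 1‖ + √r := by
      have := norm_sub_norm_le T 1
      linarith
    have h2 : ‖T‖ * ‖Y - 1‖ ≤ ‖T‖ * (1 / 2) := by gcongr
    linarith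
  calc ‖T - 1‖ ≤ 2 * √r * (2 * √r / l * ‖E‖) := hT2.trans (by gcongr)
    _ = 4 * (√r * √r) / l * ‖E‖ := by ring
    _ = _ := by rw [Real.mul_self_sqrt (Nat.cast_nonneg r)]

/-- Stability of the Cholesky decomposition of the identity, up to signs. -/
theorem lower_stability {r : ℕ} {T E : Matrix (Fin r) (Fin r) ℝ}
    (hT : ∀ i j, i < j → T i j = 0) (hTd : ∀ i, T i i ≠ 0) (h : T * Tᵀ = 1 + E)
    (hE : ‖E‖ ≤ 1 / 2) :
    ∃ S : Fin r → ℝ, (∀ i, S i = 1 ∨ S i = -1) ∧ (∀ i, 0 < T i i → S i = 1) ∧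
      ‖T - Matrix.diagonal S‖ ≤ √(2 * r) * ‖E‖ := by
  obtain ⟨hdet, hTi, hTid⟩ := lower_inv hT hTd
  set Y := (T⁻¹)ᵀ with hY
  have hTY : Tᵀ * Y = 1 := by
    rw [hY, ← Matrix.transpose_mul, Matrix.nonsing_inv_mul _ hdet, Matrix.transpose_one]
  have hTD : T = Y + E * Y := by
    calc T = T * Tᵀ * Y := by rw [Matrix.mul_assoc, hTY, Matrix.mul_one]
      _ = _ := by rw [h, Matrix.add_mul, Matrix.one_mul]
  -- Take the trace of YᵀY + YᵀEY = 1; as ‖E‖ ≤ 1/2, the second term is at most half of the first in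
  -- size.
  have hYn : ‖Y‖ ^ 2 ≤ 2 * r := by
    have h1 : Yᵀ * Y + Yᵀ * (E * Y) = 1 := by
      rw [← Matrix.mul_add, ← hTD, ← Matrix.transpose_transpose (Yᵀ * T), Matrix.transpose_mul,
        Matrix.transpose_transpose, hTY, Matrix.transpose_one]
    have h2 := congrArg Matrix.trace h1
    rw [Matrix.trace_add, ← frobenius_sq_eq_trace, Matrix.trace_one, Fintype.card_fin] at h2
    have h3 := abs_trace_mul_le Yᵀ (E * Y)
    rw [Matrix.frobenius_norm_transpose] at h3
    have h4 := neg_abs_le (Yᵀ * (E * Y)).trace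
    have h5 : ‖Y‖ * ‖E * Y‖ ≤ ‖Y‖ * (1 / 2 * ‖Y‖) :=
      mul_le_mul_of_nonneg_left ((Matrix.frobenius_norm_mul _ _).trans (by gcongr)) (norm_nonneg _)
    nlinarith
  refine ⟨fun i => if 0 ≤ T i i then 1 else -1, fun i => ?_, fun i hi => ?_, ?_⟩
  · dsimp only; split_ifs
    · exact Or.inl rfl
    · exact Or.inr rfl
  · simp [hi.le]
  have hEY : ‖T - Matrix.diagonal (fun i => if 0 ≤ T i i then (1 : ℝ) else -1)‖ ≤ ‖E * Y‖ := by
    refine (sq_le_sq₀ (norm_nonneg _) (norm_nonneg _)).1 ?_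
    rw [frobenius_sq, frobenius_sq]
    refine Finset.sum_le_sum fun i _ => Finset.sum_le_sum fun j _ => ?_
    have h1 := congrFun (congrFun hTD i) j
    rw [Matrix.add_apply] at h1
    rcases lt_trichotomy i j with hij | rfl | hij
    · rw [Matrix.sub_apply, hT i j hij, Matrix.diagonal_apply_ne _ hij.ne, sub_zero]
      simpa using sq_nonneg _
    · rw [Matrix.sub_apply, Matrix.diagonal_apply_eq]
      have h2 : T i i * Y i i = 1 := hTid i
      have h3 : (E * Y) i i = T i i - Y i i := by linarith
      have h4 : Y i i = (T i i)⁻¹ := eq_inv_of_mul_eq_one_right h2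
      rw [h3, h4]
      have h5 := hTd i
      -- On the diagonal EY is T i i minus its inverse, and for x > 0 the distance of x from 1 is at
      -- most its distance from 1/x. The rule is applied to T i i or to its negative.
      have key : ∀ x s : ℝ, 0 < x → (x - 1) ^ 2 ≤ (x - x⁻¹) ^ 2 := fun x _ hx => by
        have : x - x⁻¹ = (x - 1) * (1 + x⁻¹) := by field_simp; ring
        rw [this, mul_pow]
        have h6 : 1 ≤ (1 + x⁻¹) ^ 2 := by nlinarith [inv_pos.2 hx]
        nlinarith [sq_nonneg (x - 1)]
      split_ifs with hs
      · exact key _ 0 (lt_of_le_of_ne hs (Ne.symm h5))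
      · have := key (-(T i i)) 0 (by push Not at hs; linarith)
        rw [inv_neg] at this
        nlinarith
    · rw [Matrix.sub_apply, Matrix.diagonal_apply_ne _ hij.ne', sub_zero]
      have h2 : Y i j = 0 := hTi j i hij
      rw [h1, h2, zero_add]
  refine hEY.trans ((Matrix.frobenius_norm_mul _ _).trans ?_)
  rw [mul_comm]
  exact mul_le_mul_of_nonneg_right (norm_le_of_sq_le hYn) (norm_nonneg _)

/-- The remaining rows of the loadings, once the factors are identified from the first rows. -/
theorem norm_snd_sub_le {r : ℕ} {A T M M' E : Matrix (Fin r) (Fin r) ℝ}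
    {B B' : Matrix ν (Fin r) ℝ} {S : Matrix (Fin r) (Fin r) ℝ} {l h β χ φ θ : ℝ}
    (hA : IsUnit A.det) (hT : IsUnit T.det) (hE : T * M' * Tᵀ = M + E)
    (hl : 0 < l) (hM : ∀ v, l * (v ⬝ᵥ v) ≤ v ⬝ᵥ M *ᵥ v) (hMt' : M'ᵀ = M') (hEl : 2 * ‖E‖ ≤ l)
    (hAn : ‖A⁻¹‖ ≤ h) (hB : ‖B‖ ≤ β) (hTS : ‖T - S‖ ≤ χ) (hTn : ‖T‖ ≤ θ)
    (hφ : ‖B' * M' * (A * T)ᵀ - B * M * Aᵀ‖ ≤ φ) :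
    ‖B' - B * S‖ ≤ β * χ + (φ * h + β * ‖E‖) * (2 * r / l) * θ := by
  have hP : ∀ v, l / 2 * (v ⬝ᵥ v) ≤ v ⬝ᵥ (M + E) *ᵥ v := fun v => by
    refine le_trans (mul_le_mul_of_nonneg_right (by linarith) (dotProduct_self_nonneg' v))
      (add_lower hM (le_refl ‖E‖) v)
  have hPt : (M + E)ᵀ = M + E := by
    rw [← hE]; simp only [Matrix.transpose_mul, Matrix.transpose_transpose, hMt', Matrix.mul_assoc]
  have hPu := posDef_isUnit_det (posDef_of_lower hPt (half_pos hl) hP)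
  have hPn : ‖(M + E)⁻¹‖ ≤ 2 * r / l := by
    refine (norm_inv_le_of_lower hPt (half_pos hl) hP).trans (le_of_eq ?_)
    rw [Fintype.card_fin]; field_simp
  have hAt : IsUnit Aᵀ.det := by rwa [Matrix.det_transpose]
  set F := B' * M' * (A * T)ᵀ - B * M * Aᵀ with hF
  have h1 : F * (A⁻¹)ᵀ = B' * T⁻¹ * (M + E) - B * M := by
    have h2 : Aᵀ * (A⁻¹)ᵀ = 1 := by
      rw [← Matrix.transpose_mul, Matrix.nonsing_inv_mul _ hA, Matrix.transpose_one]
    have h3 : T⁻¹ * (M + E) = M' * Tᵀ := by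
      rw [← hE, Matrix.mul_assoc T, ← Matrix.mul_assoc, Matrix.nonsing_inv_mul _ hT, Matrix.one_mul]
    rw [hF, Matrix.sub_mul, Matrix.transpose_mul, Matrix.mul_assoc B' T⁻¹, h3]
    simp only [Matrix.mul_assoc, h2, Matrix.mul_one]
  -- B'T⁻¹ is the estimate of B in the true coordinates: removing Aᵀ on the right gives F(A⁻¹)ᵀ - BE
  -- = (B'T⁻¹ - B)(M + E), and M + E keeps the lower bound l/2.
  have h4 : B' - B * S = B * (T - S) + (F * (A⁻¹)ᵀ - B * E) * (M + E)⁻¹ * T := by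
    have h5 : F * (A⁻¹)ᵀ - B * E = (B' * T⁻¹ - B) * (M + E) := by
      rw [h1]; simp only [Matrix.sub_mul, Matrix.mul_add]; abel
    rw [h5, Matrix.mul_assoc (B' * T⁻¹ - B), Matrix.mul_nonsing_inv _ hPu, Matrix.mul_one,
      Matrix.sub_mul, Matrix.mul_assoc, Matrix.nonsing_inv_mul _ hT, Matrix.mul_one, Matrix.mul_sub]
    abel
  rw [h4]
  have hβ := (norm_nonneg _).trans hB
  have hφ0 := (norm_nonneg _).trans hφ
  have hh := (norm_nonneg _).trans hAn
  refine (norm_add_le _ _).trans (add_le_add ?_ ?_)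
  · exact (Matrix.frobenius_norm_mul _ _).trans (by gcongr)
  · have h6 : ‖F * (A⁻¹)ᵀ - B * E‖ ≤ φ * h + β * ‖E‖ := by
      refine (norm_sub_le _ _).trans (add_le_add ?_ ?_)
      · refine (Matrix.frobenius_norm_mul _ _).trans ?_
        rw [Matrix.frobenius_norm_transpose]; gcongr
      · exact (Matrix.frobenius_norm_mul _ _).trans (by gcongr)
    exact (frobenius_mul_three _ _ _).trans (by gcongr)

theorem norm_diagonal_sign {r : ℕ} {S : Fin r → ℝ} (hS : ∀ i, S i = 1 ∨ S i = -1) :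
    ‖Matrix.diagonal S‖ ≤ √r := by
  refine norm_le_of_sq_le ?_
  rw [frobenius_diagonal_sq]
  refine le_of_eq ?_
  have : ∀ i, S i ^ 2 = 1 := fun i => by rcases hS i with h | h <;> rw [h] <;> norm_num
  simp [this]

theorem norm_fromRows_le (A : Matrix κ n ℝ) (B : Matrix ν n ℝ) :
    ‖Matrix.fromRows A B‖ ≤ ‖A‖ + ‖B‖ := by
  refine (sq_le_sq₀ (norm_nonneg _) (by positivity)).1 ?_
  rw [norm_sq_fromRows]
  nlinarith [norm_nonneg A, norm_nonneg B]

/-- Identification by triangular restrictions on the first rows of the loadings. -/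
inductive TriangularRestriction {r : ℕ} (A A' M M' : Matrix (Fin r) (Fin r) ℝ) (P : Fin r → Prop) :
    Prop
  | one : A = 1 → A' = 1 → TriangularRestriction A A' M M' P
  | unit : (∀ i j, i < j → A i j = 0) → (∀ i, A i i = 1) → (∀ i j, i < j → A' i j = 0) →
      (∀ i, A' i i = 1) → M.IsDiag → M'.IsDiag → TriangularRestriction A A' M M' P
  | lower : (∀ i j, i < j → A i j = 0) → (∀ i, A i i ≠ 0) → (∀ i j, i < j → A' i j = 0) →
      (∀ i, A' i i ≠ 0) → M = 1 → M' = 1 → (∀ k, P k ∨ 0 < A' k k * A k k) →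
      TriangularRestriction A A' M M' P

/-- Up to the signs of its columns, a matrix subject to a triangular restriction is determined
by the quadratic form that it defines. -/
theorem TriangularRestriction.stability {r : ℕ} {A A' M M' E T : Matrix (Fin r) (Fin r) ℝ}
    {P : Fin r → Prop} (h : TriangularRestriction A A' M M' P) {l m : ℝ} (hl : 0 < l)
    (hM : ∀ v, l * (v ⬝ᵥ v) ≤ v ⬝ᵥ M *ᵥ v) (hm : ‖M‖ ≤ m) (hT : A' = A * T) (hA : IsUnit A.det)
    (hE : T * M' * Tᵀ = M + E) (hE1 : 4 * (√r * ‖E‖) ≤ l) (hE2 : 2 * ‖E‖ ≤ l)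
    (hE3 : ‖E‖ ≤ 1 / 2) :
    IsUnit T.det ∧ ∃ S : Fin r → ℝ, (∀ i, S i = 1 ∨ S i = -1) ∧ (∀ i, P i ∨ S i = 1) ∧
      ‖T - Matrix.diagonal S‖ ≤ (4 * r / l + √(2 * r)) * ‖E‖ ∧
      ‖M' - M‖ ≤ (1 + 2 * (2 * √r / l) * (m + 1 / 2) + (2 * √r / l) * (m + 1 / 2)) * ‖E‖ := by
  have hm0 := (norm_nonneg _).trans hm
  have hTA : T = A⁻¹ * A' := by
    rw [hT, ← Matrix.mul_assoc, Matrix.nonsing_inv_mul _ hA, Matrix.one_mul]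
  cases h with
  | one h1 h2 =>
    have h3 : T = 1 := by rw [hTA, h1, h2]; simp
    refine ⟨by rw [h3]; simp, fun _ => 1, fun _ => Or.inl rfl, fun _ => Or.inr rfl, ?_, ?_⟩
    · rw [h3, Matrix.diagonal_one, sub_self, norm_zero]; positivity
    · have h4 : M' - M = E := by
        rw [h3] at hE
        simp only [Matrix.one_mul, Matrix.transpose_one, Matrix.mul_one] at hE
        rw [hE]; abel
      rw [h4]
      refine le_mul_of_one_le_left (norm_nonneg _) ?_
      have : 0 ≤ 2 * (2 * √r / l) * (m + 1 / 2) + (2 * √r / l) * (m + 1 / 2) := by positivity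
      linarith
  | unit h1 h2 h3 h4 h5 h6 =>
    obtain ⟨k1, k2, k3⟩ := lower_inv h1 (fun i => by rw [h2]; exact one_ne_zero)
    have hTl := lower_mul k2 h3
    rw [← hTA] at hTl
    have hTd : ∀ i, T i i = 1 := fun i => by
      rw [hTl.2, h4, mul_one]; simpa [h2] using k3 i
    obtain ⟨D, rfl⟩ : ∃ D, M' = Matrix.diagonal D := ⟨_, h6.diagonal_diag.symm⟩
    obtain ⟨D₀, rfl⟩ : ∃ D₀, M = Matrix.diagonal D₀ := ⟨_, h5.diagonal_diag.symm⟩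
    have hl₀ : ∀ i, l ≤ D₀ i := fun i => by
      have := hM (Pi.single i 1)
      simpa using this
    have hTu := (lower_inv hTl.1 (fun i => by rw [hTd]; exact one_ne_zero)).1
    have hTtu : IsUnit Tᵀ.det := by rwa [Matrix.det_transpose]
    obtain ⟨s1, s2⟩ := unit_lower_stability hTl.1 hTd hl hl₀ hE hE1 hE2
    refine ⟨hTu, fun _ => 1, fun _ => Or.inl rfl, fun _ => Or.inr rfl, ?_, ?_⟩
    · rw [Matrix.diagonal_one]
      refine s2.trans ?_
      gcongr
      exact le_add_of_nonneg_right (Real.sqrt_nonneg _)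
    -- The moments are recovered as M' = T⁻¹(M + E)(T⁻¹)ᵀ with T⁻¹ = 1 + V, where V is of the order
    -- of E.
    · set V := T⁻¹ - 1 with hV
      have h7 : T⁻¹ = 1 + V := by rw [hV]; abel
      have h8 : Matrix.diagonal D = (1 + V) * (Matrix.diagonal D₀ + E) * (1 + V)ᵀ := by
        rw [← hE, ← h7, Matrix.transpose_nonsing_inv]
        calc Matrix.diagonal D = (T⁻¹ * T) * Matrix.diagonal D * (Tᵀ * Tᵀ⁻¹) := by
              rw [Matrix.nonsing_inv_mul _ hTu, Matrix.mul_nonsing_inv _ hTtu]; simp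
          _ = _ := by simp only [Matrix.mul_assoc]
      have h9 : Matrix.diagonal D - Matrix.diagonal D₀ = E + V * (Matrix.diagonal D₀ + E) +
          (Matrix.diagonal D₀ + E) * Vᵀ + V * (Matrix.diagonal D₀ + E) * Vᵀ := by
        rw [h8, Matrix.transpose_add, Matrix.transpose_one]
        simp only [Matrix.add_mul, Matrix.mul_add, Matrix.one_mul, Matrix.mul_one]; abel
      have hP : ‖Matrix.diagonal D₀ + E‖ ≤ m + 1 / 2 :=
        (norm_add_le _ _).trans (add_le_add hm hE3)
      have hV1 : ‖V‖ ≤ 1 := by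
        refine s1.trans ?_
        rw [div_mul_eq_mul_div, div_le_one hl]; linarith
      rw [h9]
      have e1 : ‖V * (Matrix.diagonal D₀ + E)‖ ≤ (2 * √r / l * ‖E‖) * (m + 1 / 2) :=
        (Matrix.frobenius_norm_mul _ _).trans (by gcongr)
      have e2 : ‖(Matrix.diagonal D₀ + E) * Vᵀ‖ ≤ (m + 1 / 2) * (2 * √r / l * ‖E‖) := by
        refine (Matrix.frobenius_norm_mul _ _).trans ?_
        rw [Matrix.frobenius_norm_transpose]; gcongr
      have e3 : ‖V * (Matrix.diagonal D₀ + E) * Vᵀ‖ ≤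
          (2 * √r / l * ‖E‖) * (m + 1 / 2) * 1 := by
        refine (frobenius_mul_three _ _ _).trans ?_
        rw [Matrix.frobenius_norm_transpose]; gcongr
      refine (norm_add_le _ _).trans ((add_le_add ((norm_add_le _ _).trans
        (add_le_add ((norm_add_le _ _).trans (add_le_add le_rfl e1)) e2)) e3).trans (le_of_eq ?_))
      ring
  | lower h1 h2 h3 h4 h5 h6 h7 =>
    obtain ⟨k1, k2, k3⟩ := lower_inv h1 h2
    have hTl := lower_mul k2 h3
    rw [← hTA] at hTl
    have hkk : ∀ i, A⁻¹ i i = (A i i)⁻¹ := fun i => eq_inv_of_mul_eq_one_right (k3 i)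
    have hTd : ∀ i, T i i ≠ 0 := fun i => by
      rw [hTl.2, hkk]; exact mul_ne_zero (inv_ne_zero (h2 i)) (h4 i)
    have hTu := (lower_inv hTl.1 hTd).1
    rw [h5, h6, Matrix.mul_one] at hE
    obtain ⟨S, s1, s2, s3⟩ := lower_stability hTl.1 hTd hE hE3
    refine ⟨hTu, S, s1, fun i => (h7 i).imp_right fun h8 => s2 i ?_, ?_, ?_⟩
    · rw [hTl.2, hkk]
      have : (A i i)⁻¹ * A' i i = A' i i * A i i * ((A i i)⁻¹) ^ 2 := by
        have := h2 i
        field_simp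
      rw [this]
      have := inv_ne_zero (h2 i)
      positivity
    · refine s3.trans ?_
      gcongr
      exact le_add_of_nonneg_left (by positivity)
    · rw [h5, h6, sub_self, norm_zero]; positivity

set_option maxHeartbeats 1000000 in
/-- Identification of the loadings and of the moments of the factors from `Γ Γᵀ`. -/
theorem exists_triangular_rate (r : ℕ) (R b l m d c₀ : ℝ) (hR : 0 < R) (hb : 0 < b) (hl : 0 < l)
    (hm0 : 0 ≤ m) (hd : 0 < d) (hc₀ : 0 < c₀) :
    ∃ c τ₀ : ℝ, 0 < c ∧ 0 < τ₀ ∧ ∀ (ν : Type) [Fintype ν] [DecidableEq ν] (N τ : ℝ)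
      (A A' M M' : Matrix (Fin r) (Fin r) ℝ) (B B' : Matrix ν (Fin r) ℝ),
      RegularLoading R b N (Matrix.fromRows A B) → 1 ≤ N → c₀ ≤ |A.det| →
      (∀ v, l * (v ⬝ᵥ v) ≤ v ⬝ᵥ M *ᵥ v) → ‖M‖ ≤ m → M'ᵀ = M' → 0 ≤ τ → τ ≤ τ₀ →
      ‖A' * M' * A'ᵀ - A * M * Aᵀ‖ ≤ d * τ → ‖B' * M' * A'ᵀ - B * M * Aᵀ‖ ≤ d * (τ * √N) →
      TriangularRestriction A A' M M' (fun k => 0 ≤ ∑ i, Matrix.fromRows A' B' i k *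
        Matrix.fromRows A B i k) →
      ‖Matrix.fromRows A' B' - Matrix.fromRows A B‖ ≤ c * (τ * √N) ∧ ‖M' - M‖ ≤ c * τ := by
  obtain ⟨h, hh0, hh⟩ := exists_norm_inv_le r (√(R * r)) c₀ hc₀
  obtain ⟨e, he⟩ : ∃ e : ℝ, e = h * d * h := ⟨_, rfl⟩
  have he0 : 0 ≤ e := by rw [he]; positivity
  obtain ⟨x, hx⟩ : ∃ x : ℝ, x = (4 * r / l + √(2 * r)) * e := ⟨_, rfl⟩
  have hx0 : 0 ≤ x := by rw [hx]; positivity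
  obtain ⟨y, hy⟩ : ∃ y : ℝ, y = √R * x + (d * h + √R * e) * (2 * r / l) * (√r + x) := ⟨_, rfl⟩
  have hy0 : 0 ≤ y := by rw [hy]; positivity
  obtain ⟨z, hz⟩ : ∃ z : ℝ, z = √(R * r) * x + y := ⟨_, rfl⟩
  have hz0 : 0 ≤ z := by rw [hz]; positivity
  obtain ⟨u, hu⟩ : ∃ u : ℝ, u =
    (1 + 2 * (2 * √r / l) * (m + 1 / 2) + (2 * √r / l) * (m + 1 / 2)) * e := ⟨_, rfl⟩
  have hu0 : 0 ≤ u := by rw [hu]; positivity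
  obtain ⟨X, hX⟩ : ∃ X : ℝ, X = 1 + 4 * √r * e / l + 2 * e / l + 2 * e + 2 * z * √R / b := ⟨_, rfl⟩
  have hX0 : 0 < X := by rw [hX]; positivity
  refine ⟨z + u + 1, 1 / X, by positivity, by positivity, ?_⟩
  intro ν _ _ N τ A A' M M' B B' hreg hN hdet hM hm hMt' hτ0 hτ hfst hsnd htri
  have hτX : τ * X ≤ 1 := by rwa [le_div_iff₀ hX0] at hτ
  have hsum : τ + 4 * √r * e / l * τ + 2 * e / l * τ + 2 * e * τ + 2 * z * √R / b * τ ≤ 1 := by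
    rw [hX] at hτX; linarith
  have m1 : 0 ≤ 4 * √r * e / l * τ := by positivity
  have m2 : 0 ≤ 2 * e / l * τ := by positivity
  have m3 : 0 ≤ 2 * e * τ := by positivity
  have m4 : 0 ≤ 2 * z * √R / b * τ := by positivity
  have hτ1 : τ ≤ 1 := by linarith
  have ht1 : 4 * √r * (e * τ) ≤ l := by
    have : 4 * √r * e / l * τ ≤ 1 := by linarith
    rw [div_mul_eq_mul_div, div_le_iff₀ hl] at this; linarith
  have ht2 : 2 * (e * τ) ≤ l := by
    have : 2 * e / l * τ ≤ 1 := by linarith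
    rw [div_mul_eq_mul_div, div_le_iff₀ hl] at this; linarith
  have ht3 : 2 * (z * √R * τ) ≤ b := by
    have : 2 * z * √R / b * τ ≤ 1 := by linarith
    rw [div_mul_eq_mul_div, div_le_iff₀ hb] at this; linarith
  obtain ⟨w, hw⟩ : ∃ w, w = √N := ⟨_, rfl⟩
  have hw1 : 1 ≤ w := by rw [hw]; exact Real.one_le_sqrt.2 hN
  have hw0 : 0 < w := by linarith
  have hwN : N = w * w := by rw [hw]; exact (Real.mul_self_sqrt (by linarith)).symm
  rw [← hw] at hsnd ⊢
  have hΓn : ‖Matrix.fromRows A B‖ ≤ √R * w := by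
    rw [hw, ← Real.sqrt_mul hR.le]; exact norm_le_of_sq_le hreg.norm_sq_le
  have hBn : ‖B‖ ≤ √R * w := by
    refine le_trans ?_ hΓn
    refine (sq_le_sq₀ (norm_nonneg _) (norm_nonneg _)).1 ?_
    rw [norm_sq_fromRows]; linarith [sq_nonneg ‖A‖]
  have hAn : ‖A‖ ≤ √(R * r) := by
    refine norm_le_of_sq_le ?_
    rw [frobenius_sq]
    calc ∑ i, ∑ j, A i j ^ 2 ≤ ∑ _i : Fin r, R := Finset.sum_le_sum fun i _ =>
          le_trans (le_of_eq (Finset.sum_congr rfl fun j _ => sq _)) (hreg.row_le (Sum.inl i))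
      _ = _ := by simp [mul_comm]
  have hAu : IsUnit A.det := by
    rw [isUnit_iff_ne_zero]; intro h0; rw [h0, abs_zero] at hdet; linarith
  have hAtu : IsUnit Aᵀ.det := by rwa [Matrix.det_transpose]
  have hAi := hh A hAn hdet
  obtain ⟨T, hT⟩ : ∃ T, A' = A * T := ⟨A⁻¹ * A', by
    rw [← Matrix.mul_assoc, Matrix.mul_nonsing_inv _ hAu, Matrix.one_mul]⟩
  -- The upper block A is boundedly invertible, so the error in A'M'A'ᵀ transfers to TM'Tᵀ with T =
  -- A⁻¹A'.
  obtain ⟨E, hE, hEn⟩ : ∃ E, T * M' * Tᵀ = M + E ∧ ‖E‖ ≤ e * τ := by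
    refine ⟨A⁻¹ * (A' * M' * A'ᵀ - A * M * Aᵀ) * Aᵀ⁻¹, ?_, ?_⟩
    · have h1 : A⁻¹ * (A' * M' * A'ᵀ - A * M * Aᵀ) * Aᵀ⁻¹ =
          (A⁻¹ * A) * (T * M' * Tᵀ) * (Aᵀ * Aᵀ⁻¹) - (A⁻¹ * A) * M * (Aᵀ * Aᵀ⁻¹) := by
        rw [hT, Matrix.transpose_mul]
        simp only [Matrix.mul_sub, Matrix.sub_mul, Matrix.mul_assoc]
      rw [h1, Matrix.nonsing_inv_mul _ hAu, Matrix.mul_nonsing_inv _ hAtu]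
      simp
    · refine (frobenius_mul_three _ _ _).trans ?_
      rw [← Matrix.transpose_nonsing_inv, Matrix.frobenius_norm_transpose]
      calc _ ≤ h * (d * τ) * h := by gcongr
        _ = _ := by rw [he]; ring
  obtain ⟨hTu, S, hS, hSP, hTS, hMM⟩ := htri.stability hl hM hm hT hAu hE
    (by linarith [mul_le_mul_of_nonneg_left hEn (Real.sqrt_nonneg (r : ℝ))]) (by linarith)
    (by linarith)
  have hTS' : ‖T - Matrix.diagonal S‖ ≤ x * τ := by
    refine hTS.trans ?_
    rw [hx, mul_assoc _ e τ]; gcongr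
  have hTn : ‖T‖ ≤ √r + x := by
    have h1 := norm_sub_norm_le T (Matrix.diagonal S)
    have h2 := norm_diagonal_sign hS
    have h3 : x * τ ≤ x := mul_le_of_le_one_right hx0 hτ1
    linarith
  have hB := norm_snd_sub_le (φ := d * (τ * w)) hAu hTu hE hl hM hMt' (by linarith) hAi hBn hTS' hTn
    (by rw [← hT]; exact hsnd)
  have hB' : ‖B' - B * Matrix.diagonal S‖ ≤ y * (τ * w) := by
    refine hB.trans ?_
    calc _ ≤ √R * w * (x * τ) + (d * (τ * w) * h + √R * w * (e * τ)) * (2 * r / l) * (√r + x) := by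
          gcongr
      _ = _ := by rw [hy]; ring
  have hA' : ‖A' - A * Matrix.diagonal S‖ ≤ √(R * r) * x * (τ * w) := by
    rw [hT, ← Matrix.mul_sub]
    refine (Matrix.frobenius_norm_mul _ _).trans ?_
    calc _ ≤ √(R * r) * (x * τ) := by gcongr
      _ = √(R * r) * x * (τ * 1) := by ring
      _ ≤ _ := by gcongr
  have hΔ : ‖Matrix.fromRows A' B' - Matrix.fromRows A B * Matrix.diagonal S‖ ≤ z * (τ * w) := by
    have h1 : Matrix.fromRows A' B' - Matrix.fromRows A B * Matrix.diagonal S =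
        Matrix.fromRows (A' - A * Matrix.diagonal S) (B' - B * Matrix.diagonal S) := by
      rw [Matrix.fromRows_mul]
      ext (i | i) j <;> rfl
    rw [h1, hz, add_mul]
    exact (norm_fromRows_le _ _).trans (add_le_add hA' hB')
  -- The restrictions, or the sign of a diagonal entry, already give S k = 1 unless the columns have
  -- nonnegative inner product. In that case a reversed column would differ from the true one by
  -- order √N, contradicting the rate.
  have hS1 : ∀ k, S k = 1 := fun k => by
    rcases hSP k with h1 | h1
    swap
    · exact h1
    refine sign_eq_one hreg.lower ?_ (hS k) h1
    calc _ ≤ z * (τ * w) * (√R * w) := by gcongr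
      _ = z * √R * τ * N := by rw [hwN]; ring
      _ < b * N := mul_lt_mul_of_pos_right (by linarith) (by linarith)
  have hSd : Matrix.diagonal S = 1 := by
    rw [← Matrix.diagonal_one]; congr 1; ext k; exact hS1 k
  rw [hSd, Matrix.mul_one] at hΔ
  refine ⟨hΔ.trans ?_, hMM.trans ?_⟩
  · gcongr; linarith
  · calc _ ≤ u * τ := by rw [hu, mul_assoc _ e τ]; gcongr
      _ ≤ _ := by gcongr; linarith

/-! ### Rates for the variances and the covariance blocks combined; invariance of the likelihood. -/

theorem norm_toBlocks₂₂_le (W : Matrix (κ ⊕ ν) (κ ⊕ ν) ℝ) : ‖W.toBlocks₂₂‖ ≤ ‖W‖ := by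
  refine (sq_le_sq₀ (norm_nonneg _) (norm_nonneg _)).1 ?_
  rw [frobenius_sq, frobenius_sq, Fintype.sum_sum_type]
  refine le_trans (Finset.sum_le_sum fun i _ => ?_) (le_add_of_nonneg_left
    (Finset.sum_nonneg fun i _ => Finset.sum_nonneg fun j _ => sq_nonneg _))
  rw [Fintype.sum_sum_type]
  exact le_add_of_nonneg_left (Finset.sum_nonneg fun j _ => sq_nonneg _)

/-- Convergence rates for the variances and for the blocks of `Γ Γᵀ`. -/
theorem exists_covariance_rate (n κ : Type) [Fintype n] [DecidableEq n] [Fintype κ]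
    [DecidableEq κ] (a b q η : ℝ) (ha : 0 < a) (hb : 0 < b) (hq : 1 ≤ q) (hη : 0 < η) :
    ∃ c τ₀ N₀ : ℝ, 0 < c ∧ 0 < τ₀ ∧ ∀ (ν : Type) [Fintype ν] [DecidableEq ν] (N τ : ℝ)
      (s₁ t₁ : κ → ℝ) (s₂ t₂ : ν → ℝ) (Γ₁ Δ₁ : Matrix κ n ℝ) (Γ₂ Δ₂ : Matrix ν n ℝ)
      (M W : Matrix (κ ⊕ ν) (κ ⊕ ν) ℝ),
      RegularLoading a b N (Matrix.fromRows Γ₁ Γ₂) → VarianceBound q (Sum.elim s₁ s₂) →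
      VarianceBound q (Sum.elim t₁ t₂) → Fintype.card n ≤ Fintype.card ν → M.PosSemidef →
      Wᵀ = W → M = Matrix.diagonal (Sum.elim s₁ s₂) +
        Matrix.fromRows Γ₁ Γ₂ * (Matrix.fromRows Γ₁ Γ₂)ᵀ + W →
      ‖W‖ ≤ τ * N → √(∑ i, W i i ^ 2) ≤ τ * √N → ‖W.toBlocks₁₁‖ ≤ τ →
      ‖W.toBlocks₁₂‖ ≤ τ * √N →
      negLik M (Sum.elim t₁ t₂) (Matrix.fromRows Δ₁ Δ₂) ≤
        negLik M (Sum.elim s₁ s₂) (Matrix.fromRows Γ₁ Γ₂) →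
      (∑ i, (t₂ i - s₂ i) ^ 2 ≤ η * N → ∀ Γ' : Matrix ν n ℝ, ‖Γ' - Γ₂‖ ^ 2 ≤ η * N →
        negLik M (Sum.elim t₁ t₂) (Matrix.fromRows Δ₁ Δ₂) ≤
          negLik M (Sum.elim s₁ t₂) (Matrix.fromRows Γ₁ Γ')) →
      N₀ ≤ N → τ ≤ τ₀ →
      ∑ i, (Sum.elim t₁ t₂ i - Sum.elim s₁ s₂ i) ^ 2 ≤ c * (τ ^ 2 * N) ∧
      ‖Δ₁ * Δ₁ᵀ - Γ₁ * Γ₁ᵀ‖ ≤ c * τ ∧ ‖Δ₂ * Δ₁ᵀ - Γ₂ * Γ₁ᵀ‖ ≤ c * (τ * √N) ∧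
      ‖Δ₂ * Δ₂ᵀ - Γ₂ * Γ₂ᵀ‖ ≤ c * (τ * N) := by
  obtain ⟨d, τ₁, N₁, hd, hτ₁, hB⟩ := exists_variance_colSpace_rate n a b q ha hb hq
  obtain ⟨c, τ₂, N₂, hc, hτ₂, hC⟩ := exists_block_rate n κ a b q d η hb hq hd hη
  refine ⟨max d c, min (min τ₁ τ₂) (min 1 (η / d)), max N₁ N₂, lt_max_of_lt_left hd,
    by positivity, ?_⟩
  intro ν _ _ N τ s₁ t₁ s₂ t₂ Γ₁ Δ₁ Γ₂ Δ₂ M W hreg hs ht hcard hMp hWt hM hW hWd hW11 hW12 hlik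
    hcomp hN hτ
  have hτ0 : 0 ≤ τ := (norm_nonneg _).trans hW11
  have hNp := hreg.N_pos
  have hτ' := hτ.trans (min_le_right _ _)
  have hτ1 : τ ≤ 1 := hτ'.trans (min_le_left _ _)
  -- For small τ the variances are already within the radius η, where the likelihood comparison with
  -- competitors is assumed.
  have hτη : τ * d ≤ η := by
    have := hτ'.trans (min_le_right _ _)
    rwa [le_div_iff₀ hd] at this
  have hτ3 := hτ.trans (min_le_left _ _)
  obtain ⟨hvar, hcol⟩ := hB (κ ⊕ ν) N τ _ _ _ (Matrix.fromRows Δ₁ Δ₂) M W hreg hs ht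
    (hcard.trans (by rw [Fintype.card_sum]; exact Nat.le_add_left _ _)) hMp hM hW hWd
    ((le_max_left _ _).trans hN) (hτ3.trans (min_le_left _ _)) hlik
  have hvar2 : ∑ i, (t₂ i - s₂ i) ^ 2 ≤ d * (τ ^ 2 * N) := by
    refine le_trans ?_ hvar
    rw [Fintype.sum_sum_type]
    exact le_add_of_nonneg_left (Finset.sum_nonneg fun i _ => sq_nonneg _)
  have hWb : W = Matrix.fromBlocks W.toBlocks₁₁ W.toBlocks₁₂ W.toBlocks₁₂ᵀ W.toBlocks₂₂ := by
    conv_lhs => rw [← Matrix.fromBlocks_toBlocks W]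
    rw [Matrix.fromBlocks_inj]
    refine ⟨rfl, rfl, ?_, rfl⟩
    conv_lhs => rw [← hWt]
    rfl
  obtain ⟨h1, h2, h3⟩ := hC ν N τ s₁ t₁ s₂ t₂ Γ₁ Δ₁ Γ₂ Δ₂ W.toBlocks₁₁ W.toBlocks₁₂ W.toBlocks₂₂ M
    hreg hs ht hcard (by rw [← hWb]; exact hM) hW11 hW12 ((norm_toBlocks₂₂_le W).trans hW) hvar2
    hcol (hcomp (hvar2.trans (by
      have : τ ^ 2 ≤ τ := by rw [sq]; exact mul_le_of_le_one_left hτ0 hτ1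
      calc d * (τ ^ 2 * N) ≤ d * (τ * N) := by gcongr
        _ = (τ * d) * N := by ring
        _ ≤ _ := by gcongr)))
    ((le_max_right _ _).trans hN) (hτ3.trans (min_le_right _ _))
  have hdm : d ≤ max d c := le_max_left _ _
  have hcm : c ≤ max d c := le_max_right _ _
  exact ⟨hvar.trans (by gcongr), h1.trans (by gcongr), h2.trans (by gcongr), h3.trans (by gcongr)⟩

theorem negLik_submatrix (e : m ≃ ι) (M : Matrix ι ι ℝ) (s : ι → ℝ) (Γ : Matrix ι n ℝ) :
    negLik (M.submatrix e e) (s ∘ e) (Γ.submatrix e id) = negLik M s Γ := by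
  have h : Matrix.diagonal (s ∘ e) + Γ.submatrix e id * (Γ.submatrix e id)ᵀ =
      (Matrix.diagonal s + Γ * Γᵀ).submatrix e e := by
    ext i j
    simp [Matrix.diagonal_apply, Matrix.mul_apply, e.injective.eq_iff]
  rw [negLik, negLik, h, Matrix.det_submatrix_equiv_self, Matrix.inv_submatrix_equiv,
    Matrix.submatrix_mul_equiv]
  congr 1
  exact Equiv.sum_comp e fun i => (M * (Matrix.diagonal s + Γ * Γᵀ)⁻¹) i i

theorem RegularLoading.submatrix {a b N : ℝ} {Γ : Matrix ι n ℝ} (h : RegularLoading a b N Γ)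
    (e : m ≃ ι) : RegularLoading a b N (Γ.submatrix e id) := by
  refine ⟨h.a_pos, h.b_pos, h.N_pos, ?_, fun i => h.row_le (e i), fun v => ?_⟩
  · rw [Fintype.card_congr e]; exact h.card_le
  · refine (h.lower v).trans (le_of_eq ?_)
    exact (Equiv.sum_comp e fun i => (Γ *ᵥ v) i * (Γ *ᵥ v) i).symm

theorem VarianceBound.comp {q : ℝ} {s : ι → ℝ} (h : VarianceBound q s) (e : m → ι) :
    VarianceBound q (s ∘ e) := ⟨h.one_le, fun i => h.lower (e i), fun i => h.upper (e i)⟩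

/-- The likelihood depends on the loadings only through `Γ Γᵀ`. -/
theorem negLik_congr (M : Matrix ι ι ℝ) (s : ι → ℝ) {Γ : Matrix ι n ℝ} {Δ : Matrix ι m ℝ}
    (h : Γ * Γᵀ = Δ * Δᵀ) : negLik M s Γ = negLik M s Δ := by
  rw [negLik, negLik, h]

/-! ### From parameters of the factor model to normalized loadings. -/

variable {N r : ℕ}

theorem logLik_eq_negLik (M : Matrix (Fin N) (Fin N) ℝ) (θ : FactorParam N r)
    {b : Matrix (Fin r) (Fin r) ℝ} (hb : θ.moment = b * bᵀ) :
    θ.logLik M = -(1 / (2 * (N : ℝ))) * negLik M θ.variance (θ.loading * b) := by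
  have h : θ.sigmaZZ = Matrix.diagonal θ.variance + θ.loading * b * (θ.loading * b)ᵀ := by
    rw [FactorParam.sigmaZZ, FactorParam.sigmaEE, hb, Matrix.transpose_mul, add_comm]
    simp only [Matrix.mul_assoc]
  rw [FactorParam.logLik, negLik, h]; ring

theorem negLik_le_of_isMLE {C : ℝ} {ic : IdentCond} {M : Matrix (Fin N) (Fin N) ℝ} (hN : 0 < N)
    {θ θ' : FactorParam N r} (h : IsMLE C ic M θ) (hθ' : θ' ∈ paramSet N r C ic)
    {b b' : Matrix (Fin r) (Fin r) ℝ} (hb : θ.moment = b * bᵀ) (hb' : θ'.moment = b' * b'ᵀ) :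
    negLik M θ.variance (θ.loading * b) ≤ negLik M θ'.variance (θ'.loading * b') := by
  have h1 : θ'.logLik M ≤ θ.logLik M := h.2 hθ'
  rw [logLik_eq_negLik M θ hb, logLik_eq_negLik M θ' hb'] at h1
  have h2 : (0 : ℝ) < 1 / (2 * (N : ℝ)) := by
    have : (0 : ℝ) < N := by exact_mod_cast hN
    positivity
  have h3 : 1 / (2 * (N : ℝ)) * negLik M θ.variance (θ.loading * b) ≤
    1 / (2 * (N : ℝ)) * negLik M θ'.variance (θ'.loading * b') := by linarith
  exact le_of_mul_le_mul_left h3 h2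

/-- Bounds on the parameters that hold uniformly in the sample sizes. -/
structure RegularParam (C m w : ℝ) (θ : FactorParam N r) : Prop where
  variance : VarianceBound (C ^ 2) θ.variance
  loading : ∀ i, θ.loading i ⬝ᵥ θ.loading i ≤ C ^ 2
  moment_posSemidef : θ.moment.PosSemidef
  moment_le : ∀ k l, |θ.moment k l| ≤ C
  moment_lower : ∀ v, m * (v ⬝ᵥ v) ≤ v ⬝ᵥ θ.moment *ᵥ v
  weightedMoment_lower : ∀ v, w * (v ⬝ᵥ v) ≤ v ⬝ᵥ θ.weightedMoment *ᵥ v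

theorem RegularParam.norm_moment_le {C m w : ℝ} {θ : FactorParam N r} (h : RegularParam C m w θ) :
    ‖θ.moment‖ ≤ √(r * r * C ^ 2) := by
  have := norm_le_of_forall_abs_le h.moment_le
  rwa [Fintype.card_fin] at this

theorem weightedMoment_eq {C : ℝ} {θ : FactorParam N r} (h : VarianceBound C θ.variance) :
    θ.weightedMoment = (N : ℝ)⁻¹ •
      (θ.loadingᵀ * Matrix.diagonal (fun i => (θ.variance i)⁻¹) * θ.loading) := by
  rw [FactorParam.weightedMoment, FactorParam.sigmaEE, inv_diagonal_of_pos h.pos]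

/-- The loadings of a regular parameter, after normalization of the factors. -/
theorem RegularParam.regularLoading {C m w : ℝ} {θ : FactorParam N r} (h : RegularParam C m w θ)
    (hN : 0 < N) (hm : 0 < m) (hw : 0 < w) {b : Matrix (Fin r) (Fin r) ℝ}
    (hb : θ.moment = b * bᵀ) :
    RegularLoading (C ^ 2) (w / C ^ 2) N θ.loading ∧
    RegularLoading (√(r * r * C ^ 2) * C ^ 2 + 1) (w / C ^ 2 * m) N (θ.loading * b) := by
  have hN' : (0 : ℝ) < N := by exact_mod_cast hN
  have hC2 := h.variance.q_pos
  have hlow : ∀ v, w / C ^ 2 * N * (v ⬝ᵥ v) ≤ (θ.loading *ᵥ v) ⬝ᵥ (θ.loading *ᵥ v) := fun v => by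
    have h1 := h.weightedMoment_lower v
    rw [weightedMoment_eq h.variance, Matrix.smul_mulVec, dotProduct_smul, smul_eq_mul,
      quadForm_weighted] at h1
    have h2 : ∑ i, (θ.variance i)⁻¹ * (θ.loading *ᵥ v) i ^ 2 ≤
        C ^ 2 * ((θ.loading *ᵥ v) ⬝ᵥ (θ.loading *ᵥ v)) := by
      rw [dotProduct, Finset.mul_sum]
      refine Finset.sum_le_sum fun i _ => ?_
      rw [← sq]
      exact mul_le_mul_of_nonneg_right (h.variance.inv_le i) (sq_nonneg _)
    have h3 : w * (v ⬝ᵥ v) ≤ (N : ℝ)⁻¹ * (C ^ 2 * ((θ.loading *ᵥ v) ⬝ᵥ (θ.loading *ᵥ v))) :=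
      h1.trans (mul_le_mul_of_nonneg_left h2 (inv_nonneg.2 hN'.le))
    rw [inv_mul_eq_div, le_div_iff₀ hN'] at h3
    rw [div_mul_eq_mul_div, div_mul_eq_mul_div, div_le_iff₀ hC2]
    linarith
  refine ⟨⟨hC2, by positivity, hN', by simp, h.loading, hlow⟩,
    ⟨by positivity, by positivity, hN', by simp, fun i => ?_, fun v => ?_⟩⟩
  · have h1 : (θ.loading * b) i ⬝ᵥ (θ.loading * b) i = (θ.loading * θ.moment * θ.loadingᵀ) i i := by
      rw [hb, ← Matrix.mul_assoc, Matrix.mul_assoc _ bᵀ, ← Matrix.transpose_mul]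
      rfl
    rw [h1, mul_mul_transpose_diag]
    have h2 := (le_abs_self _).trans (abs_quadForm_le θ.moment (θ.loading i))
    have h3 : ‖θ.moment‖ * (θ.loading i ⬝ᵥ θ.loading i) ≤ √(r * r * C ^ 2) * C ^ 2 :=
      mul_le_mul h.norm_moment_le (h.loading i) (dotProduct_self_nonneg' _) (Real.sqrt_nonneg _)
    linarith
  · rw [← Matrix.mulVec_mulVec]
    refine le_trans ?_ (hlow _)
    have h1 := lower_mul_transpose_of_lower (g := bᵀ) hm
      (fun v => by rw [Matrix.transpose_transpose, ← hb]; exact h.moment_lower v) v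
    rw [Matrix.transpose_transpose, quadForm_transpose_mul_self] at h1
    calc _ = w / C ^ 2 * N * (m * (v ⬝ᵥ v)) := by ring
      _ ≤ _ := mul_le_mul_of_nonneg_left h1 (by positivity)

/-- The sampling error of the second moments of the data is of order `τ`. -/
structure SmallNoise (r : ℕ) (τ : ℝ) (W : Matrix (Fin N) (Fin N) ℝ) : Prop where
  nonneg : 0 ≤ τ
  symm : Wᵀ = W
  all : ∑ i, ∑ j, W i j ^ 2 ≤ (τ * N) ^ 2
  diag : ∑ i, W i i ^ 2 ≤ (τ * √N) ^ 2
  rows : ∑ i : Fin N, (if i.val < r then ∑ j, W i j ^ 2 else 0) ≤ (τ * √N) ^ 2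
  corner : ∑ i : Fin N, (if i.val < r then
    ∑ j : Fin N, (if j.val < r then W i j ^ 2 else 0) else 0) ≤ τ ^ 2

/-- The three estimation errors are of order `τ`. -/
structure ErrorBound (c τ : ℝ) (θ' θ : FactorParam N r) : Prop where
  loading : ∑ i, ∑ k, (θ'.loading i k - θ.loading i k) ^ 2 ≤ c * (τ ^ 2 * N)
  variance : ∑ i, (θ'.variance i - θ.variance i) ^ 2 ≤ c * (τ ^ 2 * N)
  moment : ∑ k, ∑ l, (θ'.moment k l - θ.moment k l) ^ 2 ≤ c * τ ^ 2

theorem varianceBound_of_mem {C : ℝ} {ic : IdentCond} {θ : FactorParam N r} (hC : 1 ≤ C ^ 2)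
    (h : θ ∈ paramSet N r C ic) : VarianceBound (C ^ 2) θ.variance :=
  ⟨hC, fun i => (h.1 i).1, fun i => (h.1 i).2⟩

end FrobeniusNorm

/-! ### The estimation error under IC1, IC4 and IC5. -/

section FrobeniusNorm

attribute [local instance] Matrix.frobeniusNormedAddCommGroup Matrix.frobeniusNormedSpace

variable {ι κ ν m n : Type*} [Fintype ι] [Fintype κ] [Fintype ν] [Fintype m] [Fintype n]
  [DecidableEq ι] [DecidableEq κ] [DecidableEq ν] [DecidableEq m] [DecidableEq n]

theorem exists_splitEquiv {N r : ℕ} (h : r ≤ N) : ∃ e : Fin r ⊕ Fin (N - r) ≃ Fin N,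
    (∀ i, (e (Sum.inl i)).val = i.val) ∧ ∀ j, r ≤ (e (Sum.inr j)).val :=
  ⟨finSumFinEquiv.trans (finCongr (Nat.add_sub_cancel' h)), fun i => by simp, fun j => by simp⟩

theorem sum_ite_lt {N r : ℕ} {e : Fin r ⊕ Fin (N - r) ≃ Fin N}
    (h1 : ∀ i, (e (Sum.inl i)).val = i.val) (h2 : ∀ j, r ≤ (e (Sum.inr j)).val) (f : Fin N → ℝ) :
    ∑ i : Fin N, (if i.val < r then f i else 0) = ∑ i : Fin r, f (e (Sum.inl i)) := by
  rw [← Equiv.sum_comp e, Fintype.sum_sum_type]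
  have : ∀ j, ¬ (e (Sum.inr j)).val < r := fun j => not_lt.2 (h2 j)
  simp [h1, this]

variable {N r : ℕ}

theorem SmallNoise.norm_le {τ : ℝ} {W : Matrix (Fin N) (Fin N) ℝ} (h : SmallNoise r τ W)
    (e : ι ≃ Fin N) : ‖W.submatrix e e‖ ≤ τ * N ∧ √(∑ i, W.submatrix e e i i ^ 2) ≤ τ * √N := by
  have h0 := h.nonneg
  constructor
  · refine (sq_le_sq₀ (norm_nonneg _) (by positivity)).1 ?_
    rw [frobenius_sq]
    refine le_trans (le_of_eq ?_) h.all
    rw [← Equiv.sum_comp e]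
    exact Finset.sum_congr rfl fun i _ => Equiv.sum_comp e fun j => W (e i) j ^ 2
  · rw [Real.sqrt_le_left (by positivity)]
    exact le_trans (le_of_eq (Equiv.sum_comp e fun i => W i i ^ 2)) h.diag

theorem SmallNoise.norm_blocks_le {τ : ℝ} {W : Matrix (Fin N) (Fin N) ℝ} (h : SmallNoise r τ W)
    {e : Fin r ⊕ Fin (N - r) ≃ Fin N} (h1 : ∀ i, (e (Sum.inl i)).val = i.val)
    (h2 : ∀ j, r ≤ (e (Sum.inr j)).val) :
    ‖(W.submatrix e e).toBlocks₁₁‖ ≤ τ ∧ ‖(W.submatrix e e).toBlocks₁₂‖ ≤ τ * √N := by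
  have h0 := h.nonneg
  constructor
  · refine (sq_le_sq₀ (norm_nonneg _) h0).1 ?_
    rw [frobenius_sq]
    refine le_trans (le_of_eq ?_) h.corner
    rw [sum_ite_lt h1 h2]
    refine Finset.sum_congr rfl fun i _ => ?_
    rw [sum_ite_lt h1 h2]
    rfl
  · refine (sq_le_sq₀ (norm_nonneg _) (by positivity)).1 ?_
    rw [frobenius_sq]
    refine le_trans ?_ h.rows
    rw [sum_ite_lt h1 h2]
    refine Finset.sum_le_sum fun i _ => ?_
    rw [← Equiv.sum_comp e, Fintype.sum_sum_type]
    exact le_add_of_nonneg_left (Finset.sum_nonneg fun _ _ => sq_nonneg _)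

/-- The identifying restrictions that concern the first rows of the loadings. -/
def IdentCond.IsTriangular : IdentCond → Prop
  | .IC1 | .IC4 | .IC5 => True
  | .IC2 | .IC3 => False

/-- This makes the competitor feasible: the variances and the rows beyond the first r are free. -/
theorem IdentCond.IsTriangular.holds_congr {ic : IdentCond} (h : ic.IsTriangular)
    {θ θ' : FactorParam N r} (hm : θ'.moment = θ.moment)
    (hl : ∀ i k, i.val < r → θ'.loading i k = θ.loading i k) (hθ : ic.Holds θ) : ic.Holds θ' := by
  cases ic with
  | IC1 => exact fun i k hi => (hl i k hi).trans (hθ i k hi)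
  | IC2 => exact h.elim
  | IC3 => exact h.elim
  | IC4 =>
    refine ⟨hm ▸ hθ.1, fun i k => ⟨fun hi => ?_, fun hi => ?_⟩⟩
    · rw [hl i k (hi ▸ k.isLt)]; exact (hθ.2 i k).1 hi
    · rw [hl i k (hi.trans k.isLt)]; exact (hθ.2 i k).2 hi
  | IC5 =>
    refine ⟨hm ▸ hθ.1, fun i k => ⟨fun hi => ?_, fun hi => ?_⟩⟩
    · rw [hl i k (hi ▸ k.isLt)]; exact (hθ.2 i k).1 hi
    · rw [hl i k (hi.trans k.isLt)]; exact (hθ.2 i k).2 hi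

/-- The restrictions in terms of the upper blocks of the loadings. -/
theorem IdentCond.IsTriangular.restriction {ic : IdentCond} (h : ic.IsTriangular)
    {θ θ' : FactorParam N r} (hθ : ic.Holds θ) (hθ' : ic.Holds θ') (hs : ic.SameSigns θ' θ)
    {u : Fin r → Fin N} (hu : ∀ i, (u i).val = i.val) {c : ℝ} (hc : 0 < c)
    (hc5 : ic = .IC5 → ∀ (i : Fin N) (k : Fin r), i.val = k.val → c ≤ |θ.loading i k|) :
    TriangularRestriction (θ.loading.submatrix u id) (θ'.loading.submatrix u id) θ.moment
      θ'.moment (fun k => 0 ≤ ∑ i, θ'.loading i k * θ.loading i k) ∧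
    min 1 (c ^ r) ≤ |(θ.loading.submatrix u id).det| := by
  have hdet : ∀ A : Matrix (Fin r) (Fin r) ℝ, (∀ i j, i < j → A i j = 0) →
      A.det = ∏ i, A i i := fun A hA => Matrix.det_of_isLowerTriangular A fun i j hij => hA i j hij
  cases ic with
  | IC1 =>
    have h1 : ∀ θ : FactorParam N r, IdentCond.Holds .IC1 θ → θ.loading.submatrix u id = 1 := by
      intro θ hθ
      ext i k
      rw [Matrix.submatrix_apply, hθ (u i) (id k) (by rw [hu]; exact i.isLt), hu,
        Matrix.one_apply]
      simp [Fin.ext_iff]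
    refine ⟨.one (h1 θ hθ) (h1 θ' hθ'), ?_⟩
    rw [h1 θ hθ]; simp
  | IC2 => exact h.elim
  | IC3 => exact h.elim
  | IC4 =>
    have h1 : ∀ θ : FactorParam N r, IdentCond.Holds .IC4 θ →
        (∀ i j, i < j → θ.loading.submatrix u id i j = 0) ∧
          ∀ i, θ.loading.submatrix u id i i = 1 := fun θ hθ =>
      ⟨fun i j hij => (hθ.2 (u i) j).2 (by rw [hu]; exact hij), fun i => (hθ.2 (u i) i).1 (hu i)⟩
    refine ⟨.unit (h1 θ hθ).1 (h1 θ hθ).2 (h1 θ' hθ').1 (h1 θ' hθ').2 hθ.1 hθ'.1, ?_⟩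
    rw [hdet _ (h1 θ hθ).1]
    simp only [(h1 θ hθ).2]; simp
  | IC5 =>
    have h1 : ∀ θ : FactorParam N r, IdentCond.Holds .IC5 θ →
        (∀ i j, i < j → θ.loading.submatrix u id i j = 0) ∧
          ∀ i, θ.loading.submatrix u id i i ≠ 0 := fun θ hθ =>
      ⟨fun i j hij => (hθ.2 (u i) j).2 (by rw [hu]; exact hij), fun i => (hθ.2 (u i) i).1 (hu i)⟩
    refine ⟨.lower (h1 θ hθ).1 (h1 θ hθ).2 (h1 θ' hθ').1 (h1 θ' hθ').2 hθ.1 hθ'.1 fun k => ?_, ?_⟩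
    · refine (hs k).imp_right ?_
      rintro ⟨i, hi, hpos⟩
      have : i = u k := Fin.ext (by rw [hu, hi])
      rwa [this] at hpos
    · rw [hdet _ (h1 θ hθ).1, Finset.abs_prod]
      refine (min_le_right _ _).trans ?_
      calc c ^ r = ∏ _i : Fin r, c := by simp
        _ ≤ _ := Finset.prod_le_prod (fun _ _ => hc.le) fun i _ => hc5 rfl (u i) i (hu i)

set_option maxHeartbeats 1000000 in
-- The block κ consists of the first r variables. A competitor that keeps their true loadings and
-- the true M_ff obeys the restrictions whatever its other rows are, so the radius of comparison
-- plays no role and is set to 1. The two blocks of ΔΔᵀ that involve the first rows then determine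
-- all the loadings.
theorem exists_errorBound_of_isTriangular (r : ℕ) (C m w c₀ : ℝ) (hC : 1 ≤ C ^ 2) (hm : 0 < m)
    (hw : 0 < w) (hc₀ : 0 < c₀) {ic : IdentCond} (hic : ic.IsTriangular) :
    ∃ c τ₀ N₀ : ℝ, 0 < c ∧ 0 < τ₀ ∧ ∀ (N : ℕ) (τ : ℝ) (M W : Matrix (Fin N) (Fin N) ℝ)
      (θ θ' : FactorParam N r), RegularParam C m w θ → θ ∈ paramSet N r C ic →
      (ic = .IC5 → ∀ (i : Fin N) (k : Fin r), i.val = k.val → c₀ ≤ |θ.loading i k|) →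
      IsMLE C ic M θ' → ic.SameSigns θ' θ → M.PosSemidef → M = θ.sigmaZZ + W →
      SmallNoise r τ W → N₀ ≤ N → τ ≤ τ₀ → ErrorBound c τ θ' θ := by
  have hC0 : 0 < C ^ 2 := by linarith
  obtain ⟨a, ha⟩ : ∃ a : ℝ, a = √(r * r * C ^ 2) * C ^ 2 + 1 := ⟨_, rfl⟩
  obtain ⟨b, hb⟩ : ∃ b : ℝ, b = w / C ^ 2 * m := ⟨_, rfl⟩
  have ha0 : 0 < a := by rw [ha]; positivity
  have hb0 : 0 < b := by rw [hb]; positivity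
  obtain ⟨d, τ₁, N₁, hd, hτ₁, hcov⟩ :=
    exists_covariance_rate (Fin r) (Fin r) a b (C ^ 2) 1 ha0 hb0 hC one_pos
  obtain ⟨c, τ₂, hc, hτ₂, htri⟩ := exists_triangular_rate r (C ^ 2) (w / C ^ 2) m
    (√(r * r * C ^ 2)) d (min 1 (c₀ ^ r)) hC0 (by positivity) hm (Real.sqrt_nonneg _) hd
    (by positivity)
  refine ⟨c ^ 2 + d, min τ₁ τ₂, max N₁ (2 * r + 1), by positivity, by positivity, ?_⟩
  intro N τ M W θ θ' hreg hθ hc5 hmle hsign hMp hM hW hN hτ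
  -- At least r variables must remain beyond the first r, so that r orthonormal columns fit there.
  have hN2 : 2 * r + 1 ≤ N := by exact_mod_cast (le_max_right _ _).trans hN
  have hN0 : 0 < N := by omega
  have hN1 : (1 : ℝ) ≤ N := by exact_mod_cast hN0
  obtain ⟨e, he1, he2⟩ := exists_splitEquiv (show r ≤ N by omega)
  obtain ⟨β, hβ⟩ := exists_eq_mul_transpose hreg.moment_posSemidef
  obtain ⟨β', hβ'⟩ := exists_eq_mul_transpose hmle.1.2.1
  obtain ⟨hL1, hL2⟩ := hreg.regularLoading hN0 hm hw hβ
  rw [← ha, ← hb] at hL2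
  have hMd := posDef_of_lower (by simpa [Matrix.IsHermitian] using hreg.moment_posSemidef.isHermitian)
    hm hreg.moment_lower
  have hβu : IsUnit β.det := by
    have := posDef_isUnit_det hMd
    rw [hβ, Matrix.det_mul] at this
    exact isUnit_of_mul_isUnit_left this
  set A := θ.loading.submatrix (fun i : Fin r => e (Sum.inl i)) id with hA
  set A' := θ'.loading.submatrix (fun i : Fin r => e (Sum.inl i)) id with hA'
  set B := θ.loading.submatrix (fun i : Fin (N - r) => e (Sum.inr i)) id with hB
  set B' := θ'.loading.submatrix (fun i : Fin (N - r) => e (Sum.inr i)) id with hB'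
  have hAB : Matrix.fromRows A B = θ.loading.submatrix e id := by ext (i | i) j <;> rfl
  have hAB' : Matrix.fromRows A' B' = θ'.loading.submatrix e id := by ext (i | i) j <;> rfl
  have hABb : Matrix.fromRows (A * β) (B * β) = (θ.loading * β).submatrix e id := by
    ext (i | i) j <;> rfl
  have hABb' : Matrix.fromRows (A' * β') (B' * β') = (θ'.loading * β').submatrix e id := by
    ext (i | i) j <;> rfl
  have hsplit : ∀ s : Fin N → ℝ, Sum.elim (fun i => s (e (Sum.inl i)))
      (fun i => s (e (Sum.inr i))) = s ∘ e := fun s => by ext (i | i) <;> rfl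
  have hMe : M.submatrix e e = Matrix.diagonal (Sum.elim (fun i => θ.variance (e (Sum.inl i)))
      (fun i => θ.variance (e (Sum.inr i)))) + Matrix.fromRows (A * β) (B * β) *
        (Matrix.fromRows (A * β) (B * β))ᵀ + W.submatrix e e := by
    rw [hsplit, hABb, hM, FactorParam.sigmaZZ, FactorParam.sigmaEE, hβ]
    ext i j
    have : θ.loading * (β * βᵀ) * θ.loadingᵀ = (θ.loading * β) * (θ.loading * β)ᵀ := by
      rw [Matrix.transpose_mul]; simp only [Matrix.mul_assoc]
    rw [this]
    simp [Matrix.diagonal_apply, Matrix.mul_apply, e.injective.eq_iff, add_comm]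
  obtain ⟨hW1, hW2⟩ := hW.norm_le e
  obtain ⟨hW3, hW4⟩ := hW.norm_blocks_le he1 he2
  have hvb' := varianceBound_of_mem hC hmle.1
  obtain ⟨r1, r2, r3, -⟩ := hcov (Fin (N - r)) N τ _ (fun i => θ'.variance (e (Sum.inl i))) _
    (fun i => θ'.variance (e (Sum.inr i))) (A * β) (A' * β') (B * β) (B' * β') (M.submatrix e e)
    (W.submatrix e e) (by rw [hABb]; exact hL2.submatrix e)
    (by rw [hsplit]; exact hreg.variance.comp e) (by rw [hsplit]; exact hvb'.comp e)
    (by simp only [Fintype.card_fin]; omega) (hMp.submatrix e)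
    (by rw [Matrix.transpose_submatrix, hW.symm]) hMe hW1 hW2 hW3 hW4
    (by
      rw [hsplit, hsplit, hABb, hABb', negLik_submatrix, negLik_submatrix]
      exact negLik_le_of_isMLE hN0 hmle hθ hβ' hβ)
    (by
      intro _ Γ' _
      set s := Sum.elim (fun i => θ.variance (e (Sum.inl i)))
        (fun i => θ'.variance (e (Sum.inr i))) with hs
      -- True M_ff, true loadings and variances of the first variables, estimated variances of the
      -- others. As Γ' refers to normalized loadings, it is divided by the root β of M_ff.
      let θ₁ : FactorParam N r := ⟨(Matrix.fromRows A (Γ' * β⁻¹)).submatrix e.symm id,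
        s ∘ e.symm, θ.moment⟩
      have hrow : ∀ i k, i.val < r → θ₁.loading i k = θ.loading i k := by
        intro i k hi
        obtain ⟨x, rfl⟩ := e.surjective i
        rcases x with x | x
        · simp [θ₁, hA]
        · exact absurd hi (not_lt.2 (he2 x))
      have hmem : θ₁ ∈ paramSet N r C ic := by
        refine ⟨fun i => ?_, hθ.2.1, hθ.2.2.1, hic.holds_congr (θ := θ) (θ' := θ₁) rfl hrow hθ.2.2.2⟩
        obtain ⟨x, rfl⟩ := e.surjective i
        rcases x with x | x
        · simpa [θ₁, hs] using hθ.1 (e (Sum.inl x))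
        · simpa [θ₁, hs] using hmle.1.1 (e (Sum.inr x))
      have h1 := negLik_le_of_isMLE hN0 hmle hmem hβ' (show θ₁.moment = β * βᵀ from hβ)
      rw [← negLik_submatrix e M θ'.variance, ← negLik_submatrix e M θ₁.variance] at h1
      have h2 : θ₁.variance ∘ e = s := by ext x; simp [θ₁]
      have h3 : (θ₁.loading * β).submatrix e id = Matrix.fromRows (A * β) Γ' := by
        have h4 : (θ₁.loading * β).submatrix e id = Matrix.fromRows A (Γ' * β⁻¹) * β := by
          ext x k; simp [θ₁, Matrix.mul_apply]
        rw [h4, Matrix.fromRows_mul, Matrix.mul_assoc, Matrix.nonsing_inv_mul _ hβu,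
          Matrix.mul_one]
      rw [h2, h3] at h1
      rw [hsplit, hABb']
      exact h1)
    ((le_max_left _ _).trans hN) (hτ.trans (min_le_left _ _))
  obtain ⟨htr, hdet⟩ := hic.restriction hθ.2.2.2 hmle.1.2.2.2 hsign
    (u := fun i : Fin r => e (Sum.inl i)) he1 hc₀ hc5
  have hprod : ∀ (κ ν : Type) (X : Matrix κ (Fin r) ℝ) (Y : Matrix ν (Fin r) ℝ)
      (β : Matrix (Fin r) (Fin r) ℝ), (X * β) * (Y * β)ᵀ = X * (β * βᵀ) * Yᵀ :=
    fun κ ν X Y β => by rw [Matrix.transpose_mul]; simp only [Matrix.mul_assoc]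
  have hτ0 := hW.nonneg
  rw [hprod, hprod, ← hβ, ← hβ'] at r2 r3
  obtain ⟨f1, f2⟩ := htri (Fin (N - r)) N τ A A' θ.moment θ'.moment B B'
    (by rw [hAB]; exact hL1.submatrix e) hN1 hdet hreg.moment_lower hreg.norm_moment_le
    (by simpa [Matrix.IsHermitian] using hmle.1.2.1.isHermitian) hτ0
    (hτ.trans (min_le_right _ _)) r2 r3 (by
      convert htr using 3
      rw [← Equiv.sum_comp e, hAB, hAB']
      rfl)
  have hdc : d ≤ c ^ 2 + d := by linarith [sq_nonneg c]
  have hcd : c ^ 2 ≤ c ^ 2 + d := by linarith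
  refine ⟨?_, ?_, ?_⟩
  · rw [hAB, hAB'] at f1
    have h1 := pow_le_pow_left₀ (norm_nonneg _) f1 2
    rw [frobenius_sq, mul_pow, mul_pow, Real.sq_sqrt (by linarith)] at h1
    rw [← Equiv.sum_comp e]
    exact h1.trans (by gcongr)
  · rw [hsplit, hsplit] at r1
    rw [← Equiv.sum_comp e]
    exact r1.trans (by gcongr)
  · have h1 := pow_le_pow_left₀ (norm_nonneg _) f2 2
    rw [frobenius_sq, mul_pow] at h1
    exact h1.trans (by gcongr)

end FrobeniusNorm

/-! ### The estimation error under IC2 and IC3. -/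

section FrobeniusNorm

attribute [local instance] Matrix.frobeniusNormedAddCommGroup Matrix.frobeniusNormedSpace

variable {ι κ ν m n : Type*} [Fintype ι] [Fintype κ] [Fintype ν] [Fintype m] [Fintype n]
  [DecidableEq ι] [DecidableEq κ] [DecidableEq ν] [DecidableEq m] [DecidableEq n]

/-- Orthogonal diagonalization with the eigenvalues in decreasing order. -/
theorem exists_antitone_diagonalization {r : ℕ} {A : Matrix (Fin r) (Fin r) ℝ} (hA : Aᵀ = A) :
    ∃ (V : Matrix (Fin r) (Fin r) ℝ) (D : Fin r → ℝ), Vᵀ * V = 1 ∧ V * Vᵀ = 1 ∧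
      A * V = V * Matrix.diagonal D ∧ Antitone D := by
  have hH : A.IsHermitian := by simpa [Matrix.IsHermitian] using hA
  set σ := Tuple.sort (fun i => -hH.eigenvalues i) with hσ
  have hmono := Tuple.monotone_sort (fun i => -hH.eigenvalues i)
  set V : Matrix (Fin r) (Fin r) ℝ := Matrix.of fun i j => hH.eigenvectorBasis (σ j) i with hV
  have hVV : Vᵀ * V = 1 := by
    ext i j
    rw [Matrix.mul_apply]
    have h1 := orthonormal_iff_ite.1 hH.eigenvectorBasis.orthonormal (σ i) (σ j)
    rw [PiLp.inner_apply] at h1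
    simp only [RCLike.inner_apply, conj_trivial, σ.injective.eq_iff] at h1
    rw [Matrix.one_apply, ← h1]
    exact Finset.sum_congr rfl fun k _ => mul_comm _ _
  refine ⟨V, fun i => hH.eigenvalues (σ i), hVV, mul_eq_one_comm.1 hVV, ?_, ?_⟩
  · ext i j
    have h1 := congrFun (hH.mulVec_eigenvectorBasis (σ j)) i
    rw [Matrix.mul_diagonal, Matrix.mul_apply]
    simp only [Pi.smul_apply, smul_eq_mul] at h1
    rw [hV, Matrix.of_apply, mul_comm]
    exact h1
  · intro i j hij
    have := hmono hij
    simp only [Function.comp_apply] at this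
    linarith

/-- The case of an empty block κ: all the variables are projected, and only the rate for ΔΔᵀ as a
whole is kept. -/
theorem exists_outer_rate (n : Type) [Fintype n] [DecidableEq n] (a b q η : ℝ) (ha : 0 < a)
    (hb : 0 < b) (hq : 1 ≤ q) (hη : 0 < η) :
    ∃ c τ₀ N₀ : ℝ, 0 < c ∧ 0 < τ₀ ∧ ∀ (ι : Type) [Fintype ι] [DecidableEq ι] (N τ : ℝ)
      (s t : ι → ℝ) (Γ Δ : Matrix ι n ℝ) (M W : Matrix ι ι ℝ),
      RegularLoading a b N Γ → VarianceBound q s → VarianceBound q t →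
      Fintype.card n ≤ Fintype.card ι → M.PosSemidef → Wᵀ = W →
      M = Matrix.diagonal s + Γ * Γᵀ + W → 0 ≤ τ →
      ‖W‖ ≤ τ * N → √(∑ i, W i i ^ 2) ≤ τ * √N → negLik M t Δ ≤ negLik M s Γ →
      (∑ i, (t i - s i) ^ 2 ≤ η * N → ∀ Γ' : Matrix ι n ℝ, ‖Γ' - Γ‖ ^ 2 ≤ η * N →
        negLik M t Δ ≤ negLik M t Γ') → N₀ ≤ N → τ ≤ τ₀ →
      ∑ i, (t i - s i) ^ 2 ≤ c * (τ ^ 2 * N) ∧ ‖Δ * Δᵀ - Γ * Γᵀ‖ ≤ c * (τ * N) := by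
  obtain ⟨c, τ₀, N₀, hc, hτ₀, h⟩ := exists_covariance_rate n Empty a b q η ha hb hq hη
  refine ⟨c, τ₀, N₀, hc, hτ₀, ?_⟩
  intro ι _ _ N τ s t Γ Δ M W hreg hs ht hcard hMp hWt hM hτ hW hWd hlik hcomp hN hτ'
  set e : Empty ⊕ ι ≃ ι := Equiv.emptySum Empty ι with he
  have hsplit : ∀ (v : Empty → ℝ) (s : ι → ℝ), Sum.elim v s = s ∘ e := fun v s => by
    ext (i | i)
    · exact i.elim
    · rfl
  have hrows : ∀ (A : Matrix Empty n ℝ) (B : Matrix ι n ℝ),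
      Matrix.fromRows A B = B.submatrix e id := fun A B => by
    ext (i | i) j
    · exact i.elim
    · rfl
  have hWn : ‖W.submatrix e e‖ = ‖W‖ := by
    refine (sq_eq_sq₀ (norm_nonneg _) (norm_nonneg _)).1 ?_
    rw [frobenius_sq, frobenius_sq, ← Equiv.sum_comp e]
    exact Finset.sum_congr rfl fun i _ => Equiv.sum_comp e fun j => W (e i) j ^ 2
  have hz : ∀ {α : Type} [Fintype α] (A : Matrix Empty α ℝ), ‖A‖ = 0 := fun A => by
    rw [Subsingleton.elim A 0, norm_zero]
  have hN' := hreg.N_pos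
  obtain ⟨r1, -, -, r4⟩ := h ι N τ Empty.elim Empty.elim s t 0 0 Γ Δ (M.submatrix e e)
    (W.submatrix e e) (by rw [hrows]; exact hreg.submatrix e) (by rw [hsplit]; exact hs.comp e)
    (by rw [hsplit]; exact ht.comp e) hcard (hMp.submatrix e)
    (by rw [Matrix.transpose_submatrix, hWt])
    (by
      rw [hsplit, hrows, hM]
      ext i j
      simp [Matrix.diagonal_apply, Matrix.mul_apply, e.injective.eq_iff])
    (by rw [hWn]; exact hW) (le_trans (le_of_eq (congrArg _
      (Equiv.sum_comp e fun i => W i i ^ 2))) hWd)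
    (by rw [hz]; exact hτ) (by rw [hz]; positivity)
    (by rw [hsplit, hsplit, hrows, hrows, negLik_submatrix, negLik_submatrix]; exact hlik)
    (by
      intro h1 Γ' h2
      rw [hsplit, hrows, hrows, negLik_submatrix, negLik_submatrix]
      exact hcomp h1 Γ' h2) hN hτ'
  refine ⟨?_, r4⟩
  rw [hsplit, hsplit] at r1
  exact le_trans (le_of_eq (Equiv.sum_comp e fun i => (t i - s i) ^ 2).symm) r1

/-- Perturbation of the weighted second moments of the loadings. -/
theorem RegularLoading.weighted_perturb_le {a b N q h : ℝ} {Γ Γ' : Matrix ι n ℝ} {s t : ι → ℝ}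
    (hΓ : RegularLoading a b N Γ) (hs : VarianceBound q s) (ht : VarianceBound q t) (hh : 0 ≤ h)
    (hh1 : h ≤ 1) (hst : ∑ i, (t i - s i) ^ 2 ≤ h ^ 2 * N) (hΓ' : ‖Γ' - Γ‖ ^ 2 ≤ h ^ 2 * N) :
    ‖Γ'ᵀ * Matrix.diagonal (fun i => (t i)⁻¹) * Γ' -
      Γᵀ * Matrix.diagonal (fun i => (s i)⁻¹) * Γ‖ ≤
      (q * (2 * √a + 1) + a * q ^ 2) * h * N := by
  have hN := hΓ.N_pos
  have hw2 : √N * √N = N := Real.mul_self_sqrt hN.le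
  set w := √N with hw
  have hw0 : 0 ≤ w := Real.sqrt_nonneg _
  have hq0 := hs.q_pos
  have h1 : ‖Γ' - Γ‖ ≤ h * w := by
    refine (norm_le_of_sq_le hΓ').trans (le_of_eq ?_)
    rw [Real.sqrt_mul (sq_nonneg _), Real.sqrt_sq hh]
  have h2 : ‖Γ‖ ≤ √a * w := by
    rw [hw, ← Real.sqrt_mul hΓ.a_pos.le]; exact norm_le_of_sq_le hΓ.norm_sq_le
  have h3 : ‖Γ'‖ ≤ (√a + 1) * w := by
    have := norm_sub_norm_le Γ' Γ
    have h4 : h * w ≤ 1 * w := by gcongr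
    linarith
  have hP : ∀ A : Matrix ι n ℝ, ‖Matrix.diagonal (fun i => (t i)⁻¹) * A‖ ≤ q * ‖A‖ := fun A =>
    frobenius_diagonal_mul_le hq0.le (fun i => by
      rw [abs_of_pos (inv_pos.2 (ht.pos i))]; exact ht.inv_le i) A
  have h4 := hΓ.weighted_sub_le hs ht
  have h5 : √(∑ i, (t i - s i) ^ 2) ≤ h * w := by
    refine (Real.sqrt_le_sqrt hst).trans (le_of_eq ?_)
    rw [Real.sqrt_mul (sq_nonneg _), Real.sqrt_sq hh]
  set P := Matrix.diagonal (fun i => (t i)⁻¹) with hPd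
  have h6 : Γ'ᵀ * P * Γ' - Γᵀ * Matrix.diagonal (fun i => (s i)⁻¹) * Γ =
      (Γ' - Γ)ᵀ * (P * Γ') + Γᵀ * (P * (Γ' - Γ)) +
        (Γᵀ * P * Γ - Γᵀ * Matrix.diagonal (fun i => (s i)⁻¹) * Γ) := by
    rw [Matrix.transpose_sub]
    simp only [Matrix.sub_mul, Matrix.mul_sub, Matrix.mul_assoc]; abel
  rw [h6]
  have h7 : ‖(Γ' - Γ)ᵀ * (P * Γ')‖ ≤ h * w * (q * ((√a + 1) * w)) := by
    refine (Matrix.frobenius_norm_mul _ _).trans ?_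
    rw [Matrix.frobenius_norm_transpose]
    have := hP Γ'
    gcongr
    exact this.trans (by gcongr)
  have h8 : ‖Γᵀ * (P * (Γ' - Γ))‖ ≤ √a * w * (q * (h * w)) := by
    refine (Matrix.frobenius_norm_mul _ _).trans ?_
    rw [Matrix.frobenius_norm_transpose]
    have := hP (Γ' - Γ)
    gcongr
    exact this.trans (by gcongr)
  have h9 : a * q ^ 2 * w * √(∑ i, (t i - s i) ^ 2) ≤ a * q ^ 2 * w * (h * w) := by
    have := hΓ.a_pos
    gcongr
  refine (norm_add_le _ _).trans ((add_le_add ((norm_add_le _ _).trans (add_le_add h7 h8))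
    (h4.trans h9)).trans (le_of_eq ?_))
  rw [← hw2]; ring

variable {N r : ℕ}

/-- The identifying restrictions that make the weighted second moments of the loadings diagonal. -/
def IdentCond.IsDiagonal : IdentCond → Prop
  | .IC2 | .IC3 => True
  | .IC1 | .IC4 | .IC5 => False

/-- The loadings normalized by the square roots of the (diagonal) moments of the factors. -/
noncomputable def FactorParam.scale (θ : FactorParam N r) : Matrix (Fin r) (Fin r) ℝ :=
  Matrix.diagonal fun k => √(θ.moment k k)

/-- Absorbing the root of M_ff into the loadings makes IC2 and IC3 one condition. The diagonal
entries are products of two factors, of which one is 1 and the other decreases: M_ff decreases under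
IC2, the weighted moment under IC3. -/
theorem IdentCond.IsDiagonal.canonical {ic : IdentCond} (h : ic.IsDiagonal) {θ : FactorParam N r}
    (hθ : ic.Holds θ) {q : ℝ} (hv : VarianceBound q θ.variance) (hN : 0 < N) :
    θ.moment = θ.scale * θ.scaleᵀ ∧ θ.moment.IsDiag ∧ (∀ k, 0 < θ.moment k k) ∧
    (θ.loading * θ.scale)ᵀ * Matrix.diagonal (fun i => (θ.variance i)⁻¹) *
      (θ.loading * θ.scale) = (N : ℝ) •
        Matrix.diagonal (fun k => θ.moment k k * θ.weightedMoment k k) ∧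
    StrictAnti (fun k => θ.moment k k * θ.weightedMoment k k) := by
  have hN' : (N : ℝ) ≠ 0 := by exact_mod_cast hN.ne'
  obtain ⟨hd, hpos, hwd, hanti⟩ : θ.moment.IsDiag ∧ (∀ k, 0 < θ.moment k k) ∧
      θ.weightedMoment.IsDiag ∧ StrictAnti (fun k => θ.moment k k * θ.weightedMoment k k) := by
    cases ic with
    | IC1 => exact h.elim
    | IC2 =>
      refine ⟨hθ.1.1, hθ.1.2.2, ?_, ?_⟩
      · rw [hθ.2]; exact Matrix.isDiag_one
      · rw [hθ.2]; simpa using hθ.1.2.1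
    | IC3 =>
      obtain ⟨h1, h2, h3, h4⟩ := hθ
      refine ⟨?_, ?_, h2, ?_⟩
      · rw [h1]; exact Matrix.isDiag_one
      · intro k; rw [h1]; simp
      · rw [h1]; simpa using h3
    | IC4 => exact h.elim
    | IC5 => exact h.elim
  have hss : θ.scale * θ.scaleᵀ = θ.moment := by
    rw [FactorParam.scale, Matrix.diagonal_transpose, Matrix.diagonal_mul_diagonal]
    conv_rhs => rw [← hd.diagonal_diag]
    congr 1; ext k; exact Real.mul_self_sqrt (hpos k).le
  refine ⟨hss.symm, hd, hpos, ?_, hanti⟩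
  have h1 : θ.loadingᵀ * Matrix.diagonal (fun i => (θ.variance i)⁻¹) * θ.loading =
      (N : ℝ) • θ.weightedMoment := by
    rw [weightedMoment_eq hv, smul_smul, mul_inv_cancel₀ hN', one_smul]
  have h2 : θ.weightedMoment = Matrix.diagonal (fun k => θ.weightedMoment k k) :=
    hwd.diagonal_diag.symm
  calc _ = θ.scaleᵀ * (θ.loadingᵀ * Matrix.diagonal (fun i => (θ.variance i)⁻¹) * θ.loading) *
        θ.scale := by
        rw [Matrix.transpose_mul]; simp only [Matrix.mul_assoc]
    _ = _ := by
        rw [h1, Matrix.mul_smul, Matrix.smul_mul]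
        congr 1
        conv_lhs => rw [h2]
        rw [FactorParam.scale, Matrix.diagonal_transpose, Matrix.diagonal_mul_diagonal,
          Matrix.diagonal_mul_diagonal]
        congr 1; ext k
        have := Real.mul_self_sqrt (hpos k).le
        calc _ = √(θ.moment k k) * √(θ.moment k k) * θ.weightedMoment k k := by ring
          _ = _ := by rw [this]

/-- Parameters subject to the restrictions can be recovered from loadings with well separated
weighted second moments. -/
theorem IdentCond.IsDiagonal.exists_param {ic : IdentCond} (h : ic.IsDiagonal) {C δ l : ℝ}
    (hC : 0 < C) (hC1 : ic = .IC3 → 0 < r → 1 ≤ C) (hN : 0 < N) {t : Fin N → ℝ}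
    (ht : VarianceBound (C ^ 2) t) {Γ : Matrix (Fin N) (Fin r) ℝ} {D₀ : Fin r → ℝ}
    {E : Matrix (Fin r) (Fin r) ℝ}
    (hΓ : Γᵀ * Matrix.diagonal (fun i => (t i)⁻¹) * Γ = (N : ℝ) • (Matrix.diagonal D₀ + E))
    (hgap : ∀ i j, i < j → D₀ j + δ ≤ D₀ i) (hl : ∀ i, l ≤ D₀ i)
    (hDC : ic = .IC2 → ∀ i, D₀ i + δ ≤ C)
    (hEδ : 2 * (r * ‖E‖) < δ) (hEl : r * ‖E‖ < l) :
    ∃ (θ : FactorParam N r) (β : Matrix (Fin r) (Fin r) ℝ), θ ∈ paramSet N r C ic ∧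
      θ.variance = t ∧ θ.moment = β * βᵀ ∧ (θ.loading * β) * (θ.loading * β)ᵀ = Γ * Γᵀ := by
  have hN' : (N : ℝ) ≠ 0 := by exact_mod_cast hN.ne'
  set P := Γᵀ * Matrix.diagonal (fun i => (t i)⁻¹) * Γ with hP
  have hsymm : (Matrix.diagonal D₀ + E)ᵀ = Matrix.diagonal D₀ + E := by
    have h1 : Matrix.diagonal D₀ + E = (N : ℝ)⁻¹ • P := by
      rw [hΓ, smul_smul, inv_mul_cancel₀ hN', one_smul]
    rw [h1, Matrix.transpose_smul, hP]
    simp only [Matrix.transpose_mul, Matrix.transpose_transpose, Matrix.diagonal_transpose,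
      Matrix.mul_assoc]
  obtain ⟨V, D, hV1, hV2, hAV, hanti⟩ := exists_antitone_diagonalization hsymm
  -- The eigenvectors intertwine the eigenvalues with D₀ up to EV. The eigenvalues thus stay
  -- positive and distinct, and below C under IC2, where they become the entries of M_ff.
  have hclose : ∀ i, |D i - D₀ i| ≤ r * ‖E‖ := fun i => by
    refine abs_sub_le_of_intertwine (R := V) (E := E * V) (δ := δ) (ρ := 1) one_pos
      (by rw [← hAV, Matrix.add_mul]) (fun i => by rw [hV2, Matrix.one_apply_eq]) hgap hanti ?_
      hEδ i
    rw [div_one]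
    have h1 : ‖V‖ ≤ √r := by
      have := norm_le_of_sq_le (frobenius_sq_of_orthonormal hV1).le
      rwa [Fintype.card_fin] at this
    calc √r * ‖E * V‖ ≤ √r * (‖E‖ * √r) := by
          gcongr
          exact (Matrix.frobenius_norm_mul _ _).trans (by gcongr)
      _ = (√r * √r) * ‖E‖ := by ring
      _ = _ := by rw [Real.mul_self_sqrt (Nat.cast_nonneg r)]
  have hDpos : ∀ i, 0 < D i := fun i => by
    have := abs_le.1 (hclose i)
    linarith [hl i]
  have hDanti : StrictAnti D := fun i j hij => by
    have h1 := abs_le.1 (hclose i)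
    have h2 := abs_le.1 (hclose j)
    linarith [hgap i j hij]
  have hVPV : (Γ * V)ᵀ * Matrix.diagonal (fun i => (t i)⁻¹) * (Γ * V) =
      (N : ℝ) • Matrix.diagonal D := by
    calc _ = Vᵀ * (P * V) := by
          rw [Matrix.transpose_mul, hP]; simp only [Matrix.mul_assoc]
      _ = _ := by
          rw [hΓ, Matrix.smul_mul, hAV, Matrix.mul_smul, ← Matrix.mul_assoc, hV1, Matrix.one_mul]
  -- The rotation that enforces the restrictions leaves ΓΓᵀ, and with it the likelihood, unchanged.
  have hout : (Γ * V) * (Γ * V)ᵀ = Γ * Γᵀ := by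
    rw [Matrix.transpose_mul, Matrix.mul_assoc, ← Matrix.mul_assoc V, hV2, Matrix.one_mul]
  have htC : ∀ i, t i ∈ Set.Icc (C ^ 2)⁻¹ (C ^ 2) := fun i => ⟨ht.lower i, ht.upper i⟩
  have hdiagC : ∀ d : Fin r → ℝ, (∀ i, 0 ≤ d i ∧ d i ≤ C) →
      ∀ k l, Matrix.diagonal d k l ∈ Set.Icc (-C) C := fun d hd k l => by
    rcases eq_or_ne k l with rfl | hkl
    · rw [Matrix.diagonal_apply_eq]; exact ⟨by linarith [(hd k).1], (hd k).2⟩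
    · rw [Matrix.diagonal_apply_ne _ hkl]; exact ⟨by linarith, hC.le⟩
  cases ic with
  | IC1 => exact h.elim
  | IC2 =>
    have hsq : ∀ i, √(D i) * √(D i) = D i := fun i => Real.mul_self_sqrt (hDpos i).le
    have hsp : ∀ i, √(D i) ≠ 0 := fun i => (Real.sqrt_pos.2 (hDpos i)).ne'
    let θ : FactorParam N r := ⟨Γ * V * Matrix.diagonal (fun i => (√(D i))⁻¹), t,
      Matrix.diagonal D⟩
    have hθv : VarianceBound (C ^ 2) θ.variance := ht
    refine ⟨θ, Matrix.diagonal fun i => √(D i), ⟨htC, ?_, hdiagC D fun i => ⟨(hDpos i).le, ?_⟩,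
      ⟨Matrix.isDiag_diagonal D, ?_, ?_⟩, ?_⟩, rfl, ?_, ?_⟩
    · exact Matrix.PosSemidef.diagonal fun i => (hDpos i).le
    · have := abs_le.1 (hclose i)
      have h2 := norm_nonneg E
      have h3 := hDC rfl i
      linarith
    · simpa [θ] using hDanti
    · simpa [θ] using hDpos
    · rw [weightedMoment_eq hθv]
      have h1 : θ.loadingᵀ * Matrix.diagonal (fun i => (θ.variance i)⁻¹) * θ.loading =
          Matrix.diagonal (fun i => (√(D i))⁻¹) * ((Γ * V)ᵀ *
            Matrix.diagonal (fun i => (t i)⁻¹) * (Γ * V)) *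
            Matrix.diagonal (fun i => (√(D i))⁻¹) := by
        simp only [θ]
        rw [Matrix.transpose_mul (Γ * V), Matrix.diagonal_transpose]
        simp only [Matrix.mul_assoc]
      rw [h1, hVPV, Matrix.mul_smul, Matrix.smul_mul, smul_smul, inv_mul_cancel₀ hN', one_smul,
        Matrix.diagonal_mul_diagonal, Matrix.diagonal_mul_diagonal, ← Matrix.diagonal_one]
      congr 1; ext i
      have := hsp i
      nth_rewrite 2 [← hsq i]
      field_simp
    · simp only [θ]
      rw [Matrix.diagonal_transpose, Matrix.diagonal_mul_diagonal]
      congr 1; ext i; exact (hsq i).symm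
    · have h1 : θ.loading * Matrix.diagonal (fun i => √(D i)) = Γ * V := by
        simp only [θ]
        rw [Matrix.mul_assoc, Matrix.diagonal_mul_diagonal]
        have : (fun i => (√(D i))⁻¹ * √(D i)) = fun _ => 1 := by
          ext i; exact inv_mul_cancel₀ (hsp i)
        rw [this, Matrix.diagonal_one, Matrix.mul_one]
      rw [h1, hout]
  | IC3 =>
    let θ : FactorParam N r := ⟨Γ * V, t, 1⟩
    have hθv : VarianceBound (C ^ 2) θ.variance := ht
    have hw : θ.weightedMoment = Matrix.diagonal D := by
      rw [weightedMoment_eq hθv]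
      simp only [θ]
      rw [hVPV, smul_smul, inv_mul_cancel₀ hN', one_smul]
    refine ⟨θ, 1, ⟨htC, Matrix.PosSemidef.one, ?_, rfl, ?_, ?_, ?_⟩, rfl, ?_, ?_⟩
    · intro k l
      have := hdiagC (fun _ => 1) (fun i => ⟨zero_le_one, hC1 rfl i.pos⟩) k l
      rwa [Matrix.diagonal_one] at this
    · rw [hw]; exact Matrix.isDiag_diagonal D
    · rw [hw]; simpa using hDanti
    · rw [hw]; simpa using hDpos
    · simp [θ]
    · rw [Matrix.mul_one, hout]
  | IC4 => exact h.elim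
  | IC5 => exact h.elim

end FrobeniusNorm

section FrobeniusNorm

attribute [local instance] Matrix.frobeniusNormedAddCommGroup Matrix.frobeniusNormedSpace

variable {N r : ℕ}

theorem IdentCond.IsDiagonal.moment_sub {ic : IdentCond} (h : ic.IsDiagonal)
    {θ θ' : FactorParam N r} (hθ : ic.Holds θ) (hθ' : ic.Holds θ') {ε : ℝ}
    (hε : ∀ k, |θ'.moment k k * θ'.weightedMoment k k - θ.moment k k * θ.weightedMoment k k| ≤ ε)
    (k : Fin r) : |θ'.moment k k - θ.moment k k| ≤ ε := by
  have hε0 := (abs_nonneg _).trans (hε k)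
  cases ic with
  | IC1 => exact h.elim
  | IC2 =>
    have := hε k
    rw [hθ.2, hθ'.2] at this
    simpa using this
  | IC3 => rw [hθ.1, hθ'.1]; simpa using hε0
  | IC4 => exact h.elim
  | IC5 => exact h.elim

theorem IdentCond.IsDiagonal.sum_nonneg {ic : IdentCond} (h : ic.IsDiagonal)
    {θ θ' : FactorParam N r} (hs : ic.SameSigns θ' θ) (k : Fin r) :
    0 ≤ ∑ i, (θ'.loading * θ'.scale) i k * (θ.loading * θ.scale) i k := by
  have h1 : 0 ≤ ∑ i, θ'.loading i k * θ.loading i k := by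
    cases ic with
    | IC1 => exact h.elim
    | IC2 => exact hs k
    | IC3 => exact hs k
    | IC4 => exact h.elim
    | IC5 => exact h.elim
  have h2 : ∑ i, (θ'.loading * θ'.scale) i k * (θ.loading * θ.scale) i k =
      √(θ'.moment k k) * √(θ.moment k k) * ∑ i, θ'.loading i k * θ.loading i k := by
    rw [Finset.mul_sum]
    refine Finset.sum_congr rfl fun i _ => ?_
    rw [FactorParam.scale, FactorParam.scale, Matrix.mul_diagonal, Matrix.mul_diagonal]
    ring
  rw [h2]
  positivity

/-- The loadings, from the normalized loadings and the moments of the factors. -/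
theorem norm_loading_sub_le {θ θ' : FactorParam N r} {m ε L x : ℝ} (hm : 0 < m)
    (hM : ∀ k, m ≤ θ.moment k k) (hMM : ∀ k, |θ'.moment k k - θ.moment k k| ≤ ε)
    (hε : 2 * ε ≤ m) (hL : ‖θ.loading‖ ≤ L)
    (hx : ‖θ'.loading * θ'.scale - θ.loading * θ.scale‖ ≤ x) (hε0 : 0 ≤ ε) :
    ‖θ'.loading - θ.loading‖ ≤ (√(m / 2))⁻¹ * (x + L * (ε / √m)) := by
  have hM' : ∀ k, m / 2 ≤ θ'.moment k k := fun k => by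
    have := abs_le.1 (hMM k)
    linarith [hM k]
  have hsp : 0 < √(m / 2) := Real.sqrt_pos.2 (by positivity)
  have hsp' : 0 < √m := Real.sqrt_pos.2 hm
  have h1 : ∀ k, |√(θ'.moment k k) - √(θ.moment k k)| ≤ ε / √m := fun k => by
    rw [le_div_iff₀ hsp']
    refine le_trans ?_ (hMM k)
    have h2 : θ'.moment k k - θ.moment k k = (√(θ'.moment k k) - √(θ.moment k k)) *
        (√(θ'.moment k k) + √(θ.moment k k)) := by
      have e1 := Real.mul_self_sqrt (show 0 ≤ θ'.moment k k by linarith [hM' k])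
      have e2 := Real.mul_self_sqrt (show 0 ≤ θ.moment k k by linarith [hM k])
      linarith
    rw [h2, abs_mul]
    refine mul_le_mul_of_nonneg_left ?_ (abs_nonneg _)
    rw [abs_of_nonneg (by positivity)]
    exact (Real.sqrt_le_sqrt (hM k)).trans (le_add_of_nonneg_left (Real.sqrt_nonneg _))
  set v := fun k => √(θ'.moment k k) - √(θ.moment k k) with hv
  have hvs : Matrix.diagonal v = θ'.scale - θ.scale := by
    rw [FactorParam.scale, FactorParam.scale, Matrix.diagonal_sub]
  have h3 : θ'.loading - θ.loading = (θ'.loading * θ'.scale - θ.loading * θ.scale -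
      θ.loading * Matrix.diagonal v) * Matrix.diagonal (fun k => (√(θ'.moment k k))⁻¹) := by
    have h4 : θ'.loading * θ'.scale - θ.loading * θ.scale - θ.loading * Matrix.diagonal v =
        (θ'.loading - θ.loading) * θ'.scale := by
      rw [hvs]; simp only [Matrix.mul_sub, Matrix.sub_mul]; abel
    have h5 : (fun k => √(θ'.moment k k) * (√(θ'.moment k k))⁻¹) = fun _ => 1 := by
      ext k
      exact mul_inv_cancel₀ (Real.sqrt_pos.2 (by linarith [hM' k])).ne'
    rw [h4, FactorParam.scale, Matrix.mul_assoc, Matrix.diagonal_mul_diagonal, h5,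
      Matrix.diagonal_one, Matrix.mul_one]
  rw [h3]
  refine (frobenius_mul_diagonal_le (inv_nonneg.2 hsp.le) (fun k => ?_) _).trans ?_
  · rw [abs_of_nonneg (by positivity)]
    exact inv_anti₀ hsp (Real.sqrt_le_sqrt (hM' k))
  · refine mul_le_mul_of_nonneg_left ((norm_sub_le _ _).trans (add_le_add hx ?_)) (by positivity)
    refine (frobenius_mul_diagonal_le (by positivity) h1 _).trans ?_
    rw [mul_comm]
    gcongr

set_option maxHeartbeats 1000000 in
-- The restrictions now involve all the loadings and the variances, so the competitor becomes
-- feasible only after a rotation. This needs separated eigenvalues, and room below C for M_ff under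
-- IC2, hence a competitor close to the truth: here the radius of comparison in the rate theorems
-- matters.
theorem exists_errorBound_of_isDiagonal (r : ℕ) (C m w δ : ℝ) (hC0 : 0 < C) (hC : 1 ≤ C ^ 2)
    (hm : 0 < m) (hw : 0 < w) (hδ : 0 < δ) {ic : IdentCond} (hic : ic.IsDiagonal) :
    ∃ c τ₀ N₀ : ℝ, 0 < c ∧ 0 < τ₀ ∧ ∀ (N : ℕ) (τ : ℝ) (M W : Matrix (Fin N) (Fin N) ℝ)
      (θ θ' : FactorParam N r), RegularParam C m w θ → θ ∈ paramSet N r C ic →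
      (∀ i j, i < j → θ.moment j j * θ.weightedMoment j j + δ ≤
        θ.moment i i * θ.weightedMoment i i) →
      (ic = .IC2 → ∀ k, θ.moment k k + δ ≤ C) →
      IsMLE C ic M θ' → ic.SameSigns θ' θ → M.PosSemidef → M = θ.sigmaZZ + W →
      SmallNoise r τ W → N₀ ≤ N → τ ≤ τ₀ → ErrorBound c τ θ' θ := by
  have hq0 : 0 < C ^ 2 := by linarith
  obtain ⟨a, ha⟩ : ∃ a : ℝ, a = √(r * r * C ^ 2) * C ^ 2 + 1 := ⟨_, rfl⟩
  obtain ⟨b, hb⟩ : ∃ b : ℝ, b = w / C ^ 2 * m := ⟨_, rfl⟩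
  have ha0 : 0 < a := by rw [ha]; positivity
  have hb0 : 0 < b := by rw [hb]; positivity
  obtain ⟨l, hl⟩ : ∃ l : ℝ, l = b / C ^ 2 := ⟨_, rfl⟩
  have hl0 : 0 < l := by rw [hl]; positivity
  obtain ⟨g, hg⟩ : ∃ g : ℝ, g = C ^ 2 * (2 * √a + 1) + a * (C ^ 2) ^ 2 := ⟨_, rfl⟩
  have hg0 : 0 < g := by rw [hg]; positivity
  -- A perturbation of relative size h moves the normalized weighted moments by at most gh; the last
  -- two inequalities are what keeps the eigenvalues distinct and positive.
  obtain ⟨h, hh0, hh1, hhδ, hhl⟩ : ∃ h : ℝ, 0 < h ∧ h ≤ 1 ∧ 2 * (r * (g * h)) < δ ∧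
      r * (g * h) < l := by
    obtain ⟨X, hX⟩ : ∃ X : ℝ, X = 1 + 4 * (r * g) / δ + 2 * (r * g) / l := ⟨_, rfl⟩
    have m1 : 0 ≤ 4 * (r * g) / δ := by positivity
    have m2 : 0 ≤ 2 * (r * g) / l := by positivity
    have hX0 : 0 < X := by rw [hX]; positivity
    have h1 : X⁻¹ * X = 1 := inv_mul_cancel₀ hX0.ne'
    have hXi := inv_pos.2 hX0
    rw [hX] at h1
    have n1 := mul_nonneg m1 hXi.le
    have n2 := mul_nonneg m2 hXi.le
    rw [← hX] at h1
    have h2 : X⁻¹ + 4 * (r * g) / δ * X⁻¹ + 2 * (r * g) / l * X⁻¹ = 1 := by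
      rw [← h1]; nth_rewrite 5 [hX]; ring
    have h3 : 4 * (r * g) / δ * X⁻¹ ≤ 1 := by linarith
    have h4 : 2 * (r * g) / l * X⁻¹ ≤ 1 := by linarith
    rw [div_mul_eq_mul_div, div_le_iff₀ hδ] at h3
    rw [div_mul_eq_mul_div, div_le_iff₀ hl0] at h4
    exact ⟨X⁻¹, hXi, by linarith, by linarith, by linarith⟩
  obtain ⟨c₁, τ₁, N₁, hc₁, hτ₁, hout⟩ :=
    exists_outer_rate (Fin r) a b (C ^ 2) (h ^ 2) ha0 hb0 hC (by positivity)
  obtain ⟨c₂, τ₂, hc₂, hτ₂, hdiag⟩ := exists_diag_rate r a b (C ^ 2) c₁ δ hb0 hC hc₁ hδ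
  obtain ⟨c₃, hc₃⟩ : ∃ c₃ : ℝ, c₃ = (√(m / 2))⁻¹ * (c₂ + √(C ^ 2) * (c₂ / √m)) := ⟨_, rfl⟩
  refine ⟨c₃ ^ 2 + c₁ + r * c₂ ^ 2, min (min τ₁ τ₂) (m / (2 * c₂)), max N₁ (r + 1),
    by positivity, by positivity, ?_⟩
  intro N τ M W θ θ' hreg hθ hgap hDC hmle hsign hMp hM hW hN hτ
  have hNr : r + 1 ≤ N := by exact_mod_cast (le_max_right _ _).trans hN
  have hN0 : 0 < N := by omega
  have hNp : (0 : ℝ) < N := by exact_mod_cast hN0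
  have hτ0 := hW.nonneg
  have hτc : 2 * (c₂ * τ) ≤ m := by
    have := hτ.trans (min_le_right _ _)
    rw [le_div_iff₀ (by positivity)] at this; linarith
  have hvb' := varianceBound_of_mem hC hmle.1
  obtain ⟨k1, k2, k3, k4, k5⟩ := hic.canonical hθ.2.2.2 hreg.variance hN0
  obtain ⟨j1, j2, j3, j4, j5⟩ := hic.canonical hmle.1.2.2.2 hvb' hN0
  obtain ⟨hL1, hL2⟩ := hreg.regularLoading hN0 hm hw k1
  rw [← ha, ← hb] at hL2
  set Γ := θ.loading * θ.scale with hΓ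
  set Δ := θ'.loading * θ'.scale with hΔ
  set D₀ := fun k => θ.moment k k * θ.weightedMoment k k with hD₀
  set D := fun k => θ'.moment k k * θ'.weightedMoment k k with hD
  have hD₀l : ∀ i, l ≤ D₀ i := fun i => by
    have h1 := hL2.weighted_lower hreg.variance (Pi.single i 1)
    rw [k4] at h1
    simp only [Matrix.mulVec_single_one, single_one_dotProduct, Pi.single_eq_same, Matrix.col_apply,
      ← hl] at h1
    rw [Matrix.smul_apply, Matrix.diagonal_apply_eq, smul_eq_mul] at h1
    have h2 : l * N ≤ D₀ i * N := by linarith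
    exact le_of_mul_le_mul_right h2 hNp
  have hMm : ∀ k, m ≤ θ.moment k k := fun k => by
    have := hreg.moment_lower (Pi.single k 1)
    simpa using this
  obtain ⟨hW1, hW2⟩ := hW.norm_le (Equiv.refl (Fin N))
  have hMe : M = Matrix.diagonal θ.variance + Γ * Γᵀ + W := by
    rw [hM, FactorParam.sigmaZZ, FactorParam.sigmaEE, k1, hΓ, Matrix.transpose_mul,
      add_comm (θ.loading * _ * _)]
    simp only [Matrix.mul_assoc]
  obtain ⟨r1, r2⟩ := hout (Fin N) N τ θ.variance θ'.variance Γ Δ M W hL2 hreg.variance hvb'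
    (by simp only [Fintype.card_fin]; omega) hMp hW.symm hMe hτ0 hW1 hW2
    (negLik_le_of_isMLE hN0 hmle hθ j1 k1)
    (by
      intro hst Γ' hΓ'
      -- Γ' and the estimated variances are within h of the truth, so some feasible parameter has
      -- these variances and the same product ΓΓᵀ as Γ'.
      have hE := hL2.weighted_perturb_le hreg.variance hvb' hh0.le hh1 hst hΓ'
      rw [← hg, k4] at hE
      set E := (N : ℝ)⁻¹ • (Γ'ᵀ * Matrix.diagonal (fun i => (θ'.variance i)⁻¹) * Γ' -
        (N : ℝ) • Matrix.diagonal D₀) with hEd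
      have hEn : ‖E‖ ≤ g * h := by
        rw [hEd, norm_smul, Real.norm_eq_abs, abs_of_pos (inv_pos.2 hNp), inv_mul_eq_div,
          div_le_iff₀ hNp]
        exact hE
      have hrE : r * ‖E‖ ≤ r * (g * h) := mul_le_mul_of_nonneg_left hEn (Nat.cast_nonneg r)
      obtain ⟨θ₁, β, p1, p2, p3, p4⟩ := hic.exists_param (C := C) (δ := δ) (l := l) (E := E)
        (D₀ := D₀) hC0 (fun h3 hr => by
          subst h3
          -- Under IC3 the true M_ff is the identity and lies in the box, which forces C ≥ 1 as soon
          -- as r > 0.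
          have h1 := (hθ.2.2.1 ⟨0, hr⟩ ⟨0, hr⟩).2
          rwa [hθ.2.2.2.1, Matrix.one_apply_eq] at h1) hN0 hvb' (Γ := Γ') (by
          rw [hEd, smul_add, smul_smul, mul_inv_cancel₀ hNp.ne', one_smul]; abel) hgap hD₀l
        (fun h2 i => by
          have h3 := hDC h2 i
          subst h2
          have h4 : D₀ i = θ.moment i i := by
            rw [hD₀]; dsimp only; rw [hθ.2.2.2.2, Matrix.one_apply_eq, mul_one]
          rw [h4]; exact h3)
        (by linarith) (by linarith)
      have h5 := negLik_le_of_isMLE hN0 hmle p1 j1 p3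
      rw [p2] at h5
      exact h5.trans (le_of_eq (negLik_congr M _ p4)))
    ((le_max_left _ _).trans hN) ((hτ.trans (min_le_left _ _)).trans (min_le_left _ _))
  obtain ⟨f1, f2⟩ := hdiag (Fin N) N τ θ.variance θ'.variance Γ Δ D₀ D hL2 hreg.variance hvb' k4 j4
    hgap j5.antitone hτ0 ((hτ.trans (min_le_left _ _)).trans (min_le_right _ _)) r1 r2
    (hic.sum_nonneg hsign)
  have hMM := hic.moment_sub hθ.2.2.2 hmle.1.2.2.2 f2
  have hLn : ‖θ.loading‖ ≤ √(C ^ 2) * √N := by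
    rw [← Real.sqrt_mul hq0.le]; exact norm_le_of_sq_le hL1.norm_sq_le
  have hfin := norm_loading_sub_le hm hMm hMM hτc hLn f1 (by positivity)
  have hfin' : ‖θ'.loading - θ.loading‖ ≤ c₃ * (τ * √N) := by
    refine hfin.trans (le_of_eq ?_)
    rw [hc₃]; ring
  have n1 : 0 ≤ c₃ ^ 2 := sq_nonneg _
  have n2 : 0 ≤ r * c₂ ^ 2 := by positivity
  refine ⟨?_, r1.trans ?_, ?_⟩
  · have h1 := pow_le_pow_left₀ (norm_nonneg _) hfin' 2
    rw [frobenius_sq, mul_pow, mul_pow, Real.sq_sqrt hNp.le] at h1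
    refine h1.trans ?_
    gcongr; linarith
  · gcongr; linarith
  · have h1 : ∀ k, ∑ l, (θ'.moment k l - θ.moment k l) ^ 2 ≤ c₂ ^ 2 * τ ^ 2 := fun k => by
      rw [Finset.sum_eq_single_of_mem k (Finset.mem_univ _) fun l _ hl => by
        rw [j2 hl.symm, k2 hl.symm]; simp]
      rw [← sq_abs, ← mul_pow]
      exact pow_le_pow_left₀ (abs_nonneg _) (hMM k) 2
    calc _ ≤ ∑ _k : Fin r, c₂ ^ 2 * τ ^ 2 := Finset.sum_le_sum fun k _ => h1 k
      _ = (r * c₂ ^ 2) * τ ^ 2 := by simp; ring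
      _ ≤ _ := by gcongr; linarith

end FrobeniusNorm

/-! ### Second moments of the entries of the sampling error. -/

section SamplingError

variable {Ω : Type*} [MeasurableSpace Ω] {μ : Measure Ω} [IsProbabilityMeasure μ]

theorem memLp_two_mul {X Y : Ω → ℝ} (hX : MemLp X 4 μ) (hY : MemLp Y 4 μ) :
    MemLp (fun ω => X ω * Y ω) 2 μ := by
  have : ENNReal.HolderTriple 4 4 2 := ⟨by
    rw [← ENNReal.toReal_eq_toReal_iff' (by simp) (by simp),
      ENNReal.toReal_add (by simp) (by simp)]
    simp; norm_num⟩
  exact hY.mul hX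

/-- The summands are centered and pairwise independent, so their variances add up. -/
theorem integral_sq_sum_le {T : ℕ} {Y : Fin T → Ω → ℝ} (hY : ∀ t, MemLp (Y t) 2 μ)
    (h0 : ∀ t, ∫ ω, Y t ω ∂μ = 0) (hind : Pairwise fun s t => IndepFun (Y s) (Y t) μ)
    {v : Fin T → ℝ} (hv : ∀ t, ∫ ω, Y t ω ^ 2 ∂μ ≤ v t) :
    MemLp (fun ω => ∑ t, Y t ω) 2 μ ∧ ∫ ω, (∑ t, Y t ω) ^ 2 ∂μ ≤ ∑ t, v t := by
  have hmem : MemLp (fun ω => ∑ t, Y t ω) 2 μ := memLp_finsetSum _ fun t _ => hY t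
  refine ⟨hmem, ?_⟩
  have hsum : (∑ t, Y t) = fun ω => ∑ t, Y t ω := by ext ω; simp
  have h1 := IndepFun.variance_sum (s := Finset.univ) (fun t _ => hY t)
    (fun s _ t _ hst => hind hst)
  have hz : ∫ ω, ∑ t, Y t ω ∂μ = 0 := by
    rw [integral_finsetSum _ fun t _ => (hY t).integrable (by norm_num)]
    simp [h0]
  rw [hsum, variance_of_integral_eq_zero hmem.aestronglyMeasurable.aemeasurable hz] at h1
  rw [h1]
  refine Finset.sum_le_sum fun t _ => ?_
  rw [variance_of_integral_eq_zero (hY t).aestronglyMeasurable.aemeasurable (h0 t)]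
  exact hv t

variable {e : ℕ → ℕ → Ω → ℝ} {σ2 : ℕ → ℝ}

theorem ErrorAssumption.memLp_two (he : ErrorAssumption μ e σ2) (i t : ℕ) : MemLp (e i t) 2 μ :=
  (he.memLp i t).mono_exponent (by norm_num)

/-- Weighted sums of the errors. -/
theorem ErrorAssumption.weighted_sum (he : ErrorAssumption μ e σ2) {T : ℕ} (x : Fin T → ℝ) (i : ℕ) :
    MemLp (fun ω => ∑ t : Fin T, x t * e i t ω) 4 μ ∧
      ∫ ω, (∑ t : Fin T, x t * e i t ω) ^ 2 ∂μ ≤ (∑ t, x t ^ 2) * σ2 i := by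
  refine ⟨memLp_finsetSum _ fun t _ => (he.memLp i t).const_mul (x t), ?_⟩
  rw [Finset.sum_mul]
  refine (integral_sq_sum_le (fun t => (he.memLp_two i t).const_mul (x t)) (fun t => ?_)
    (fun s t hst => ?_) (v := fun t => x t ^ 2 * σ2 i) fun t => ?_).2
  · rw [integral_const_mul, he.mean_zero, mul_zero]
  · have h1 := he.indep.indepFun (i := (i, (s : ℕ))) (j := (i, (t : ℕ)))
      (by simpa [Fin.ext_iff] using hst)
    exact h1.comp (measurable_const_mul (x s)) (measurable_const_mul (x t))
  · simp only [mul_pow]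
    rw [integral_const_mul, he.variance]

theorem ErrorAssumption.integral_mul (he : ErrorAssumption μ e σ2) (i j t : ℕ) :
    ∫ ω, e i t ω * e j t ω ∂μ = if i = j then σ2 i else 0 := by
  split_ifs with h
  · subst h
    rw [← he.variance i t]
    exact integral_congr_ae (ae_of_all _ fun ω => (sq _).symm)
  · have h1 := he.indep.indepFun (i := (i, t)) (j := (j, t)) (by simpa using h)
    rw [h1.integral_fun_mul_eq_mul_integral (he.memLp i t).aestronglyMeasurable
      (he.memLp j t).aestronglyMeasurable, he.mean_zero, zero_mul]

theorem ErrorAssumption.integrable_pow_four (he : ErrorAssumption μ e σ2) (i t : ℕ) :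
    Integrable (fun ω => e i t ω ^ 4) μ := by
  refine (memLp_two_mul (he.memLp i t) (he.memLp i t)).integrable_sq.congr
    (ae_of_all _ fun ω => ?_)
  ring

/-- Sums of centered products of the errors. -/
theorem ErrorAssumption.product_sum (he : ErrorAssumption μ e σ2) {κ : ℝ}
    (hκ : ∀ i t, ∫ ω, e i t ω ^ 4 ∂μ ≤ κ) (T : ℕ) (i j : ℕ) :
    MemLp (fun ω => ∑ t : Fin T, (e i t ω * e j t ω - if i = j then σ2 i else 0)) 2 μ ∧
      ∫ ω, (∑ t : Fin T, (e i t ω * e j t ω - if i = j then σ2 i else 0)) ^ 2 ∂μ ≤ T * κ := by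
  set d := if i = j then σ2 i else 0 with hd
  have hmem : ∀ t : ℕ, MemLp (fun ω => e i t ω * e j t ω) 2 μ := fun t =>
    memLp_two_mul (he.memLp i t) (he.memLp j t)
  have h := integral_sq_sum_le (μ := μ) (Y := fun (t : Fin T) ω => e i t ω * e j t ω - d)
    (fun t => (hmem t).sub (memLp_const d)) (fun t => ?_) (fun s t hst => ?_)
    (v := fun _ => κ) fun t => ?_
  · refine ⟨h.1, h.2.trans (le_of_eq ?_)⟩
    simp
  · rw [integral_sub ((hmem t).integrable (by norm_num)) (integrable_const d), he.integral_mul]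
    simp [hd]
  · have hst' : (s : ℕ) ≠ t := fun h => hst (Fin.ext h)
    -- Products at different dates involve disjoint sets of errors, also when i = j.
    have h1 := he.indep.indepFun_prodMk_prodMk₀
      (fun p => (he.memLp p.1 p.2).aestronglyMeasurable.aemeasurable)
      (i, (s : ℕ)) (j, (s : ℕ)) (i, (t : ℕ)) (j, (t : ℕ)) (by simp [hst']) (by simp [hst'])
      (by simp [hst']) (by simp [hst'])
    have hm : Measurable fun p : ℝ × ℝ => p.1 * p.2 - d := by fun_prop
    exact h1.comp hm hm
  · have h1 : ∫ ω, (e i t ω * e j t ω - d) ^ 2 ∂μ ≤ ∫ ω, (e i t ω * e j t ω) ^ 2 ∂μ := by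
      have h2 : ∫ ω, (e i t ω * e j t ω - d) ^ 2 ∂μ =
          Var[fun ω => e i t ω * e j t ω; μ] := by
        rw [variance_eq_integral (hmem t).aestronglyMeasurable.aemeasurable, he.integral_mul]
      rw [h2]
      exact variance_le_expectation_sq (hmem t).aestronglyMeasurable
    refine h1.trans ?_
    have hi := he.integrable_pow_four i t
    have hj := he.integrable_pow_four j t
    have h3 : ∫ ω, (e i t ω * e j t ω) ^ 2 ∂μ ≤
        ∫ ω, (1 / 2 * e i t ω ^ 4 + 1 / 2 * e j t ω ^ 4) ∂μ := by
      refine integral_mono (hmem t).integrable_sq ((hi.const_mul _).add (hj.const_mul _)) fun ω => ?_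
      dsimp only
      nlinarith [sq_nonneg (e i t ω ^ 2 - e j t ω ^ 2)]
    rw [integral_add (hi.const_mul _) (hj.const_mul _), integral_const_mul, integral_const_mul] at h3
    linarith [hκ i t, hκ j t]

set_option maxHeartbeats 1000000 in
/-- The second moment of an entry of the sampling error. -/
theorem ErrorAssumption.entry_bound (he : ErrorAssumption μ e σ2) {κ q a : ℝ}
    (hκ : ∀ i t, ∫ ω, e i t ω ^ 4 ∂μ ≤ κ) (hq : ∀ i, σ2 i ≤ q) (hσ : ∀ i, 0 ≤ σ2 i)
    {T : ℕ} (hT : 0 < T) (x y : Fin T → ℝ)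
    (hx : ∑ t, x t ^ 2 ≤ T * a) (hy : ∑ t, y t ^ 2 ≤ T * a) (i j : ℕ) {V : Ω → ℝ}
    (hV : ∀ ω, V ω = (T : ℝ)⁻¹ * (∑ t : Fin T, x t * e j t ω) +
      (T : ℝ)⁻¹ * (∑ t : Fin T, y t * e i t ω) +
      (T : ℝ)⁻¹ * (∑ t : Fin T, (e i t ω * e j t ω - if i = j then σ2 i else 0)) -
      ((T : ℝ)⁻¹ * ∑ t : Fin T, e i t ω) * ((T : ℝ)⁻¹ * ∑ t : Fin T, e j t ω)) :
    Integrable (fun ω => V ω ^ 2) μ ∧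
      ∫ ω, V ω ^ 2 ∂μ ≤ (8 * a * q + 8 * q ^ 2 + 8 * κ) * (T : ℝ)⁻¹ := by
  have hT' : (0 : ℝ) < T := by exact_mod_cast hT
  have hq0 : 0 ≤ q := (hσ 0).trans (hq 0)
  obtain ⟨a1, a2⟩ := he.weighted_sum x j
  obtain ⟨b1, b2⟩ := he.weighted_sum y i
  obtain ⟨c1, c2⟩ := he.product_sum hκ T i j
  have hone : ∀ i, MemLp (fun ω => ∑ t : Fin T, e i t ω) 4 μ ∧
      ∫ ω, (∑ t : Fin T, e i t ω) ^ 2 ∂μ ≤ T * σ2 i := fun i => by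
    have := he.weighted_sum (fun _ : Fin T => 1) i
    simpa using this
  obtain ⟨d1, d2⟩ := hone i
  obtain ⟨f1, f2⟩ := hone j
  obtain ⟨g1, g2⟩ := he.product_sum hκ T i i
  obtain ⟨h1, h2⟩ := he.product_sum hκ T j j
  set A := fun ω => ∑ t : Fin T, x t * e j t ω with hA
  set B := fun ω => ∑ t : Fin T, y t * e i t ω with hB
  set P := fun ω => ∑ t : Fin T, (e i t ω * e j t ω - if i = j then σ2 i else 0) with hP
  set X := fun ω => ∑ t : Fin T, e i t ω with hX
  set Y := fun ω => ∑ t : Fin T, e j t ω with hY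
  set G := fun ω => ∑ t : Fin T, (e i t ω * e i t ω - if i = i then σ2 i else 0) with hG
  set H := fun ω => ∑ t : Fin T, (e j t ω * e j t ω - if j = j then σ2 j else 0) with hH
  have h24 : (2 : ENNReal) ≤ 4 := by norm_num
  have hA2 := a1.mono_exponent h24
  have hB2 := b1.mono_exponent h24
  have hX2 := d1.mono_exponent h24
  have hY2 := f1.mono_exponent h24
  have hXY := memLp_two_mul (d1.const_mul (T : ℝ)⁻¹) (f1.const_mul (T : ℝ)⁻¹)
  have hVmem : MemLp V 2 μ := by
    have := (((hA2.const_mul (T : ℝ)⁻¹).add (hB2.const_mul (T : ℝ)⁻¹)).add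
      (c1.const_mul (T : ℝ)⁻¹)).sub hXY
    convert this using 1
    ext ω; rw [hV]; rfl
  refine ⟨hVmem.integrable_sq, ?_⟩
  -- fourth powers of the sample means are controlled by the sample variances
  have key : ∀ (k : ℕ) (ω : Ω), ((T : ℝ)⁻¹ * ∑ t : Fin T, e k t ω) ^ 4 ≤
      2 * σ2 k * ((T : ℝ)⁻¹ ^ 2 * (∑ t : Fin T, e k t ω) ^ 2) + (T : ℝ)⁻¹ ^ 2 *
        (∑ t : Fin T, (e k t ω * e k t ω - if k = k then σ2 k else 0)) ^ 2 := by
    intro k ω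
    have e1 := sq_sum_le_card_mul_sum_sq (s := Finset.univ) (f := fun t : Fin T => e k t ω)
    rw [Finset.card_univ, Fintype.card_fin] at e1
    have e2 : ∑ t : Fin T, (e k t ω * e k t ω - if k = k then σ2 k else 0) =
        ∑ t : Fin T, e k t ω ^ 2 - T * σ2 k := by
      simp [Finset.sum_sub_distrib, sq]
    rw [e2]
    set S := ∑ t : Fin T, e k t ω
    set Z := ∑ t : Fin T, e k t ω ^ 2
    have e3 : ((T : ℝ)⁻¹ * S) ^ 2 ≤ (T : ℝ)⁻¹ * Z := by
      rw [mul_pow, sq, mul_assoc]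
      refine mul_le_mul_of_nonneg_left ?_ (inv_nonneg.2 hT'.le)
      rw [inv_mul_le_iff₀ hT']; exact e1
    have e4 : (T : ℝ)⁻¹ * (Z - T * σ2 k) = (T : ℝ)⁻¹ * Z - σ2 k := by field_simp
    have e5 : (T : ℝ)⁻¹ ^ 2 * S ^ 2 = ((T : ℝ)⁻¹ * S) ^ 2 := by ring
    have e6 : (T : ℝ)⁻¹ ^ 2 * (Z - T * σ2 k) ^ 2 = ((T : ℝ)⁻¹ * Z - σ2 k) ^ 2 := by
      rw [← e4]; ring
    rw [e5, e6]
    -- If d is the sample second moment minus σ², Cauchy–Schwarz gives u ≤ σ² + d. Hence u² ≤ σ²u +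
    -- ud ≤ σ²u + u²/2 + d²/2, so the fourth power of a mean is controlled by squares of sums whose
    -- second moments are known.
    set u := ((T : ℝ)⁻¹ * S) ^ 2 with hu
    have hu0 : 0 ≤ u := sq_nonneg _
    have e7 : ((T : ℝ)⁻¹ * S) ^ 4 = u ^ 2 := by rw [hu]; ring
    rw [e7]
    nlinarith [sq_nonneg (u - ((T : ℝ)⁻¹ * Z - σ2 k)), mul_le_mul_of_nonneg_left e3 hu0]
  set I := (T : ℝ)⁻¹ with hI
  have hI0 : 0 < I := inv_pos.2 hT'
  have hIT : I * T = 1 := inv_mul_cancel₀ hT'.ne'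
  have hbound : ∀ ω, V ω ^ 2 ≤ 4 * I ^ 2 * A ω ^ 2 + 4 * I ^ 2 * B ω ^ 2 + 4 * I ^ 2 * P ω ^ 2 +
      (4 * q * I ^ 2 * X ω ^ 2 + 4 * q * I ^ 2 * Y ω ^ 2 + 2 * I ^ 2 * G ω ^ 2 +
        2 * I ^ 2 * H ω ^ 2) := by
    intro ω
    have k1 := key i ω
    have k2 := key j ω
    have k3 : V ω ^ 2 ≤ 4 * ((I * A ω) ^ 2 + (I * B ω) ^ 2 + (I * P ω) ^ 2 +
        ((I * X ω) * (I * Y ω)) ^ 2) := by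
      have : V ω = I * A ω + I * B ω + I * P ω - (I * X ω) * (I * Y ω) := hV ω
      rw [this]
      generalize I * A ω = α
      generalize I * B ω = β
      generalize I * P ω = γ
      generalize (I * X ω) * (I * Y ω) = δ
      nlinarith [sq_nonneg (α - β), sq_nonneg (α - γ), sq_nonneg (α + δ), sq_nonneg (β - γ),
        sq_nonneg (β + δ), sq_nonneg (γ + δ)]
    have k4 : 2 * ((I * X ω) * (I * Y ω)) ^ 2 ≤ (I * X ω) ^ 4 + (I * Y ω) ^ 4 := by
      nlinarith [sq_nonneg ((I * X ω) ^ 2 - (I * Y ω) ^ 2)]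
    have k5 : 2 * σ2 i * (I ^ 2 * X ω ^ 2) ≤ 2 * q * (I ^ 2 * X ω ^ 2) := by
      have := hq i; gcongr
    have k6 : 2 * σ2 j * (I ^ 2 * Y ω ^ 2) ≤ 2 * q * (I ^ 2 * Y ω ^ 2) := by
      have := hq j; gcongr
    have k1' : (I * X ω) ^ 4 ≤ 2 * σ2 i * (I ^ 2 * X ω ^ 2) + I ^ 2 * G ω ^ 2 := k1
    have k2' : (I * Y ω) ^ 4 ≤ 2 * σ2 j * (I ^ 2 * Y ω ^ 2) + I ^ 2 * H ω ^ 2 := k2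
    have k7 : 4 * ((I * A ω) ^ 2 + (I * B ω) ^ 2 + (I * P ω) ^ 2 +
        ((I * X ω) * (I * Y ω)) ^ 2) = 4 * I ^ 2 * A ω ^ 2 + 4 * I ^ 2 * B ω ^ 2 +
        4 * I ^ 2 * P ω ^ 2 + 2 * (2 * ((I * X ω) * (I * Y ω)) ^ 2) := by ring
    rw [k7] at k3
    calc V ω ^ 2 ≤ _ := k3
      _ ≤ 4 * I ^ 2 * A ω ^ 2 + 4 * I ^ 2 * B ω ^ 2 + 4 * I ^ 2 * P ω ^ 2 +
          2 * ((2 * q * (I ^ 2 * X ω ^ 2) + I ^ 2 * G ω ^ 2) +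
            (2 * q * (I ^ 2 * Y ω ^ 2) + I ^ 2 * H ω ^ 2)) := by
          linarith [k1'.trans (add_le_add_left k5 _), k2'.trans (add_le_add_left k6 _)]
      _ = _ := by ring
  have iA := hA2.integrable_sq.const_mul (4 * I ^ 2)
  have iB := hB2.integrable_sq.const_mul (4 * I ^ 2)
  have iP := c1.integrable_sq.const_mul (4 * I ^ 2)
  have iX := hX2.integrable_sq.const_mul (4 * q * I ^ 2)
  have iY := hY2.integrable_sq.const_mul (4 * q * I ^ 2)
  have iG := g1.integrable_sq.const_mul (2 * I ^ 2)
  have iH := h1.integrable_sq.const_mul (2 * I ^ 2)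
  have hint := integral_mono hVmem.integrable_sq
    (((iA.add iB).add iP).add (((iX.add iY).add iG).add iH)) hbound
  have hsplit : ∫ ω, (4 * I ^ 2 * A ω ^ 2 + 4 * I ^ 2 * B ω ^ 2 + 4 * I ^ 2 * P ω ^ 2 +
      (4 * q * I ^ 2 * X ω ^ 2 + 4 * q * I ^ 2 * Y ω ^ 2 + 2 * I ^ 2 * G ω ^ 2 +
        2 * I ^ 2 * H ω ^ 2)) ∂μ =
      4 * I ^ 2 * ∫ ω, A ω ^ 2 ∂μ + 4 * I ^ 2 * ∫ ω, B ω ^ 2 ∂μ + 4 * I ^ 2 * ∫ ω, P ω ^ 2 ∂μ +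
      (4 * q * I ^ 2 * ∫ ω, X ω ^ 2 ∂μ + 4 * q * I ^ 2 * ∫ ω, Y ω ^ 2 ∂μ +
        2 * I ^ 2 * ∫ ω, G ω ^ 2 ∂μ + 2 * I ^ 2 * ∫ ω, H ω ^ 2 ∂μ) := by
    simp only [← integral_const_mul]
    exact (integral_add ((iA.add iB).add iP) (((iX.add iY).add iG).add iH)).trans
      (congrArg₂ (· + ·)
        ((integral_add (iA.add iB) iP).trans (congrArg₂ (· + ·) (integral_add iA iB) rfl))
        ((integral_add ((iX.add iY).add iG) iH).trans (congrArg₂ (· + ·)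
          ((integral_add (iX.add iY) iG).trans (congrArg₂ (· + ·) (integral_add iX iY) rfl)) rfl)))
  have hI2 : I ^ 2 * T = I := by rw [sq, mul_assoc, hIT, mul_one]
  have n1 : ∫ ω, A ω ^ 2 ∂μ ≤ T * (a * q) := by
    refine a2.trans ?_
    calc (∑ t, x t ^ 2) * σ2 j ≤ (T * a) * q := by
          have := hq j
          have h0 : 0 ≤ ∑ t, x t ^ 2 := Finset.sum_nonneg fun _ _ => sq_nonneg _
          have := h0.trans hx
          gcongr
          exact hσ j
      _ = _ := by ring
  have n2 : ∫ ω, B ω ^ 2 ∂μ ≤ T * (a * q) := by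
    refine b2.trans ?_
    calc (∑ t, y t ^ 2) * σ2 i ≤ (T * a) * q := by
          have := hq i
          have h0 : 0 ≤ ∑ t, y t ^ 2 := Finset.sum_nonneg fun _ _ => sq_nonneg _
          have := h0.trans hy
          gcongr
          exact hσ i
      _ = _ := by ring
  have n3 : ∫ ω, X ω ^ 2 ∂μ ≤ T * q := d2.trans (mul_le_mul_of_nonneg_left (hq i) hT'.le)
  have n4 : ∫ ω, Y ω ^ 2 ∂μ ≤ T * q := f2.trans (mul_le_mul_of_nonneg_left (hq j) hT'.le)
  refine hint.trans ?_
  have hsplit' := hsplit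
  calc _ = _ := hsplit
    _ ≤ 4 * I ^ 2 * (T * (a * q)) + 4 * I ^ 2 * (T * (a * q)) + 4 * I ^ 2 * (T * κ) +
      (4 * q * I ^ 2 * (T * q) + 4 * q * I ^ 2 * (T * q) + 2 * I ^ 2 * (T * κ) +
        2 * I ^ 2 * (T * κ)) := by gcongr
    _ = (8 * a * q + 8 * q ^ 2 + 8 * κ) * (I ^ 2 * T) := by ring
    _ = _ := by rw [hI2]

end SamplingError

/-! ### Algebra of sample covariances of signal plus noise. -/

section SampleMoment

variable {T n : ℕ}

theorem sampleMoment_posSemidef (x : Fin T → Fin n → ℝ) : (sampleMoment x).PosSemidef := by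
  refine (Matrix.posSemidef_sum _ fun t _ => ?_).smul (by positivity)
  simpa using Matrix.posSemidef_vecMulVec_self_star (x t - sampleMean x)

theorem sampleMoment_apply (x : Fin T → Fin n → ℝ) (i j : Fin n) :
    sampleMoment x i j =
      (T : ℝ)⁻¹ * ∑ t, (x t i - sampleMean x i) * (x t j - sampleMean x j) := by
  simp [sampleMoment, Matrix.sum_apply, vecMulVec_apply]

theorem sampleMean_apply (x : Fin T → Fin n → ℝ) (i : Fin n) :
    sampleMean x i = (T : ℝ)⁻¹ * ∑ t, x t i := by
  simp [sampleMean]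

theorem sum_sub_sampleMean (x : Fin T → Fin n → ℝ) (hT : 0 < T) (i : Fin n) :
    ∑ t, (x t i - sampleMean x i) = 0 := by
  have : (T : ℝ) ≠ 0 := by exact_mod_cast hT.ne'
  rw [Finset.sum_sub_distrib, sampleMean_apply]
  simp only [Finset.sum_const, Finset.card_univ, Fintype.card_fin, nsmul_eq_mul]
  field_simp
  ring

/-- The sample covariance of signal plus noise. -/
theorem covariance_signal_add_noise (hT : 0 < T) {x y u v : Fin T → ℝ}
    (hx : ∑ t, x t = 0) (hy : ∑ t, y t = 0) :
    (T : ℝ)⁻¹ * ∑ t, (x t + (u t - (T : ℝ)⁻¹ * ∑ s, u s)) * (y t + (v t - (T : ℝ)⁻¹ * ∑ s, v s)) =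
      (T : ℝ)⁻¹ * ∑ t, x t * y t + (T : ℝ)⁻¹ * ∑ t, x t * v t + (T : ℝ)⁻¹ * ∑ t, y t * u t +
        (T : ℝ)⁻¹ * ∑ t, u t * v t - ((T : ℝ)⁻¹ * ∑ t, u t) * ((T : ℝ)⁻¹ * ∑ t, v t) := by
  have hT' : (T : ℝ) ≠ 0 := by exact_mod_cast hT.ne'
  set a := (T : ℝ)⁻¹ * ∑ s, u s with ha
  set b := (T : ℝ)⁻¹ * ∑ s, v s with hb
  have h1 : ∑ t, (x t + (u t - a)) * (y t + (v t - b)) =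
      ∑ t, x t * y t + ∑ t, x t * v t + ∑ t, y t * u t + ∑ t, u t * v t - b * ∑ t, x t
        - a * ∑ t, y t - b * ∑ t, u t - a * ∑ t, v t + T * (a * b) := by
    have h2 : (T : ℝ) * (a * b) = ∑ _t : Fin T, a * b := by simp
    rw [h2]
    simp only [Finset.mul_sum, ← Finset.sum_add_distrib, ← Finset.sum_sub_distrib]
    refine Finset.sum_congr rfl fun t _ => ?_
    ring
  rw [h1, hx, hy]
  have h3 : ∑ t, u t = T * a := by rw [ha]; field_simp
  have h4 : ∑ t, v t = T * b := by rw [hb]; field_simp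
  rw [h3, h4]
  field_simp
  ring

end SampleMoment

section Noise

variable {Ω : Type*} {r : ℕ}

/-- The entries of the sampling error. -/
theorem sampleMoment_observation_apply (α : (N T : ℕ) → Fin N → ℝ)
    (lam : (N T : ℕ) → Fin N → Fin r → ℝ) (f : (N T : ℕ) → Fin T → Fin r → ℝ)
    (e : ℕ → ℕ → Ω → ℝ) (σ2 : ℕ → ℝ) {N T : ℕ} (hT : 0 < T) (ω : Ω) (i j : Fin N) :
    (sampleMoment (observation α lam f e N T ω) - (trueParam lam σ2 f N T).sigmaZZ) i j =
      (T : ℝ)⁻¹ * (∑ t : Fin T, (lam N T i ⬝ᵥ (f N T t - sampleMean (f N T))) * e j t ω) +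
      (T : ℝ)⁻¹ * (∑ t : Fin T, (lam N T j ⬝ᵥ (f N T t - sampleMean (f N T))) * e i t ω) +
      (T : ℝ)⁻¹ * (∑ t : Fin T,
        (e i t ω * e j t ω - if (i : ℕ) = (j : ℕ) then σ2 i else 0)) -
      ((T : ℝ)⁻¹ * ∑ t : Fin T, e i t ω) * ((T : ℝ)⁻¹ * ∑ t : Fin T, e j t ω) := by
  have hT' : (T : ℝ) ≠ 0 := by exact_mod_cast hT.ne'
  have hmean : ∀ k, sampleMean (observation α lam f e N T ω) k =
      α N T k + lam N T k ⬝ᵥ sampleMean (f N T) + (T : ℝ)⁻¹ * ∑ t : Fin T, e k t ω := by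
    intro k
    rw [sampleMean_apply]
    simp only [observation, Finset.sum_add_distrib, sampleMean, dotProduct_smul, dotProduct_sum]
    simp only [Finset.sum_const, Finset.card_univ, Fintype.card_fin, nsmul_eq_mul, smul_eq_mul]
    field_simp
  have hdev : ∀ (t : Fin T) k, observation α lam f e N T ω t k -
      sampleMean (observation α lam f e N T ω) k =
      lam N T k ⬝ᵥ (f N T t - sampleMean (f N T)) + (e k t ω - (T : ℝ)⁻¹ * ∑ s : Fin T, e k s ω) := by
    intro t k
    rw [hmean, dotProduct_sub]
    simp only [observation]
    ring
  have hzero : ∀ k, ∑ t, lam N T k ⬝ᵥ (f N T t - sampleMean (f N T)) = 0 := by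
    intro k
    rw [← dotProduct_sum]
    have : ∑ t, (f N T t - sampleMean (f N T)) = 0 := by
      ext l
      simpa using sum_sub_sampleMean (f N T) hT l
    rw [this, dotProduct_zero]
  have hsig : ((trueParam lam σ2 f N T).loading * (trueParam lam σ2 f N T).moment *
      (trueParam lam σ2 f N T).loadingᵀ) i j = (T : ℝ)⁻¹ * ∑ t,
        (lam N T i ⬝ᵥ (f N T t - sampleMean (f N T))) *
          (lam N T j ⬝ᵥ (f N T t - sampleMean (f N T))) := by
    simp only [trueParam, sampleMoment, Matrix.mul_smul, Matrix.smul_mul, Matrix.smul_apply,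
      Matrix.mul_sum, Matrix.sum_mul, Matrix.sum_apply, smul_eq_mul]
    congr 1
    refine Finset.sum_congr rfl fun t _ => ?_
    rw [Matrix.mul_vecMulVec, Matrix.vecMulVec_mul, Matrix.vecMulVec_apply, Matrix.vecMul_transpose]
    rfl
  have hdiag : (trueParam lam σ2 f N T).sigmaEE i j = if (i : ℕ) = (j : ℕ) then σ2 i else 0 := by
    simp [FactorParam.sigmaEE, trueParam, Matrix.diagonal_apply, Fin.ext_iff]
  rw [Matrix.sub_apply, FactorParam.sigmaZZ, Matrix.add_apply, hsig, hdiag, sampleMoment_apply]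
  simp only [hdev]
  rw [covariance_signal_add_noise hT (hzero i) (hzero j), Finset.sum_sub_distrib]
  simp only [Finset.sum_const, Finset.card_univ, Fintype.card_fin, nsmul_eq_mul]
  field_simp
  ring

/-- The sample second moment of the signal. -/
theorem sum_sq_signal (lam : Fin r → ℝ) {T : ℕ} (hT : 0 < T) (f : Fin T → Fin r → ℝ) :
    ∑ t, (lam ⬝ᵥ (f t - sampleMean f)) ^ 2 = T * (lam ⬝ᵥ sampleMoment f *ᵥ lam) := by
  have hT' : (T : ℝ) ≠ 0 := by exact_mod_cast hT.ne'
  simp only [sampleMoment, Matrix.smul_mulVec, dotProduct_smul, Matrix.sum_mulVec, dotProduct_sum,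
    smul_eq_mul]
  rw [mul_inv_cancel_left₀ hT']
  refine Finset.sum_congr rfl fun t _ => ?_
  rw [Matrix.vecMulVec_mulVec, dotProduct_smul, dotProduct_comm _ lam]
  simp [sq]

end Noise

/-! ### Probability that the sampling error is small. -/

section NoiseEvent

variable {Ω : Type*} [MeasurableSpace Ω] {μ : Measure Ω} [IsProbabilityMeasure μ]

theorem sum_ite_lt_le {N : ℕ} (r : ℕ) {c : Fin N → ℝ} {b : ℝ} (hb : 0 ≤ b) (hc : ∀ i, c i ≤ b) :
    ∑ i : Fin N, (if i.val < r then c i else 0) ≤ r * b := by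
  rw [← Finset.sum_filter]
  refine (Finset.sum_le_card_nsmul _ _ b fun i _ => hc i).trans ?_
  rw [nsmul_eq_mul]
  refine mul_le_mul_of_nonneg_right ?_ hb
  have h : (Finset.univ.filter fun i : Fin N => i.val < r).card ≤ (Finset.range r).card :=
    Finset.card_le_card_of_injOn Fin.val (fun i hi => by simpa using hi)
      (fun _ _ _ _ h => Fin.ext h)
  rw [Finset.card_range] at h
  exact_mod_cast h

/-- A random symmetric matrix whose entries have second moments of order `b` is small with high
probability. -/
theorem measure_not_smallNoise_le {N : ℕ} (r : ℕ) (hN : 0 < N) {W : Ω → Matrix (Fin N) (Fin N) ℝ}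
    {b τ : ℝ} (hb : 0 ≤ b) (hτ : 0 < τ) (hsymm : ∀ ω, (W ω)ᵀ = W ω)
    (hint : ∀ i j, Integrable (fun ω => W ω i j ^ 2) μ)
    (hbound : ∀ i j, ∫ ω, W ω i j ^ 2 ∂μ ≤ b) :
    μ {ω | ¬ SmallNoise r τ (W ω)} ≤ ENNReal.ofReal ((2 + r + r * r) * b / τ ^ 2) := by
  have hN' : (0 : ℝ) < N := by exact_mod_cast hN
  set S1 : Ω → ℝ := fun ω => ∑ i, ∑ j, W ω i j ^ 2 with hS1
  set S2 : Ω → ℝ := fun ω => ∑ i, W ω i i ^ 2 with hS2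
  set S3 : Ω → ℝ := fun ω => ∑ i : Fin N, (if i.val < r then ∑ j, W ω i j ^ 2 else 0) with hS3
  set S4 : Ω → ℝ := fun ω => ∑ i : Fin N, (if i.val < r then
    ∑ j : Fin N, (if j.val < r then W ω i j ^ 2 else 0) else 0) with hS4
  have hite : ∀ (p : Prop) [Decidable p] (g : Ω → ℝ), Integrable g μ →
      Integrable (fun ω => if p then g ω else 0) μ := fun p _ g hg => by
    split_ifs
    · exact hg
    · exact integrable_const 0
  have hite' : ∀ (p : Prop) [Decidable p] (g : Ω → ℝ),
      ∫ ω, (if p then g ω else 0) ∂μ = if p then ∫ ω, g ω ∂μ else 0 := fun p _ g => by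
    split_ifs <;> simp
  have hrow : ∀ i, Integrable (fun ω => ∑ j, W ω i j ^ 2) μ := fun i =>
    integrable_finsetSum _ fun j _ => hint i j
  have hrow' : ∀ i : Fin N, Integrable (fun ω => ∑ j : Fin N,
      (if j.val < r then W ω i j ^ 2 else 0)) μ := fun i =>
    integrable_finsetSum _ fun j _ => hite _ _ (hint i j)
  have i1 : Integrable S1 μ := integrable_finsetSum _ fun i _ => hrow i
  have i2 : Integrable S2 μ := integrable_finsetSum _ fun i _ => hint i i
  have i3 : Integrable S3 μ := integrable_finsetSum _ fun i _ => hite _ _ (hrow i)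
  have i4 : Integrable S4 μ := integrable_finsetSum _ fun i _ => hite _ _ (hrow' i)
  have b0 : ∀ i, ∫ ω, ∑ j, W ω i j ^ 2 ∂μ ≤ N * b := fun i => by
    rw [integral_finsetSum _ fun j _ => hint i j]
    exact (Finset.sum_le_sum fun j _ => hbound i j).trans (by simp)
  have b1 : ∫ ω, S1 ω ∂μ ≤ N ^ 2 * b := by
    rw [hS1, integral_finsetSum _ fun i _ => hrow i]
    exact (Finset.sum_le_sum fun i _ => b0 i).trans (by simp [sq, mul_assoc])
  have b2 : ∫ ω, S2 ω ∂μ ≤ N * b := by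
    rw [hS2, integral_finsetSum _ fun i _ => hint i i]
    exact (Finset.sum_le_sum fun i _ => hbound i i).trans (by simp)
  have b3 : ∫ ω, S3 ω ∂μ ≤ r * (N * b) := by
    rw [hS3, integral_finsetSum _ fun i _ => hite _ _ (hrow i)]
    simp only [hite']
    exact sum_ite_lt_le r (by positivity) b0
  have b4 : ∫ ω, S4 ω ∂μ ≤ r * (r * b) := by
    rw [hS4, integral_finsetSum _ fun i _ => hite _ _ (hrow' i)]
    simp only [hite']
    refine sum_ite_lt_le r (by positivity) fun i => ?_
    rw [integral_finsetSum _ fun j _ => hite _ _ (hint i j)]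
    simp only [hite']
    exact sum_ite_lt_le r hb (hbound i)
  -- One Markov inequality serves all four bounds: each sum is divided by the number of its entries
  -- in powers of N. The expectations are at most b, b, rb and r²b, whence the factor 2 + r + r².
  set S : Ω → ℝ := fun ω => ((N : ℝ) ^ 2)⁻¹ * S1 ω + (N : ℝ)⁻¹ * S2 ω + (N : ℝ)⁻¹ * S3 ω + S4 ω
    with hS
  have iS : Integrable S μ :=
    (((i1.const_mul _).add (i2.const_mul _)).add (i3.const_mul _)).add i4
  have hsum : ∫ ω, S ω ∂μ = ((N : ℝ) ^ 2)⁻¹ * ∫ ω, S1 ω ∂μ + (N : ℝ)⁻¹ * ∫ ω, S2 ω ∂μ +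
      (N : ℝ)⁻¹ * ∫ ω, S3 ω ∂μ + ∫ ω, S4 ω ∂μ := by
    simp only [← integral_const_mul]
    exact (integral_add (((i1.const_mul _).add (i2.const_mul _)).add (i3.const_mul _)) i4).trans
      (congrArg₂ (· + ·) ((integral_add ((i1.const_mul _).add (i2.const_mul _))
        (i3.const_mul _)).trans (congrArg₂ (· + ·)
          (integral_add (i1.const_mul _) (i2.const_mul _)) rfl)) rfl)
  have hSb : ∫ ω, S ω ∂μ ≤ (2 + r + r * r) * b := by
    rw [hsum]
    have c1 : ((N : ℝ) ^ 2)⁻¹ * ∫ ω, S1 ω ∂μ ≤ b := by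
      rw [inv_mul_le_iff₀ (by positivity)]; exact b1
    have c2 : (N : ℝ)⁻¹ * ∫ ω, S2 ω ∂μ ≤ b := by
      rw [inv_mul_le_iff₀ hN']; exact b2
    have c3 : (N : ℝ)⁻¹ * ∫ ω, S3 ω ∂μ ≤ r * b := by
      rw [inv_mul_le_iff₀ hN']; linarith [b3]
    linarith
  have p1 : ∀ ω, 0 ≤ S1 ω := fun ω => by positivity
  have p2 : ∀ ω, 0 ≤ S2 ω := fun ω => by positivity
  have p3 : ∀ ω, 0 ≤ S3 ω := fun ω => Finset.sum_nonneg fun i _ => by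
    split_ifs <;> positivity
  have p4 : ∀ ω, 0 ≤ S4 ω := fun ω => Finset.sum_nonneg fun i _ => by
    split_ifs
    · exact Finset.sum_nonneg fun j _ => by split_ifs <;> positivity
    · exact le_rfl
  have hS0 : ∀ ω, 0 ≤ S ω := fun ω => by
    have := p1 ω; have := p2 ω; have := p3 ω; have := p4 ω
    positivity
  have hsub : {ω | ¬ SmallNoise r τ (W ω)} ⊆ {ω | τ ^ 2 ≤ S ω} := by
    intro ω hω
    by_contra hlt
    refine hω ?_
    have hlt' : S ω ≤ τ ^ 2 := (not_le.1 hlt).le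
    have q1 : 0 ≤ ((N : ℝ) ^ 2)⁻¹ * S1 ω := by have := p1 ω; positivity
    have q2 : 0 ≤ (N : ℝ)⁻¹ * S2 ω := by have := p2 ω; positivity
    have q3 : 0 ≤ (N : ℝ)⁻¹ * S3 ω := by have := p3 ω; positivity
    have q4 := p4 ω
    have hSω : S ω = ((N : ℝ) ^ 2)⁻¹ * S1 ω + (N : ℝ)⁻¹ * S2 ω + (N : ℝ)⁻¹ * S3 ω + S4 ω := rfl
    have hsqN : (τ * √N) ^ 2 = N * τ ^ 2 := by
      rw [mul_pow, Real.sq_sqrt hN'.le, mul_comm]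
    refine ⟨hτ.le, hsymm ω, ?_, ?_, ?_, ?_⟩
    · have : ((N : ℝ) ^ 2)⁻¹ * S1 ω ≤ τ ^ 2 := by linarith
      rw [inv_mul_le_iff₀ (by positivity)] at this
      rw [mul_pow, mul_comm]; exact this
    · have : (N : ℝ)⁻¹ * S2 ω ≤ τ ^ 2 := by linarith
      rw [inv_mul_le_iff₀ hN'] at this
      rw [hsqN]; exact this
    · have : (N : ℝ)⁻¹ * S3 ω ≤ τ ^ 2 := by linarith
      rw [inv_mul_le_iff₀ hN'] at this
      rw [hsqN]; exact this
    · have : S4 ω ≤ τ ^ 2 := by linarith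
      exact this
  have hM := mul_meas_ge_le_integral_of_nonneg (ae_of_all μ hS0) iS (τ ^ 2)
  have hτ2 : 0 < τ ^ 2 := by positivity
  calc μ {ω | ¬ SmallNoise r τ (W ω)} ≤ μ {ω | τ ^ 2 ≤ S ω} := measure_mono hsub
    _ = ENNReal.ofReal (μ.real {ω | τ ^ 2 ≤ S ω}) := (ofReal_measureReal).symm
    _ ≤ _ := by
        refine ENNReal.ofReal_le_ofReal ?_
        rw [le_div_iff₀ hτ2, mul_comm]
        exact hM.trans hSb

variable {r : ℕ} {e : ℕ → ℕ → Ω → ℝ} {σ2 : ℕ → ℝ}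

/-- The sampling error is of order `√(κ / T)` with high probability, uniformly in `N`. -/
theorem ErrorAssumption.exists_measure_not_smallNoise_le (he : ErrorAssumption μ e σ2)
    {C : ℝ} (hσ : ∀ i, σ2 i ∈ Set.Icc (C ^ 2)⁻¹ (C ^ 2)) (α : (N T : ℕ) → Fin N → ℝ)
    (lam : (N T : ℕ) → Fin N → Fin r → ℝ) (f : (N T : ℕ) → Fin T → Fin r → ℝ)
    (hlam : ∀ N T i, lam N T i ⬝ᵥ lam N T i ≤ C ^ 2) :
    ∃ K : ℝ, 0 ≤ K ∧ ∀ N T : ℕ, 0 < N → 0 < T → (∀ k l, |sampleMoment (f N T) k l| ≤ C) →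
      ∀ κ : ℝ, 0 < κ → μ {ω | ¬ SmallNoise r (√(κ / T))
        (sampleMoment (observation α lam f e N T ω) - (trueParam lam σ2 f N T).sigmaZZ)} ≤
          ENNReal.ofReal (K / κ) := by
  obtain ⟨K4, hK4⟩ := he.fourth_moment
  set a := √((r : ℝ) * r * C ^ 2) * C ^ 2 with ha
  have ha0 : 0 ≤ a := by positivity
  set b := 8 * a * C ^ 2 + 8 * (C ^ 2) ^ 2 + 8 * K4 ^ 4 with hb
  have hb0 : 0 ≤ b := by positivity
  refine ⟨(2 + r + r * r) * b, by positivity, fun N T hN hT hM κ hκ => ?_⟩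
  have hT' : (0 : ℝ) < T := by exact_mod_cast hT
  have hsig : ∀ i : Fin N, ∑ t, (lam N T i ⬝ᵥ (f N T t - sampleMean (f N T))) ^ 2 ≤ T * a := by
    intro i
    rw [sum_sq_signal _ hT]
    refine mul_le_mul_of_nonneg_left ?_ hT'.le
    let _ := Matrix.frobeniusNormedAddCommGroup (m := Fin r) (n := Fin r) (α := ℝ)
    refine (le_abs_self _).trans ((abs_quadForm_le _ _).trans ?_)
    have h1 := norm_le_of_forall_abs_le hM
    have h2 : 0 ≤ lam N T i ⬝ᵥ lam N T i := by
      simpa using dotProduct_star_self_nonneg (lam N T i)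
    refine mul_le_mul (h1.trans (le_of_eq ?_)) (hlam N T i) h2 (Real.sqrt_nonneg _)
    simp
  have hent := fun i j : Fin N => he.entry_bound (κ := K4 ^ 4) (q := C ^ 2) (a := a) hK4
    (fun i => (hσ i).2) (fun i => le_trans (by positivity) (hσ i).1) hT _ _ (hsig i) (hsig j) i j
    (fun ω => sampleMoment_observation_apply α lam f e σ2 hT ω i j)
  -- With τ² = κ/T, the factor 1/T of the second moments cancels, and the bound depends on neither N
  -- nor T.
  have h := measure_not_smallNoise_le (μ := μ) r hN (b := b * (T : ℝ)⁻¹) (τ := √(κ / T))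
    (W := fun ω => sampleMoment (observation α lam f e N T ω) - (trueParam lam σ2 f N T).sigmaZZ)
    (by positivity) (by positivity) (fun ω => ?_) (fun i j => (hent i j).1) fun i j => (hent i j).2
  · refine h.trans (le_of_eq ?_)
    rw [Real.sq_sqrt (by positivity)]
    congr 1
    field_simp
  · have h1 : (sampleMoment (observation α lam f e N T ω))ᵀ =
        sampleMoment (observation α lam f e N T ω) := by
      simpa [Matrix.IsHermitian] using (sampleMoment_posSemidef (observation α lam f e N T ω)).1
    have h2 : (sampleMoment (f N T))ᵀ = sampleMoment (f N T) := by
      simpa [Matrix.IsHermitian] using (sampleMoment_posSemidef (f N T)).1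
    simp [FactorParam.sigmaZZ, FactorParam.sigmaEE, trueParam, h1, h2, Matrix.transpose_mul,
      Matrix.mul_assoc]

end NoiseEvent

/-! ### Limits turned into bounds that hold for all large sample sizes. -/

section FrobeniusNorm

attribute [local instance] Matrix.frobeniusNormedAddCommGroup Matrix.frobeniusNormedSpace

variable {ι κ ν m n : Type*} [Fintype ι] [Fintype κ] [Fintype ν] [Fintype m] [Fintype n]
  [DecidableEq ι] [DecidableEq κ] [DecidableEq ν] [DecidableEq m] [DecidableEq n]

/-- For A = BᵀB, write v = B⁻¹(Bv), so that |v|² ≤ ‖B⁻¹‖² |Bv|². The added 1 keeps the constant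
positive in dimension zero. -/
theorem exists_lower_of_posDef {A : Matrix m m ℝ} (hA : A.PosDef) :
    ∃ c : ℝ, 0 < c ∧ ∀ v, c * (v ⬝ᵥ v) ≤ v ⬝ᵥ A *ᵥ v := by
  obtain ⟨B, hB⟩ : ∃ B : Matrix m m ℝ, A = Bᵀ * B := by
    obtain ⟨g, hg⟩ := exists_eq_mul_transpose hA.posSemidef
    exact ⟨gᵀ, by rw [Matrix.transpose_transpose, hg]⟩
  have hdet : IsUnit B.det := by
    have h := hA.det_pos
    rw [hB, Matrix.det_mul, Matrix.det_transpose] at h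
    exact isUnit_iff_ne_zero.2 fun h0 => by simp [h0] at h
  refine ⟨(‖B⁻¹‖ ^ 2 + 1)⁻¹, by positivity, fun v => ?_⟩
  rw [inv_mul_le_iff₀ (by positivity), hB, quadForm_transpose_mul_self]
  have h1 := mulVec_sq_le B⁻¹ (B *ᵥ v)
  rw [Matrix.mulVec_mulVec, Matrix.nonsing_inv_mul _ hdet, Matrix.one_mulVec] at h1
  have h2 := dotProduct_self_nonneg' (B *ᵥ v)
  linarith

theorem exists_eventually_lower {β : Type*} {l : Filter β} {r : ℕ}
    {A : β → Matrix (Fin r) (Fin r) ℝ} {A₀ : Matrix (Fin r) (Fin r) ℝ}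
    (hA : ∀ i j, Tendsto (fun p => A p i j) l (𝓝 (A₀ i j))) (h₀ : A₀.PosDef) :
    ∃ c : ℝ, 0 < c ∧ ∀ᶠ p in l, ∀ v, c * (v ⬝ᵥ v) ≤ v ⬝ᵥ A p *ᵥ v := by
  obtain ⟨c, hc, hlow⟩ := exists_lower_of_posDef h₀
  refine ⟨c / 2, half_pos hc, ?_⟩
  have hε : 0 < c / (2 * (r + 1)) := by positivity
  have hev : ∀ᶠ p in l, ∀ i j, |(A p - A₀) i j| ≤ c / (2 * (r + 1)) := by
    refine eventually_all.2 fun i => eventually_all.2 fun j => ?_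
    filter_upwards [(hA i j).eventually (Metric.ball_mem_nhds _ hε)] with p hp
    rw [Matrix.sub_apply, ← Real.dist_eq]
    exact (Metric.mem_ball.1 hp).le
  filter_upwards [hev] with p hp v
  have h1 := norm_le_of_forall_abs_le hp
  have h2 : √((Fintype.card (Fin r) : ℝ) * Fintype.card (Fin r) * (c / (2 * (r + 1))) ^ 2) ≤
      c / 2 := by
    rw [Real.sqrt_le_left (by positivity), Fintype.card_fin]
    have h3 : (r : ℝ) * (c / (2 * (r + 1))) ≤ c / 2 := by
      rw [mul_div_assoc', div_le_div_iff₀ (by positivity) (by positivity)]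
      nlinarith
    calc (r : ℝ) * r * (c / (2 * (r + 1))) ^ 2 = (r * (c / (2 * (r + 1)))) ^ 2 := by ring
      _ ≤ _ := pow_le_pow_left₀ (by positivity) h3 2
  have h4 := add_lower hlow (h1.trans h2) v
  rw [add_sub_cancel] at h4
  linarith

theorem exists_eventually_add_le {β ι : Type*} [Finite ι] {l : Filter β} {x y : β → ι → ℝ}
    {x₀ y₀ : ι → ℝ} (hx : ∀ i, Tendsto (fun p => x p i) l (𝓝 (x₀ i)))
    (hy : ∀ i, Tendsto (fun p => y p i) l (𝓝 (y₀ i))) (h : ∀ i, x₀ i < y₀ i) :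
    ∃ δ : ℝ, 0 < δ ∧ ∀ᶠ p in l, ∀ i, x p i + δ ≤ y p i := by
  have h1 : ∀ᶠ δ : ℝ in 𝓝[>] 0, ∀ i, x₀ i + δ < y₀ i := by
    refine eventually_all.2 fun i => ?_
    have h2 : ∀ᶠ δ : ℝ in 𝓝 0, δ < y₀ i - x₀ i := eventually_lt_nhds (sub_pos.2 (h i))
    filter_upwards [nhdsWithin_le_nhds h2] with δ hδ
    linarith
  obtain ⟨δ, hδ, hδ0⟩ := (h1.and self_mem_nhdsWithin).exists
  refine ⟨δ, hδ0, eventually_all.2 fun i => ?_⟩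
  filter_upwards [((hx i).add_const δ).eventually_lt (hy i) (hδ i)] with p hp
  exact hp.le

/-- Ordered sequences with distinct limits are eventually separated. -/
theorem exists_eventually_gap {β : Type*} {l : Filter β} [l.NeBot] {r : ℕ} {d : β → Fin r → ℝ}
    {d₀ : Fin r → ℝ} (hd : ∀ k, Tendsto (fun p => d p k) l (𝓝 (d₀ k)))
    (hanti : ∀ᶠ p in l, StrictAnti (d p)) (hinj : Function.Injective d₀) :
    ∃ δ : ℝ, 0 < δ ∧ ∀ᶠ p in l, ∀ i j, i < j → d p j + δ ≤ d p i := by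
  obtain ⟨δ, hδ, h⟩ := exists_eventually_add_le (ι := {q : Fin r × Fin r // q.1 < q.2})
    (x := fun p q => d p q.1.2) (y := fun p q => d p q.1.1) (fun q => hd q.1.2) (fun q => hd q.1.1)
    fun q => lt_of_le_of_ne
      (le_of_tendsto_of_tendsto (hd q.1.2) (hd q.1.1) (hanti.mono fun p hp => (hp q.2).le))
      fun heq => q.2.ne' (hinj heq)
  exact ⟨δ, hδ, h.mono fun p hp i j hij => hp ⟨(i, j), hij⟩⟩

/-- The estimation errors are eventually of the order of the sampling error. -/
theorem exists_eventually_errorBound {r : ℕ} {C : ℝ} (hC : 0 < C) (hC1 : 1 ≤ C ^ 2) {ic : IdentCond}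
    {θ : (N T : ℕ) → FactorParam N r} {Mbar Q : Matrix (Fin r) (Fin r) ℝ}
    (hM : ∀ k l, Tendsto (fun p : ℕ × ℕ => (θ p.1 p.2).moment k l) atTop (𝓝 (Mbar k l)))
    (hMbar : Mbar.PosDef)
    (hQ : ∀ k l, Tendsto (fun p : ℕ × ℕ => (θ p.1 p.2).weightedMoment k l) atTop (𝓝 (Q k l)))
    (hQpos : Q.PosDef) (hMC : ∀ k l, |Mbar k l| < C)
    (hvar : ∀ N T i, (θ N T).variance i ∈ Set.Icc (C ^ 2)⁻¹ (C ^ 2))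
    (hload : ∀ N T i, (θ N T).loading i ⬝ᵥ (θ N T).loading i ≤ C ^ 2)
    (hpsd : ∀ N T, (θ N T).moment.PosSemidef)
    (hic : ∀ᶠ p : ℕ × ℕ in atTop, ic.Holds (θ p.1 p.2)) (hicLim : ic.HoldsInLimit θ Mbar Q) :
    ∃ c τ₀ : ℝ, 0 < c ∧ 0 < τ₀ ∧ ∀ᶠ p : ℕ × ℕ in atTop, ∀ (τ : ℝ) (M : Matrix (Fin p.1) (Fin p.1) ℝ)
      (θ' : FactorParam p.1 r), IsMLE C ic M θ' → ic.SameSigns θ' (θ p.1 p.2) → M.PosSemidef →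
      SmallNoise r τ (M - (θ p.1 p.2).sigmaZZ) → τ ≤ τ₀ → ErrorBound c τ θ' (θ p.1 p.2) := by
  obtain ⟨m, hm, hmlow⟩ := exists_eventually_lower hM hMbar
  obtain ⟨w, hw, hwlow⟩ := exists_eventually_lower hQ hQpos
  have hMle : ∀ᶠ p : ℕ × ℕ in atTop, ∀ k l, |(θ p.1 p.2).moment k l| ≤ C :=
    eventually_all.2 fun k => eventually_all.2 fun l =>
      ((hM k l).abs.eventually_lt_const (hMC k l)).mono fun p hp => hp.le
  have hreg : ∀ᶠ p : ℕ × ℕ in atTop, RegularParam C m w (θ p.1 p.2) := by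
    filter_upwards [hmlow, hwlow, hMle] with p h1 h2 h3
    exact ⟨⟨hC1, fun i => (hvar _ _ i).1, fun i => (hvar _ _ i).2⟩, hload _ _, hpsd _ _, h3, h1, h2⟩
  have hmem : ∀ᶠ p : ℕ × ℕ in atTop, θ p.1 p.2 ∈ paramSet p.1 r C ic := by
    filter_upwards [hMle, hic] with p h1 h2
    exact ⟨hvar _ _, hpsd _ _, fun k l => abs_le.1 (h1 k l), h2⟩
  have hlarge : ∀ N₀ : ℝ, ∀ᶠ p : ℕ × ℕ in atTop, N₀ ≤ p.1 := fun N₀ => by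
    have h1 : Tendsto (fun p : ℕ × ℕ => (p.1 : ℝ)) atTop atTop :=
      tendsto_natCast_atTop_atTop.comp (by rw [← prod_atTop_atTop_eq]; exact tendsto_fst)
    exact h1.eventually_ge_atTop N₀
  by_cases htri : ic.IsTriangular
  · obtain ⟨c₀, hc₀, hlow⟩ : ∃ c₀ : ℝ, 0 < c₀ ∧ ∀ᶠ p : ℕ × ℕ in atTop, ic = .IC5 →
        ∀ (i : Fin p.1) (k : Fin r), i.val = k.val → c₀ ≤ |(θ p.1 p.2).loading i k| := by
      by_cases h5 : ic = .IC5
      · subst h5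
        obtain ⟨c₀, h1, h2⟩ := hicLim
        exact ⟨c₀, h1, h2.mono fun p hp _ => hp⟩
      · exact ⟨1, one_pos, Eventually.of_forall fun p h => absurd h h5⟩
    obtain ⟨c, τ₀, N₀, hc, hτ₀, h⟩ := exists_errorBound_of_isTriangular r C m w c₀ hC1 hm hw hc₀ htri
    refine ⟨c, τ₀, hc, hτ₀, ?_⟩
    filter_upwards [hreg, hmem, hlow, hlarge N₀] with p h1 h2 h3 h4 τ M θ' g1 g2 g3 g4 g5
    exact h p.1 τ M _ (θ p.1 p.2) θ' h1 h2 h3 g1 g2 g3 (by abel) g4 h4 g5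
  · have hcases : ic = .IC2 ∨ ic = .IC3 := by
      cases ic <;> simp_all [IdentCond.IsTriangular]
    have hdiag : ic.IsDiagonal := by
      rcases hcases with rfl | rfl <;> trivial
    -- One of the two factors is 1, so the gap comes from the limit of M_ff under IC2 and from Q
    -- under IC3. Room below C is needed only under IC2, where rotated competitors have a different
    -- M_ff.
    obtain ⟨δ, hδ, hgap, hcap⟩ : ∃ δ : ℝ, 0 < δ ∧ (∀ᶠ p : ℕ × ℕ in atTop, ∀ i j, i < j →
        (θ p.1 p.2).moment j j * (θ p.1 p.2).weightedMoment j j + δ ≤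
          (θ p.1 p.2).moment i i * (θ p.1 p.2).weightedMoment i i) ∧
        ∀ᶠ p : ℕ × ℕ in atTop, ic = .IC2 → ∀ k, (θ p.1 p.2).moment k k + δ ≤ C := by
      rcases hcases with rfl | rfl
      · obtain ⟨δ₁, hδ₁, h1⟩ := exists_eventually_gap
          (d := fun (p : ℕ × ℕ) k => (θ p.1 p.2).moment k k) (fun k => hM k k)
          (hic.mono fun p hp => hp.1.2.1) hicLim
        obtain ⟨δ₂, hδ₂, h2⟩ := exists_eventually_add_le
          (x := fun (p : ℕ × ℕ) k => (θ p.1 p.2).moment k k) (y := fun _ _ => C) (fun k => hM k k)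
          (fun k => tendsto_const_nhds) fun k => (le_abs_self _).trans_lt (hMC k k)
        refine ⟨min δ₁ δ₂, lt_min hδ₁ hδ₂, ?_, ?_⟩
        · filter_upwards [h1, hic] with p g1 g2 i j hij
          rw [g2.2]
          have := g1 i j hij
          simp only [Matrix.one_apply_eq, mul_one]
          linarith [min_le_left δ₁ δ₂]
        · filter_upwards [h2] with p g1 _ k
          linarith [g1 k, min_le_right δ₁ δ₂]
      · obtain ⟨δ₁, hδ₁, h1⟩ := exists_eventually_gap
          (d := fun (p : ℕ × ℕ) k => (θ p.1 p.2).weightedMoment k k) (fun k => hQ k k)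
          (hic.mono fun p hp => hp.2.2.1) hicLim
        refine ⟨δ₁, hδ₁, ?_, Eventually.of_forall fun p h => by cases h⟩
        filter_upwards [h1, hic] with p g1 g2 i j hij
        rw [g2.1]
        have := g1 i j hij
        simp only [Matrix.one_apply_eq, one_mul]
        exact this
    obtain ⟨c, τ₀, N₀, hc, hτ₀, h⟩ := exists_errorBound_of_isDiagonal r C m w δ hC hC1 hm hw hδ hdiag
    refine ⟨c, τ₀, hc, hτ₀, ?_⟩
    filter_upwards [hreg, hmem, hgap, hcap, hlarge N₀] with p h1 h2 h3 h3' h4 τ M θ' g1 g2 g3 g4 g5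
    exact h p.1 τ M _ (θ p.1 p.2) θ' h1 h2 h3 h3' g1 g2 g3 (by abel) g4 h4 g5

end FrobeniusNorm

/-! ### Conclusion in probability. -/

section Rates

variable {Ω : Type*} [MeasurableSpace Ω] {μ : Measure Ω}

theorem vecNorm_sq {n : ℕ} (v : Fin n → ℝ) : vecNorm v ^ 2 = ∑ k, v k ^ 2 := by
  rw [vecNorm, Real.sq_sqrt (by simpa using dotProduct_star_self_nonneg v)]
  simp [dotProduct, sq]

theorem frobNorm_sq {m n : ℕ} (A : Matrix (Fin m) (Fin n) ℝ) :
    frobNorm A ^ 2 = ∑ i, ∑ j, A i j ^ 2 := by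
  have h : (Aᵀ * A).trace = ∑ i, ∑ j, A i j ^ 2 := by
    rw [Finset.sum_comm]
    simp [Matrix.trace, Matrix.mul_apply, sq]
  rw [frobNorm, Real.sq_sqrt (by rw [h]; positivity), h]

/-- A bound of order `κ / T` on events of probability close to one gives `O_p(T⁻¹)`. -/
theorem isBigOp_of_good {X : ℕ → ℕ → Ω → ℝ} {G : ℝ → ℕ → ℕ → Ω → Prop} {c : ℝ}
    (hG : ∀ ε : ℝ, 0 < ε → ∃ κ : ℝ, 0 < κ ∧ ∀ᶠ p : ℕ × ℕ in atTop,
      μ {ω | ¬ G κ p.1 p.2 ω} ≤ ENNReal.ofReal ε)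
    (hX : ∀ (κ : ℝ) (N T : ℕ) (ω : Ω), 0 < κ → 0 < N → 0 < T → G κ N T ω →
      |X N T ω| ≤ c * κ * (1 / T)) :
    IsBigOp μ X fun _ T => 1 / (T : ℝ) := by
  intro ε hε
  obtain ⟨κ, hκ, h⟩ := hG ε hε
  refine ⟨c * κ, ?_⟩
  filter_upwards [h, eventually_ge_atTop (1, 1)] with p hp hpos
  refine (measure_mono fun ω hω hg => ?_).trans hp
  have h1 := hX κ p.1 p.2 ω hκ hpos.1 hpos.2 hg
  rw [Set.mem_ofPred_eq, abs_of_nonneg (by positivity : (0 : ℝ) ≤ 1 / (p.2 : ℝ))] at hω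
  exact absurd h1 (not_le.2 hω)

end Rates

theorem theorem5p2 {Ω : Type*} [MeasurableSpace Ω] (μ : Measure Ω) [IsProbabilityMeasure μ]
    (r : ℕ) (C : ℝ) (hC : 0 < C) (ic : IdentCond)
    (α : (N T : ℕ) → Fin N → ℝ)
    (lam : (N T : ℕ) → Fin N → Fin r → ℝ)
    (f : (N T : ℕ) → Fin T → Fin r → ℝ)
    (e : ℕ → ℕ → Ω → ℝ) (σ2 : ℕ → ℝ)
    -- the sample variance of the (nonrandom) factors converges to a positive definite limit
    (Mbar : Matrix (Fin r) (Fin r) ℝ) (hMbar : Mbar.PosDef)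
    (hM : Tendsto (fun p : ℕ × ℕ => sampleMoment (f p.1 p.2)) atTop (𝓝 Mbar))
    -- the errors
    (he : ErrorAssumption μ e σ2)
    -- bounds on the loadings and variances; limits of the loading moments
    (hlam : ∀ N T i, vecNorm (lam N T i) ≤ C)
    (hσ : ∀ i, σ2 i ∈ Set.Icc (C ^ 2)⁻¹ (C ^ 2))
    (Q : Matrix (Fin r) (Fin r) ℝ) (hQpos : Q.PosDef)
    (hQ : Tendsto (fun p : ℕ × ℕ => (trueParam lam σ2 f p.1 p.2).weightedMoment) atTop (𝓝 Q))
    (Om : Matrix (Fin r × Fin r) (Fin r × Fin r) ℝ)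
    (hOm : Tendsto (fun p : ℕ × ℕ => (trueParam lam σ2 f p.1 p.2).kroneckerMoment) atTop (𝓝 Om))
    -- the limit of the factor moments is inside the bounds imposed in the estimation
    (hMC : ∀ k l, |Mbar k l| < C)
    -- the true parameters satisfy the identifying restrictions
    (hic : ∀ᶠ p : ℕ × ℕ in atTop, ic.Holds (trueParam lam σ2 f p.1 p.2))
    (hicLim : ic.HoldsInLimit (trueParam lam σ2 f) Mbar Q)
    -- the estimator is, with probability tending to one, an MLE with the right column signs
    (est : (N T : ℕ) → Ω → FactorParam N r)
    (hest : Tendsto (fun p : ℕ × ℕ =>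
      μ {ω | ¬ (IsMLE C ic (sampleMoment (observation α lam f e p.1 p.2 ω)) (est p.1 p.2 ω) ∧
        ic.SameSigns (est p.1 p.2 ω) (trueParam lam σ2 f p.1 p.2))}) atTop (𝓝 0)) :
    IsBigOp μ (fun N T ω => (N : ℝ)⁻¹ * ∑ i : Fin N,
        1 / (est N T ω).variance i * vecNorm ((est N T ω).loading i - lam N T i) ^ 2)
      (fun _ T => 1 / (T : ℝ)) ∧
    IsBigOp μ (fun N T ω => (N : ℝ)⁻¹ * ∑ i : Fin N, ((est N T ω).variance i - σ2 i) ^ 2)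
      (fun _ T => 1 / (T : ℝ)) ∧
    IsBigOp μ (fun N T ω => frobNorm ((est N T ω).moment - sampleMoment (f N T)) ^ 2)
      (fun _ T => 1 / (T : ℝ)) := by
  have hlam' : ∀ N T i, lam N T i ⬝ᵥ lam N T i ≤ C ^ 2 := fun N T i => by
    have h := pow_le_pow_left₀ (Real.sqrt_nonneg _) (hlam N T i) 2
    rwa [Real.sq_sqrt (by simpa using dotProduct_star_self_nonneg (lam N T i))] at h
  -- The interval that contains σ_0² is nonempty.
  have hC1 : 1 ≤ C ^ 2 := by
    have h := (hσ 0).1.trans (hσ 0).2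
    by_contra hlt
    have h1 : C ^ 2 < 1 := not_le.1 hlt
    have h2 : 1 < (C ^ 2)⁻¹ := (one_lt_inv₀ (by positivity)).2 h1
    linarith
  have hM' : ∀ k l, Tendsto (fun p : ℕ × ℕ => (trueParam lam σ2 f p.1 p.2).moment k l) atTop
      (𝓝 (Mbar k l)) := fun k l => tendsto_pi_nhds.1 (tendsto_pi_nhds.1 hM k) l
  have hQ' : ∀ k l, Tendsto (fun p : ℕ × ℕ => (trueParam lam σ2 f p.1 p.2).weightedMoment k l) atTop
      (𝓝 (Q k l)) := fun k l => tendsto_pi_nhds.1 (tendsto_pi_nhds.1 hQ k) l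
  obtain ⟨c, τ₀, hc, hτ₀, herr⟩ := exists_eventually_errorBound hC hC1 hM' hMbar hQ' hQpos hMC
    (fun N T i => hσ i) hlam' (fun N T => sampleMoment_posSemidef (f N T)) hic hicLim
  obtain ⟨K, hK, hnoise⟩ := he.exists_measure_not_smallNoise_le hσ α lam f hlam'
  have hMle : ∀ᶠ p : ℕ × ℕ in atTop, ∀ k l, |sampleMoment (f p.1 p.2) k l| ≤ C :=
    eventually_all.2 fun k => eventually_all.2 fun l =>
      ((hM' k l).abs.eventually_lt_const (hMC k l)).mono fun p hp => hp.le
  have hT : Tendsto (fun p : ℕ × ℕ => (p.2 : ℝ)) atTop atTop :=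
    tendsto_natCast_atTop_atTop.comp (by rw [← prod_atTop_atTop_eq]; exact tendsto_snd)
  have hgood : ∀ ε : ℝ, 0 < ε → ∃ κ : ℝ, 0 < κ ∧ ∀ᶠ p : ℕ × ℕ in atTop,
      μ {ω | ¬ ((∀ i, (C ^ 2)⁻¹ ≤ (est p.1 p.2 ω).variance i) ∧
        ErrorBound c √(κ / p.2) (est p.1 p.2 ω) (trueParam lam σ2 f p.1 p.2))} ≤
          ENNReal.ofReal ε := by
    intro ε hε
    -- The noise event fails with probability at most K/κ, which this κ makes at most ε/2; the other
    -- half is left for the failure of the estimator to be a maximizer with the right signs. The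
    -- added 1 covers K = 0.
    have hκ : 0 < 2 * K / ε + 1 := by positivity
    refine ⟨2 * K / ε + 1, hκ, ?_⟩
    have hest' := hest.eventually_le_const (u := ENNReal.ofReal (ε / 2))
      (ENNReal.ofReal_pos.2 (half_pos hε))
    -- For fixed κ, √(κ/T) tends to zero, so it falls below the threshold of the deterministic bound
    -- however N behaves.
    have hsmall : ∀ᶠ p : ℕ × ℕ in atTop, √((2 * K / ε + 1) / p.2) ≤ τ₀ := by
      have h1 := hT.const_div_atTop (2 * K / ε + 1)
      filter_upwards [h1.eventually_le_const (pow_pos hτ₀ 2)] with p hp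
      exact Real.sqrt_le_left hτ₀.le |>.2 hp
    filter_upwards [hest', hsmall, herr, hMle, eventually_ge_atTop (1, 1)] with p h1 h2 h3 h4 h5
    have h6 := hnoise p.1 p.2 h5.1 h5.2 h4 (2 * K / ε + 1) hκ
    have h7 : K / (2 * K / ε + 1) ≤ ε / 2 := by
      rw [div_le_iff₀ hκ]
      have : ε / 2 * (2 * K / ε + 1) = K + ε / 2 := by field_simp
      linarith
    refine (measure_mono (t := _ ∪ _) fun ω hω => ?_).trans ((measure_union_le _ _).trans
      ((add_le_add h1 (h6.trans (ENNReal.ofReal_le_ofReal h7))).trans (le_of_eq ?_)))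
    · by_contra hno
      rw [Set.mem_union, not_or] at hno
      obtain ⟨g1, g2⟩ := hno
      obtain ⟨g3, g4⟩ := not_not.1 g1
      exact hω ⟨fun i => (g3.1.1 i).1,
        h3 _ _ _ g3 g4 (sampleMoment_posSemidef _) (not_not.1 g2) h2⟩
    · rw [← ENNReal.ofReal_add (by positivity) (by positivity), add_halves]
  have hsq : ∀ (κ : ℝ) (T : ℕ), 0 < κ → √(κ / T) ^ 2 = κ * (1 / T) := fun κ T hκ => by
    rw [Real.sq_sqrt (by positivity)]; ring
  have hrate : ∀ (X : ℕ → ℕ → Ω → ℝ) (c' : ℝ), (∀ (κ : ℝ) (N T : ℕ) (ω : Ω), 0 < κ → 0 < N → 0 < T →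
      (∀ i, (C ^ 2)⁻¹ ≤ (est N T ω).variance i) ∧
        ErrorBound c √(κ / T) (est N T ω) (trueParam lam σ2 f N T) →
      |X N T ω| ≤ c' * κ * (1 / T)) → IsBigOp μ X fun _ T => 1 / (T : ℝ) := fun X c' h =>
    isBigOp_of_good (G := fun κ N T ω => (∀ i, (C ^ 2)⁻¹ ≤ (est N T ω).variance i) ∧
      ErrorBound c √(κ / T) (est N T ω) (trueParam lam σ2 f N T)) hgood h
  refine ⟨hrate _ (C ^ 2 * c) fun κ N T ω hκ hN hTpos h => ?_,
    hrate _ c fun κ N T ω hκ hN hTpos h => ?_, hrate _ c fun κ N T ω hκ hN hTpos h => ?_⟩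
  · have hN' : (0 : ℝ) < N := by exact_mod_cast hN
    have hpos : ∀ i, 0 < (est N T ω).variance i := fun i => lt_of_lt_of_le (by positivity) (h.1 i)
    -- The estimated variances lie in the parameter set, so the weights in the first average are
    -- bounded by C².
    have h1 : ∀ i, 1 / (est N T ω).variance i ≤ C ^ 2 := fun i => by
      rw [one_div]
      exact inv_le_of_inv_le₀ (by positivity) (h.1 i)
    rw [abs_of_nonneg (mul_nonneg (by positivity) (Finset.sum_nonneg fun i _ =>
      mul_nonneg (one_div_nonneg.2 (hpos i).le) (sq_nonneg _))), inv_mul_le_iff₀ hN']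
    calc ∑ i : Fin N, 1 / (est N T ω).variance i *
          vecNorm ((est N T ω).loading i - lam N T i) ^ 2
        ≤ ∑ i : Fin N, C ^ 2 * ∑ k, ((est N T ω).loading i k - lam N T i k) ^ 2 :=
          Finset.sum_le_sum fun i _ => by
            rw [vecNorm_sq]
            exact mul_le_mul_of_nonneg_right (h1 i) (Finset.sum_nonneg fun k _ => sq_nonneg _)
      _ = C ^ 2 * ∑ i : Fin N, ∑ k, ((est N T ω).loading i k - lam N T i k) ^ 2 := by
          rw [Finset.mul_sum]
      _ ≤ C ^ 2 * (c * (√(κ / T) ^ 2 * N)) := mul_le_mul_of_nonneg_left h.2.loading (by positivity)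
      _ = _ := by rw [hsq κ T hκ]; ring
  · have hN' : (0 : ℝ) < N := by exact_mod_cast hN
    rw [abs_of_nonneg (by positivity), inv_mul_le_iff₀ hN']
    refine h.2.variance.trans (le_of_eq ?_)
    rw [hsq κ T hκ]; ring
  · rw [abs_of_nonneg (sq_nonneg _), frobNorm_sq]
    refine h.2.moment.trans (le_of_eq ?_)
    rw [hsq κ T hκ]; ring
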